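/- Fix $0<\alpha\le\beta<1$, $A,B>0$, $T>0$. **Paths.** Let $\mathcal M$ be the set of non-negative measures on $[0,1]$ with total mass at most $1$, with the weak topology, and $\mathcal M_{\rm ac}\subset\mathcal M$ the set of measures $\gamma(x)\,dx$ with $0\le\gamma\le 1$. Let $D([0,T],\mathcal M)$ be the space of right-continuous paths with left limits, with the Skorohod topology, and let $D([0,T],\mathcal M_{\rm ac})$ be the set of those with values in $\mathcal M_{\rm ac}$; such a path is written $\pi(t,dx)=u(t,x)\,dx$ and identified with $u$. Write $u_t=u(t,\cdot)$, $\nabla=\partial_x$, $\Delta=\partial_x^2$, $\langle f,g\rangle=\int_0^1 fg\,dx$, $\sigma(a)=a(1-a)$. **Energy.** For $u\in D([0,T],\mathcal M_{\rm ac})$ let $$\mathcal Q(u)=\sup_G\Big\{\int_0^T\langle u_t,\nabla G_t\rangle\,dt-\frac12\int_0^T\langle G_t,G_t\rangle\,dt\Big\},$$ the supremum being over smooth $G:[0,T]\times(0,1)\to\mathbb R$ with compact support. If $\mathcal Q(u)<\infty$, then for almost every $t$ the function $u_t$ has a continuous version, whose boundary values are denoted by $u_t(0)$, $u_t(1)$.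 **Rate functional.** Let $\mathfrak b_{\varrho,D}(a,M)=\frac1D\{(1-a)\varrho(e^M-1)+a(1-\varrho)(e^{-M}-1)\}$. For $H\in C^{1,2}([0,T]\times[0,1])$ and $u\in D([0,T],\mathcal M_{\rm ac})$ with $\mathcal Q(u)<\infty$ let $$\begin{aligned}J_{T,H}(u)=\;&\langle u_T,H_T\rangle-\langle u_0,H_0\rangle-\int_0^T\langle u_t,\partial_tH_t\rangle dt-\int_0^T\langle u_t,\Delta H_t\rangle dt\\&+\int_0^Tu_t(1)\nabla H_t(1)dt-\int_0^Tu_t(0)\nabla H_t(0)dt-\int_0^T\langle\sigma(u_t),(\nabla H_t)^2\rangle dt\\&-\int_0^T\{\mathfrak b_{\alpha,A}(u_t(0),H_t(0))+\mathfrak b_{\beta,B}(u_t(1),H_t(1))\}dt,\end{aligned}$$ and let $J_{T,H}(\pi)=\infty$ for all other $\pi\in D([0,T],\mathcal M)$. Let $I_{[0,T]}(\pi)=\sup_{H\in C^{1,2}([0,T]\times[0,1])}J_{T,H}(\pi)$. For a measurable $\gamma:[0,1]\to[0,1]$ let $I_{[0,T]}(\pi|\gamma)=I_{[0,T]}(\pi)$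 if $\pi(0,dx)=\gamma(x)\,dx$, and $I_{[0,T]}(\pi|\gamma)=\infty$ otherwise. **Hydrodynamic equation.** A function $u\in L^2(0,S;H^1([0,1]))$ is a generalized solution on $[0,S]\times[0,1]$ of $$\partial_tu=\Delta u,\quad \nabla u(t,0)=A^{-1}[u(t,0)-\alpha],\quad \nabla u(t,1)=B^{-1}[\beta-u(t,1)],\quad u(0,\cdot)=\gamma,$$ if for every $0<t\le S$ and $H\in C^{1,2}([0,S]\times[0,1])$ $$\begin{aligned}&\langle u_t,H_t\rangle-\langle\gamma,H_0\rangle-\int_0^t\langle u_s,\partial_sH_s\rangle ds\\&\quad=-\int_0^t\langle\nabla u_s,\nabla H_s\rangle ds-\int_0^t\Big\{\frac1B[u_s(1)-\beta]H_s(1)+\frac1A[u_s(0)-\alpha]H_s(0)\Big\}ds.\end{aligned}$$ **The set $\Pi_\gamma$** consists of all paths $\pi(t,dx)=u(t,x)\,dx$ in $D([0,T],\mathcal M_{\rm ac})$ such that (a) for some $0<\mathfrak t\le T$, $u$ is a generalized solution of the hydrodynamic equation on $[0,\mathfrak t]\times[0,1]$ with initial condition $\gamma$ (in particular $u(0,\cdot)=\gamma$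 a.e.); (b) for every $0<\delta\le T$ there is $\epsilon>0$ with $\epsilon\le u(t,x)\le1-\epsilon$ for all $(t,x)\in[\delta,T]\times[0,1]$; (c) $u$ is $C^\infty$ on $(0,T]\times[0,1]$. **Theorem.** For every measurable $\gamma:[0,1]\to[0,1]$, the set $\Pi_\gamma$ is $I_{[0,T]}(\cdot|\gamma)$-dense: for every $\pi\in D([0,T],\mathcal M)$ with $I_{[0,T]}(\pi|\gamma)<\infty$ there is a sequence $(\pi^n)$ in $\Pi_\gamma$ such that $\pi^n\to\pi$ in $D([0,T],\mathcal M)$ and $I_{[0,T]}(\pi^n|\gamma)\to I_{[0,T]}(\pi|\gamma)$. If moreover $\epsilon_0\le\gamma\le1-\epsilon_0$ almost everywhere for some $\epsilon_0>0$, then the same holds with (b) replaced by: there is $\epsilon>0$ with $\epsilon\le u(t,x)\le1-\epsilon$ for all $(t,x)\in[0,T]\times[0,1]$. -/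

import Mathlib

open MeasureTheory Set Filter Topology
open scoped unitInterval ContDiff Uniformity

noncomputable section

/-! ### Càdlàg paths and the Skorohod topology -/

/-- `D([0,T], X)`: right-continuous functions `[0,T] → X` with left limits. -/
structure SkorohodPath (T : ℝ) (X : Type*) [TopologicalSpace X] where
  toFun : Icc (0 : ℝ) T → X
  right_cont : ∀ t, ContinuousWithinAt toFun (Ici t) t
  left_lim : ∀ t, ∃ l, Tendsto toFun (𝓝[<] t) (𝓝 l)

namespace SkorohodPath

/-- The path evaluated at a real time (frozen outside `[0,T]`). -/
def ev {T : ℝ} {X : Type*} [TopologicalSpace X] (hT : 0 < T) (w : SkorohodPath T X) : ℝ → X :=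
  IccExtend hT.le w.toFun

/-- Basic entourage of the Skorohod topology: some increasing bijection `l` of `[0,T]`
(automatically a homeomorphism) is uniformly `ε`-close to the identity, and the paths are uniformly
`V`-close after the time change `l`. -/
def entourage {T : ℝ} {X : Type*} [TopologicalSpace X] (V : Set (X × X)) (ε : ℝ) :
    Set (SkorohodPath T X × SkorohodPath T X) :=
  {p | ∃ l : Icc (0 : ℝ) T ≃o Icc (0 : ℝ) T,
    (∀ t, dist (l t) t < ε) ∧ ∀ t, (p.1.toFun t, p.2.toFun (l t)) ∈ V}

theorem entourage_mono {T : ℝ} {X : Type*} [TopologicalSpace X] {V W : Set (X × X)} {ε δ : ℝ}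
    (hV : V ⊆ W) (h : ε ≤ δ) : (entourage V ε : Set (SkorohodPath T X × _)) ⊆ entourage W δ := by
  rintro p ⟨l, h1, h2⟩
  exact ⟨l, fun t => (h1 t).trans_le h, fun t => hV (h2 t)⟩

/-- The entourages of the Skorohod topology form a filter basis. -/
def basis (T : ℝ) (X : Type*) [UniformSpace X] :
    FilterBasis (SkorohodPath T X × SkorohodPath T X) where
  sets := {S | ∃ V ∈ 𝓤 X, ∃ ε > (0 : ℝ), S = entourage V ε}
  nonempty := ⟨_, univ, univ_mem, 1, one_pos, rfl⟩
  inter_sets := by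
    rintro _ _ ⟨V, hV, ε, hε, rfl⟩ ⟨W, hW, δ, hδ, rfl⟩
    exact ⟨_, ⟨V ∩ W, inter_mem hV hW, min ε δ, lt_min hε hδ, rfl⟩,
      subset_inter (entourage_mono inter_subset_left (min_le_left _ _))
        (entourage_mono inter_subset_right (min_le_right _ _))⟩

/-- The Skorohod (`J₁`) uniformity; its topology is the Skorohod topology on `D([0,T], X)`. -/
instance instUniformSpace (T : ℝ) (X : Type*) [UniformSpace X] :
    UniformSpace (SkorohodPath T X) :=
  UniformSpace.ofCore (UniformSpace.Core.mkOfBasis (basis T X)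
    (by
      rintro _ ⟨V, hV, ε, hε, rfl⟩ w
      exact ⟨OrderIso.refl _, fun t => by simpa using hε, fun t => refl_mem_uniformity hV⟩)
    (by
      rintro _ ⟨V, hV, ε, hε, rfl⟩
      refine ⟨_, ⟨Prod.swap ⁻¹' V, symm_le_uniformity hV, ε, hε, rfl⟩, ?_⟩
      rintro p ⟨l, h1, h2⟩
      refine ⟨l.symm, fun t => ?_, fun t => ?_⟩
      · have := h1 (l.symm t)
        rwa [OrderIso.apply_symm_apply, dist_comm] at this
      · have := h2 (l.symm t)
        rwa [OrderIso.apply_symm_apply] at this)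
    (by
      rintro _ ⟨V, hV, ε, hε, rfl⟩
      obtain ⟨W, hW, hWV⟩ := comp_mem_uniformity_sets hV
      refine ⟨_, ⟨W, hW, ε / 2, half_pos hε, rfl⟩, ?_⟩
      rintro ⟨x, z⟩ ⟨y, ⟨l, h1, h2⟩, ⟨m, h3, h4⟩⟩
      refine ⟨l.trans m, fun t => ?_, fun t => hWV ⟨y.toFun (l t), h2 t, h4 (l t)⟩⟩
      calc dist (m (l t)) t ≤ dist (m (l t)) (l t) + dist (l t) t := dist_triangle _ _ _
        _ < ε / 2 + ε / 2 := add_lt_add (h3 _) (h1 _)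
        _ = ε := add_halves ε))

theorem mem_uniformity_iff {T : ℝ} {X : Type*} [UniformSpace X]
    {S : Set (SkorohodPath T X × SkorohodPath T X)} :
    S ∈ 𝓤 (SkorohodPath T X) ↔ ∃ V ∈ 𝓤 X, ∃ ε > (0 : ℝ), entourage V ε ⊆ S := by
  change S ∈ (basis T X).filter ↔ _
  rw [FilterBasis.mem_filter_iff]
  constructor
  · rintro ⟨_, ⟨V, hV, ε, hε, rfl⟩, h⟩
    exact ⟨V, hV, ε, hε, h⟩
  · rintro ⟨V, hV, ε, hε, h⟩
    exact ⟨_, ⟨V, hV, ε, hε, rfl⟩, h⟩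

end SkorohodPath

/-! ### Measures on `[0,1]` with mass at most one -/

/-- The space `ℳ` of non-negative measures on `[0,1]` with total mass at most `1`. -/
def SubProb : Type := {μ : FiniteMeasure I // μ.mass ≤ 1}

namespace SubProb

/-- The underlying measure. -/
def meas (μ : SubProb) : Measure I := (μ.1 : Measure I)

/-- The weak uniformity, generated by the maps `μ ↦ ∫ F dμ` with `F` continuous on `[0,1]`. -/
instance instUniformSpace : UniformSpace SubProb :=
  UniformSpace.comap (fun (μ : SubProb) (F : C(I, ℝ)) => ∫ x, F x ∂μ.meas) inferInstance

/-- The topology of `SubProb` is the weak topology of finite measures. -/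
theorem isInducing_val : IsInducing (fun μ : SubProb => (μ.1 : FiniteMeasure I)) := by
  have h0 : IsInducing (fun (μ : SubProb) (F : C(I, ℝ)) => ∫ x, F x ∂μ.meas) := ⟨rfl⟩
  rw [isInducing_iff_nhds]
  intro μ
  have key : ∀ (l : Filter SubProb), l ≤ 𝓝 μ ↔ Tendsto (fun ν : SubProb => ν.1) l (𝓝 μ.1) := by
    intro l
    rw [FiniteMeasure.tendsto_iff_forall_integral_tendsto, h0.nhds_eq_comap, ← tendsto_iff_comap,
      tendsto_pi_nhds]
    constructor
    · intro h f
      exact h f.toContinuousMap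
    · intro h F
      exact h (BoundedContinuousFunction.mkOfCompact F)
  apply le_antisymm
  · rw [← tendsto_iff_comap]
    exact (key _).1 le_rfl
  · exact (key _).2 tendsto_comap

/-- `μ(dx) = f(x) dx`. -/
def HasDensity (μ : SubProb) (f : I → ℝ) : Prop :=
  AEMeasurable f ∧ μ.meas = (volume : Measure I).withDensity (fun x => ENNReal.ofReal (f x))

/-- `μ ∈ ℳ_ac`: `μ` has a density with values in `[0,1]`. -/
def IsAC (μ : SubProb) : Prop :=
  ∃ f : I → ℝ, (∀ x, f x ∈ Icc (0 : ℝ) 1) ∧ μ.HasDensity f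

/-- A version of the Lebesgue density. -/
def dens (μ : SubProb) (x : I) : ℝ := (μ.meas.rnDeriv volume x).toReal

end SubProb

/-! ### Boundary values and test functions -/

open Classical in
/-- The value at `x₀` of the continuous version of `f : [0,1] → ℝ` (`0` if there is none). -/
def contVal (f : I → ℝ) (x₀ : I) : ℝ :=
  if h : ∃ g : C(I, ℝ), g =ᵐ[volume] f then h.choose x₀ else 0

theorem contVal_eq {f : I → ℝ} (g : C(I, ℝ)) (h : g =ᵐ[volume] f) (x₀ : I) :
    contVal f x₀ = g x₀ := by
  have hex : ∃ g : C(I, ℝ), g =ᵐ[volume] f := ⟨g, h⟩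
  have h1 : (hex.choose : I → ℝ) =ᵐ[volume] g := hex.choose_spec.trans h.symm
  have h2 : EqOn (IccExtend zero_le_one (hex.choose : I → ℝ)) (IccExtend zero_le_one (g : I → ℝ))
      (Icc (0 : ℝ) 1) := by
    refine Measure.eqOn_Icc_of_ae_eq volume zero_ne_one ?_
      hex.choose.continuous.Icc_extend'.continuousOn g.continuous.Icc_extend'.continuousOn
    refine (ae_restrict_iff_subtype measurableSet_Icc).2 ?_
    filter_upwards [h1] with x hx
    simpa using hx
  have h3 := h2 x₀.2
  simp only [IccExtend_val] at h3
  rw [contVal, dif_pos hex, h3]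

/-- `C^{1,2}([0,T]×[0,1])`, bundled with the derivatives `∂ₜH`, `∇H`, `ΔH`
(one-sided at the boundary). -/
structure C12 (T : ℝ) where
  toFun : ℝ → ℝ → ℝ
  dt : ℝ → ℝ → ℝ
  dx : ℝ → ℝ → ℝ
  dxx : ℝ → ℝ → ℝ
  cont : ContinuousOn (fun p : ℝ × ℝ => toFun p.1 p.2) (Icc 0 T ×ˢ Icc 0 1)
  cont_dt : ContinuousOn (fun p : ℝ × ℝ => dt p.1 p.2) (Icc 0 T ×ˢ Icc 0 1)
  cont_dx : ContinuousOn (fun p : ℝ × ℝ => dx p.1 p.2) (Icc 0 T ×ˢ Icc 0 1)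
  cont_dxx : ContinuousOn (fun p : ℝ × ℝ => dxx p.1 p.2) (Icc 0 T ×ˢ Icc 0 1)
  has_dt : ∀ t ∈ Icc 0 T, ∀ x ∈ Icc (0 : ℝ) 1,
    HasDerivWithinAt (fun s => toFun s x) (dt t x) (Icc 0 T) t
  has_dx : ∀ t ∈ Icc 0 T, ∀ x ∈ Icc (0 : ℝ) 1,
    HasDerivWithinAt (toFun t) (dx t x) (Icc 0 1) x
  has_dxx : ∀ t ∈ Icc 0 T, ∀ x ∈ Icc (0 : ℝ) 1,
    HasDerivWithinAt (dx t) (dxx t x) (Icc 0 1) x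

/-! ### Energy and rate functional -/

/-- `G : [0,T]×(0,1) → ℝ` is smooth with compact support. -/
def IsEnergyTest (T : ℝ) (G : ℝ → ℝ → ℝ) : Prop :=
  ContDiffOn ℝ ∞ (fun p : ℝ × ℝ => G p.1 p.2) (Icc 0 T ×ˢ Ioo 0 1) ∧
  ∃ K : Set (ℝ × ℝ), IsCompact K ∧ K ⊆ Icc 0 T ×ˢ Ioo 0 1 ∧
    ∀ p ∈ Icc 0 T ×ˢ Ioo (0 : ℝ) 1, p ∉ K → G p.1 p.2 = 0

/-- The energy `𝒬_{[0,T]}`. -/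
def energy {T : ℝ} (hT : 0 < T) (w : SkorohodPath T SubProb) : EReal :=
  ⨆ (G : ℝ → ℝ → ℝ) (_ : IsEnergyTest T G),
    (((∫ t in (0 : ℝ)..T, ∫ x : I, deriv (G t) x ∂(w.ev hT t).meas)
      - 1 / 2 * ∫ t in (0 : ℝ)..T, ∫ x : I, G t x ^ 2 : ℝ) : EReal)

/-- `w ∈ D_ℰ([0,T], ℳ_ac)`: absolutely continuous at all times, and of finite energy. -/
def FiniteEnergyAC {T : ℝ} (hT : 0 < T) (w : SkorohodPath T SubProb) : Prop :=
  (∀ t, (w.toFun t).IsAC) ∧ energy hT w < ⊤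

/-- The mobility `σ(a) = a(1-a)`. -/
def mobility (a : ℝ) : ℝ := a * (1 - a)

/-- `𝔟_{ϱ,D}(a,M)`. -/
def bdryB (ϱ D a M : ℝ) : ℝ :=
  1 / D * ((1 - a) * ϱ * (Real.exp M - 1) + a * (1 - ϱ) * (Real.exp (-M) - 1))

/-- The boundary value `u_t(x₀)` of a path `π(t,dx) = u(t,x) dx`. -/
def bdryVal {T : ℝ} (hT : 0 < T) (w : SkorohodPath T SubProb) (x₀ : I) (t : ℝ) : ℝ :=
  contVal (w.ev hT t).dens x₀

/-- `J_{T,H}(u)` for paths of finite energy. -/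
def functionalJ (α β A B : ℝ) {T : ℝ} (hT : 0 < T) (H : C12 T) (w : SkorohodPath T SubProb) : ℝ :=
  (∫ x : I, H.toFun T x ∂(w.ev hT T).meas) - (∫ x : I, H.toFun 0 x ∂(w.ev hT 0).meas)
  - (∫ t in (0 : ℝ)..T, ∫ x : I, H.dt t x ∂(w.ev hT t).meas)
  - (∫ t in (0 : ℝ)..T, ∫ x : I, H.dxx t x ∂(w.ev hT t).meas)
  + (∫ t in (0 : ℝ)..T, bdryVal hT w 1 t * H.dx t 1)
  - (∫ t in (0 : ℝ)..T, bdryVal hT w 0 t * H.dx t 0)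
  - (∫ t in (0 : ℝ)..T, ∫ x : I, mobility ((w.ev hT t).dens x) * H.dx t x ^ 2)
  - ∫ t in (0 : ℝ)..T,
      (bdryB α A (bdryVal hT w 0 t) (H.toFun t 0) + bdryB β B (bdryVal hT w 1 t) (H.toFun t 1))

open Classical in
/-- `I_{[0,T]}(π)`: the supremum of `J_{T,H}(π)` over `H ∈ C^{1,2}`, where `J_{T,H}(π) = ∞` if
`π ∉ D_ℰ([0,T], ℳ_ac)`. -/
def rate (α β A B : ℝ) {T : ℝ} (hT : 0 < T) (w : SkorohodPath T SubProb) : EReal :=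
  ⨆ H : C12 T, if FiniteEnergyAC hT w then (functionalJ α β A B hT H w : EReal) else ⊤

open Classical in
/-- `I_{[0,T]}(π | γ)`. -/
def rateFrom (α β A B : ℝ) {T : ℝ} (hT : 0 < T) (γ : I → ℝ) (w : SkorohodPath T SubProb) : EReal :=
  if (w.ev hT 0).HasDensity γ then rate α β A B hT w else ⊤

/-! ### The hydrodynamic equation -/

/-- `g` is the generalized derivative of `f` on `(0,1)`. -/
def IsWeakDeriv (f g : I → ℝ) : Prop :=
  ∀ φ : ℝ → ℝ, ContDiff ℝ ∞ φ → HasCompactSupport φ → tsupport φ ⊆ Ioo 0 1 →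
    ∫ x : I, f x * deriv φ x = -∫ x : I, g x * φ x

/-- `u` is a generalized solution in `[0,T]×[0,1]` of `∂ₜu = Δu`, `∇u(t,0) = (u(t,0)-α)/A`,
`∇u(t,1) = (β-u(t,1))/B`, `u(0,·) = γ`: it lies in `L²(0,T;H¹)`, with generalized space derivative
`v`, and satisfies the weak formulation. -/
def IsHydroSolution (α β A B T : ℝ) (γ : I → ℝ) (u : ℝ → I → ℝ) : Prop :=
  ∃ v : ℝ → I → ℝ,
    MemLp (fun p : ℝ × I => u p.1 p.2) 2 ((volume.restrict (Icc 0 T)).prod volume) ∧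
    MemLp (fun p : ℝ × I => v p.1 p.2) 2 ((volume.restrict (Icc 0 T)).prod volume) ∧
    (∀ᵐ t ∂(volume.restrict (Icc 0 T)), IsWeakDeriv (u t) (v t)) ∧
    ∀ t ∈ Ioc 0 T, ∀ H : C12 T,
      (∫ x : I, u t x * H.toFun t x) - (∫ x : I, γ x * H.toFun 0 x)
        - (∫ s in (0 : ℝ)..t, ∫ x : I, u s x * H.dt s x)
      = -(∫ s in (0 : ℝ)..t, ∫ x : I, v s x * H.dx s x)
        - ∫ s in (0 : ℝ)..t, (1 / B * (contVal (u s) 1 - β) * H.toFun s 1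
            + 1 / A * (contVal (u s) 0 - α) * H.toFun s 0)

/-! ### The set `Π_γ` and density -/

/-- Paths `π(t,dx) = u(t,x) dx` in `D([0,T], ℳ_ac)` which follow the hydrodynamic equation started
from `γ` on some time interval `[0,t₀]`, are smooth on `(0,T]×[0,1]`, and whose density satisfies
the further requirement `bound`. -/
def smoothPaths (α β A B : ℝ) {T : ℝ} (hT : 0 < T) (γ : I → ℝ) (bound : (ℝ → ℝ → ℝ) → Prop) :
    Set (SkorohodPath T SubProb) :=
  {w | ∃ u : ℝ → ℝ → ℝ,
    (∀ t ∈ Icc 0 T, (∀ x ∈ Icc (0 : ℝ) 1, u t x ∈ Icc (0 : ℝ) 1) ∧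
      (w.ev hT t).HasDensity (fun x : I => u t x)) ∧
    (∃ t₀ ∈ Ioc 0 T, IsHydroSolution α β A B t₀ γ (fun t x => u t x)) ∧
    (fun x : I => u 0 x) =ᵐ[volume] γ ∧
    bound u ∧
    ContDiffOn ℝ ∞ (fun p : ℝ × ℝ => u p.1 p.2) (Ioc 0 T ×ˢ Icc 0 1)}

/-- The set `Π_γ`: the density is bounded away from `0` and `1` on `[δ,T]×[0,1]` for
every `δ > 0`. -/
def piGamma (α β A B : ℝ) {T : ℝ} (hT : 0 < T) (γ : I → ℝ) : Set (SkorohodPath T SubProb) :=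
  smoothPaths α β A B hT γ fun u => ∀ δ ∈ Ioc 0 T, ∃ ε > 0,
    ∀ t ∈ Icc δ T, ∀ x ∈ Icc (0 : ℝ) 1, ε ≤ u t x ∧ u t x ≤ 1 - ε

/-- The variant of `Π_γ` with densities bounded away from `0` and `1` on all of `[0,T]×[0,1]`. -/
def piGammaUniform (α β A B : ℝ) {T : ℝ} (hT : 0 < T) (γ : I → ℝ) :
    Set (SkorohodPath T SubProb) :=
  smoothPaths α β A B hT γ fun u => ∃ ε > 0,
    ∀ t ∈ Icc 0 T, ∀ x ∈ Icc (0 : ℝ) 1, ε ≤ u t x ∧ u t x ≤ 1 - ε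

/-- `S` is `J`-dense: each `w` with `J w < ∞` is the limit of a sequence in `S` along which `J`
converges to `J w`. -/
def IsRateDense {E : Type*} [TopologicalSpace E] (J : E → EReal) (S : Set E) : Prop :=
  ∀ w, J w < ⊤ → ∃ s : ℕ → E, (∀ n, s n ∈ S) ∧ Tendsto s atTop (𝓝 w) ∧
    Tendsto (fun n => J (s n)) atTop (𝓝 (J w))

end

open intervalIntegral renaming integral_of_le → iint_of_le, integral_add → iint_add,
  integral_sub → iint_sub, integral_neg → iint_neg, integral_congr → iint_congr,
  integral_const → iint_const, integral_const_mul → iint_const_mul,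
  integral_mul_const → iint_mul_const, integral_nonneg → iint_nonneg,
  integral_mono_on → iint_mono_on, integral_mono_ae_restrict → iint_mono_ae,
  integral_hasDerivAt_right → iint_hasDerivAt_right,
  integral_add_adjacent_intervals → iint_add_adjacent
open Real (exp norm_eq_abs)

local notation "𝕁" => Icc (0 : ℝ) 1
local notation "𝕁ᵒ" => Ioo (0 : ℝ) 1
local notation "ℝ²" => ℝ × ℝ
local notation "𝕡" => projIcc (0 : ℝ) 1 zero_le_one
local notation:max "⇈" f:max => fun p : ℝ × ℝ => f (Prod.fst p) (Prod.snd p)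
local notation "IvlInt" f:max a:max b:max => IntervalIntegrable f volume a b

noncomputable section

variable {a b t x c r δ ε μ C α β A B T θ ϱ D : ℝ} {f : ℝ → ℝ} {u v g k F ρ ρx ρt : ℝ → ℝ → ℝ}
  {hT : 0 < T} {w : SkorohodPath T SubProb}

theorem uIcc01 : uIcc (0 : ℝ) 1 = 𝕁 := uIcc_of_le zero_le_one

theorem iint01 {E : Type*} [NormedAddCommGroup E] [NormedSpace ℝ E] {f : ℝ → E} {μ : Measure ℝ} :
    ∫ x in (0)..1, f x ∂μ = ∫ x in Ioc 0 1, f x ∂μ := iint_of_le zero_le_one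

theorem Continuous.along (hF : Continuous ⇈F) (t : ℝ) :
    Continuous (F t) := hF.comp (by fun_prop : Continuous fun x : ℝ => (t, x))

/-! ### Integrals over the unit interval -/

theorem integral_unitInterval {E : Type*} [NormedAddCommGroup E] [NormedSpace ℝ E] (f : ℝ → E) :
    ∫ x : I, f x = ∫ x in (0)..1, f x := by
  rw [iint01, ← integral_Icc_eq_integral_Ioc]; exact integral_subtype_comap measurableSet_Icc f

theorem integral_unitInterval' {E : Type*} [NormedAddCommGroup E] [NormedSpace ℝ E] (f : I → E) :
    ∫ x : I, f x = ∫ x in (0)..1, f (𝕡 x) := by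
  rw [← integral_unitInterval]; simp

theorem measurePreserving_coe_unitInterval :
    MeasurePreserving ((↑) : I → ℝ) volume (volume.restrict 𝕁) := by
  refine ⟨measurable_subtype_coe, ?_⟩
  exact map_comap_subtype_coe measurableSet_Icc volume

theorem ae_unitInterval_iff {p : ℝ → Prop} : (∀ᵐ x : I, p x) ↔ ∀ᵐ x ∂(volume.restrict 𝕁), p x :=
  (ae_restrict_iff_subtype measurableSet_Icc).symm

theorem intble_Icc (hab : a ≤ b) (h : ContinuousOn f (Icc a b)) : IvlInt f a b :=
  ContinuousOn.intervalIntegrable (by rwa [uIcc_of_le hab])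

theorem intble01 (h : ContinuousOn f 𝕁) : IvlInt f 0 1 := intble_Icc zero_le_one h

/-- Integration by parts on `[a,b]` for functions with continuous one-sided derivatives. -/
theorem integral_mul_deriv_Icc (hab : a ≤ b) {f' g g' : ℝ → ℝ}
    (hf : ∀ x ∈ Icc a b, HasDerivWithinAt f (f' x) (Icc a b) x)
    (hg : ∀ x ∈ Icc a b, HasDerivWithinAt g (g' x) (Icc a b) x)
    (hf' : IvlInt f' a b) (hg' : IvlInt g' a b) :
    ∫ x in a..b, f x * g' x = f b * g b - f a * g a - ∫ x in a..b, f' x * g x := by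
  have key : ∀ {f f' : ℝ → ℝ}, (∀ x ∈ Icc a b, HasDerivWithinAt f (f' x) (Icc a b) x) →
      ∀ x ∈ Ioo (min a b) (max a b), HasDerivWithinAt f (f' x) (Ioi x) x := by
    intro f f' h x hx; rw [min_eq_left hab, max_eq_right hab] at hx
    exact ((h x (Ioo_subset_Icc_self hx)).hasDerivAt (Icc_mem_nhds hx.1 hx.2)).hasDerivWithinAt
  refine intervalIntegral.integral_mul_deriv_eq_deriv_mul_of_hasDeriv_right ?_ ?_ (key hf) (key hg)
    hf' hg'
  · rw [uIcc_of_le hab]; exact fun x hx => (hf x hx).continuousWithinAt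
  · rw [uIcc_of_le hab]; exact fun x hx => (hg x hx).continuousWithinAt

theorem integral_deriv_Icc (hab : a ≤ b) {f' : ℝ → ℝ}
    (hf : ∀ x ∈ Icc a b, HasDerivWithinAt f (f' x) (Icc a b) x)
    (hf' : IvlInt f' a b) : ∫ x in a..b, f' x = f b - f a := by
  have := integral_mul_deriv_Icc hab (f := fun _ => 1) (f' := fun _ => 0)
    (fun x _ => hasDerivWithinAt_const _ _ _) hf (by simp) hf'
  simpa using this

/-- `∫ ∫ ∂ₜΨ dx dt = ∫ Ψ(b,x) dx - ∫ Ψ(a,x) dx`. -/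
theorem integral_integral_deriv_time (hab : a ≤ b) {Ψ Ψt : ℝ → ℝ → ℝ} (hd : ∀ x ∈ 𝕁, ∀ t ∈ Icc a b,
      HasDerivWithinAt (fun s => Ψ s x) (Ψt t x) (Icc a b) t)
    (hi : ∀ x ∈ 𝕁, IvlInt (fun t => Ψt t x) a b) (hItg : Integrable ⇈Ψt
      ((volume.restrict (Ioc a b)).prod (volume.restrict (Ioc (0 : ℝ) 1))))
    (ha : IvlInt (Ψ a) 0 1) (hb : IvlInt (Ψ b) 0 1) : ∫ t in a..b, ∫ x in (0)..1, Ψt t x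
      = (∫ x in (0)..1, Ψ b x) - ∫ x in (0)..1, Ψ a x := by
  rw [← iint_sub hb ha, iint_of_le hab]; simp only [iint_of_le (zero_le_one' ℝ)]
  rw [integral_integral_swap hItg]
  refine setIntegral_congr_fun measurableSet_Ioc fun x hx => ?_
  have hx' := Ioc_subset_Icc_self hx
  rw [← integral_deriv_Icc hab (hd x hx') (hi x hx'), iint_of_le hab]

theorem integrable_prod_of_continuousOn (h : ContinuousOn ⇈F (Icc a b ×ˢ 𝕁)) : Integrable ⇈F
      ((volume.restrict (Ioc a b)).prod (volume.restrict (Ioc (0 : ℝ) 1))) := by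
  rw [Measure.prod_restrict]
  exact (h.integrableOn_compact (isCompact_Icc.prod isCompact_Icc)).mono_set
    (prod_mono Ioc_subset_Icc_self Ioc_subset_Icc_self)

/-- `integral_integral_deriv_time` for continuous integrands. -/
theorem integral_integral_deriv_time_of_continuousOn (hab : a ≤ b) {Ψ Ψt : ℝ → ℝ → ℝ}
    (hd : ∀ x ∈ 𝕁, ∀ t ∈ Icc a b, HasDerivWithinAt (fun s => Ψ s x) (Ψt t x) (Icc a b) t)
    (hc : ContinuousOn ⇈Ψ (Icc a b ×ˢ 𝕁)) (hct : ContinuousOn ⇈Ψt (Icc a b ×ˢ 𝕁)) :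
    ∫ t in a..b, ∫ x in (0)..1, Ψt t x = (∫ x in (0)..1, Ψ b x) - ∫ x in (0)..1, Ψ a x := by
  have hx : ∀ t ∈ Icc a b, IvlInt (Ψ t) 0 1 := fun t ht =>
    intble01
      (hc.comp (f := fun x => (t, x)) (by fun_prop) fun x hx => ⟨ht, hx⟩)
  refine integral_integral_deriv_time hab hd (fun x hx => ?_) (integrable_prod_of_continuousOn hct)
    (hx a (left_mem_Icc.2 hab)) (hx b (right_mem_Icc.2 hab))
  exact intble_Icc hab
    (hct.comp (f := fun t => (t, x)) (by fun_prop) fun t ht => ⟨ht, hx⟩)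

theorem intervalIntegral_le_of_le_of_nonneg (hab : a ≤ b) {g : ℝ → ℝ}
    (hg : IvlInt g a b) (hg0 : ∀ t ∈ Ioc a b, 0 ≤ g t)
    (h : ∀ t ∈ Ioc a b, f t ≤ g t) : ∫ t in a..b, f t ≤ ∫ t in a..b, g t := by
  by_cases hf : IvlInt f a b
  · refine iint_mono_ae hab hf hg ?_
    rw [← Measure.restrict_congr_set Ioc_ae_eq_Icc]
    exact (ae_restrict_iff' measurableSet_Ioc).2 (.of_forall h)
  · rw [intervalIntegral.integral_undef hf]; rw [iint_of_le hab]
    exact setIntegral_nonneg measurableSet_Ioc hg0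

/-! ### The Green function of the Robin Laplacian -/

/-- The Green function of `-Δ` on `[0,1]` with `∂u(0) = u(0)/A`, `∂u(1) = -u(1)/B`. -/
def robinGreen (A B x y : ℝ) : ℝ := A + min x y - (x + A) * (y + A) / (1 + A + B)

/-- The solution of `-u'' = v` with homogeneous Robin boundary conditions. -/
def robinSol (A B : ℝ) (v : ℝ → ℝ) (x : ℝ) : ℝ :=
  (A * (∫ y in (0)..1, v y) + (∫ y in (0)..x, y * v y) + x * ∫ y in x..1, v y)
    - (x + A) / (1 + A + B) * ∫ y in (0)..1, (y + A) * v y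

/-- The derivative of `robinSol`. -/
def robinSolDeriv (A B : ℝ) (v : ℝ → ℝ) (x : ℝ) : ℝ :=
  (∫ y in x..1, v y) - 1 / (1 + A + B) * ∫ y in (0)..1, (y + A) * v y

theorem robinGreen_comm (A B x y : ℝ) : robinGreen A B x y = robinGreen A B y x := by
  unfold robinGreen; rw [min_comm]; ring

@[fun_prop]
theorem Continuous.robinGreen {X : Type*} [TopologicalSpace X] (A B : ℝ) {f g : X → ℝ}
    (hf : Continuous f) (hg : Continuous g) : Continuous fun x => robinGreen A B (f x) (g x) := by
  unfold _root_.robinGreen; fun_prop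

theorem integral_robinGreen_mul (A B : ℝ) {v : ℝ → ℝ} (hv : Continuous v) (hx : x ∈ 𝕁) :
    ∫ y in (0)..1, robinGreen A B x y * v y = robinSol A B v x := by
  have hi : ∀ {f : ℝ → ℝ}, Continuous f → ∀ a b, IvlInt f a b :=
    fun hf a b => hf.intervalIntegrable a b
  have h1 : ∫ y in (0)..1, min x y * v y = (∫ y in (0)..x, y * v y) + x * ∫ y in x..1, v y := by
    rw [← iint_add_adjacent (b := x) (hi (by fun_prop) _ _)
      (hi (by fun_prop) _ _), ← iint_const_mul]
    congr 1
    · refine iint_congr fun y hy => ?_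
      rw [uIcc_of_le hx.1] at hy; simp [min_eq_right hy.2]
    · refine iint_congr fun y hy => ?_
      rw [uIcc_of_le hx.2] at hy; simp [min_eq_left hy.1]
  have h2 : ∀ y, robinGreen A B x y * v y
      = A * v y + min x y * v y - (x + A) / (1 + A + B) * ((y + A) * v y) := by
    intro y; unfold robinGreen; ring
  simp only [h2]
  rw [iint_sub (hi (by fun_prop) _ _) (hi (by fun_prop) _ _),
    iint_add (hi (by fun_prop) _ _) (hi (by fun_prop) _ _), h1,
    iint_const_mul, iint_const_mul]
  unfold robinSol; ring

theorem hasDerivAt_integral_left {v : ℝ → ℝ} (hv : Continuous v) (x : ℝ) :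
    HasDerivAt (fun x => ∫ y in x..1, v y) (-v x) x :=
  intervalIntegral.integral_hasDerivAt_left (hv.intervalIntegrable _ _)
    hv.aestronglyMeasurable.stronglyMeasurableAtFilter hv.continuousAt

theorem hasDerivAt_robinSol (A B : ℝ) {v : ℝ → ℝ} (hv : Continuous v) (x : ℝ) :
    HasDerivAt (robinSol A B v) (robinSolDeriv A B v x) x := by
  have h1 : HasDerivAt (fun x => ∫ y in (0)..x, y * v y) (x * v x) x := iint_hasDerivAt_right
      (Continuous.intervalIntegrable (by fun_prop) _ _)
      (Continuous.aestronglyMeasurable (by fun_prop)).stronglyMeasurableAtFilter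
      (Continuous.continuousAt (by fun_prop))
  have h2 := (hasDerivAt_id x).mul (hasDerivAt_integral_left hv x)
  have h3 := (((hasDerivAt_id x).add_const A).div_const (1 + A + B)).mul_const
    (∫ y in (0)..1, (y + A) * v y)
  have h4 := ((h1.const_add (A * (∫ y in (0)..1, v y))).add h2).sub h3
  refine h4.congr_deriv ?_
  simp only [robinSolDeriv, id]; ring

theorem hasDerivAt_robinSolDeriv (A B : ℝ) {v : ℝ → ℝ} (hv : Continuous v) (x : ℝ) :
    HasDerivAt (robinSolDeriv A B v) (-v x) x := (hasDerivAt_integral_left hv x).sub_const _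

theorem robinSol_zero (A B : ℝ) (v : ℝ → ℝ) (hA : A ≠ 0) :
    robinSolDeriv A B v 0 = robinSol A B v 0 / A := by
  simp only [robinSolDeriv, robinSol, intervalIntegral.integral_same]; field_simp; ring

theorem robinSol_one (A B : ℝ) {v : ℝ → ℝ} (hv : Continuous v) (hB : B ≠ 0) (hD : 1 + A + B ≠ 0) :
    robinSolDeriv A B v 1 = -(robinSol A B v 1) / B := by
  have : ∫ y in (0)..1, (y + A) * v y = (∫ y in (0)..1, y * v y) + A * ∫ y in (0)..1, v y := by
    simp only [add_mul]
    rw [iint_add (Continuous.intervalIntegrable (by fun_prop) _ _)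
      (Continuous.intervalIntegrable (by fun_prop) _ _), iint_const_mul]
  simp only [robinSolDeriv, robinSol, intervalIntegral.integral_same, this]; field_simp; ring

theorem integral_robinSol_mul_nonneg (hA : 0 < A) (hB : 0 < B) {v : ℝ → ℝ}
    (hv : Continuous v) : 0 ≤ ∫ x in (0)..1, robinSol A B v x * v x := by
  have hc : Continuous (robinSolDeriv A B v) :=
    continuous_iff_continuousAt.2 fun x => (hasDerivAt_robinSolDeriv A B hv x).continuousAt
  have h := integral_mul_deriv_Icc (zero_le_one' ℝ)
    (fun x _ => (hasDerivAt_robinSol A B hv x).hasDerivWithinAt)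
    (fun x _ => (hasDerivAt_robinSolDeriv A B hv x).hasDerivWithinAt)
    (hc.intervalIntegrable _ _) (hv.neg.intervalIntegrable _ _)
  rw [robinSol_zero A B v hA.ne', robinSol_one A B hv hB.ne' (by positivity)] at h
  simp only [mul_neg, iint_neg] at h
  have h2 : 0 ≤ ∫ x in (0)..1, robinSolDeriv A B v x * robinSolDeriv A B v x :=
    iint_nonneg zero_le_one fun x _ => mul_self_nonneg _
  have h3 : 0 ≤ robinSol A B v 1 * (robinSol A B v 1 / B) := by
    rw [← mul_div_assoc]; exact div_nonneg (mul_self_nonneg _) hB.le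
  have h4 : 0 ≤ robinSol A B v 0 * (robinSol A B v 0 / A) := by
    rw [← mul_div_assoc]; exact div_nonneg (mul_self_nonneg _) hA.le
  have h5 : robinSol A B v 1 * (-robinSol A B v 1 / B)
    = -(robinSol A B v 1 * (robinSol A B v 1 / B)) := by ring
  linarith

theorem robinSol_neg_deriv_deriv (A B : ℝ) {U U' U'' : ℝ → ℝ} (h1 : ∀ x, HasDerivAt U (U' x) x)
    (h2 : ∀ x, HasDerivAt U' (U'' x) x) (hc : Continuous U'')
    (h00 : U 0 = 0) (h01 : U 1 = 0) (h10 : U' 0 = 0) (h11 : U' 1 = 0) (x : ℝ) :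
    robinSol A B (fun y => -U'' y) x = U x := by
  have hI : ∀ a b, ∫ y in a..b, -U'' y = U' a - U' b := by
    intro a b
    rw [iint_neg, intervalIntegral.integral_eq_sub_of_hasDerivAt
      (fun y _ => h2 y) (hc.intervalIntegrable _ _)]
    ring
  have hJ : ∀ c a b, ∫ y in a..b, (y + c) * -U'' y
      = (U b - (b + c) * U' b) - (U a - (a + c) * U' a) := by
    intro c a b
    refine intervalIntegral.integral_eq_sub_of_hasDerivAt (f := fun y => U y - (y + c) * U' y)
      (fun y _ => ?_) (Continuous.intervalIntegrable (by fun_prop) _ _)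
    refine ((h1 y).sub (((hasDerivAt_id y).add_const c).mul (h2 y))).congr_deriv ?_
    simp only [id]; ring
  have hJ0 := hJ 0 0 x
  simp only [add_zero] at hJ0; rw [robinSol, hI, hI, hJ0, hJ, h00, h01, h10, h11]; ring

/-! ### The Green operator on `L²` -/

/-- The space `L²([0,1]; ℂ)`. -/
abbrev L2C : Type := Lp ℂ 2 (volume : Measure I)

/-- The Green function as a continuous family of continuous functions. -/
def robinKer (A B : ℝ) : C(I, C(I, ℂ)) :=
  ContinuousMap.curry ⟨fun p : I × I => (robinGreen A B p.1 p.2 : ℂ), by fun_prop⟩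

@[simp] theorem robinKer_apply (A B : ℝ) (x y : I) :
    robinKer A B x y = (robinGreen A B x y : ℂ) := rfl

/-- The embedding of continuous functions into `L²`. -/
abbrev toL2C : C(I, ℂ) →L[ℂ] L2C := ContinuousMap.toLp 2 volume ℂ

theorem coeFn_toL2C (f : C(I, ℂ)) : toL2C f =ᵐ[volume] f := ContinuousMap.coeFn_toLp _ _

/-- The Green operator `L² → C([0,1])`. -/
def greenC (A B : ℝ) : L2C →L[ℂ] C(I, ℂ) := LinearMap.mkContinuous
    { toFun := fun f => ⟨fun x => inner ℂ (toL2C (robinKer A B x)) f, by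
        exact Continuous.inner (𝕜 := ℂ) (toL2C.continuous.comp (robinKer A B).continuous)
          continuous_const⟩
      map_add' := fun f g => by ext x; simp [inner_add_right]
      map_smul' := fun c f => by ext x; simp [inner_smul_right] }
    (‖toL2C‖ * ‖robinKer A B‖) (fun f => by
      refine (ContinuousMap.norm_le _ (by positivity)).2 fun x => ?_
      change ‖inner ℂ (toL2C (robinKer A B x)) f‖ ≤ _
      refine (norm_inner_le_norm _ _).trans ?_
      gcongr
      exact (toL2C.le_opNorm _).trans (by gcongr; exact (robinKer A B).norm_coe_le_norm x))

theorem greenC_apply (A B : ℝ) (f : L2C) (x : I) :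
    greenC A B f x = ∫ y : I, (robinGreen A B x y : ℂ) * f y := by
  change inner ℂ (toL2C (robinKer A B x)) f = _; rw [L2.inner_def]
  refine integral_congr_ae ?_
  filter_upwards [coeFn_toL2C (robinKer A B x)] with y hy
  rw [hy]; simp [mul_comm]

theorem greenC_toL2C (A B : ℝ) (f : C(I, ℂ)) (x : I) :
    greenC A B (toL2C f) x = ∫ y : I, (robinGreen A B x y : ℂ) * f y := by
  rw [greenC_apply]
  refine integral_congr_ae ?_
  filter_upwards [coeFn_toL2C f] with y hy
  rw [hy]

theorem L2C_integrable (f : L2C) : Integrable f := (Lp.memLp f).integrable (by norm_num)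

/-- The Green operator on `L²`. -/
def greenOp (A B : ℝ) : L2C →L[ℂ] L2C := toL2C ∘L greenC A B

theorem inner_greenOp (A B : ℝ) (f g : L2C) : inner ℂ (greenOp A B f) g
      = ∫ x : I, ∫ y : I, (robinGreen A B x y : ℂ) * (starRingEnd ℂ (f y) * g x) := by
  rw [L2.inner_def]
  refine integral_congr_ae ?_
  filter_upwards [coeFn_toL2C (greenC A B f)] with x hx
  change inner ℂ (toL2C (greenC A B f) x) (g x) = _; rw [hx, greenC_apply]
  simp only [RCLike.inner_apply]; rw [← integral_conj, ← integral_const_mul]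
  refine integral_congr_ae (.of_forall fun y => ?_)
  simp
  ring

theorem greenOp_isSymmetric (A B : ℝ) : (greenOp A B).IsSymmetric := by
  intro f g
  change inner ℂ (greenOp A B f) g = inner ℂ f (greenOp A B g)
  rw [← inner_conj_symm f, inner_greenOp, inner_greenOp, integral_integral_swap]
  · rw [← integral_conj]
    refine integral_congr_ae (.of_forall fun y => ?_)
    beta_reduce
    rw [← integral_conj]
    refine integral_congr_ae (.of_forall fun x => ?_)
    beta_reduce
    rw [robinGreen_comm A B x y]
    simp only [map_mul, Complex.conj_ofReal, RingHomCompTriple.comp_apply, RingHom.id_apply]; ring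
  · have h1 : Integrable (fun p : I × I => g p.1 * starRingEnd ℂ (f p.2))
        ((volume : Measure I).prod volume) := (L2C_integrable g).mul_prod
        ((L2C_integrable f).mono (Complex.continuous_conj.comp_aestronglyMeasurable
          (L2C_integrable f).1) (by simp))
    have hk : Continuous fun p : I × I => (robinGreen A B p.1 p.2 : ℂ) := by
      fun_prop
    obtain ⟨C, hC⟩ := isCompact_univ.exists_bound_of_continuousOn hk.continuousOn
    refine (h1.bdd_mul hk.aestronglyMeasurable
      (.of_forall fun p => hC p (mem_univ p))).congr (.of_forall fun p => ?_)
    simp [Function.uncurry, mul_comm]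

theorem continuous_extend_unitInterval {E : Type*} [TopologicalSpace E] (f : C(I, E)) :
    Continuous fun x : ℝ => f (𝕡 x) := by fun_prop

theorem greenC_toL2C_re (A B : ℝ) (f : C(I, ℂ)) (x : I) : (greenC A B (toL2C f) x).re
      = robinSol A B (fun y => (f (𝕡 y)).re) x := by
  rw [← integral_robinGreen_mul A B (by fun_prop) x.2, greenC_toL2C, ← RCLike.re_eq_complex_re,
    ← integral_re]
  · rw [← integral_unitInterval]; simp
  · have hk : Continuous fun y : I => (robinGreen A B x y : ℂ) * f y := by fun_prop
    exact hk.integrable_of_hasCompactSupport (HasCompactSupport.of_compactSpace _)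

theorem greenC_toL2C_im (A B : ℝ) (f : C(I, ℂ)) (x : I) : (greenC A B (toL2C f) x).im
      = robinSol A B (fun y => (f (𝕡 y)).im) x := by
  rw [← integral_robinGreen_mul A B (by fun_prop) x.2, greenC_toL2C, ← RCLike.im_eq_complex_im,
    ← integral_im]
  · rw [← integral_unitInterval]; simp
  · have hk : Continuous fun y : I => (robinGreen A B x y : ℂ) * f y := by fun_prop
    exact hk.integrable_of_hasCompactSupport (HasCompactSupport.of_compactSpace _)

theorem greenOp_isPositive (hA : 0 < A) (hB : 0 < B) : (greenOp A B).IsPositive := by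
  refine ⟨greenOp_isSymmetric A B, fun f => ?_⟩
  have hd : DenseRange toL2C := ContinuousMap.toLp_denseRange ℂ volume ℂ (by norm_num)
  refine hd.induction_on (p := fun f => 0 ≤ (greenOp A B).reApplyInnerSelf f) f ?_ ?_
  · exact isClosed_le continuous_const (greenOp A B).reApplyInnerSelf_continuous
  · intro f; rw [ContinuousLinearMap.reApplyInnerSelf_apply, L2.inner_def]
    have : ∫ x : I, inner ℂ (greenOp A B (toL2C f) x) (toL2C f x)
        = ∫ x : I, inner ℂ (greenC A B (toL2C f) x) (f x) := by
      refine integral_congr_ae ?_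
      filter_upwards [coeFn_toL2C f, coeFn_toL2C (greenC A B (toL2C f))] with x h1 h2
      rw [h1]
      change inner ℂ (toL2C (greenC A B (toL2C f)) x) (f x) = _; rw [h2]
    rw [this, ← integral_re]
    · have h2 : ∀ x : I, RCLike.re (inner ℂ (greenC A B (toL2C f) x) (f x))
          = robinSol A B (fun y => (f (𝕡 y)).re) x * (f (𝕡 x)).re
            + robinSol A B (fun y => (f (𝕡 y)).im) x * (f (𝕡 x)).im := by
        intro x; rw [← greenC_toL2C_re, ← greenC_toL2C_im]; simp; ring
      simp only [h2]
      have hc : ∀ {v : ℝ → ℝ}, Continuous v → Continuous (robinSol A B v) := fun hv =>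
        continuous_iff_continuousAt.2 fun x => (hasDerivAt_robinSol A B hv x).continuousAt
      rw [integral_unitInterval (fun x => robinSol A B (fun y => (f (𝕡 y)).re) x * (f (𝕡 x)).re
            + robinSol A B (fun y => (f (𝕡 y)).im) x * (f (𝕡 x)).im), iint_add]
      · exact add_nonneg (integral_robinSol_mul_nonneg hA hB (by fun_prop))
          (integral_robinSol_mul_nonneg hA hB (by fun_prop))
      · exact ((hc (by fun_prop)).mul (by fun_prop)).intervalIntegrable _ _
      · exact ((hc (by fun_prop)).mul (by fun_prop)).intervalIntegrable _ _
    · have hk : Continuous fun x : I => (inner ℂ (greenC A B (toL2C f) x) (f x)) := by fun_prop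
      exact hk.integrable_of_hasCompactSupport (HasCompactSupport.of_compactSpace _)

theorem pow_mul_exp_neg_le (hx : 0 ≤ x) (ht : 0 < t) (n : ℕ) :
    x ^ n * exp (-(t * x)) ≤ n.factorial / t ^ n := by
  have h := Real.pow_div_factorial_le_exp (t * x) (by positivity) n
  rw [div_le_iff₀ (by positivity), mul_pow] at h; rw [le_div_iff₀ (by positivity), Real.exp_neg]
  calc x ^ n * (exp (t * x))⁻¹ * t ^ n = (t ^ n * x ^ n) * (exp (t * x))⁻¹ := by ring
    _ ≤ (exp (t * x) * n.factorial) * (exp (t * x))⁻¹ := by gcongr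
    _ = n.factorial := by field_simp

theorem abs_exp_sub_one_sub_le (y : ℝ) : |exp y - 1 - y| ≤ y ^ 2 * exp |y| := by
  have h1 := Real.add_one_le_exp y
  have h2 := Real.add_one_le_exp (-y)
  have hp := Real.exp_pos y
  have h3 : exp (-y) * exp y = 1 := by rw [← Real.exp_add]; simp
  rw [abs_of_nonneg (by linarith)]
  have h4 : exp y - 1 ≤ y * exp y := by nlinarith
  rcases le_total 0 y with h | h
  · rw [abs_of_nonneg h]; nlinarith
  · have : 1 ≤ exp |y| := Real.one_le_exp (abs_nonneg _)
    nlinarith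

/-- The function `g ↦ g⁻ᵏ e^{-t/g}` on `(0,∞)`, extended by `0`. -/
def heatSymbol (k : ℕ) (t g : ℝ) : ℝ := if g ≤ 0 then 0 else g⁻¹ ^ k * exp (-(t * g⁻¹))

theorem heatSymbol_nonneg (k : ℕ) (t g : ℝ) : 0 ≤ heatSymbol k t g := by
  unfold heatSymbol; split_ifs with h
  · exact le_rfl
  · have : 0 < g := not_le.1 h
    positivity

theorem heatSymbol_le (k : ℕ) (ht : 0 < t) (g : ℝ) : heatSymbol k t g ≤ k.factorial / t ^ k := by
  unfold heatSymbol; split_ifs with h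
  · positivity
  · exact pow_mul_exp_neg_le (inv_nonneg.2 (not_le.1 h).le) ht k

theorem mul_heatSymbol_succ (k : ℕ) (t g : ℝ) : g * heatSymbol (k + 1) t g = heatSymbol k t g := by
  unfold heatSymbol; split_ifs with h
  · simp
  · have : g ≠ 0 := (not_le.1 h).ne'
    rw [pow_succ]; field_simp

theorem continuous_heatSymbol (k : ℕ) (ht : 0 < t) : Continuous (heatSymbol k t) := by
  rw [continuous_iff_continuousAt]
  intro g
  rcases lt_trichotomy g 0 with h | rfl | h
  · refine (continuousAt_const (y := (0 : ℝ))).congr ?_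
    filter_upwards [Iio_mem_nhds h] with x hx
    simp [heatSymbol, (mem_Iio.1 hx).le]
  · have h0 : heatSymbol k t 0 = 0 := by simp [heatSymbol]
    rw [ContinuousAt, h0]
    refine squeeze_zero_norm (a := fun g => |g| * ((k + 1).factorial / t ^ (k + 1))) ?_ ?_
    · intro g
      rw [← mul_heatSymbol_succ, norm_mul, norm_eq_abs, norm_eq_abs,
        abs_of_nonneg (heatSymbol_nonneg _ _ _)]
      gcongr; exact heatSymbol_le _ ht _
    · have : Tendsto (fun g : ℝ => |g| * ((k + 1).factorial / t ^ (k + 1))) (𝓝 0)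
          (𝓝 (|0| * ((k + 1).factorial / t ^ (k + 1)))) := Continuous.tendsto (by fun_prop) 0
      simpa using this
  · have : ContinuousAt (fun g : ℝ => g⁻¹ ^ k * exp (-(t * g⁻¹))) g := by
      have := h.ne'
      fun_prop (disch := assumption)
    refine this.congr ?_
    filter_upwards [Ioi_mem_nhds h] with x hx
    simp [heatSymbol, not_le.2 (mem_Ioi.1 hx)]

theorem heatSymbol_taylor (k : ℕ) {s : ℝ} (ht : 0 < t) (hs : |s| ≤ t / 2) (g : ℝ) :
    |heatSymbol k (t + s) g - heatSymbol k t g + s * heatSymbol (k + 1) t g|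
      ≤ (k + 2).factorial / (t / 2) ^ (k + 2) * s ^ 2 := by
  by_cases h : g ≤ 0
  · simp only [heatSymbol, h, if_true]; simp; positivity
  · have hg : 0 < g⁻¹ := inv_pos.2 (not_le.1 h)
    simp only [heatSymbol, h, if_false]
    set x := g⁻¹
    have e1 : x ^ k * exp (-((t + s) * x)) - x ^ k * exp (-(t * x))
        + s * (x ^ (k + 1) * exp (-(t * x)))
        = x ^ k * exp (-(t * x)) * (exp (-(s * x)) - 1 - (-(s * x))) := by
      have : exp (-((t + s) * x)) = exp (-(t * x)) * exp (-(s * x)) := by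
        rw [← Real.exp_add]; congr 1; ring
      rw [this]; ring
    rw [e1, abs_mul, abs_of_nonneg (by positivity)]
    have h2 : exp (-(t * x)) * exp |-(s * x)| ≤ exp (-(t / 2 * x)) := by
      rw [← Real.exp_add]
      apply Real.exp_le_exp.2
      rw [abs_neg, abs_mul, abs_of_pos hg]; nlinarith
    calc x ^ k * exp (-(t * x)) * |exp (-(s * x)) - 1 - (-(s * x))|
        ≤ x ^ k * exp (-(t * x)) * ((-(s * x)) ^ 2 * exp |-(s * x)|) := by
          gcongr; exact abs_exp_sub_one_sub_le _
      _ = x ^ (k + 2) * s ^ 2 * (exp (-(t * x)) * exp |-(s * x)|) := by ring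
      _ ≤ x ^ (k + 2) * s ^ 2 * exp (-(t / 2 * x)) := by gcongr
      _ = (x ^ (k + 2) * exp (-(t / 2 * x))) * s ^ 2 := by ring
      _ ≤ _ := by
        gcongr; exact pow_mul_exp_neg_le hg.le (by positivity) _

/-- The operators `G⁻ᵏ e^{-t/G}`. -/
def heatOp {E : Type*} [NormedAddCommGroup E] [InnerProductSpace ℂ E] [CompleteSpace E]
    (G : E →L[ℂ] E) (k : ℕ) (t : ℝ) : E →L[ℂ] E := cfc (heatSymbol k t) G

theorem apply_heatOp_succ {E : Type*} [NormedAddCommGroup E] [InnerProductSpace ℂ E] [CompleteSpace E]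
    {G : E →L[ℂ] E} (hG : G.IsPositive) (k : ℕ) (ht : 0 < t) (f : E) :
    G (heatOp G (k + 1) t f) = heatOp G k t f := by
  have h : G * heatOp G (k + 1) t = heatOp G k t := by
    have h1 : cfc (fun x : ℝ => x) (G) = G := cfc_id' ℝ _ hG.isSelfAdjoint
    unfold heatOp
    nth_rewrite 1 [← h1]
    rw [← cfc_mul (fun x => x) (heatSymbol (k + 1) t) (G) (by fun_prop)
      (continuous_heatSymbol _ ht).continuousOn]
    simp only [mul_heatSymbol_succ]
  rw [← h]; rfl

theorem hasDerivAt_heatOp {E : Type*} [NormedAddCommGroup E] [InnerProductSpace ℂ E] [CompleteSpace E]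
    {G : E →L[ℂ] E} (k : ℕ) (ht : 0 < t) : HasDerivAt (heatOp G k) (-heatOp G (k + 1) t) t := by
  rw [hasDerivAt_iff_isLittleO]
  set C : ℝ := (k + 2).factorial / (t / 2) ^ (k + 2)
  have hO : (fun t' => heatOp G k t' - heatOp G k t - (t' - t) • -heatOp G (k + 1) t)
      =O[𝓝 t] fun t' => (t' - t) ^ 2 := by
    refine Asymptotics.IsBigO.of_bound C ?_
    filter_upwards [Metric.ball_mem_nhds t (half_pos ht)] with t' ht'
    rw [Metric.mem_ball, Real.dist_eq] at ht'
    have ht'' : 0 < t' := by have := (abs_lt.1 ht').1; linarith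
    have e : heatOp G k t' - heatOp G k t - (t' - t) • -heatOp G (k + 1) t
        = cfc (fun g => heatSymbol k t' g - heatSymbol k t g
            + (t' - t) * heatSymbol (k + 1) t g) (G) := by
      have c1 := (continuous_heatSymbol k ht).continuousOn (s := spectrum ℝ (G))
      have c2 := (continuous_heatSymbol k ht'').continuousOn (s := spectrum ℝ (G))
      have c3 := (continuous_heatSymbol (k + 1) ht).continuousOn
        (s := spectrum ℝ (G))
      rw [cfc_add (f := fun g => heatSymbol k t' g - heatSymbol k t g)
        (g := fun g => (t' - t) * heatSymbol (k + 1) t g) (a := G) (hf := c2.sub c1)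
        (hg := continuousOn_const.mul c3), cfc_sub _ _ _ c2 c1, cfc_const_mul _ _ _ c3]
      simp only [heatOp, smul_neg, sub_neg_eq_add]
    rw [e, norm_eq_abs, abs_of_nonneg (sq_nonneg _)]
    refine norm_cfc_le (by positivity) fun g _ => ?_
    have := heatSymbol_taylor k ht ht'.le g
    simpa using this
  refine hO.trans_isLittleO ?_
  have : (fun t' : ℝ => (t' - t) ^ 2) = fun t' => (t' - t) * (t' - t) := by ext; ring
  rw [this]
  have h1 : (fun t' : ℝ => t' - t) =o[𝓝 t] fun _ => (1 : ℝ) := by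
    rw [Asymptotics.isLittleO_one_iff]; exact Continuous.tendsto' (by fun_prop) _ _ (sub_self t)
  simpa using h1.mul_isBigO (Asymptotics.isBigO_refl (fun t' : ℝ => t' - t) (𝓝 t))

theorem norm_heatOp_zero_le {E : Type*} [NormedAddCommGroup E] [InnerProductSpace ℂ E] [CompleteSpace E]
    {G : E →L[ℂ] E} (ht : 0 < t) : ‖heatOp G 0 t‖ ≤ 1 := by
  refine norm_cfc_le zero_le_one fun g _ => ?_
  rw [norm_eq_abs, abs_of_nonneg (heatSymbol_nonneg _ _ _)]; simpa using heatSymbol_le 0 ht g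

theorem norm_heatOp_zero_mul_sub_le {E : Type*} [NormedAddCommGroup E] [InnerProductSpace ℂ E] [CompleteSpace E]
    {G : E →L[ℂ] E} (hG : G.IsPositive) (ht : 0 < t) : ‖heatOp G 0 t * G - G‖ ≤ t := by
  have h1 : cfc (fun x : ℝ => x) (G) = G := cfc_id' ℝ _ hG.isSelfAdjoint
  have hc := (continuous_heatSymbol 0 ht).continuousOn (s := spectrum ℝ (G))
  have e : heatOp G 0 t * G - G = cfc (fun g => heatSymbol 0 t g * g - g) (G) := by
    rw [cfc_sub (fun g => heatSymbol 0 t g * g) (fun g => g) G (hc.mul continuousOn_id)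
      continuousOn_id, cfc_mul (heatSymbol 0 t) (fun g => g) G hc continuousOn_id, h1]
    rfl
  rw [e]
  refine norm_cfc_le ht.le fun g hg => ?_
  have hg0 : 0 ≤ g := spectrum_nonneg_of_nonneg
    ((ContinuousLinearMap.nonneg_iff_isPositive _).2 hG) hg
  rcases hg0.eq_or_lt with rfl | hg0
  · simpa using ht.le
  · have h2 : heatSymbol 0 t g = exp (-(t * g⁻¹)) := by simp [heatSymbol, not_le.2 hg0]
    have h3 := Real.add_one_le_exp (-(t * g⁻¹))
    have h4 : exp (-(t * g⁻¹)) ≤ 1 := Real.exp_le_one_iff.2 (by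
      have := mul_pos ht (inv_pos.2 hg0); linarith)
    rw [h2, norm_eq_abs, abs_le]
    have h5 : t * g⁻¹ * g = t := by field_simp
    constructor <;> nlinarith

theorem tendsto_heatOp_zero {E : Type*} [NormedAddCommGroup E] [InnerProductSpace ℂ E]
    [CompleteSpace E] {G : E →L[ℂ] E} (hG : G.IsPositive) (hd : DenseRange G) (f : E) :
    Tendsto (fun t => heatOp G 0 t f) (𝓝[>] 0) (𝓝 f) := by
  rw [Metric.tendsto_nhds]
  intro ε hε
  obtain ⟨g, hg⟩ := hd.exists_dist_lt f (show 0 < ε / 3 by positivity)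
  have h1 : Tendsto (fun t : ℝ => t * ‖g‖) (𝓝[>] 0) (𝓝 0) :=
    (Continuous.tendsto' (by fun_prop) _ _ (by simp)).mono_left nhdsWithin_le_nhds
  filter_upwards [h1.eventually_lt_const (show 0 < ε / 3 by positivity), self_mem_nhdsWithin]
    with t ht ht0
  have h2 : dist (heatOp G 0 t f) (heatOp G 0 t (G g)) ≤ dist f (G g) := by
    rw [dist_eq_norm, dist_eq_norm, ← map_sub]
    exact (ContinuousLinearMap.le_of_opNorm_le _ (norm_heatOp_zero_le ht0) _).trans (by simp)
  have h3 : dist (heatOp G 0 t (G g)) (G g) ≤ t * ‖g‖ := by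
    rw [dist_eq_norm]
    exact ContinuousLinearMap.le_of_opNorm_le _ (norm_heatOp_zero_mul_sub_le hG ht0) g
  calc dist (heatOp G 0 t f) f
      ≤ dist (heatOp G 0 t f) (heatOp G 0 t (G g)) + dist (heatOp G 0 t (G g)) (G g)
        + dist (G g) f := dist_triangle4 _ _ _ _
    _ < ε / 3 + ε / 3 + ε / 3 := by
        rw [dist_comm (G g) f]; gcongr <;> first | exact h2.trans_lt hg | exact h3.trans_lt ht
    _ = ε := by ring

theorem integrableOn_unitInterval_iff {E : Type*} [NormedAddCommGroup E] {F : ℝ → E} :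
    IntegrableOn F 𝕁 ↔ Integrable (fun x : I => F x) := by
  rw [IntegrableOn, ← measurePreserving_coe_unitInterval.map_eq]
  exact (MeasurableEmbedding.subtype_coe measurableSet_Icc).integrable_map_iff

theorem greenOp_ker {f : L2C} (hf : greenOp A B f = 0) : f = 0 := by
  set F : ℝ → ℂ := fun y => f (𝕡 y)
  have hFi : IntegrableOn F 𝕁 volume :=
    integrableOn_unitInterval_iff.2 (by simpa [F] using L2C_integrable f)
  have key : ∀ᵐ x, x ∈ 𝕁ᵒ → F x = 0 := by
    refine isOpen_Ioo.ae_eq_zero_of_integral_contDiff_smul_eq_zero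
      (hFi.mono_set Ioo_subset_Icc_self).locallyIntegrableOn fun U hU _ hUs => ?_
    have hU1 : ContDiff ℝ ∞ (deriv U) := (contDiff_infty_iff_deriv.1 hU).2
    have hU2 : ContDiff ℝ ∞ (deriv (deriv U)) := (contDiff_infty_iff_deriv.1 hU1).2
    have hz : ∀ x, x ∉ 𝕁ᵒ → U x = 0 ∧ deriv U x = 0 := fun x hx => by
      have : x ∉ tsupport U := fun h => hx (hUs h)
      exact ⟨image_eq_zero_of_notMem_tsupport this,
        image_eq_zero_of_notMem_tsupport fun h => this (tsupport_deriv_subset h)⟩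
    have hsol := robinSol_neg_deriv_deriv A B
      (fun x => (hU.differentiable (by simp) x).hasDerivAt)
      (fun x => (hU1.differentiable (by simp) x).hasDerivAt) hU2.continuous
      (hz 0 (by simp)).1 (hz 1 (by simp)).1 (hz 0 (by simp)).2 (hz 1 (by simp)).2
    have hc2 := hU2.continuous
    let V : C(I, ℂ) := ⟨fun y => ((-deriv (deriv U) y : ℝ) : ℂ), by fun_prop⟩
    have h1 : ∀ x : I, greenC A B (toL2C V) x = (U x : ℂ) := by
      intro x
      rw [← hsol, ← integral_robinGreen_mul A B (by fun_prop) x.2, greenC_toL2C,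
        ← integral_unitInterval, ← integral_complex_ofReal]
      simp [V]
    have h2 : inner ℂ (greenOp A B (toL2C V)) f = 0 := by
      have := greenOp_isSymmetric A B (toL2C V) f
      change inner ℂ (greenOp A B (toL2C V)) f = inner ℂ (toL2C V) (greenOp A B f) at this
      rw [this, hf, inner_zero_right]
    rw [L2.inner_def] at h2
    have h3 : ∫ x : I, inner ℂ (greenOp A B (toL2C V) x) (f x) = ∫ x : I, U x • F x := by
      refine integral_congr_ae ?_
      filter_upwards [coeFn_toL2C (greenC A B (toL2C V))] with x hx
      change inner ℂ (toL2C (greenC A B (toL2C V)) x) (f x) = _; rw [hx, h1]; simp [F, mul_comm]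
    rw [h3, integral_unitInterval (fun x => U x • F x),
      iint01, ← integral_Icc_eq_integral_Ioc] at h2
    rw [← h2, setIntegral_eq_integral_of_forall_compl_eq_zero]
    intro x hx; rw [(hz x fun h => hx (Ioo_subset_Icc_self h)).1, zero_smul]
  have key2 : ∀ᵐ x ∂(volume.restrict 𝕁), F x = 0 := by
    rw [← Measure.restrict_congr_set Ioo_ae_eq_Icc]
    exact (ae_restrict_iff' measurableSet_Ioo).2 key
  rw [← ae_unitInterval_iff] at key2
  apply Lp.eq_zero_iff_ae_eq_zero.2
  filter_upwards [key2] with x hx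
  simpa [F] using hx

theorem greenOp_denseRange (A B : ℝ) : DenseRange (greenOp A B) := by
  have hsa : IsSelfAdjoint (greenOp A B) :=
    ContinuousLinearMap.isSelfAdjoint_iff_isSymmetric.2 (greenOp_isSymmetric A B)
  have h : (greenOp A B).rangeᗮ = ⊥ := by
    rw [ContinuousLinearMap.orthogonal_range, ContinuousLinearMap.isSelfAdjoint_iff'.1 hsa,
      LinearMap.ker_eq_bot']
    intro f hf; exact greenOp_ker hf
  have h2 := (Submodule.topologicalClosure_eq_top_iff (K := (greenOp A B).range)).2 h
  intro x
  have : x ∈ (greenOp A B).range.topologicalClosure := by rw [h2]; trivial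
  exact this

theorem integral_norm_le_norm_L2C (f : L2C) : ∫ x : I, ‖f x‖ ≤ ‖f‖ := by
  have h := eLpNorm_le_eLpNorm_of_exponent_le (μ := (volume : Measure I)) (p := 1) (q := 2)
    (by norm_num) (Lp.aestronglyMeasurable f)
  rw [Lp.norm_def, integral_norm_eq_lintegral_enorm (Lp.aestronglyMeasurable f),
    ← eLpNorm_one_eq_lintegral_enorm]
  exact ENNReal.toReal_mono (Lp.eLpNorm_ne_top f) h

/-- The semigroup generated by the Laplacian with homogeneous Robin boundary conditions: `v k t`
is `(-1)ᵏ` times the `k`-th time derivative of the solution started from `f`. -/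
theorem exists_robin_semigroup (hA : 0 < A) (hB : 0 < B) {f : I → ℝ}
    (hf : MemLp f 2) : ∃ v : ℕ → ℝ → C(I, ℝ), (∀ k t, 0 < t → HasDerivAt (v k) (-v (k + 1) t) t) ∧
      (∀ k t, 0 < t → ∀ x : I, v k t x = robinSol A B (fun y => v (k + 1) t (𝕡 y)) x) ∧
      Tendsto (fun t => ∫ x : I, |v 0 t x - f x|) (𝓝[>] 0) (𝓝 0) := by
  have hG := greenOp_isPositive hA hB
  have hF : MemLp (fun x => (f x : ℂ)) 2 (volume : Measure I) := hf.ofReal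
  set F : L2C := hF.toLp _
  set R : C(I, ℂ) →L[ℝ] C(I, ℝ) := ContinuousLinearMap.compLeftContinuous ℝ I Complex.reCLM
  have hR : ∀ (g : C(I, ℂ)) x, R g x = (g x).re := fun g x => rfl
  set c : ℕ → ℝ → C(I, ℂ) := fun k t => greenC A B (heatOp (greenOp A B) (k + 1) t F)
  have hc : ∀ k t, 0 < t → toL2C (c k t) = heatOp (greenOp A B) k t F := fun k t ht =>
    apply_heatOp_succ hG k ht F
  refine ⟨fun k t => R (c k t), fun k t ht => ?_, fun k t ht x => ?_, ?_⟩
  · have h1 : HasDerivAt (fun t => heatOp (greenOp A B) (k + 1) t F)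
        (-heatOp (greenOp A B) (k + 1 + 1) t F) t :=
      ((ContinuousLinearMap.apply ℂ L2C F).restrictScalars ℝ).hasFDerivAt.comp_hasDerivAt t
        (hasDerivAt_heatOp (G := greenOp A B) (k + 1) ht)
    have h2 := ((greenC A B).restrictScalars ℝ).hasFDerivAt.comp_hasDerivAt t h1
    have h3 := R.hasFDerivAt.comp_hasDerivAt t h2
    refine h3.congr_deriv ?_
    change R (greenC A B (-_)) = -R (greenC A B _); rw [map_neg, map_neg]
  · have h1 : c k t = greenC A B (toL2C (c (k + 1) t)) := by rw [hc _ _ ht]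
    rw [hR, h1, greenC_toL2C_re]; rfl
  · refine squeeze_zero' (.of_forall fun t => integral_nonneg fun x => abs_nonneg _)
      (g := fun t => ‖heatOp (greenOp A B) 0 t F - F‖) ?_ ?_
    · filter_upwards [self_mem_nhdsWithin] with t ht
      refine le_trans ?_ (integral_norm_le_norm_L2C _)
      refine integral_mono_of_nonneg (.of_forall fun x => abs_nonneg _)
        (L2C_integrable _).norm ?_
      filter_upwards [Lp.coeFn_sub (heatOp (greenOp A B) 0 t F) F, hF.coeFn_toLp,
        coeFn_toL2C (c 0 t)] with x h1 h2 h3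
      rw [hc 0 t ht] at h3; rw [h1, Pi.sub_apply, h3, h2, hR]
      refine le_trans (le_of_eq ?_) (Complex.abs_re_le_norm _)
      simp
    · have := (tendsto_heatOp_zero hG (greenOp_denseRange A B) F).sub_const F
      simpa using this.norm

/-! ### Joint smoothness of curves of continuous functions -/

/-- Evaluation of a curve of continuous functions at a point of the line. -/
def evalCurve (c : ℝ → C(I, ℝ)) (p : ℝ²) : ℝ := c p.1 (𝕡 p.2)

theorem continuousOn_evalCurve {c : ℝ → C(I, ℝ)} {s : Set ℝ} (hc : ContinuousOn c s) :
    ContinuousOn (evalCurve c) (s ×ˢ univ) := by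
  have h1 : ContinuousOn (fun p : ℝ² => (c p.1, 𝕡 p.2)) (s ×ˢ univ) :=
    (hc.comp continuousOn_fst fun p hp => hp.1).prodMk (by fun_prop)
  exact (continuous_eval (F := C(I, ℝ)) (X := I) (Y := ℝ)).comp_continuousOn h1

theorem hasFDerivWithinAt_evalCurve {c : ℝ → C(I, ℝ)} {c' : C(I, ℝ)} {d : ℝ}
    (hc : HasDerivAt c c' t) {s : Set ℝ}
    (hx : HasDerivWithinAt (fun y => c t (𝕡 y)) d 𝕁 x) : HasFDerivWithinAt (evalCurve c)
      (c' (𝕡 x) • ContinuousLinearMap.fst ℝ ℝ ℝ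
        + d • ContinuousLinearMap.snd ℝ ℝ ℝ) (s ×ˢ 𝕁) (t, x) := by
  have h1 : HasFDerivWithinAt
      (fun p : ℝ² => (c p.1 - c t) (𝕡 p.2))
      (c' (𝕡 x) • ContinuousLinearMap.fst ℝ ℝ ℝ) (s ×ˢ 𝕁) (t, x) := by
    apply HasFDerivAt.hasFDerivWithinAt
    rw [hasFDerivAt_iff_isLittleO]
    have e1 : (fun p : ℝ² => (c p.1 - c t - (p.1 - t) • c') (𝕡 p.2))
        =o[𝓝 (t, x)] fun p => p - (t, x) := by
      have h := (hasDerivAt_iff_isLittleO.1 hc).comp_tendsto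
        (Continuous.tendsto' continuous_fst (t, x) t rfl)
      have h2 : (fun p : ℝ² => p.1 - t) =O[𝓝 (t, x)] fun p => p - (t, x) :=
        Asymptotics.IsBigO.of_bound 1 (.of_forall fun p => by
          simpa using norm_fst_le (p - (t, x)))
      refine Asymptotics.IsBigO.trans_isLittleO ?_ (h.trans_isBigO h2)
      exact Asymptotics.IsBigO.of_bound 1 (.of_forall fun p => by
        simpa using ContinuousMap.norm_coe_le_norm (c p.1 - c t - (p.1 - t) • c') _)
    have e2 : (fun p : ℝ² => (p.1 - t) * (c' (𝕡 p.2) - c' (𝕡 x)))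
        =o[𝓝 (t, x)] fun p => p - (t, x) := by
      have h2 : (fun p : ℝ² => p.1 - t) =O[𝓝 (t, x)] fun p => p - (t, x) :=
        Asymptotics.IsBigO.of_bound 1 (.of_forall fun p => by
          simpa using norm_fst_le (p - (t, x)))
      have h3 : (fun p : ℝ² => c' (𝕡 p.2) - c' (𝕡 x)) =o[𝓝 (t, x)] fun _ => (1 : ℝ) := by
        rw [Asymptotics.isLittleO_one_iff]; exact Continuous.tendsto' (by fun_prop) _ _ (by simp)
      simpa using (h2.norm_right.mul_isLittleO h3)
    refine (e1.add e2).congr_left fun p => ?_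
    simp
    ring
  have h2 : HasFDerivWithinAt (fun p : ℝ² => c t (𝕡 p.2))
      (d • ContinuousLinearMap.snd ℝ ℝ ℝ) (s ×ˢ 𝕁) (t, x) := by
    have := HasFDerivWithinAt.comp (t, x) (s := s ×ˢ 𝕁) (f := Prod.snd)
      hx.hasFDerivWithinAt hasFDerivWithinAt_snd fun p hp => hp.2
    refine this.congr_fderiv ?_
    ext <;> simp
  refine (h1.add h2).congr_of_eventuallyEq (.of_forall fun p => ?_) ?_ <;>
    simp [evalCurve]

theorem contDiffOn_evalCurve_of_family {ι : Type*} {c : ι → ℝ → C(I, ℝ)} {τ ξ : ι → ι} {r q : ι → ℝ}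
    (ht : ∀ i, ∀ t > 0, HasDerivAt (c i) (r i • c (τ i) t) t) (hx : ∀ i, ∀ t > 0, ∀ x ∈ 𝕁,
      HasDerivWithinAt (fun y => c i t (𝕡 y)) (q i * c (ξ i) t (𝕡 x)) 𝕁 x) (i : ι) :
    ContDiffOn ℝ ∞ (evalCurve (c i)) (Ioi 0 ×ˢ 𝕁) := by
  have hu : UniqueDiffOn ℝ (Ioi (0 : ℝ) ×ˢ 𝕁) :=
    (uniqueDiffOn_Ioi 0).prod (uniqueDiffOn_Icc zero_lt_one)
  rw [contDiffOn_infty]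
  intro n
  induction n generalizing i with
  | zero =>
    rw [Nat.cast_zero, contDiffOn_zero]
    exact (continuousOn_evalCurve fun t ht' => (ht i t ht').continuousAt.continuousWithinAt).mono
      (prod_mono le_rfl (subset_univ _))
  | succ n ih =>
    rw [Nat.cast_succ, contDiffOn_succ_iff_hasFDerivWithinAt_of_uniqueDiffOn hu]
    refine ⟨by simp, fun p => (r i * evalCurve (c (τ i)) p) • ContinuousLinearMap.fst ℝ ℝ ℝ
      + (q i * evalCurve (c (ξ i)) p) • ContinuousLinearMap.snd ℝ ℝ ℝ, ?_, ?_⟩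
    · exact ((contDiffOn_const.mul (ih _)).smul contDiffOn_const).add
        ((contDiffOn_const.mul (ih _)).smul contDiffOn_const)
    · rintro ⟨t, x⟩ ⟨h1, h2⟩
      exact hasFDerivWithinAt_evalCurve (ht i t h1) (hx i t h1 x h2)

/-- `robinSolDeriv` as a bounded operator on continuous functions. -/
def robinSolDerivCLM (A B : ℝ) : C(I, ℝ) →L[ℝ] C(I, ℝ) := LinearMap.mkContinuous
    { toFun := fun w => ⟨fun x => robinSolDeriv A B (fun y => w (𝕡 y)) x, by
        have : Continuous (robinSolDeriv A B fun y => w (𝕡 y)) :=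
          continuous_iff_continuousAt.2 fun x =>
            (hasDerivAt_robinSolDeriv A B (continuous_extend_unitInterval w) x).continuousAt
        fun_prop⟩
      map_add' := fun f g => by
        ext x
        have hi : ∀ (h : C(I, ℝ)) (a b : ℝ), IntervalIntegrable
            (fun y => h (𝕡 y)) volume a b := fun h a b =>
          (continuous_extend_unitInterval h).intervalIntegrable _ _
        have hj : ∀ (h : C(I, ℝ)) (a b : ℝ), IntervalIntegrable
            (fun y => (y + A) * h (𝕡 y)) volume a b := fun h a b =>
          Continuous.intervalIntegrable (by fun_prop) _ _
        simp only [robinSolDeriv, ContinuousMap.coe_add, Pi.add_apply, ContinuousMap.coe_mk, mul_add]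
        rw [iint_add (hi f _ _) (hi g _ _), iint_add (hj f _ _) (hj g _ _)]; ring
      map_smul' := fun a f => by
        ext x
        simp only [robinSolDeriv, ContinuousMap.coe_smul, Pi.smul_apply, ContinuousMap.coe_mk,
          smul_eq_mul, RingHom.id_apply, mul_left_comm _ a, iint_const_mul]
        ring }
    (1 + |1 / (1 + A + B)| * (1 + |A|)) (fun f => by
      refine (ContinuousMap.norm_le _ (by positivity)).2 fun x => ?_
      have h1 : ‖∫ y in (x : ℝ)..1, f (𝕡 y)‖ ≤ ‖f‖ * |1 - (x : ℝ)| :=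
        intervalIntegral.norm_integral_le_of_norm_le_const fun y _ => f.norm_coe_le_norm _
      have h2 : ‖∫ y in (0)..1, (y + A) * f (𝕡 y)‖
          ≤ ((1 + |A|) * ‖f‖) * |1 - (0 : ℝ)| := by
        refine intervalIntegral.norm_integral_le_of_norm_le_const fun y hy => ?_
        rw [uIoc_of_le zero_le_one] at hy; rw [norm_mul]; gcongr
        · refine (norm_add_le _ _).trans ?_
          rw [norm_eq_abs, norm_eq_abs, abs_of_pos hy.1]; linarith [hy.2]
        · exact f.norm_coe_le_norm _
      have h3 : |1 - (x : ℝ)| ≤ 1 := by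
        rw [abs_of_nonneg (by linarith [x.2.2])]; linarith [x.2.1]
      simp only [sub_zero, abs_one, mul_one] at h2
      change ‖(∫ y in (x : ℝ)..1, f (𝕡 y)) - 1 / (1 + A + B)
        * ∫ y in (0)..1, (y + A) * f (𝕡 y)‖ ≤ _
      refine (norm_sub_le _ _).trans ?_
      rw [norm_mul, norm_eq_abs (1 / (1 + A + B))]
      have h4 : ‖f‖ * |1 - (x : ℝ)| ≤ ‖f‖ := mul_le_of_le_one_right (norm_nonneg _) h3
      calc _ ≤ ‖f‖ + |1 / (1 + A + B)| * ((1 + |A|) * ‖f‖) := by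
            gcongr; exact h1.trans h4
        _ = _ := by ring)

theorem robinSolDerivCLM_apply (A B : ℝ) (w : C(I, ℝ)) (x : I) : robinSolDerivCLM A B w x
      = robinSolDeriv A B (fun y => w (𝕡 y)) x := rfl

/-! ### The hydrodynamic flow -/

/-- `ρ`, with space derivative `ρx` and time derivative `ρt`, is a classical solution of the
hydrodynamic equation at positive times, with initial condition `ρ 0` attained in `L¹`. -/
structure RobinFlow (α β A B : ℝ) (ρ ρx ρt : ℝ → ℝ → ℝ) : Prop where
  smooth : ContDiffOn ℝ ∞ ⇈ρ (Ioi 0 ×ˢ 𝕁)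
  cont_x : ContinuousOn ⇈ρx (Ioi 0 ×ˢ 𝕁)
  cont_t : ContinuousOn ⇈ρt (Ioi 0 ×ˢ 𝕁)
  has_x : ∀ t > 0, ∀ x ∈ 𝕁, HasDerivWithinAt (ρ t) (ρx t x) 𝕁 x
  has_xx : ∀ t > 0, ∀ x ∈ 𝕁, HasDerivWithinAt (ρx t) (ρt t x) 𝕁 x
  has_t : ∀ t > 0, ∀ x ∈ 𝕁, HasDerivAt (fun s => ρ s x) (ρt t x) t
  bc_zero : ∀ t > 0, ρx t 0 = (ρ t 0 - α) / A
  bc_one : ∀ t > 0, ρx t 1 = (β - ρ t 1) / B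
  meas : Measurable ⇈ρ
  meas_x : Measurable ⇈ρx
  init : Tendsto (fun t => ∫ x in (0)..1, |ρ t x - ρ 0 x|) (𝓝[>] 0) (𝓝 0)

theorem measurable_ite_pos_of_continuousOn {F G : ℝ² → ℝ}
    (hF : ContinuousOn F (Ioi 0 ×ˢ univ)) (hG : Measurable G) :
    Measurable fun p : ℝ² => if 0 < p.1 then F p else G p := by
  have hs : MeasurableSet (Ioi (0 : ℝ) ×ˢ (univ : Set ℝ)) := measurableSet_Ioi.prod MeasurableSet.univ
  refine measurable_of_restrict_of_restrict_compl hs ?_ ?_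
  · convert (continuousOn_iff_continuous_domRestrict.1 hF).measurable using 1
    ext p
    have h : (0 : ℝ) < p.1.1 := p.2.1
    simp [h]
  · convert hG.comp (measurable_subtype_coe (p := fun p => p ∈ (Ioi (0 : ℝ) ×ˢ (univ : Set ℝ))ᶜ))
      using 1
    ext p
    have h : ¬ (0 : ℝ) < p.1.1 := fun h => p.2 ⟨h, trivial⟩
    simp [h]

theorem exists_robinFlow (α β : ℝ) (hA : 0 < A) (hB : 0 < B) {γ : I → ℝ}
    (hγ : Measurable γ) (hγ01 : ∀ x, γ x ∈ 𝕁) : ∃ ρ ρx ρt : ℝ → ℝ → ℝ,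
      RobinFlow α β A B ρ ρx ρt ∧ ∀ x, ρ 0 x = γ (𝕡 x) := by
  set b : ℝ := (β - α) / (1 + A + B)
  set a : ℝ := α + A * b
  have hD : (1 + A + B) ≠ 0 := by positivity
  have hb : b * (1 + A + B) = β - α := by simp only [b]; field_simp
  have hf : MemLp (fun x : I => γ x - (a + b * x)) 2 (volume : Measure I) := by
    refine MemLp.of_bound (Measurable.aestronglyMeasurable (by fun_prop)) (1 + |a| + |b|)
      (.of_forall fun x => ?_)
    have h1 := hγ01 x
    have h2 : |b * (x : ℝ)| ≤ |b| := by
      rw [abs_mul, abs_of_nonneg x.2.1]; exact mul_le_of_le_one_right (abs_nonneg _) x.2.2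
    rw [norm_eq_abs]
    calc |γ x - (a + b * x)| ≤ |γ x| + |a + b * x| := abs_sub _ _
      _ ≤ 1 + (|a| + |b|) := by
        gcongr
        · rw [abs_of_nonneg h1.1]; exact h1.2
        · exact (abs_add_le _ _).trans (by gcongr)
      _ = _ := by ring
  obtain ⟨v, hv1, hv2, hv3⟩ := exists_robin_semigroup hA hB hf
  set d : ℕ → ℝ → C(I, ℝ) := fun k t => robinSolDerivCLM A B (v (k + 1) t)
  have hvc : ∀ k, ContinuousOn (v k) (Ioi 0) := fun k t ht =>
    (hv1 k t ht).continuousAt.continuousWithinAt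
  have hd1 : ∀ k t, 0 < t → HasDerivAt (d k) (-d (k + 1) t) t := by
    intro k t ht
    refine ((robinSolDerivCLM A B).hasFDerivAt.comp_hasDerivAt t (hv1 (k + 1) t ht)).congr_deriv ?_
    simp [d]
  have hdc : ∀ k, ContinuousOn (d k) (Ioi 0) := fun k t ht =>
    (hd1 k t ht).continuousAt.continuousWithinAt
  have hve : ∀ k t, 0 < t → ∀ x ∈ 𝕁, v k t (𝕡 x) = robinSol A B (fun y => v (k + 1) t (𝕡 y)) x := by
    intro k t ht x hx; rw [hv2 k t ht, projIcc_of_mem _ hx]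
  have hde : ∀ k t, ∀ x ∈ 𝕁, d k t (𝕡 x) = robinSolDeriv A B (fun y => v (k + 1) t (𝕡 y)) x := by
    intro k t x hx; rw [robinSolDerivCLM_apply, projIcc_of_mem _ hx]
  have hvx : ∀ k, ∀ t > 0, ∀ x ∈ 𝕁, HasDerivWithinAt (fun y => v k t (𝕡 y))
        (d k t (𝕡 x)) 𝕁 x := by
    intro k t ht x hx; rw [hde k t x hx]
    exact (hasDerivAt_robinSol A B (by fun_prop) x).hasDerivWithinAt.congr
      (fun y hy => hve k t ht y hy) (hve k t ht x hx)
  have hdx : ∀ k, ∀ t > 0, ∀ x ∈ 𝕁, HasDerivWithinAt (fun y => d k t (𝕡 y))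
        (-v (k + 1) t (𝕡 x)) 𝕁 x := by
    intro k t ht x hx
    exact (hasDerivAt_robinSolDeriv A B (by fun_prop) x).hasDerivWithinAt.congr
      (fun y hy => hde k t y hy) (hde k t x hx)
  have hsm : ContDiffOn ℝ ∞ (evalCurve (v 0)) (Ioi 0 ×ˢ 𝕁) := by
    refine contDiffOn_evalCurve_of_family (ι := ℕ × Bool)
      (c := fun i => if i.2 then d i.1 else v i.1)
      (τ := fun i => (i.1 + 1, i.2)) (ξ := fun i => if i.2 then (i.1 + 1, false) else (i.1, true))
      (r := fun _ => -1) (q := fun i => if i.2 then -1 else 1) ?_ ?_ (0, false)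
    · rintro ⟨k, _ | _⟩ t ht
      · simpa using hv1 k t ht
      · simpa using hd1 k t ht
    · rintro ⟨k, _ | _⟩ t ht x hx
      · simpa using hvx k t ht x hx
      · simpa using hdx k t ht x hx
  refine ⟨fun t x => if 0 < t then (a + b * x) + v 0 t (𝕡 x)
      else γ (𝕡 x),
    fun t x => if 0 < t then b + d 0 t (𝕡 x) else 0,
    fun t x => -v 1 t (𝕡 x), ?_, fun x => by simp⟩
  have hprod : ∀ {F G : ℝ² → ℝ}, ContinuousOn F (Ioi 0 ×ˢ univ) →
      ContinuousOn (fun p => if 0 < p.1 then F p else G p) (Ioi 0 ×ˢ 𝕁) := by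
    intro F G hF
    refine (hF.mono (prod_mono le_rfl (subset_univ _))).congr fun p hp => ?_
    have : (0 : ℝ) < p.1 := hp.1
    simp [this]
  refine ⟨?_, ?_, ?_, ?_, ?_, ?_, ?_, ?_, ?_, ?_, ?_⟩
  · refine (ContDiffOn.add (f := fun p : ℝ² => a + b * p.2)
      (contDiffOn_const.add (contDiffOn_const.mul contDiffOn_snd)) hsm).congr fun p hp => ?_
    have : (0 : ℝ) < p.1 := hp.1
    simp only [this, if_true, evalCurve]
  · exact hprod (continuousOn_const.add (continuousOn_evalCurve (hdc 0)))
  · exact ((continuousOn_evalCurve (hvc 1)).mono (prod_mono le_rfl (subset_univ _))).neg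
  · intro t ht x hx; simp only [ht.lt, if_true]
    refine (((hasDerivWithinAt_id x _).const_mul b).const_add a |>.add (hvx 0 t ht x hx)).congr_deriv
      ?_
    simp
  · intro t ht x hx; simp only [ht.lt, if_true]; exact (hdx 0 t ht x hx).const_add b
  · intro t ht x hx
    have h1 : HasDerivAt (fun s => v 0 s (𝕡 x))
        (-v 1 t (𝕡 x)) t := by
      exact (ContinuousMap.evalCLM ℝ (𝕡 x)).hasFDerivAt.comp_hasDerivAt t
        (hv1 0 t ht)
    refine (h1.const_add (a + b * x)).congr_of_eventuallyEq ?_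
    filter_upwards [Ioi_mem_nhds ht] with s hs
    have : (0 : ℝ) < s := hs
    simp [this]
  · intro t ht; simp only [ht.lt, if_true]
    rw [hde 0 t 0 (by simp), hve 0 t ht 0 (by simp), robinSol_zero A B _ hA.ne']; simp only [a]
    field_simp; ring
  · intro t ht; simp only [ht.lt, if_true]
    rw [hde 0 t 1 (by simp), hve 0 t ht 1 (by simp),
      robinSol_one A B (by fun_prop) hB.ne' hD]
    simp only [a]; field_simp; linarith
  · refine measurable_ite_pos_of_continuousOn (F := fun p => (a + b * p.2) + evalCurve (v 0) p)
      (G := fun p => γ (𝕡 p.2)) ?_ ?_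
    · exact ContinuousOn.add (by fun_prop) (continuousOn_evalCurve (hvc 0))
    · exact hγ.comp (continuous_projIcc.measurable.comp measurable_snd)
  · refine measurable_ite_pos_of_continuousOn (F := fun p => b + evalCurve (d 0) p)
      (G := fun p => 0) ?_ measurable_const
    exact continuousOn_const.add (continuousOn_evalCurve (hdc 0))
  · refine hv3.congr' ?_
    filter_upwards [self_mem_nhdsWithin] with t ht
    have : (0 : ℝ) < t := ht
    rw [← integral_unitInterval]; simp only [this, if_true, lt_irrefl, if_false, projIcc_val]
    refine integral_congr_ae (.of_forall fun x => ?_)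
    beta_reduce
    congr 1; ring

/-! ### Comparison principle -/

theorem expNegInvGlue_le_one (x : ℝ) : expNegInvGlue x ≤ 1 := by
  rcases le_or_gt x 0 with h | h
  · simp [expNegInvGlue.zero_of_nonpos h]
  · simp only [expNegInvGlue, not_le.2 h, if_false]
    exact Real.exp_le_one_iff.2 (neg_nonpos.2 (inv_nonneg.2 h.le))

/-- A smooth convex function, positive on `(-∞,0)` and vanishing on `[0,∞)`. -/
def negGlue (r : ℝ) : ℝ := ∫ s in (0)..(-r), expNegInvGlue s

theorem continuous_expNegInvGlue : Continuous expNegInvGlue :=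
  (expNegInvGlue.contDiff (n := 0)).continuous

theorem hasDerivAt_negGlue (r : ℝ) : HasDerivAt negGlue (-expNegInvGlue (-r)) r := by
  have h : HasDerivAt (fun u => ∫ s in (0)..u, expNegInvGlue s) (expNegInvGlue (-r)) (-r) :=
    iint_hasDerivAt_right (continuous_expNegInvGlue.intervalIntegrable _ _)
      continuous_expNegInvGlue.aestronglyMeasurable.stronglyMeasurableAtFilter
      continuous_expNegInvGlue.continuousAt
  exact (h.comp r (hasDerivAt_neg r)).congr_deriv (by simp)

theorem continuous_negGlue : Continuous negGlue :=
  continuous_iff_continuousAt.2 fun r => (hasDerivAt_negGlue r).continuousAt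

theorem negGlue_of_nonneg (hr : 0 ≤ r) : negGlue r = 0 := by
  rw [negGlue, intervalIntegral.integral_symm, iint_of_le (by linarith),
    setIntegral_congr_fun measurableSet_Ioc
      (fun s hs => expNegInvGlue.zero_of_nonpos hs.2)]
  simp

theorem negGlue_pos (hr : r < 0) : 0 < negGlue r := intervalIntegral.intervalIntegral_pos_of_pos_on
    (continuous_expNegInvGlue.intervalIntegrable _ _)
    (fun _ hs => expNegInvGlue.pos_of_pos hs.1) (by linarith)

theorem negGlue_nonneg (r : ℝ) : 0 ≤ negGlue r := by
  rcases lt_or_ge r 0 with h | h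
  · exact (negGlue_pos h).le
  · exact (negGlue_of_nonneg h).ge

theorem negGlue_le (hc : 0 ≤ c) (h : -c ≤ r) : negGlue r ≤ c := by
  rcases le_or_gt 0 r with hr | hr
  · rwa [negGlue_of_nonneg hr]
  · have := intervalIntegral.norm_integral_le_of_norm_le_const (a := 0) (b := -r)
      (f := expNegInvGlue) (C := 1) fun s _ => by
        rw [norm_eq_abs, abs_of_nonneg (expNegInvGlue.nonneg _)]; exact expNegInvGlue_le_one _
    rw [sub_zero, one_mul, abs_of_pos (by linarith)] at this
    exact (le_abs_self _).trans (this.trans (by linarith))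

/-- A classical subsolution of the hydrodynamic equation on `(0,T]×[0,1]`. -/
structure IsSubsolution (α β A B T : ℝ) (q qx qxx qt : ℝ → ℝ → ℝ) : Prop where
  cont : ContinuousOn ⇈q (Ioc 0 T ×ˢ 𝕁)
  cont_x : ContinuousOn ⇈qx (Ioc 0 T ×ˢ 𝕁)
  cont_xx : ContinuousOn ⇈qxx (Ioc 0 T ×ˢ 𝕁)
  cont_t : ContinuousOn ⇈qt (Ioc 0 T ×ˢ 𝕁)
  has_x : ∀ t ∈ Ioc 0 T, ∀ x ∈ 𝕁, HasDerivWithinAt (q t) (qx t x) 𝕁 x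
  has_xx : ∀ t ∈ Ioc 0 T, ∀ x ∈ 𝕁, HasDerivWithinAt (qx t) (qxx t x) 𝕁 x
  has_t : ∀ t ∈ Ioc 0 T, ∀ x ∈ 𝕁, HasDerivAt (fun s => q s x) (qt t x) t
  le : ∀ t ∈ Ioc 0 T, ∀ x ∈ 𝕁, qt t x ≤ qxx t x
  bc_zero : ∀ t ∈ Ioc 0 T, (q t 0 - α) / A ≤ qx t 0
  bc_one : ∀ t ∈ Ioc 0 T, qx t 1 ≤ (β - q t 1) / B

theorem ContinuousOn.slice {s r : Set ℝ} (h : ContinuousOn ⇈F (s ×ˢ r)) (ht : t ∈ s) :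
    ContinuousOn (F t) r := h.comp (f := fun x => (t, x)) (by fun_prop) fun _ hx => ⟨ht, hx⟩

namespace RobinFlow

theorem cont (h : RobinFlow α β A B ρ ρx ρt) :
    ContinuousOn ⇈ρ (Ioi 0 ×ˢ 𝕁) := h.smooth.continuousOn

theorem comparison (h : RobinFlow α β A B ρ ρx ρt) (hA : 0 < A) (hB : 0 < B) (h0 : IvlInt (ρ 0) 0 1)
    {q qx qxx qt : ℝ → ℝ → ℝ} (hq : IsSubsolution α β A B T q qx qxx qt)
    (hi : ∀ η > 0, ∀ᶠ a in 𝓝[>] (0 : ℝ), ∀ x ∈ 𝕁, q a x ≤ ρ 0 x + η) :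
    ∀ t ∈ Ioc 0 T, ∀ x ∈ 𝕁, q t x ≤ ρ t x := by
  set d : ℝ → ℝ → ℝ := fun t x => ρ t x - q t x
  have sub : Ioc 0 T ×ˢ 𝕁 ⊆ Ioi 0 ×ˢ 𝕁 := prod_mono (fun _ h => h.1) le_rfl
  have hdc : ContinuousOn ⇈d (Ioc 0 T ×ˢ 𝕁) := (h.cont.mono sub).sub hq.cont
  have static : ∀ t ∈ Ioc 0 T, ∫ x in (0)..1, -expNegInvGlue (-d t x) * (ρt t x - qt t x) ≤ 0 := by
    intro t ht
    have cE : ContinuousOn (fun x => -expNegInvGlue (-d t x)) 𝕁 :=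
      (continuous_expNegInvGlue.comp_continuousOn (hdc.slice ht).neg).neg
    have cE' : Continuous (deriv expNegInvGlue) :=
      (expNegInvGlue.contDiff (n := 1)).continuous_deriv le_rfl
    have cdx : ContinuousOn (fun x => ρx t x - qx t x) 𝕁 :=
      (h.cont_x.slice ht.1).sub (hq.cont_x.slice ht)
    have cρt : ContinuousOn (ρt t) 𝕁 := h.cont_t.slice ht.1
    have ibp := integral_mul_deriv_Icc (zero_le_one' ℝ)
      (f := fun x => -expNegInvGlue (-d t x))
      (f' := fun x => deriv expNegInvGlue (-d t x) * (ρx t x - qx t x))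
      (g := fun x => ρx t x - qx t x) (g' := fun x => ρt t x - qxx t x)
      (fun x hx => by
        have h1 : HasDerivAt expNegInvGlue (deriv expNegInvGlue (-d t x)) (-d t x) :=
          ((expNegInvGlue.contDiff (n := 1)).differentiable (by simp) _).hasDerivAt
        have h2 := (h.has_x t ht.1 x hx).sub (hq.has_x t ht x hx)
        refine (h1.comp_hasDerivWithinAt x h2.neg).neg.congr_deriv ?_
        ring)
      (fun x hx => (h.has_xx t ht.1 x hx).sub (hq.has_xx t ht x hx))
      (intble01 ((cE'.comp_continuousOn (hdc.slice ht).neg).mul cdx))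
      (intble01 (cρt.sub (hq.cont_xx.slice ht)))
    have hmono : ∫ x in (0)..1, -expNegInvGlue (-d t x) * (ρt t x - qt t x)
        ≤ ∫ x in (0)..1, -expNegInvGlue (-d t x) * (ρt t x - qxx t x) := by
      refine iint_mono_on zero_le_one
        (intble01 (cE.mul (cρt.sub (hq.cont_t.slice ht))))
        (intble01 (cE.mul (cρt.sub (hq.cont_xx.slice ht)))) fun x hx => ?_
      have := hq.le t ht x hx
      have := expNegInvGlue.nonneg (-d t x)
      nlinarith
    have hpos : 0 ≤ ∫ x in (0)..1,
        deriv expNegInvGlue (-d t x) * (ρx t x - qx t x) * (ρx t x - qx t x) :=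
      iint_nonneg zero_le_one fun x _ => by
        rw [mul_assoc]; exact mul_nonneg expNegInvGlue.monotone.deriv_nonneg (mul_self_nonneg _)
    have b1 : 0 ≤ expNegInvGlue (-d t 1) * (ρx t 1 - qx t 1) := by
      rcases le_or_gt 0 (d t 1) with h' | h'
      · rw [expNegInvGlue.zero_of_nonpos (by linarith), zero_mul]
      · refine mul_nonneg (expNegInvGlue.nonneg _) ?_
        have h1 := hq.bc_one t ht
        have h2 := h.bc_one t ht.1
        have h3 : (β - q t 1) / B ≤ (β - ρ t 1) / B := by
          gcongr; simp only [d] at h'; linarith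
        linarith
    have b0 : expNegInvGlue (-d t 0) * (ρx t 0 - qx t 0) ≤ 0 := by
      rcases le_or_gt 0 (d t 0) with h' | h'
      · rw [expNegInvGlue.zero_of_nonpos (by linarith), zero_mul]
      · refine mul_nonpos_of_nonneg_of_nonpos (expNegInvGlue.nonneg _) ?_
        have h1 := hq.bc_zero t ht
        have h2 := h.bc_zero t ht.1
        have h3 : (ρ t 0 - α) / A ≤ (q t 0 - α) / A := by
          gcongr; simp only [d] at h'; linarith
        linarith
    linarith
  have decr : ∀ a b, 0 < a → a ≤ b → b ≤ T →
      ∫ x in (0)..1, negGlue (d b x) ≤ ∫ x in (0)..1, negGlue (d a x) := by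
    intro a b ha hab hb
    have hs : Icc a b ×ˢ 𝕁 ⊆ Ioc 0 T ×ˢ 𝕁 :=
      prod_mono (fun t ht => ⟨ha.trans_le ht.1, ht.2.trans hb⟩) le_rfl
    have := integral_integral_deriv_time_of_continuousOn hab
      (Ψ := fun t x => negGlue (d t x))
      (Ψt := fun t x => -expNegInvGlue (-d t x) * (ρt t x - qt t x))
      (fun x hx t ht => by
        have ht' : t ∈ Ioc 0 T := ⟨ha.trans_le ht.1, ht.2.trans hb⟩
        exact ((hasDerivAt_negGlue (d t x)).comp t
          ((h.has_t t ht'.1 x hx).sub (hq.has_t t ht' x hx))).hasDerivWithinAt)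
      (continuous_negGlue.comp_continuousOn (hdc.mono hs))
      (((continuous_expNegInvGlue.comp_continuousOn (hdc.mono hs).neg).neg).mul
        ((h.cont_t.mono (hs.trans sub)).sub (hq.cont_t.mono hs)))
    have h2 := intervalIntegral_le_of_le_of_nonneg hab
      (f := fun t => ∫ x in (0)..1, -expNegInvGlue (-d t x) * (ρt t x - qt t x))
      (g := fun _ => 0) (by simp) (fun _ _ => le_rfl)
      (fun t ht => static t ⟨ha.trans ht.1, ht.2.trans hb⟩)
    simp only [intervalIntegral.integral_zero] at h2; linarith
  intro b hb x hx
  have hzero : ∫ x in (0)..1, negGlue (d b x) ≤ 0 := by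
    refine le_of_forall_pos_le_add fun ε hε => ?_
    have ev1 := hi (ε / 2) (half_pos hε)
    have ev2 := h.init.eventually_lt_const (half_pos hε)
    obtain ⟨a, ⟨h1, h2⟩, ha0, hab⟩ := ((ev1.and ev2).and (Ioc_mem_nhdsGT hb.1)).exists
    refine (decr a b ha0 hab hb.2).trans ?_
    have ha : a ∈ Ioc 0 T := ⟨ha0, hab.trans hb.2⟩
    have hItg : IvlInt (fun x => |ρ a x - ρ 0 x|) 0 1 := ((intble01 (h.cont.slice ha0)).sub h0).abs
    have : ∫ x in (0)..1, negGlue (d a x) ≤ ∫ x in (0)..1, (|ρ a x - ρ 0 x| + ε / 2) := by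
      refine iint_mono_on zero_le_one
        (intble01 (continuous_negGlue.comp_continuousOn (hdc.slice ha)))
        (hItg.add intervalIntegrable_const) fun x hx => ?_
      refine negGlue_le (by positivity) ?_
      have h3 := h1 x hx
      have h4 := neg_abs_le (ρ a x - ρ 0 x)
      simp only [d]; linarith
    rw [iint_add hItg intervalIntegrable_const] at this
    simp only [iint_const, sub_zero, smul_eq_mul, one_mul] at this; linarith
  have hcont := continuous_negGlue.comp_continuousOn (hdc.slice hb)
  by_contra hcon
  have hneg : d b x < 0 := by simp only [d]; linarith
  have := intervalIntegral.integral_pos zero_lt_one hcont (fun y _ => negGlue_nonneg _)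
    ⟨x, hx, negGlue_pos hneg⟩
  exact absurd this (not_lt.2 hzero)

theorem const_le (h : RobinFlow α β A B ρ ρx ρt) (hA : 0 < A) (hB : 0 < B)
    (h0 : IvlInt (ρ 0) 0 1) (hα : c ≤ α) (hβ : c ≤ β) (hc : ∀ x ∈ 𝕁, c ≤ ρ 0 x) :
    ∀ t > 0, ∀ x ∈ 𝕁, c ≤ ρ t x := by
  intro t ht
  refine h.comparison hA hB h0 (T := t) (q := fun _ _ => c) (qx := fun _ _ => 0)
    (qxx := fun _ _ => 0) (qt := fun _ _ => 0) ⟨continuousOn_const, continuousOn_const,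
      continuousOn_const, continuousOn_const, fun _ _ _ _ => hasDerivWithinAt_const _ _ _,
      fun _ _ _ _ => hasDerivWithinAt_const _ _ _, fun _ _ _ _ => hasDerivAt_const _ _,
      fun _ _ _ _ => le_rfl, fun _ _ => ?_, fun _ _ => ?_⟩ ?_ t ⟨ht, le_rfl⟩
  · exact div_nonpos_of_nonpos_of_nonneg (by linarith) hA.le
  · exact div_nonneg (by linarith) hB.le
  · exact fun η hη => .of_forall fun a x hx => by linarith [hc x hx]

theorem one_sub (h : RobinFlow α β A B ρ ρx ρt) :
    RobinFlow (1 - α) (1 - β) A B (fun t x => 1 - ρ t x) (fun t x => -ρx t x)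
      (fun t x => -ρt t x) where
  smooth := contDiffOn_const.sub h.smooth
  cont_x := h.cont_x.neg
  cont_t := h.cont_t.neg
  has_x t ht x hx := (h.has_x t ht x hx).const_sub 1
  has_xx t ht x hx := (h.has_xx t ht x hx).neg
  has_t t ht x hx := (h.has_t t ht x hx).const_sub 1
  bc_zero t ht := by rw [h.bc_zero t ht]; ring
  bc_one t ht := by rw [h.bc_one t ht]; ring
  meas := measurable_const.sub h.meas
  meas_x := h.meas_x.neg
  init := by
    refine h.init.congr fun t => ?_
    simp only [sub_sub_sub_cancel_left, abs_sub_comm]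

theorem exists_lower_bound (h : RobinFlow α β A B ρ ρx ρt) (hA : 0 < A) (hB : 0 < B)
    (h0 : IvlInt (ρ 0) 0 1) (hα : 0 < α) (hβ : 0 < β)
    (hc : ∀ x ∈ 𝕁, 0 ≤ ρ 0 x) (hδ : 0 < δ) (T : ℝ) :
    ∃ ε > 0, ∀ t ∈ Icc δ T, ∀ x ∈ 𝕁, ε ≤ ρ t x := by
  set K : ℝ := |T| + 1
  have hK : 1 ≤ K := by simp only [K]; linarith [abs_nonneg T]
  set c : ℝ := min α β / (1 + 2 * A)
  have hcpos : 0 < c := by simp only [c]; positivity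
  have hcα : c * (1 + 2 * A) ≤ α := by
    simp only [c]; rw [div_mul_cancel₀ _ (by positivity)]; exact min_le_left _ _
  have hcβ : c ≤ β := by
    have : c * (1 + 2 * A) ≤ β := by
      simp only [c]; rw [div_mul_cancel₀ _ (by positivity)]; exact min_le_right _ _
    nlinarith
  set q : ℝ → ℝ → ℝ := fun t x => c * exp (-(K * (x + 1) ^ 2) / t)
  have hqpos : ∀ t x, 0 < q t x := fun t x => by simp only [q]; positivity
  have hexp : ∀ y : ℝ, y * exp (-y) ≤ 1 := fun y => by
    have h1 := Real.add_one_le_exp y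
    have h2 : exp y * exp (-y) = 1 := by rw [← Real.exp_add]; simp
    nlinarith [Real.exp_pos (-y)]
  have ne : ∀ p ∈ Ioc (0 : ℝ) T ×ˢ 𝕁, p.1 ≠ 0 := fun p hp => hp.1.1.ne'
  have hx1 : ∀ t x : ℝ, HasDerivAt (q t) (-(2 * K * (x + 1)) / t * q t x) x := by
    intro t x
    have h1 : HasDerivAt (fun x : ℝ => -(K * (x + 1) ^ 2) / t) (-(2 * K * (x + 1)) / t) x := by
      have := ((((hasDerivAt_id x).add_const 1).pow 2).const_mul K).neg.div_const t
      refine this.congr_deriv ?_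
      simp
      ring
    refine (h1.exp.const_mul c).congr_deriv ?_
    simp only [q]; ring
  have hq : IsSubsolution α β A B T q (fun t x => -(2 * K * (x + 1)) / t * q t x)
      (fun t x => (-(2 * K) / t + (2 * K * (x + 1)) ^ 2 / t ^ 2) * q t x)
      (fun t x => K * (x + 1) ^ 2 / t ^ 2 * q t x) := by
    have cq : ContinuousOn ⇈q (Ioc 0 T ×ˢ 𝕁) := by
      simp only [q]; fun_prop (disch := assumption)
    refine ⟨cq, ?_, ?_, ?_, fun t _ x _ => (hx1 t x).hasDerivWithinAt, ?_, ?_, ?_, ?_, ?_⟩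
    · exact ContinuousOn.mul (by fun_prop (disch := assumption)) cq
    · refine ContinuousOn.mul (ContinuousOn.add (by fun_prop (disch := assumption)) ?_) cq
      exact ContinuousOn.div (by fun_prop) (by fun_prop) fun p hp => pow_ne_zero 2 (ne p hp)
    · refine ContinuousOn.mul ?_ cq
      exact ContinuousOn.div (by fun_prop) (by fun_prop) fun p hp => pow_ne_zero 2 (ne p hp)
    · intro t ht x hx
      have h1 : HasDerivAt (fun x : ℝ => -(2 * K * (x + 1)) / t) (-(2 * K) / t) x := by
        refine ((((hasDerivAt_id x).add_const 1).const_mul (2 * K)).neg.div_const t).congr_deriv ?_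
        simp
      refine ((h1.mul (hx1 t x)).congr_deriv ?_).hasDerivWithinAt
      have := ht.1.ne'
      field_simp
    · intro t ht x hx
      have h1 : HasDerivAt (fun t : ℝ => -(K * (x + 1) ^ 2) / t) (K * (x + 1) ^ 2 / t ^ 2) t := by
        have := (hasDerivAt_inv ht.1.ne').const_mul (-(K * (x + 1) ^ 2))
        simp only [div_eq_mul_inv]
        refine this.congr_deriv ?_
        ring
      refine (h1.exp.const_mul c).congr_deriv ?_
      simp only [q]; ring
    · intro t ht x hx
      refine mul_le_mul_of_nonneg_right ?_ (hqpos t x).le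
      have ht0 := ht.1
      have htK : t ≤ K := by simp only [K]; linarith [ht.2, le_abs_self T]
      have hx1 : 1 ≤ (x + 1) ^ 2 := by nlinarith [hx.1]
      have : -(2 * K) / t + (2 * K * (x + 1)) ^ 2 / t ^ 2 - K * (x + 1) ^ 2 / t ^ 2
          = K * ((4 * K - 1) * (x + 1) ^ 2 - 2 * t) / t ^ 2 := by field_simp; ring
      have h2 : 0 ≤ K * ((4 * K - 1) * (x + 1) ^ 2 - 2 * t) / t ^ 2 := by
        apply div_nonneg _ (sq_nonneg t)
        apply mul_nonneg (by linarith)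
        nlinarith
      linarith
    · intro t ht
      have ht0 := ht.1
      rw [div_le_iff₀ hA]
      have h1 := hexp (K / t)
      have h2 : q t 0 = c * exp (-(K / t)) := by simp only [q]; congr 2; ring
      have h3 : exp (-(K / t)) ≤ 1 := Real.exp_le_one_iff.2 (by
        have : 0 < K / t := by positivity
        linarith)
      have h4 : -(2 * K * (0 + 1)) / t * q t 0 = -(2 * c) * (K / t * exp (-(K / t))) := by
        rw [h2]; ring
      rw [h4, h2]; nlinarith [mul_pos hcpos hA]
    · intro t ht
      have ht0 := ht.1
      have h1 : q t 1 ≤ β := by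
        have h3 : exp (-(K * (1 + 1) ^ 2) / t) ≤ 1 := Real.exp_le_one_iff.2
          (div_nonpos_of_nonpos_of_nonneg (by nlinarith) ht0.le)
        simp only [q]; nlinarith
      have h2 : -(2 * K * (1 + 1)) / t * q t 1 ≤ 0 :=
        mul_nonpos_of_nonpos_of_nonneg (div_nonpos_of_nonpos_of_nonneg (by nlinarith) ht0.le)
          (hqpos t 1).le
      exact h2.trans (div_nonneg (by linarith) hB.le)
  have hmono : ∀ t > 0, ∀ x ∈ 𝕁, q t x ≤ c * t := by
    intro t ht x hx
    have h1 := hexp (1 / t)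
    have h2 : exp (-(K * (x + 1) ^ 2) / t) ≤ exp (-(1 / t)) := by
      apply Real.exp_le_exp.2
      rw [← neg_div]; gcongr; nlinarith [hx.1]
    have h3 : exp (-(1 / t)) ≤ t := by
      have : 1 / t * exp (-(1 / t)) * t ≤ 1 * t := by gcongr
      rw [one_mul] at this
      calc _ = 1 / t * exp (-(1 / t)) * t := by field_simp
        _ ≤ t := this
    simp only [q]; gcongr; exact h2.trans h3
  have cmp := h.comparison hA hB h0 hq (fun η hη => by
    have : Tendsto (fun t : ℝ => c * t) (𝓝[>] 0) (𝓝 0) :=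
      (Continuous.tendsto' (by fun_prop) _ _ (by simp)).mono_left nhdsWithin_le_nhds
    filter_upwards [this.eventually_lt_const hη, self_mem_nhdsWithin] with a ha ha0 x hx
    linarith [hmono a ha0 x hx, hc x hx])
  refine ⟨c * exp (-(K * 4) / δ), by positivity, fun t ht x hx => ?_⟩
  have ht0 : 0 < t := hδ.trans_le ht.1
  refine le_trans ?_ (cmp t ⟨ht0, ht.2⟩ x hx)
  simp only [q]
  gcongr c * exp ?_
  rw [neg_div, neg_div]
  have : (x + 1) ^ 2 ≤ 4 := by nlinarith [hx.1, hx.2]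
  have h5 : K * (x + 1) ^ 2 / t ≤ K * 4 / δ := by
    gcongr; exact ht.1
  linarith

end RobinFlow

/-- Lebesgue measure on `(a,b]×(0,1]`. -/
abbrev rectMeasure (a b : ℝ) : Measure (ℝ²) :=
  (volume.restrict (Ioc a b)).prod (volume.restrict (Ioc (0 : ℝ) 1))

/-- A solution of the hydrodynamic equation with values in `[0,1]`, bounded away from `0` and `1`
at positive times, and with square integrable gradient. -/
structure HydroFlow (α β A B : ℝ) (ρ ρx ρt : ℝ → ℝ → ℝ) : Prop
    extends RobinFlow α β A B ρ ρx ρt where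
  mem : ∀ t x, x ∈ 𝕁 → ρ t x ∈ 𝕁
  bound : ∀ δ > 0, ∀ T, ∃ ε > 0, ∀ t ∈ Icc δ T, ∀ x ∈ 𝕁, ε ≤ ρ t x ∧ ρ t x ≤ 1 - ε
  memLp : ∀ T > 0, MemLp ⇈ρx 2 (rectMeasure 0 T)

theorem RobinFlow.energy_bound
    (h : RobinFlow α β A B ρ ρx ρt) (hA : 0 < A) (hB : 0 < B) (hα : α ∈ 𝕁)
    (hβ : β ∈ 𝕁) (hm : ∀ t > 0, ∀ x ∈ 𝕁, ρ t x ∈ 𝕁) (ha : 0 < a) (haT : a ≤ T) :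
    ∫ t in a..T, ∫ x in (0)..1, ρx t x ^ 2 ≤ 1 + T * (1 / A + 1 / B) := by
  have hs : Icc a T ×ˢ 𝕁 ⊆ Ioi 0 ×ˢ 𝕁 := prod_mono (fun t ht => ha.trans_le ht.1) le_rfl
  have c0 := h.cont.mono hs
  have cx := h.cont_x.mono hs
  have ct := h.cont_t.mono hs
  have e1 := integral_integral_deriv_time_of_continuousOn haT (Ψ := fun t x => ρ t x ^ 2)
    (Ψt := fun t x => 2 * ρ t x * ρt t x)
    (fun x hx t ht => by
      refine (((h.has_t t (ha.trans_le ht.1) x hx).pow 2).congr_deriv ?_).hasDerivWithinAt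
      simp) (c0.pow 2) ((continuousOn_const.mul c0).mul ct)
  have static : ∀ t ∈ Icc a T, ∫ x in (0)..1, 2 * ρ t x * ρt t x
      ≤ (2 * (1 / A + 1 / B)) - 2 * ∫ x in (0)..1, ρx t x ^ 2 := by
    intro t ht
    have ht0 : 0 < t := ha.trans_le ht.1
    have ibp := integral_mul_deriv_Icc (zero_le_one' ℝ) (h.has_x t ht0) (h.has_xx t ht0)
      (intble01 (cx.slice ht))
      (intble01 (ct.slice ht))
    have e2 : ∫ x in (0)..1, 2 * ρ t x * ρt t x = 2 * ∫ x in (0)..1, ρ t x * ρt t x := by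
      rw [← iint_const_mul]; exact iint_congr fun x _ => by ring
    have e3 : ∫ x in (0)..1, ρx t x * ρx t x = ∫ x in (0)..1, ρx t x ^ 2 :=
      iint_congr fun x _ => by ring
    rw [e2, ibp, e3, h.bc_one t ht0, h.bc_zero t ht0]
    have m0 := hm t ht0 0 (by simp)
    have m1 := hm t ht0 1 (by simp)
    have b1 : ρ t 1 * ((β - ρ t 1) / B) ≤ 1 / B := by
      rw [← mul_div_assoc]; gcongr; nlinarith [m1.1, m1.2, hβ.1, hβ.2]
    have b0 : -(ρ t 0 * ((ρ t 0 - α) / A)) ≤ 1 / A := by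
      rw [← mul_div_assoc, ← neg_div]; gcongr; nlinarith [m0.1, m0.2, hα.1, hα.2]
    linarith
  have int1 : IvlInt (fun t => ∫ x in (0)..1, ρx t x ^ 2) a T := by
    have := (integrable_prod_of_continuousOn (F := fun t x => ρx t x ^ 2) (cx.pow 2)).integral_prod_left
    rw [intervalIntegrable_iff_integrableOn_Ioc_of_le haT]; simp only [iint01]; exact this
  have int2 : IvlInt (fun t => ∫ x in (0)..1, 2 * ρ t x * ρt t x) a T := by
    have := (integrable_prod_of_continuousOn (F := fun t x => 2 * ρ t x * ρt t x)
      ((continuousOn_const.mul c0).mul ct)).integral_prod_left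
    rw [intervalIntegrable_iff_integrableOn_Ioc_of_le haT]; simp only [iint01]; exact this
  have e4 := iint_mono_on haT int2
    (intervalIntegrable_const.sub (int1.const_mul 2)) static
  rw [iint_sub intervalIntegrable_const (int1.const_mul 2)] at e4
  simp only [iint_const_mul, iint_const, smul_eq_mul] at e4
  have i1 : 0 ≤ ∫ x in (0)..1, ρ T x ^ 2 := iint_nonneg zero_le_one fun x _ => sq_nonneg _
  have i2 : ∫ x in (0)..1, ρ a x ^ 2 ≤ ∫ x in (0)..1, (1 : ℝ) := by
    refine iint_mono_on zero_le_one
      (intble01 ((c0.slice (left_mem_Icc.2 haT)).pow 2)) intervalIntegrable_const fun x hx => ?_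
    have := hm a ha x hx
    nlinarith [this.1, this.2]
  simp at i2
  have : 0 ≤ a * (1 / A + 1 / B) := by positivity
  nlinarith

theorem exists_hydroFlow (hA : 0 < A) (hB : 0 < B) (hα : α ∈ 𝕁ᵒ)
    (hβ : β ∈ 𝕁ᵒ) {γ : I → ℝ} (hγ : Measurable γ) (hγ01 : ∀ x, γ x ∈ 𝕁) :
    ∃ ρ ρx ρt : ℝ → ℝ → ℝ, HydroFlow α β A B ρ ρx ρt ∧ (∀ x, ρ 0 x = γ (𝕡 x)) ∧
      ∀ c, c ≤ α → c ≤ β → α ≤ 1 - c → β ≤ 1 - c → (∀ x, c ≤ γ x ∧ γ x ≤ 1 - c) →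
        ∀ t ≥ 0, ∀ x ∈ 𝕁, c ≤ ρ t x ∧ ρ t x ≤ 1 - c := by
  obtain ⟨ρ', ρx, ρt, h', h0'⟩ := exists_robinFlow α β hA hB hγ hγ01
  -- freeze the solution at negative times
  set ρ : ℝ → ℝ → ℝ := fun t x => ρ' (max t 0) x
  have hpos : ∀ t, 0 < t → ρ t = ρ' t := fun t ht => by simp only [ρ, max_eq_left ht.le]
  have hρ0 : ρ 0 = ρ' 0 := by simp only [ρ, max_self]
  have hcongr : EqOn ⇈ρ (fun p => ρ' p.1 p.2) (Ioi 0 ×ˢ 𝕁) :=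
    fun p hp => by simp only [hpos p.1 hp.1]
  have h : RobinFlow α β A B ρ ρx ρt := { h' with
      smooth := h'.smooth.congr hcongr
      has_x := fun t ht x hx => by rw [hpos t ht]; exact h'.has_x t ht x hx
      has_t := fun t ht x hx => by
        refine (h'.has_t t ht x hx).congr_of_eventuallyEq ?_
        filter_upwards [Ioi_mem_nhds ht] with s hs
        rw [hpos s hs]
      bc_zero := fun t ht => by rw [hpos t ht]; exact h'.bc_zero t ht
      bc_one := fun t ht => by rw [hpos t ht]; exact h'.bc_one t ht
      meas := h'.meas.comp (by fun_prop : Measurable fun p : ℝ² => (max p.1 0, p.2))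
      init := by
        refine h'.init.congr' ?_
        filter_upwards [self_mem_nhdsWithin] with t ht
        rw [hpos t ht, hρ0] }
  have h0 : ∀ x, ρ 0 x = γ (𝕡 x) := fun x => by rw [hρ0, h0']
  have hneg : ∀ t ≤ 0, ∀ x, ρ t x = γ (𝕡 x) := fun t ht x => by
    simp only [ρ, max_eq_right ht, h0']
  have hItg : IvlInt (ρ 0) 0 1 := by
    refine (intervalIntegrable_const (c := (1 : ℝ))).mono_fun
      (h.meas.comp (by fun_prop : Measurable fun x : ℝ => ((0 : ℝ), x))).aestronglyMeasurable
      (.of_forall fun x => ?_)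
    have := hγ01 (𝕡 x)
    change ‖ρ 0 x‖ ≤ _; rw [h0, norm_eq_abs, abs_of_nonneg this.1]; simpa using this.2
  have hItg' : IvlInt (fun x => 1 - ρ 0 x) 0 1 := intervalIntegrable_const.sub hItg
  have hmemc : ∀ c, c ≤ α → c ≤ β → α ≤ 1 - c → β ≤ 1 - c → (∀ x, c ≤ γ x ∧ γ x ≤ 1 - c) →
        ∀ t, ∀ x ∈ 𝕁, c ≤ ρ t x ∧ ρ t x ≤ 1 - c := by
    intro c c1 c2 c3 c4 c5 t x hx
    rcases le_or_gt t 0 with ht | ht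
    · rw [hneg t ht]; exact c5 _
    · have l1 := h.const_le hA hB hItg c1 c2 (fun x _ => by rw [h0]; exact (c5 _).1) t ht x hx
      have l2 := h.one_sub.const_le hA hB hItg' (c := c) (by linarith) (by linarith)
        (fun x _ => by rw [h0]; linarith [(c5 (𝕡 x)).2]) t ht x hx
      exact ⟨l1, by linarith⟩
  have hmem : ∀ t x, x ∈ 𝕁 → ρ t x ∈ 𝕁 := fun t x hx => by
    have := hmemc 0 hα.1.le hβ.1.le (by linarith [hα.2]) (by linarith [hβ.2])
      (fun x => by simpa using hγ01 x) t x hx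
    simpa using this
  refine ⟨ρ, ρx, ρt, { h with mem := hmem, bound := ?_, memLp := ?_ }, h0,
    fun c c1 c2 c3 c4 c5 t _ => hmemc c c1 c2 c3 c4 c5 t⟩
  · intro δ hδ T
    obtain ⟨ε₁, hε₁, h1⟩ := h.exists_lower_bound hA hB hItg hα.1 hβ.1
      (fun x hx => (hmem 0 x hx).1) hδ T
    obtain ⟨ε₂, hε₂, h2⟩ := h.one_sub.exists_lower_bound hA hB hItg' (by linarith [hα.2])
      (by linarith [hβ.2]) (fun x hx => by linarith [(hmem 0 x hx).2]) hδ T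
    refine ⟨min ε₁ ε₂, lt_min hε₁ hε₂, fun t ht x hx => ?_⟩
    have := h1 t ht x hx
    have := h2 t ht x hx
    exact ⟨(min_le_left _ _).trans (by assumption), by linarith [min_le_right ε₁ ε₂]⟩
  · intro T hT
    refine (memLp_two_iff_integrable_sq h.meas_x.aestronglyMeasurable).2 ?_
    have hcov : AECover (rectMeasure 0 T) atTop
        (fun n : ℕ => Ioi (T / (n + 1)) ×ˢ (univ : Set ℝ)) := by
      refine ⟨?_, fun n => measurableSet_Ioi.prod MeasurableSet.univ⟩
      have : ∀ᵐ p ∂(rectMeasure 0 T), p ∈ Ioc 0 T ×ˢ Ioc (0 : ℝ) 1 := by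
        rw [rectMeasure, Measure.prod_restrict]
        exact ae_restrict_mem (measurableSet_Ioc.prod measurableSet_Ioc)
      filter_upwards [this] with p hp
      have hlim : Tendsto (fun n : ℕ => T / ((n : ℝ) + 1)) atTop (𝓝 0) :=
        (tendsto_const_nhds (x := T)).div_atTop
          (tendsto_natCast_atTop_atTop.atTop_add tendsto_const_nhds)
      filter_upwards [hlim.eventually_lt_const hp.1.1] with n hn
      exact ⟨hn, trivial⟩
    have hres : ∀ n : ℕ, (rectMeasure 0 T).restrict (Ioi (T / (n + 1)) ×ˢ (univ : Set ℝ))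
        = rectMeasure (T / (n + 1)) T := by
      intro n
      rw [rectMeasure, Measure.prod_restrict, Measure.restrict_restrict
        (measurableSet_Ioi.prod MeasurableSet.univ), rectMeasure, Measure.prod_restrict]
      congr 1; rw [prod_inter_prod, univ_inter]
      congr 1
      ext t
      have : 0 < T / ((n : ℝ) + 1) := by positivity
      simp only [mem_inter_iff, mem_Ioi, mem_Ioc]
      exact ⟨fun h => ⟨h.1, h.2.2⟩, fun h => ⟨h.1, this.trans h.1, h.2⟩⟩
    have hsub : ∀ n : ℕ, Icc (T / (n + 1)) T ×ˢ 𝕁 ⊆ Ioi 0 ×ˢ 𝕁 := fun n =>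
      prod_mono (fun t ht => lt_of_lt_of_le (by positivity) ht.1) le_rfl
    have hI : ∀ n : ℕ, Integrable (fun p : ℝ² => ρx p.1 p.2 ^ 2)
        (rectMeasure (T / (n + 1)) T) := fun n =>
      integrable_prod_of_continuousOn (F := fun t x => ρx t x ^ 2)
        ((h.cont_x.mono (hsub n)).pow 2)
    refine hcov.integrable_of_integral_bounded_of_nonneg_ae (1 + T * (1 / A + 1 / B))
      (fun n => ?_) (.of_forall fun p => sq_nonneg _) (.of_forall fun n => ?_)
    · rw [IntegrableOn, hres]; exact hI n
    · have hle : T / ((n : ℝ) + 1) ≤ T := div_le_self hT.le (by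
        have : (0 : ℝ) ≤ n := Nat.cast_nonneg n
        linarith)
      have hb := h.energy_bound hA hB (Ioo_subset_Icc_self hα) (Ioo_subset_Icc_self hβ)
        (fun t _ x hx => hmem t x hx) (a := T / (n + 1)) (T := T) (by positivity) hle
      rw [hres, integral_prod _ (hI n)]; rw [iint_of_le hle] at hb; simpa only [iint01] using hb

/-! ### The action functional -/

/-- A `C^{1,1}` test function on `[0,T]×[0,1]`, continuously extended to the plane together with its
derivatives. -/
structure SpaceTimeTest (T : ℝ) where
  h : ℝ → ℝ → ℝ
  ht : ℝ → ℝ → ℝ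
  hx : ℝ → ℝ → ℝ
  cont : Continuous ⇈h
  cont_t : Continuous ⇈ht
  cont_x : Continuous ⇈hx
  has_t : ∀ t ∈ Icc 0 T, ∀ x ∈ 𝕁, HasDerivWithinAt (fun s => h s x) (ht t x) (Icc 0 T) t
  has_x : ∀ t ∈ Icc 0 T, ∀ x ∈ 𝕁, HasDerivWithinAt (h t) (hx t x) 𝕁 x

attribute [fun_prop] SpaceTimeTest.cont SpaceTimeTest.cont_t SpaceTimeTest.cont_x

/-- The density `-u ∂ₜH + ∇u ∇H - σ(u) (∇H)²`. -/
def bulkDensity {T : ℝ} (K : SpaceTimeTest T) (t x u g : ℝ) : ℝ :=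
  -u * K.ht t x + g * K.hx t x - u * (1 - u) * K.hx t x ^ 2

/-- The boundary contribution to the action. -/
def bdryDensity (α β A B : ℝ) {T : ℝ} (K : SpaceTimeTest T) (t u₀ u₁ : ℝ) : ℝ :=
  bdryB α A u₀ (K.h t 0) + bdryB β B u₁ (K.h t 1)

/-- The time density of the action of a profile `u` with gradient `g`. -/
def rateDensity (α β A B : ℝ) {T : ℝ} (K : SpaceTimeTest T) (t : ℝ) (u g : ℝ → ℝ) : ℝ :=
  (∫ x in (0)..1, bulkDensity K t x (u x) (g x)) - bdryDensity α β A B K t (u 0) (u 1)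

/-- `u`, with space derivative `g`, is a measurable path of profiles with values in `[0,1]` and
square integrable gradient on `(a,b]×[0,1]`. -/
structure IsPath (a b : ℝ) (u g : ℝ → ℝ → ℝ) : Prop where
  meas : Measurable ⇈u
  meas_x : Measurable ⇈g
  mem : ∀ t ∈ Ioc a b, ∀ x ∈ 𝕁, u t x ∈ 𝕁
  memLp : MemLp ⇈g 2 (rectMeasure a b)

theorem ae_rectMeasure_mem (a b : ℝ) : ∀ᵐ p ∂(rectMeasure a b), p ∈ Ioc a b ×ˢ Ioc (0 : ℝ) 1 := by
  rw [rectMeasure, Measure.prod_restrict]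
  exact ae_restrict_mem (measurableSet_Ioc.prod measurableSet_Ioc)

theorem Integrable.continuous_mul_rect {f F : ℝ² → ℝ} (hF : Continuous F)
    (hf : Integrable f (rectMeasure a b)) : Integrable (fun p => F p * f p) (rectMeasure a b) := by
  obtain ⟨C, hC⟩ := (isCompact_Icc.prod isCompact_Icc :
    IsCompact (Icc a b ×ˢ 𝕁)).exists_bound_of_continuousOn hF.continuousOn
  refine hf.bdd_mul (c := C) hF.aestronglyMeasurable ?_
  filter_upwards [ae_rectMeasure_mem a b] with p hp
  exact hC p ⟨Ioc_subset_Icc_self hp.1, Ioc_subset_Icc_self hp.2⟩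

theorem intervalIntegrable_integral_of_rect (hab : a ≤ b) (h : Integrable ⇈F (rectMeasure a b)) :
    IvlInt (fun t => ∫ x in (0)..1, F t x) a b := by
  have := h.integral_prod_left
  rw [intervalIntegrable_iff_integrableOn_Ioc_of_le hab]; simp only [iint01]; exact this

theorem ae_intervalIntegrable_of_rect (h : Integrable ⇈F (rectMeasure a b)) :
    ∀ᵐ t ∂(volume.restrict (Ioc a b)), IvlInt (F t) 0 1 := by
  filter_upwards [h.prod_right_ae] with t ht
  rw [intervalIntegrable_iff_integrableOn_Ioc_of_le zero_le_one]; exact ht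

theorem measurable_slice (hu : Measurable ⇈u) (t : ℝ) :
    Measurable (u t) := hu.comp (by fun_prop : Measurable fun x : ℝ => (t, x))

theorem measurable_slice_left (hu : Measurable ⇈u)
    (x : ℝ) : Measurable fun t => u t x := hu.comp (by fun_prop : Measurable fun t : ℝ => (t, x))

theorem intervalIntegrable_of_measurable_of_bound (hab : a ≤ b)
    (hf : Measurable f) (h : ∀ t ∈ Ioc a b, |f t| ≤ C) : IvlInt f a b := by
  rw [intervalIntegrable_iff_integrableOn_Ioc_of_le hab]
  exact IntegrableOn.of_bound (by simp) hf.aestronglyMeasurable C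
    ((ae_restrict_iff' measurableSet_Ioc).2 (.of_forall h))

theorem intervalIntegrable_bdryB (hab : a ≤ b) {u M : ℝ → ℝ} (hu : Measurable u)
    (hu1 : ∀ t ∈ Ioc a b, u t ∈ 𝕁) (hM : Continuous M) :
    IvlInt (fun t => bdryB ϱ D (u t) (M t)) a b := by
  have hui : IvlInt u a b :=
    intervalIntegrable_of_measurable_of_bound hab hu (C := 1) fun t ht => by
      rw [abs_of_nonneg (hu1 t ht).1]; exact (hu1 t ht).2
  have h1 : IvlInt (fun t => 1 / D * (ϱ * (exp (M t) - 1))) a b :=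
    Continuous.intervalIntegrable (by fun_prop) _ _
  have h2 := hui.mul_continuousOn (g := fun t => 1 / D * ((1 - ϱ) * (exp (-M t) - 1)
    - ϱ * (exp (M t) - 1))) (by fun_prop)
  refine (h1.add h2).congr fun t _ => ?_
  simp only [bdryB]; ring

namespace IsPath

theorem integrable_u (h : IsPath a b u g) : Integrable ⇈u (rectMeasure a b) := by
  refine Integrable.of_bound h.meas.aestronglyMeasurable 1 ?_
  filter_upwards [ae_rectMeasure_mem a b] with p hp
  have := h.mem p.1 hp.1 p.2 (Ioc_subset_Icc_self hp.2)
  rw [norm_eq_abs, abs_of_nonneg this.1]; exact this.2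

theorem integrable_g (h : IsPath a b u g) :
    Integrable ⇈g (rectMeasure a b) := h.memLp.integrable (by norm_num)

theorem integrable_mobility (h : IsPath a b u g) :
    Integrable (fun p : ℝ² => u p.1 p.2 * (1 - u p.1 p.2)) (rectMeasure a b) := by
  refine Integrable.of_bound (h.meas.mul (measurable_const.sub h.meas)).aestronglyMeasurable 1 ?_
  filter_upwards [ae_rectMeasure_mem a b] with p hp
  have := h.mem p.1 hp.1 p.2 (Ioc_subset_Icc_self hp.2)
  rw [norm_eq_abs, abs_le]
  constructor <;> nlinarith [this.1, this.2]

theorem integrable_bulkDensity (h : IsPath a b u g) (K : SpaceTimeTest T) :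
    Integrable (fun p : ℝ² => bulkDensity K p.1 p.2 (u p.1 p.2) (g p.1 p.2)) (rectMeasure a b) := by
  have h1 := Integrable.continuous_mul_rect K.cont_t h.integrable_u
  have h2 := Integrable.continuous_mul_rect K.cont_x h.integrable_g
  have h3 := Integrable.continuous_mul_rect (F := fun p => K.hx p.1 p.2 ^ 2)
    (K.cont_x.pow 2) h.integrable_mobility
  refine ((h1.neg.add h2).sub h3).congr (.of_forall fun p => ?_)
  simp only [bulkDensity, Pi.add_apply, Pi.sub_apply, Pi.neg_apply]; ring

theorem intervalIntegrable_bdryDensity (h : IsPath a b u g) (hab : a ≤ b) (α β A B : ℝ)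
    (K : SpaceTimeTest T) : IvlInt (fun t => bdryDensity α β A B K t (u t 0) (u t 1)) a b := by
  have c0 : Continuous fun t => K.h t 0 := K.cont.comp (by fun_prop : Continuous fun t : ℝ => (t, (0 : ℝ)))
  have c1 : Continuous fun t => K.h t 1 := K.cont.comp (by fun_prop : Continuous fun t : ℝ => (t, (1 : ℝ)))
  exact (intervalIntegrable_bdryB hab (measurable_slice_left h.meas 0)
    (fun t ht => h.mem t ht 0 (by simp)) c0).add
    (intervalIntegrable_bdryB hab (measurable_slice_left h.meas 1)
    (fun t ht => h.mem t ht 1 (by simp)) c1)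

theorem intervalIntegrable_rateDensity (h : IsPath a b u g) (hab : a ≤ b) (α β A B : ℝ)
    (K : SpaceTimeTest T) : IvlInt (fun t => rateDensity α β A B K t (u t) (g t)) a b :=
  (intervalIntegrable_integral_of_rect hab (F := fun t x => bulkDensity K t x (u t x) (g t x))
    (h.integrable_bulkDensity K)).sub (h.intervalIntegrable_bdryDensity hab α β A B K)

theorem rectMeasure_mono {d : ℝ} (h1 : a ≤ c) (h2 : d ≤ b) : rectMeasure c d ≤ rectMeasure a b := by
  rw [rectMeasure, rectMeasure, Measure.prod_restrict, Measure.prod_restrict]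
  exact Measure.restrict_mono (prod_mono (Ioc_subset_Ioc h1 h2) le_rfl) le_rfl

theorem mono (h : IsPath a b u g) {d : ℝ} (h1 : a ≤ c) (h2 : d ≤ b) : IsPath c d u g :=
  ⟨h.meas, h.meas_x, fun t ht => h.mem t (Ioc_subset_Ioc h1 h2 ht),
    h.memLp.mono_measure (rectMeasure_mono h1 h2)⟩

end IsPath

/-! ### Static inequalities -/

/-- The derivative of `a log a + (1 - a) log (1 - a)`. -/
def logit (a : ℝ) : ℝ := Real.log a - Real.log (1 - a)

theorem neg_bdryB_le (M : ℝ) (hD : 0 < D) (hϱ : ϱ ∈ 𝕁)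
    (ha : a ∈ 𝕁) : -bdryB ϱ D a M ≤ (a - ϱ) / D * M := by
  have h1 := Real.add_one_le_exp M
  have h2 := Real.add_one_le_exp (-M)
  have h3 : 0 ≤ (1 - a) * ϱ := mul_nonneg (by linarith [ha.2]) hϱ.1
  have h4 : 0 ≤ a * (1 - ϱ) := mul_nonneg ha.1 (by linarith [hϱ.2])
  have : -bdryB ϱ D a M = 1 / D * -((1 - a) * ϱ * (exp M - 1)
    + a * (1 - ϱ) * (exp (-M) - 1)) := by rw [bdryB]; ring
  rw [this, show (a - ϱ) / D * M = 1 / D * ((a - ϱ) * M) by ring]; gcongr; nlinarith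

theorem reverse_bdryB_le (M : ℝ) (hD : 0 < D) (hϱ : ϱ ∈ 𝕁ᵒ) (ha : a ∈ 𝕁ᵒ) :
    (a - ϱ) / D * M - bdryB ϱ D a M ≤ (a - ϱ) / D * logit a + |logit ϱ| / D := by
  have p0 : 0 < (1 - a) * ϱ := mul_pos (by linarith [ha.2]) hϱ.1
  have q0 : 0 < a * (1 - ϱ) := mul_pos ha.1 (by linarith [hϱ.2])
  set p := (1 - a) * ϱ
  set q := a * (1 - ϱ)
  have hL : logit a - logit ϱ = Real.log q - Real.log p := by
    simp only [logit, p, q]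
    rw [Real.log_mul ha.1.ne' (by linarith [hϱ.2]), Real.log_mul (by linarith [ha.2]) hϱ.1.ne']
    ring
  set L := Real.log q - Real.log p
  have e1 : q * (1 + M - L) ≤ p * exp M := by
    have h := Real.add_one_le_exp (M - L)
    have : p * exp M = q * exp (M - L) := by
      have hq : q = exp (Real.log q) := (Real.exp_log q0).symm
      have hp : p = exp (Real.log p) := (Real.exp_log p0).symm
      nth_rewrite 1 [hp]
      nth_rewrite 1 [hq]
      rw [← Real.exp_add, ← Real.exp_add]
      congr 1; simp only [L]; ring
    rw [this]; gcongr; linarith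
  have e2 : p * (1 + L - M) ≤ q * exp (-M) := by
    have h := Real.add_one_le_exp (L - M)
    have : q * exp (-M) = p * exp (L - M) := by
      have hq : q = exp (Real.log q) := (Real.exp_log q0).symm
      have hp : p = exp (Real.log p) := (Real.exp_log p0).symm
      nth_rewrite 1 [hp]
      nth_rewrite 1 [hq]
      rw [← Real.exp_add, ← Real.exp_add]
      congr 1; simp only [L]; ring
    rw [this]; gcongr; linarith
  have hpq : q - p = a - ϱ := by simp only [p, q]; ring
  have e3 : (a - ϱ) * M - (p * (exp M - 1) + q * (exp (-M) - 1)) ≤ (a - ϱ) * L := by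
    rw [← hpq]; nlinarith
  have e4 : -(a - ϱ) * logit ϱ ≤ |logit ϱ| := by
    refine (le_abs_self _).trans ?_
    rw [abs_mul]
    refine mul_le_of_le_one_left (abs_nonneg _) ?_
    rw [abs_neg, abs_le]
    constructor <;> linarith [ha.1, ha.2, hϱ.1, hϱ.2]
  have e5 : (a - ϱ) / D * M - bdryB ϱ D a M
      = 1 / D * ((a - ϱ) * M - (p * (exp M - 1) + q * (exp (-M) - 1))) := by
    rw [bdryB]; ring
  have e6 : (a - ϱ) / D * logit a + |logit ϱ| / D
      = 1 / D * ((a - ϱ) * logit a + |logit ϱ|) := by ring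
  rw [e5, e6]; gcongr
  refine e3.trans ?_
  rw [← hL]; linarith

theorem hasDerivAt_logit (hr : r ∈ 𝕁ᵒ) : HasDerivAt logit (1 / (r * (1 - r))) r := by
  have h1 := Real.hasDerivAt_log hr.1.ne'
  have h2 := ((hasDerivAt_id r).const_sub 1).log (by simpa using (sub_pos.2 hr.2).ne')
  refine (h1.sub h2).congr_deriv ?_
  have := hr.1.ne'
  have := (sub_pos.2 hr.2).ne'
  simp only [id]; field_simp; ring

/-- The cost rate of following the hydrodynamic equation backwards in time is at most the entropy
production. -/
theorem static_reverse_le (hA : 0 < A) (hB : 0 < B) (hα : α ∈ 𝕁ᵒ)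
    (hβ : β ∈ 𝕁ᵒ) {r r' r'' k k' : ℝ → ℝ} (hr : ∀ x ∈ 𝕁, HasDerivWithinAt r (r' x) 𝕁 x)
    (hr' : ∀ x ∈ 𝕁, HasDerivWithinAt r' (r'' x) 𝕁 x)
    (hr'' : ContinuousOn r'' 𝕁) (hmem : ∀ x ∈ 𝕁, r x ∈ 𝕁ᵒ)
    (h0 : r' 0 = (r 0 - α) / A) (h1 : r' 1 = (β - r 1) / B)
    (hk : ∀ x ∈ 𝕁, HasDerivWithinAt k (k' x) 𝕁 x) (hk' : ContinuousOn k' 𝕁) :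
    (∫ x in (0)..1, (-r'' x * k x + r' x * k' x - r x * (1 - r x) * k' x ^ 2))
      - (bdryB α A (r 0) (k 0) + bdryB β B (r 1) (k 1))
      ≤ (∫ x in (0)..1, -(logit (r x) * r'' x)) + (|logit α| / A + |logit β| / B) := by
  have cr : ContinuousOn r 𝕁 := fun x hx => (hr x hx).continuousWithinAt
  have cr' : ContinuousOn r' 𝕁 := fun x hx => (hr' x hx).continuousWithinAt
  have ck : ContinuousOn k 𝕁 := fun x hx => (hk x hx).continuousWithinAt
  have cl : ContinuousOn (fun x => logit (r x)) 𝕁 := fun x hx =>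
    (hasDerivAt_logit (hmem x hx)).continuousAt.comp_continuousWithinAt (cr x hx)
  have hne : ∀ x ∈ 𝕁, r x * (1 - r x) ≠ 0 := fun x hx =>
    (mul_pos (hmem x hx).1 (sub_pos.2 (hmem x hx).2)).ne'
  have cl' : ContinuousOn (fun x => 1 / (r x * (1 - r x)) * r' x) 𝕁 :=
    (continuousOn_const.div (cr.mul (continuousOn_const.sub cr)) hne).mul cr'
  have ii : ∀ {f : ℝ → ℝ}, ContinuousOn f 𝕁 → IvlInt f 0 1 := fun hf => intble01 hf
  have i1 := integral_mul_deriv_Icc (zero_le_one' ℝ) hk hr' (ii hk') (ii hr'')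
  have i2 := integral_mul_deriv_Icc (zero_le_one' ℝ)
    (fun x hx => (hasDerivAt_logit (hmem x hx)).comp_hasDerivWithinAt x (hr x hx)) hr'
    (ii cl') (ii hr'')
  have j1 : IvlInt (fun x => -(k x * r'' x)) 0 1 := ii (ck.mul hr'').neg
  have j2 : IvlInt (fun x => k' x * r' x) 0 1 := ii (hk'.mul cr')
  have j3 : IvlInt (fun x => r' x * k' x - r x * (1 - r x) * k' x ^ 2) 0 1 :=
    ii ((cr'.mul hk').sub ((cr.mul (continuousOn_const.sub cr)).mul (hk'.pow 2)))
  have e1 : ∫ x in (0)..1, (-r'' x * k x + r' x * k' x - r x * (1 - r x) * k' x ^ 2)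
      = -(∫ x in (0)..1, k x * r'' x) + ∫ x in (0)..1,
        (r' x * k' x - r x * (1 - r x) * k' x ^ 2) := by
    rw [← iint_neg, ← iint_add j1 j3]; exact iint_congr fun x _ => by ring
  have e2 : ∫ x in (0)..1, -(logit (r x) * r'' x) = -∫ x in (0)..1, (logit ∘ r) x * r'' x := by
    rw [← iint_neg]; rfl
  have e3 : (∫ x in (0)..1, k' x * r' x) + (∫ x in (0)..1,
        (r' x * k' x - r x * (1 - r x) * k' x ^ 2))
      ≤ ∫ x in (0)..1, 1 / (r x * (1 - r x)) * r' x * r' x := by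
    rw [← iint_add j2 j3]
    refine iint_mono_on zero_le_one (j2.add j3) (ii (cl'.mul cr')) fun x hx => ?_
    have hs := mul_pos (hmem x hx).1 (sub_pos.2 (hmem x hx).2)
    set s := r x * (1 - r x)
    rw [show 1 / s * r' x * r' x = r' x ^ 2 / s by ring, le_div_iff₀ hs]
    nlinarith [sq_nonneg (r' x - s * k' x)]
  have b0 := reverse_bdryB_le (k 0) hA hα (hmem 0 (by simp))
  have b1 := reverse_bdryB_le (k 1) hB hβ (hmem 1 (by simp))
  rw [e1, e2, i1, i2, h0, h1]; simp only [Function.comp]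
  have f1 : k 1 * ((β - r 1) / B) = -((r 1 - β) / B * k 1) := by ring
  have f2 : logit (r 1) * ((β - r 1) / B) = -((r 1 - β) / B * logit (r 1)) := by ring
  have f3 : k 0 * ((r 0 - α) / A) = (r 0 - α) / A * k 0 := by ring
  have f4 : logit (r 0) * ((r 0 - α) / A) = (r 0 - α) / A * logit (r 0) := by ring
  rw [f1, f2, f3, f4]; linarith

/-- The action of the path `u` with gradient `g` on `[a,b]`, tested against `K`. -/
def action (α β A B : ℝ) {T : ℝ} (K : SpaceTimeTest T) (a b : ℝ) (u g : ℝ → ℝ → ℝ) : ℝ :=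
  (∫ x in (0)..1, u b x * K.h b x) - (∫ x in (0)..1, u a x * K.h a x)
    + ∫ t in a..b, rateDensity α β A B K t (u t) (g t)

theorem action_add (K : SpaceTimeTest T) (hab : a ≤ b) (hbc : b ≤ c) (h : IsPath a c u g) :
    action α β A B K a b u g + action α β A B K b c u g = action α β A B K a c u g := by
  simp only [action]
  rw [← iint_add_adjacent ((h.mono le_rfl hbc).intervalIntegrable_rateDensity hab α β A B K)
    ((h.mono hab le_rfl).intervalIntegrable_rateDensity hbc α β A B K)]
  ring

theorem action_congr (K : SpaceTimeTest T) {u' g' : ℝ → ℝ → ℝ}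
    (hab : a ≤ b) (ha : u a =ᵐ[volume.restrict (Ioc 0 1)] u' a)
    (hb : u b =ᵐ[volume.restrict (Ioc 0 1)] u' b) (hu : ∀ t ∈ Ioo a b, u t = u' t ∧ g t = g' t) :
    action α β A B K a b u g = action α β A B K a b u' g' := by
  have key : ∀ t, u t =ᵐ[volume.restrict (Ioc 0 1)] u' t →
      ∫ x in (0)..1, u t x * K.h t x = ∫ x in (0)..1, u' t x * K.h t x := by
    intro t h; rw [iint01, iint01]
    refine integral_congr_ae ?_
    filter_upwards [h] with x hx
    rw [hx]
  simp only [action]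
  rw [key a ha, key b hb, iint_of_le hab, iint_of_le hab,
    integral_Ioc_eq_integral_Ioo, integral_Ioc_eq_integral_Ioo]
  congr 1
  refine setIntegral_congr_fun measurableSet_Ioo fun t ht => ?_
  rw [(hu t ht).1, (hu t ht).2]

theorem tendsto_integral_left_of_intervalIntegrable (hb : 0 < b) (hf : IvlInt f 0 b) :
    Tendsto (fun a => ∫ t in a..b, f t) (𝓝[>] 0) (𝓝 (∫ t in (0)..b, f t)) := by
  have h := intervalIntegral.continuousOn_primitive_interval_left
    ((intervalIntegrable_iff' (by simp)).1 hf) 0 left_mem_uIcc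
  have h2 : 𝓝[>] (0 : ℝ) ≤ 𝓝[uIcc 0 b] 0 := by
    rw [uIcc_of_le hb.le, ← nhdsWithin_Ioc_eq_nhdsGT hb]
    exact nhdsWithin_mono _ Ioc_subset_Icc_self
  exact h.tendsto.mono_left h2

theorem tendsto_integral_right_of_intervalIntegrable (hab : a < b) (hf : IvlInt f a b) :
    Tendsto (fun e => ∫ t in a..(b - e), f t) (𝓝[>] 0) (𝓝 (∫ t in a..b, f t)) := by
  have h := intervalIntegral.continuousOn_primitive_interval
    ((intervalIntegrable_iff' (by simp)).1 hf) b right_mem_uIcc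
  have h2 : Tendsto (fun e : ℝ => b - e) (𝓝[>] 0) (𝓝[uIcc a b] b) := by
    refine tendsto_nhdsWithin_iff.2 ⟨?_, ?_⟩
    · have : Continuous fun e : ℝ => b - e := by fun_prop
      simpa using (this.tendsto 0).mono_left nhdsWithin_le_nhds
    · filter_upwards [Ioo_mem_nhdsGT (sub_pos.2 hab)] with e he
      rw [uIcc_of_le hab.le]
      constructor <;> linarith [he.1, he.2]
  exact h.tendsto.comp h2

namespace HydroFlow

theorem intervalIntegrable_slice (h : HydroFlow α β A B ρ ρx ρt) (t : ℝ) : IvlInt (ρ t) 0 1 :=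
  intervalIntegrable_of_measurable_of_bound (C := 1) zero_le_one (measurable_slice h.meas t)
    fun x hx => by
      have := h.mem t x (Ioc_subset_Icc_self hx)
      rw [abs_of_nonneg this.1]; exact this.2

theorem tendsto_integral_comp (h : HydroFlow α β A B ρ ρx ρt) {Φ : ℝ → ℝ → ℝ → ℝ}
    (hΦ : Continuous fun p : ℝ × ℝ² => Φ p.1 p.2.1 p.2.2) :
    Tendsto (fun a => ∫ x in (0)..1, Φ a x (ρ a x)) (𝓝[>] 0)
      (𝓝 (∫ x in (0)..1, Φ 0 x (ρ 0 x))) := by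
  have hK : IsCompact (𝕁 ×ˢ 𝕁 ×ˢ 𝕁) := isCompact_Icc.prod (isCompact_Icc.prod isCompact_Icc)
  obtain ⟨M, hM⟩ := hK.exists_bound_of_continuousOn hΦ.continuousOn
  have hM0 : 0 ≤ M := (norm_nonneg _).trans (hM (0, 0, 0) (by simp))
  have huc := hK.uniformContinuousOn_of_continuous hΦ.continuousOn
  rw [Metric.uniformContinuousOn_iff] at huc
  have hItg : ∀ a ∈ 𝕁, IvlInt (fun x => Φ a x (ρ a x)) 0 1 := by
    intro a ha
    refine intervalIntegrable_of_measurable_of_bound (C := M) zero_le_one ?_ fun x hx => ?_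
    · exact hΦ.measurable.comp (measurable_const.prodMk
        (measurable_id.prodMk (measurable_slice h.meas a)))
    · exact hM (a, x, ρ a x) ⟨ha, Ioc_subset_Icc_self hx, h.mem a x (Ioc_subset_Icc_self hx)⟩
  rw [Metric.tendsto_nhds]
  intro ε hε
  obtain ⟨δ, hδ, hd⟩ := huc (ε / 4) (by positivity)
  have hsmall : ∀ᶠ a in 𝓝[>] (0 : ℝ), ∫ x in (0)..1, |ρ a x - ρ 0 x| < ε * δ / (8 * (M + 1)) :=
    (tendsto_order.1 h.init).2 _ (by positivity)
  filter_upwards [hsmall, Ioo_mem_nhdsGT (lt_min hδ one_pos)] with a ha ha'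
  have ha1 : a ∈ 𝕁 := ⟨ha'.1.le, (ha'.2.trans_le (min_le_right _ _)).le⟩
  have hpt : ∀ x ∈ 𝕁, |Φ a x (ρ a x) - Φ 0 x (ρ 0 x)| ≤ ε / 4 + 2 * M / δ * |ρ a x - ρ 0 x| := by
    intro x hx
    have m1 := h.mem a x hx
    have m0 := h.mem 0 x hx
    by_cases hc : |ρ a x - ρ 0 x| < δ
    · have := hd (a, x, ρ a x) ⟨ha1, hx, m1⟩ (0, x, ρ 0 x) ⟨by simp, hx, m0⟩ (by
        simp only [Prod.dist_eq, dist_self, Real.dist_eq, sub_zero]; rw [abs_of_pos ha'.1]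
        exact max_lt (ha'.2.trans_le (min_le_left _ _)) (max_lt hδ hc))
      rw [Real.dist_eq] at this
      refine this.le.trans (le_add_of_nonneg_right (by positivity))
    · push Not at hc
      have e1 := hM (a, x, ρ a x) ⟨ha1, hx, m1⟩
      have e2 := hM (0, x, ρ 0 x) ⟨by simp, hx, m0⟩
      rw [norm_eq_abs] at e1 e2
      have e3 : 2 * M ≤ 2 * M / δ * |ρ a x - ρ 0 x| := by
        rw [div_mul_eq_mul_div, le_div_iff₀ hδ]; gcongr
      refine (abs_sub _ _).trans ?_
      linarith
  have hdi : IvlInt (fun x => |ρ a x - ρ 0 x|) 0 1 :=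
    ((h.intervalIntegrable_slice a).sub (h.intervalIntegrable_slice 0)).abs
  have hri : IvlInt (fun x => ε / 4 + 2 * M / δ * |ρ a x - ρ 0 x|) 0 1 :=
    intervalIntegrable_const.add (hdi.const_mul _)
  rw [Real.dist_eq, ← iint_sub (hItg a ha1) (hItg 0 (by simp))]
  calc |∫ x in (0)..1, (Φ a x (ρ a x) - Φ 0 x (ρ 0 x))|
      ≤ ∫ x in (0)..1, |Φ a x (ρ a x) - Φ 0 x (ρ 0 x)| :=
        intervalIntegral.abs_integral_le_integral_abs zero_le_one
    _ ≤ ∫ x in (0)..1, (ε / 4 + 2 * M / δ * |ρ a x - ρ 0 x|) := iint_mono_on zero_le_one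
          (((hItg a ha1).sub (hItg 0 (by simp))).abs) hri hpt
    _ = ε / 4 + 2 * M / δ * ∫ x in (0)..1, |ρ a x - ρ 0 x| := by
        rw [iint_add intervalIntegrable_const (hdi.const_mul _), iint_const_mul]; simp
    _ ≤ ε / 4 + 2 * M / δ * (ε * δ / (8 * (M + 1))) := by gcongr
    _ = ε / 4 + ε / 4 * (M / (M + 1)) := by field_simp; ring
    _ ≤ ε / 4 + ε / 4 * 1 := by
        gcongr; rw [div_le_one (by positivity)]; linarith
    _ < ε := by linarith

theorem isPath (h : HydroFlow α β A B ρ ρx ρt) (hb : 0 < b) : IsPath 0 b ρ ρx :=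
  ⟨h.meas, h.meas_x, fun t _ x hx => h.mem t x hx, h.memLp b hb⟩

/-- The density in time of the linear part of the action. -/
def _root_.linDensity (α β A B : ℝ) {T : ℝ} (K : SpaceTimeTest T) (t : ℝ) (u g : ℝ → ℝ) : ℝ :=
  (∫ x in (0)..1, (-u x * K.ht t x + g x * K.hx t x))
    + ((u 1 - β) / B * K.h t 1 + (u 0 - α) / A * K.h t 0)

theorem _root_.SpaceTimeTest.cont_right (K : SpaceTimeTest T) (x : ℝ) :
    Continuous fun t => K.h t x := K.cont.comp (by fun_prop : Continuous fun t : ℝ => (t, x))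

theorem _root_.IsPath.integrable_linBulk (hp : IsPath a b u g)
    (K : SpaceTimeTest T) : Integrable (fun p : ℝ² => -u p.1 p.2 * K.ht p.1 p.2
      + g p.1 p.2 * K.hx p.1 p.2) (rectMeasure a b) := by
  have h1 := Integrable.continuous_mul_rect K.cont_t hp.integrable_u
  have h2 := Integrable.continuous_mul_rect K.cont_x hp.integrable_g
  refine (h1.neg.add h2).congr (.of_forall fun p => ?_)
  simp only [Pi.add_apply, Pi.neg_apply]; ring

theorem _root_.IsPath.intervalIntegrable_linDensity
    (hp : IsPath a b u g) (hab : a ≤ b) (α β A B : ℝ) (K : SpaceTimeTest T) :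
    IvlInt (fun t => linDensity α β A B K t (u t) (g t)) a b := by
  have hu : ∀ x ∈ 𝕁, IvlInt (fun t => u t x) a b := fun x hx =>
    intervalIntegrable_of_measurable_of_bound (C := 1) hab (measurable_slice_left hp.meas x)
      fun t ht => by
        have := hp.mem t ht x hx
        rw [abs_of_nonneg this.1]; exact this.2
  have hb : ∀ x ∈ 𝕁, ∀ ϱ D : ℝ, IvlInt (fun t => (u t x - ϱ) / D * K.h t x) a b := fun x hx ϱ D =>
    (((hu x hx).sub intervalIntegrable_const).div_const D).mul_continuousOn
      (K.cont_right x).continuousOn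
  exact (intervalIntegrable_integral_of_rect hab (F := fun t x => -u t x * K.ht t x
    + g t x * K.hx t x) (hp.integrable_linBulk K)).add
    ((hb 1 (by simp) β B).add (hb 0 (by simp) α A))

theorem linDensity_eq (h : HydroFlow α β A B ρ ρx ρt) (K : SpaceTimeTest T) (ht : 0 < t)
    (htT : t ≤ T) : linDensity α β A B K t (ρ t) (ρx t)
      = -∫ x in (0)..1, (ρt t x * K.h t x + ρ t x * K.ht t x) := by
  have ht' : t ∈ Icc 0 T := ⟨ht.le, htT⟩
  have ck : ContinuousOn (K.h t) 𝕁 := (K.cont.along t).continuousOn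
  have ckt : ContinuousOn (K.ht t) 𝕁 := (K.cont_t.along t).continuousOn
  have ckx : ContinuousOn (K.hx t) 𝕁 := (K.cont_x.along t).continuousOn
  have cr : ContinuousOn (ρ t) 𝕁 := h.cont.slice ht
  have crx : ContinuousOn (ρx t) 𝕁 := h.cont_x.slice ht
  have crt : ContinuousOn (ρt t) 𝕁 := h.cont_t.slice ht
  have ii : ∀ {f : ℝ → ℝ}, ContinuousOn f 𝕁 → IvlInt f 0 1 := fun hf => intble01 hf
  have ibp := integral_mul_deriv_Icc (zero_le_one' ℝ) (K.has_x t ht') (h.has_xx t ht)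
    (ii ckx) (ii crt)
  have j1 : IvlInt (fun x => K.h t x * ρt t x) 0 1 := ii (ck.mul crt)
  have j2 : IvlInt (fun x => ρ t x * K.ht t x) 0 1 := ii (cr.mul ckt)
  have j3 : IvlInt (fun x => K.hx t x * ρx t x) 0 1 := ii (ckx.mul crx)
  have e1 : ∫ x in (0)..1, (ρt t x * K.h t x + ρ t x * K.ht t x)
      = (∫ x in (0)..1, K.h t x * ρt t x) + ∫ x in (0)..1, ρ t x * K.ht t x := by
    rw [← iint_add j1 j2]; exact iint_congr fun x _ => by ring
  have e2 : ∫ x in (0)..1, (-ρ t x * K.ht t x + ρx t x * K.hx t x)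
      = (∫ x in (0)..1, K.hx t x * ρx t x) - ∫ x in (0)..1, ρ t x * K.ht t x := by
    rw [← iint_sub j3 j2]; exact iint_congr fun x _ => by ring
  rw [linDensity, e1, e2, ibp, h.bc_zero t ht, h.bc_one t ht]; ring

theorem lin_identity (h : HydroFlow α β A B ρ ρx ρt) (K : SpaceTimeTest T) (hb : 0 < b)
    (hbT : b ≤ T) : (∫ x in (0)..1, ρ b x * K.h b x) - (∫ x in (0)..1, ρ 0 x * K.h 0 x)
      + ∫ t in (0)..b, linDensity α β A B K t (ρ t) (ρx t) = 0 := by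
  have key : ∀ a ∈ Ioo 0 b, (∫ x in (0)..1, ρ b x * K.h b x) - (∫ x in (0)..1, ρ a x * K.h a x)
      + ∫ t in a..b, linDensity α β A B K t (ρ t) (ρx t) = 0 := by
    intro a ha
    have hs : Icc a b ×ˢ 𝕁 ⊆ Ioi 0 ×ˢ 𝕁 := prod_mono (fun t ht => ha.1.trans_le ht.1) le_rfl
    have hs' : Icc a b ⊆ Icc 0 T := Icc_subset_Icc ha.1.le hbT
    have e := integral_integral_deriv_time_of_continuousOn ha.2.le
      (Ψ := fun t x => ρ t x * K.h t x) (Ψt := fun t x => ρt t x * K.h t x + ρ t x * K.ht t x)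
      (fun x hx t ht => ((h.has_t t (ha.1.trans_le ht.1) x hx).hasDerivWithinAt).mul
        ((K.has_t t (hs' ht) x hx).mono hs'))
      ((h.cont.mono hs).mul K.cont.continuousOn)
      (((h.cont_t.mono hs).mul K.cont.continuousOn).add
        ((h.cont.mono hs).mul K.cont_t.continuousOn))
    rw [← e, ← iint_congr (g := fun t => linDensity α β A B K t (ρ t) (ρx t)) (f := fun t =>
        -∫ x in (0)..1, (ρt t x * K.h t x + ρ t x * K.ht t x)) (fun t ht => by
        rw [uIcc_of_le ha.2.le] at ht
        exact (h.linDensity_eq K (ha.1.trans_le ht.1) (ht.2.trans hbT)).symm),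
      iint_neg, add_neg_cancel]
  have lim := ((tendsto_const_nhds (x := ∫ x in (0)..1, ρ b x * K.h b x)).sub
    (h.tendsto_integral_comp (Φ := fun a x y => y * K.h a x) (by
      have : Continuous fun p : ℝ × ℝ² => K.h p.1 p.2.1 :=
        K.cont.comp (by fun_prop : Continuous fun p : ℝ × ℝ² => (p.1, p.2.1))
      fun_prop))).add (tendsto_integral_left_of_intervalIntegrable hb
        ((h.isPath hb).intervalIntegrable_linDensity hb.le α β A B K))
  refine tendsto_nhds_unique lim (tendsto_const_nhds.congr' ?_)
  filter_upwards [Ioo_mem_nhdsGT hb] with a ha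
  exact (key a ha).symm

theorem _root_.IsPath.rateDensity_le_linDensity (hp : IsPath a b u g)
    (hA : 0 < A) (hB : 0 < B) (hα : α ∈ 𝕁) (hβ : β ∈ 𝕁)
    (K : SpaceTimeTest T) : ∀ᵐ t ∂(volume.restrict (Ioc a b)),
      rateDensity α β A B K t (u t) (g t) ≤ linDensity α β A B K t (u t) (g t) := by
  filter_upwards [ae_intervalIntegrable_of_rect
      (F := fun t x => bulkDensity K t x (u t x) (g t x)) (hp.integrable_bulkDensity K),
    ae_intervalIntegrable_of_rect (F := fun t x => -u t x * K.ht t x + g t x * K.hx t x)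
      (hp.integrable_linBulk K), ae_restrict_mem measurableSet_Ioc] with t h1 h2 ht
  have b0 := neg_bdryB_le (K.h t 0) hA hα (hp.mem t ht 0 (by simp))
  have b1 := neg_bdryB_le (K.h t 1) hB hβ (hp.mem t ht 1 (by simp))
  have e : ∫ x in (0)..1, bulkDensity K t x (u t x) (g t x)
      ≤ ∫ x in (0)..1, (-u t x * K.ht t x + g t x * K.hx t x) := by
    refine iint_mono_on zero_le_one h1 h2 fun x hx => ?_
    have := hp.mem t ht x hx
    have : 0 ≤ u t x * (1 - u t x) * K.hx t x ^ 2 :=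
      mul_nonneg (mul_nonneg this.1 (sub_nonneg.2 this.2)) (sq_nonneg _)
    simp only [bulkDensity]; linarith
  simp only [rateDensity, linDensity, bdryDensity]; linarith

theorem action_nonpos (h : HydroFlow α β A B ρ ρx ρt) (hA : 0 < A) (hB : 0 < B)
    (hα : α ∈ 𝕁) (hβ : β ∈ 𝕁) (K : SpaceTimeTest T) (hb : 0 < b)
    (hbT : b ≤ T) : action α β A B K 0 b ρ ρx ≤ 0 := by
  refine le_trans ?_ (h.lin_identity K hb hbT).le
  rw [action]
  refine add_le_add le_rfl ?_
  have hp := h.isPath hb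
  refine iint_mono_ae hb.le
    (hp.intervalIntegrable_rateDensity hb.le α β A B K)
    (hp.intervalIntegrable_linDensity hb.le α β A B K) ?_
  rw [← Measure.restrict_congr_set Ioc_ae_eq_Icc]; exact hp.rateDensity_le_linDensity hA hB hα hβ K

/-- The path run backwards from time `θ`. -/
theorem isPath_reverse (h : HydroFlow α β A B ρ ρx ρt) (hb : 0 < b) (θ : ℝ) :
    IsPath (θ - b) θ (fun t => ρ (θ - t)) (fun t => ρx (θ - t)) := by
  have hm : Measurable fun p : ℝ² => (θ - p.1, p.2) := by fun_prop
  refine ⟨h.meas.comp hm, h.meas_x.comp hm, fun t _ x hx => h.mem _ x hx, ?_⟩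
  have hmp : MeasurePreserving (fun t : ℝ => θ - t) (volume.restrict (Ico (θ - b) θ))
      (volume.restrict (Ioc 0 b)) := by
    have := (Measure.measurePreserving_sub_left volume θ).restrict_preimage
      (measurableSet_Ioc (a := (0 : ℝ)) (b := b))
    convert this using 2
    ext t; simp only [mem_Ico, mem_preimage, mem_Ioc]
    constructor <;> rintro ⟨h1, h2⟩ <;> constructor <;> linarith
  have hmp' : MeasurePreserving (fun t : ℝ => θ - t) (volume.restrict (Ioc (θ - b) θ))
      (volume.restrict (Ioc 0 b)) := by
    rwa [Measure.restrict_congr_set (Ico_ae_eq_Ioc (μ := volume) (a := θ - b) (b := θ))] at hmp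
  exact (h.memLp b hb).comp_measurePreserving (hmp'.prod (MeasurePreserving.id _))

/-- The entropy of a profile. -/
def _root_.profileEntropy (f : ℝ → ℝ) : ℝ := ∫ x in (0)..1, -Real.binEntropy (f x)

theorem tendsto_profileEntropy (h : HydroFlow α β A B ρ ρx ρt) :
    Tendsto (fun a => profileEntropy (ρ a)) (𝓝[>] 0) (𝓝 (profileEntropy (ρ 0))) :=
  h.tendsto_integral_comp (Φ := fun _ _ y => -Real.binEntropy y)
    (Real.binEntropy_continuous.neg.comp (by fun_prop : Continuous fun p : ℝ × ℝ² => p.2.2))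

theorem mem_Ioo (h : HydroFlow α β A B ρ ρx ρt) (ht : 0 < t) (hx : x ∈ 𝕁) : ρ t x ∈ 𝕁ᵒ := by
  obtain ⟨ε, hε, hb⟩ := h.bound t ht t
  have := hb t ⟨le_rfl, le_rfl⟩ x hx
  constructor <;> linarith [this.1, this.2]

theorem action_reverse_le_aux (h : HydroFlow α β A B ρ ρx ρt) (hA : 0 < A) (hB : 0 < B)
    (hα : α ∈ 𝕁ᵒ) (hβ : β ∈ 𝕁ᵒ) (K : SpaceTimeTest T)
    (ha : a ∈ Ioo 0 b) (hbθ : b ≤ θ) (hθT : θ ≤ T) :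
    action α β A B K (θ - b) (θ - a) (fun t => ρ (θ - t)) (fun t => ρx (θ - t))
      ≤ profileEntropy (ρ a) - profileEntropy (ρ b)
        + (b - a) * (|logit α| / A + |logit β| / B) := by
  have hab : θ - b ≤ θ - a := by linarith [ha.2]
  have hpos : ∀ t ∈ Icc (θ - b) (θ - a), 0 < θ - t := fun t ht => by linarith [ht.2, ha.1]
  have hs' : Icc (θ - b) (θ - a) ⊆ Icc 0 T := Icc_subset_Icc (by linarith) (by linarith [ha.1])
  have hcomp : ∀ {F : ℝ → ℝ → ℝ}, ContinuousOn ⇈F (Ioi 0 ×ˢ 𝕁) →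
      ContinuousOn (fun p : ℝ² => F (θ - p.1) p.2) (Icc (θ - b) (θ - a) ×ˢ 𝕁) :=
    fun hF => hF.comp (f := fun p : ℝ² => (θ - p.1, p.2)) (by fun_prop)
      fun p hp => ⟨hpos p.1 hp.1, hp.2⟩
  have c0 := hcomp h.cont
  have cx := hcomp h.cont_x
  have ct := hcomp h.cont_t
  have hd : ∀ x ∈ 𝕁, ∀ t ∈ Icc (θ - b) (θ - a),
      HasDerivAt (fun s => ρ (θ - s) x) (-ρt (θ - t) x) t := fun x hx t ht => by
    have := (h.has_t _ (hpos t ht) x hx).comp_const_sub θ t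
    simpa using this
  have cl : ContinuousOn (fun p : ℝ² => logit (ρ (θ - p.1) p.2))
      (Icc (θ - b) (θ - a) ×ˢ 𝕁) := fun p hp =>
    (hasDerivAt_logit (h.mem_Ioo (hpos p.1 hp.1) hp.2)).continuousAt.comp_continuousWithinAt
      (f := fun p : ℝ² => ρ (θ - p.1) p.2) (c0 p hp)
  have e1 := integral_integral_deriv_time_of_continuousOn hab
    (Ψ := fun t x => ρ (θ - t) x * K.h t x)
    (Ψt := fun t x => -ρt (θ - t) x * K.h t x + ρ (θ - t) x * K.ht t x)
    (fun x hx t ht => ((hd x hx t ht).hasDerivWithinAt).mul ((K.has_t t (hs' ht) x hx).mono hs'))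
    (c0.mul K.cont.continuousOn) ((ct.neg.mul K.cont.continuousOn).add
      (c0.mul K.cont_t.continuousOn))
  have e2 := integral_integral_deriv_time_of_continuousOn hab
    (Ψ := fun t x => -Real.binEntropy (ρ (θ - t) x))
    (Ψt := fun t x => -(logit (ρ (θ - t) x) * ρt (θ - t) x))
    (fun x hx t ht => by
      have hm := h.mem_Ioo (hpos t ht) hx
      refine ((((Real.hasDerivAt_binEntropy hm.1.ne' hm.2.ne).comp t (hd x hx t ht)).neg).congr_deriv
        ?_).hasDerivWithinAt
      simp only [logit]
      ring)
    ((Real.binEntropy_continuous.comp_continuousOn c0).neg) ((cl.mul ct).neg)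
  simp only [sub_sub_cancel] at e1 e2
  have i1 : IvlInt (fun t => ∫ x in (0)..1,
      (-ρt (θ - t) x * K.h t x + ρ (θ - t) x * K.ht t x)) (θ - b) (θ - a) :=
    intervalIntegrable_integral_of_rect hab (integrable_prod_of_continuousOn (F := fun t x =>
      -ρt (θ - t) x * K.h t x + ρ (θ - t) x * K.ht t x) ((ct.neg.mul K.cont.continuousOn).add (c0.mul K.cont_t.continuousOn)))
  have i2 : IvlInt (fun t => ∫ x in (0)..1,
      -(logit (ρ (θ - t) x) * ρt (θ - t) x)) (θ - b) (θ - a) :=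
    intervalIntegrable_integral_of_rect hab (integrable_prod_of_continuousOn (F := fun t x =>
      -(logit (ρ (θ - t) x) * ρt (θ - t) x)) ((cl.mul ct).neg))
  have i3 := ((h.isPath_reverse (ha.1.trans ha.2) θ).mono (c := θ - b) (d := θ - a) le_rfl
    (by linarith [ha.1])).intervalIntegrable_rateDensity hab α β A B K
  rw [action]; simp only [sub_sub_cancel]; rw [← e1, ← iint_add i1 i3]
  have e3 : (b - a) * (|logit α| / A + |logit β| / B)
      = ∫ t in (θ - b)..(θ - a), (|logit α| / A + |logit β| / B) := by
    rw [iint_const]; simp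
  rw [e3]
  change _ ≤ (∫ x in (0)..1, -Real.binEntropy (ρ a x)) - (∫ x in (0)..1,
    -Real.binEntropy (ρ b x)) + _
  rw [← e2, ← iint_add i2 intervalIntegrable_const]
  refine iint_mono_on hab (i1.add i3)
    (i2.add intervalIntegrable_const) fun t ht => ?_
  have ht0 := hpos t ht
  have htT := hs' ht
  have ckx : Continuous (K.hx t) := K.cont_x.along t
  have ck : Continuous (K.h t) := K.cont.along t
  have ckt : Continuous (K.ht t) := K.cont_t.along t
  have st := static_reverse_le hA hB hα hβ (h.has_x _ ht0) (h.has_xx _ ht0)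
    (h.cont_t.slice ht0) (fun x hx => h.mem_Ioo ht0 hx) (h.bc_zero _ ht0) (h.bc_one _ ht0)
    (K.has_x t htT) ckx.continuousOn
  refine le_trans (le_of_eq ?_) st
  have d0 : ContinuousOn (ρ (θ - t)) 𝕁 := h.cont.slice ht0
  have dx : ContinuousOn (ρx (θ - t)) 𝕁 := h.cont_x.slice ht0
  have dt : ContinuousOn (ρt (θ - t)) 𝕁 := h.cont_t.slice ht0
  have j1 : IvlInt (fun x => -ρt (θ - t) x * K.h t x + ρ (θ - t) x * K.ht t x)
    0 1 := intble01
        ((dt.neg.mul ck.continuousOn).add (d0.mul ckt.continuousOn))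
  have j2 : IvlInt (fun x => bulkDensity K t x (ρ (θ - t) x) (ρx (θ - t) x))
    0 1 := intble01
        (((d0.neg.mul ckt.continuousOn).add (dx.mul ckx.continuousOn)).sub
          ((d0.mul (continuousOn_const.sub d0)).mul (ckx.continuousOn.pow 2)))
  rw [rateDensity, ← add_sub_assoc, ← iint_add j1 j2]
  congr 1
  refine iint_congr fun x _ => ?_
  simp only [bulkDensity]; ring

/-- The action of the time reversed flow is bounded by the entropy difference. -/
theorem action_reverse_le (h : HydroFlow α β A B ρ ρx ρt) (hA : 0 < A) (hB : 0 < B)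
    (hα : α ∈ 𝕁ᵒ) (hβ : β ∈ 𝕁ᵒ) (K : SpaceTimeTest T) (hb : 0 < b) (hbθ : b ≤ θ) (hθT : θ ≤ T) :
    action α β A B K (θ - b) θ (fun t => ρ (θ - t)) (fun t => ρx (θ - t))
      ≤ profileEntropy (ρ 0) - profileEntropy (ρ b) + b * (|logit α| / A + |logit β| / B) := by
  have hcK : Continuous fun p : ℝ × ℝ² => K.h (θ - p.1) p.2.1 :=
    K.cont.comp (by fun_prop : Continuous fun p : ℝ × ℝ² => (θ - p.1, p.2.1))
  have l1 := h.tendsto_integral_comp (Φ := fun a x y => y * K.h (θ - a) x) (by fun_prop)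
  have l2 := tendsto_integral_right_of_intervalIntegrable (by linarith : θ - b < θ)
    ((h.isPath_reverse hb θ).intervalIntegrable_rateDensity (by linarith) α β A B K)
  have l3 := (h.tendsto_profileEntropy.sub_const (profileEntropy (ρ b))).add
    ((((by fun_prop : Continuous fun a : ℝ => b - a).tendsto (0 : ℝ)).mono_left
      (nhdsWithin_le_nhds (s := Ioi (0 : ℝ)))).mul_const (|logit α| / A + |logit β| / B))
  have l4 := ((l1.sub_const (∫ x in (0)..1, ρ b x * K.h (θ - b) x)).add l2)
  simp only [sub_zero] at l3 l4; rw [action]; simp only [sub_self, sub_sub_cancel]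
  refine le_of_tendsto_of_tendsto l4 l3 ?_
  filter_upwards [Ioo_mem_nhdsGT hb] with a ha
  have := h.action_reverse_le_aux hA hB hα hβ K ha hbθ hθT
  rw [action] at this; simpa only [sub_sub_cancel] using this

end HydroFlow

/-! ### A bound for paths with bounded time derivative -/

theorem sq_le_exp_sub {p q : ℝ} (hc : 0 ≤ c) (hp : c ≤ p) (hq : c ≤ q) (hp1 : p ≤ 1) (hq1 : q ≤ 1)
    (M : ℝ) : c * M ^ 2 / 2 - 1 ≤ p * (exp M - 1) + q * (exp (-M) - 1) := by
  rcases le_total 0 M with h | h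
  · have h1 := Real.quadratic_le_exp_of_nonneg h
    have h2 := Real.exp_pos (-M)
    have h3 : c * (M ^ 2 / 2) ≤ p * (exp M - 1) := by
      gcongr
      · linarith
      · linarith
    nlinarith [mul_nonneg (hc.trans hq) h2.le]
  · have h1 := Real.quadratic_le_exp_of_nonneg (neg_nonneg.2 h)
    have h2 := Real.exp_pos M
    have h3 : c * (M ^ 2 / 2) ≤ q * (exp (-M) - 1) := by
      gcongr
      · linarith
      · nlinarith
    nlinarith [mul_nonneg (hc.trans hp) h2.le]

theorem neg_bdryB_le_of_mem (hD : 0 < D) (hϱ : ϱ ∈ 𝕁)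
    (ha : a ∈ 𝕁) (hc : 0 < c) (h1 : c ≤ (1 - a) * ϱ) (h2 : c ≤ a * (1 - ϱ)) (M C : ℝ) :
    C * |M| - bdryB ϱ D a M ≤ D * C ^ 2 / (2 * c) + 1 / D := by
  have h := sq_le_exp_sub hc.le h1 h2 (by nlinarith [ha.1, ha.2, hϱ.1, hϱ.2])
    (by nlinarith [ha.1, ha.2, hϱ.1, hϱ.2]) M
  have hb : 1 / D * (c * M ^ 2 / 2 - 1) ≤ bdryB ϱ D a M := by
    rw [bdryB]; gcongr
  have e : C * |M| ≤ D * C ^ 2 / (2 * c) + 1 / D * (c * M ^ 2 / 2) := by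
    have : 0 ≤ (D * C - c * |M|) ^ 2 / (2 * c * D) := by positivity
    have e2 : (D * C - c * |M|) ^ 2 / (2 * c * D)
        = D * C ^ 2 / (2 * c) + 1 / D * (c * M ^ 2 / 2) - C * |M| := by
      rw [← sq_abs M]; field_simp; ring
    linarith
  linarith

/-- A bound on the action of a path which is bounded away from `0` and `1`, in terms of its
derivatives. -/
theorem exists_action_le (hA : 0 < A) (hB : 0 < B) (hα : α ∈ 𝕁ᵒ)
    (hβ : β ∈ 𝕁ᵒ) (hε : 0 < ε) : ∃ C, 0 ≤ C ∧ ∀ (T : ℝ) (K : SpaceTimeTest T)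
      (a b C₁ : ℝ) (u g ut : ℝ → ℝ → ℝ), 0 ≤ a → a ≤ b → b ≤ T → IsPath a b u g →
      (∀ t ∈ Icc a b, ∀ x ∈ 𝕁, ε ≤ u t x ∧ u t x ≤ 1 - ε) → (Measurable ⇈ut) →
      (∀ t ∈ Icc a b, ∀ x ∈ 𝕁, |ut t x| ≤ C₁) → (∀ x ∈ 𝕁, ∀ t ∈ Icc a b,
        HasDerivWithinAt (fun s => u s x) (ut t x) (Icc a b) t) → action α β A B K a b u g
        ≤ C * ((b - a) * (1 + C₁ ^ 2) + ∫ t in a..b, ∫ x in (0)..1, g t x ^ 2) := by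
  set κ : ℝ := ε / 2
  have hκ : 0 < κ := by positivity
  set ca : ℝ := ε * min α (1 - α)
  set cb : ℝ := ε * min β (1 - β)
  have hca : 0 < ca := mul_pos hε (lt_min hα.1 (sub_pos.2 hα.2))
  have hcb : 0 < cb := mul_pos hε (lt_min hβ.1 (sub_pos.2 hβ.2))
  refine ⟨1 / κ + A / (2 * ca) + (1 / A + 1 / B), by positivity, ?_⟩
  intro T K a b C₁ u g ut ha0 hab hbT hp hmem hut hC₁ hd
  have hs' : Icc a b ⊆ Icc 0 T := Icc_subset_Icc ha0 hbT
  have hmem01 : ∀ t ∈ Icc a b, ∀ x ∈ 𝕁, u t x ∈ 𝕁 := fun t ht x hx =>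
    ⟨hε.le.trans (hmem t ht x hx).1, (hmem t ht x hx).2.trans (by linarith)⟩
  have hC0 : 0 ≤ C₁ := (abs_nonneg _).trans (hC₁ a (left_mem_Icc.2 hab) 0 (by simp))
  have hutI : Integrable ⇈ut (rectMeasure a b) := by
    refine Integrable.of_bound hut.aestronglyMeasurable C₁ ?_
    filter_upwards [ae_rectMeasure_mem a b] with p hp
    exact hC₁ _ (Ioc_subset_Icc_self hp.1) _ (Ioc_subset_Icc_self hp.2)
  have int1 : Integrable (fun p : ℝ² => ut p.1 p.2 * K.h p.1 p.2 + u p.1 p.2 * K.ht p.1 p.2)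
      (rectMeasure a b) := by
    refine ((Integrable.continuous_mul_rect K.cont hutI).add
      (Integrable.continuous_mul_rect K.cont_t hp.integrable_u)).congr
      (.of_forall fun p => ?_)
    simp only [Pi.add_apply]; ring
  have hui : ∀ t ∈ Icc a b, IvlInt (fun x => u t x * K.h t x) 0 1 := by
    intro t ht
    refine (intervalIntegrable_of_measurable_of_bound (C := 1) zero_le_one
      (measurable_slice hp.meas t) fun x hx => ?_).mul_continuousOn
        (K.cont.along t).continuousOn
    have := hmem01 t ht x (Ioc_subset_Icc_self hx)
    rw [abs_of_nonneg this.1]; exact this.2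
  have e1 := integral_integral_deriv_time hab (Ψ := fun t x => u t x * K.h t x)
    (Ψt := fun t x => ut t x * K.h t x + u t x * K.ht t x)
    (fun x hx t ht => (hd x hx t ht).mul ((K.has_t t (hs' ht) x hx).mono hs'))
    (fun x hx => by
      have q1 : IvlInt (fun t => ut t x) a b :=
        intervalIntegrable_of_measurable_of_bound hab (measurable_slice_left hut x)
          fun t ht => hC₁ t (Ioc_subset_Icc_self ht) x hx
      have q2 : IvlInt (fun t => u t x) a b :=
        intble_Icc hab fun t ht => (hd x hx t ht).continuousWithinAt
      exact (q1.mul_continuousOn (K.cont_right x).continuousOn).add (q2.mul_continuousOn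
        (K.cont_t.comp (by fun_prop : Continuous fun t : ℝ => (t, x))).continuousOn))
    int1 (hui a (left_mem_Icc.2 hab)) (hui b (right_mem_Icc.2 hab))
  have hg2 : Integrable (fun p : ℝ² => g p.1 p.2 ^ 2) (rectMeasure a b) := hp.memLp.integrable_sq
  have i1 := intervalIntegrable_integral_of_rect hab
    (F := fun t x => ut t x * K.h t x + u t x * K.ht t x) int1
  have i2 := hp.intervalIntegrable_rateDensity hab α β A B K
  have i3 := intervalIntegrable_integral_of_rect hab (F := fun t x => g t x ^ 2) hg2
  have e2 : (b - a) * (1 + C₁ ^ 2) = ∫ t in a..b, (1 + C₁ ^ 2) := by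
    rw [iint_const]; simp
  rw [action, ← e1, ← iint_add i1 i2, e2, ← iint_add intervalIntegrable_const i3, ← iint_const_mul]
  refine iint_mono_ae hab (i1.add i2)
    ((intervalIntegrable_const.add i3).const_mul _) ?_
  rw [← Measure.restrict_congr_set Ioc_ae_eq_Icc]
  filter_upwards [ae_intervalIntegrable_of_rect (F := fun t x => g t x ^ 2) hg2,
    ae_intervalIntegrable_of_rect (F := fun t x => ut t x * K.h t x + u t x * K.ht t x) int1,
    ae_intervalIntegrable_of_rect
      (F := fun t x => bulkDensity K t x (u t x) (g t x)) (hp.integrable_bulkDensity K),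
    ae_restrict_mem measurableSet_Ioc] with t k1 k2 k3 ht'
  have ht := Ioc_subset_Icc_self ht'
  have ckx : Continuous (K.hx t) := K.cont_x.along t
  have habs : IvlInt (fun x => |K.hx t x|) 0 1 := ckx.abs.intervalIntegrable _ _
  set S : ℝ := ∫ x in (0)..1, |K.hx t x|
  have hS : ∀ x ∈ 𝕁, |K.h t x| ≤ |K.h t 0| + S := by
    intro x hx
    have f1 : ∫ y in (0)..x, K.hx t y = K.h t x - K.h t 0 :=
      integral_deriv_Icc hx.1 (fun y hy => (K.has_x t (hs' ht) y ⟨hy.1, hy.2.trans hx.2⟩).mono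
        (Icc_subset_Icc le_rfl hx.2)) (ckx.intervalIntegrable _ _)
    have f2 : |∫ y in (0)..x, K.hx t y| ≤ S := by
      refine (intervalIntegral.abs_integral_le_integral_abs hx.1).trans ?_
      exact intervalIntegral.integral_mono_interval le_rfl hx.1 hx.2
        (.of_forall fun y => abs_nonneg _) habs
    have : K.h t x = K.h t 0 + ∫ y in (0)..x, K.hx t y := by rw [f1]; ring
    rw [this]; exact (abs_add_le _ _).trans (by linarith)
  have m0 := hmem t ht 0 (by simp)
  have m1 := hmem t ht 1 (by simp)
  have b0 : C₁ * |K.h t 0| - bdryB α A (u t 0) (K.h t 0) ≤ A * C₁ ^ 2 / (2 * ca) + 1 / A := by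
    refine neg_bdryB_le_of_mem hA ⟨hα.1.le, hα.2.le⟩ (hmem01 t ht 0 (by simp)) hca ?_ ?_ _ _
    · exact mul_le_mul (by linarith) (min_le_left _ _) (lt_min hα.1 (sub_pos.2 hα.2)).le
        (by linarith)
    · exact mul_le_mul m0.1 (min_le_right _ _) (lt_min hα.1 (sub_pos.2 hα.2)).le (by linarith)
  have b1 : 0 * |K.h t 1| - bdryB β B (u t 1) (K.h t 1) ≤ B * 0 ^ 2 / (2 * cb) + 1 / B := by
    refine neg_bdryB_le_of_mem hB ⟨hβ.1.le, hβ.2.le⟩ (hmem01 t ht 1 (by simp)) hcb ?_ ?_ _ _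
    · exact mul_le_mul (by linarith) (min_le_left _ _) (lt_min hβ.1 (sub_pos.2 hβ.2)).le
        (by linarith)
    · exact mul_le_mul m1.1 (min_le_right _ _) (lt_min hβ.1 (sub_pos.2 hβ.2)).le (by linarith)
  have i4 : IvlInt (fun x => C₁ * (|K.h t 0| + S) - C₁ * |K.hx t x| + (C₁ ^ 2 / κ
      + 1 / κ * g t x ^ 2)) 0 1 := (intervalIntegrable_const.sub (habs.const_mul _)).add
      (intervalIntegrable_const.add (k1.const_mul _))
  have bulk : (∫ x in (0)..1, (ut t x * K.h t x + u t x * K.ht t x))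
      + ∫ x in (0)..1, bulkDensity K t x (u t x) (g t x)
      ≤ C₁ * |K.h t 0| + C₁ ^ 2 / κ + 1 / κ * ∫ x in (0)..1, g t x ^ 2 := by
    rw [← iint_add k2 k3]
    refine (iint_mono_on zero_le_one (k2.add k3) i4 fun x hx => ?_).trans
      (le_of_eq ?_)
    · have hm := hmem t ht x hx
      have f1 : ut t x * K.h t x ≤ C₁ * (|K.h t 0| + S) := by
        refine (le_abs_self _).trans ?_
        rw [abs_mul]; exact mul_le_mul (hC₁ t ht x hx) (hS x hx) (abs_nonneg _) hC0
      have f2 : κ ≤ u t x * (1 - u t x) := by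
        simp only [κ]; nlinarith [hm.1, hm.2]
      have f3 : κ * K.hx t x ^ 2 ≤ u t x * (1 - u t x) * K.hx t x ^ 2 := by gcongr
      have f4 : g t x * K.hx t x ≤ 1 / κ * g t x ^ 2 + κ * K.hx t x ^ 2 / 4 := by
        have : 0 ≤ (g t x - κ * K.hx t x / 2) ^ 2 / κ := by positivity
        have e : (g t x - κ * K.hx t x / 2) ^ 2 / κ
          = 1 / κ * g t x ^ 2 + κ * K.hx t x ^ 2 / 4 - g t x * K.hx t x := by field_simp; ring
        linarith
      have f5 : C₁ * |K.hx t x| ≤ C₁ ^ 2 / κ + κ * K.hx t x ^ 2 / 4 := by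
        have : 0 ≤ (C₁ - κ * |K.hx t x| / 2) ^ 2 / κ := by positivity
        have e : (C₁ - κ * |K.hx t x| / 2) ^ 2 / κ
          = C₁ ^ 2 / κ + κ * K.hx t x ^ 2 / 4 - C₁ * |K.hx t x| := by
            rw [← sq_abs (K.hx t x)]; field_simp; ring
        linarith
      have f6 : 0 ≤ κ * K.hx t x ^ 2 := by positivity
      simp only [bulkDensity]; linarith
    · rw [iint_add (intervalIntegrable_const.sub (habs.const_mul _))
        (intervalIntegrable_const.add (k1.const_mul _)),
        iint_sub intervalIntegrable_const (habs.const_mul _),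
        iint_add intervalIntegrable_const (k1.const_mul _), iint_const, iint_const,
        iint_const_mul, iint_const_mul]
      simp only [sub_zero, smul_eq_mul, one_mul, S]; ring
  have hG : 0 ≤ ∫ x in (0)..1, g t x ^ 2 := iint_nonneg zero_le_one fun x _ => sq_nonneg _
  set G : ℝ := ∫ x in (0)..1, g t x ^ 2
  simp only [rateDensity, bdryDensity]
  have g1 : 1 / κ * (C₁ ^ 2 + G) ≤ 1 / κ * (1 + C₁ ^ 2 + G) := by gcongr; linarith
  have g2 : A / (2 * ca) * C₁ ^ 2 ≤ A / (2 * ca) * (1 + C₁ ^ 2 + G) := by gcongr; linarith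
  have g3 : (1 / A + 1 / B) * 1 ≤ (1 / A + 1 / B) * (1 + C₁ ^ 2 + G) := by
    gcongr; nlinarith [sq_nonneg C₁]
  have g4 : 1 / κ * (C₁ ^ 2 + G) = C₁ ^ 2 / κ + 1 / κ * G := by ring
  have g5 : A / (2 * ca) * C₁ ^ 2 = A * C₁ ^ 2 / (2 * ca) := by ring
  have g6 : B * 0 ^ 2 / (2 * cb) = 0 := by simp
  rw [g6] at b1; linarith

theorem MeasureTheory.Integrable.sub_fun {X : Type*} [MeasurableSpace X] {μ : Measure X}
    {f g : X → ℝ} (hf : Integrable f μ) (hg : Integrable g μ) :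
    Integrable (fun x => f x - g x) μ := hf.sub hg

theorem IntervalIntegrable.add_fun {g : ℝ → ℝ} (hf : IvlInt f a b) (hg : IvlInt g a b) :
    IvlInt (fun x => f x + g x) a b := hf.add hg

theorem IntervalIntegrable.sub_fun {g : ℝ → ℝ} (hf : IvlInt f a b) (hg : IvlInt g a b) :
    IvlInt (fun x => f x - g x) a b := hf.sub hg

/-! ### Convexity of the action -/

theorem IsPath.action_eq (hp : IsPath a b u g) (hab : a ≤ b)
    (K : SpaceTimeTest T) : action α β A B K a b u g
      = (∫ x in (0)..1, u b x * K.h b x) - (∫ x in (0)..1, u a x * K.h a x)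
        + ((∫ p, bulkDensity K p.1 p.2 (u p.1 p.2) (g p.1 p.2) ∂(rectMeasure a b))
          - ∫ t in Ioc a b, bdryDensity α β A B K t (u t 0) (u t 1)) := by
  have e : ∫ p, bulkDensity K p.1 p.2 (u p.1 p.2) (g p.1 p.2) ∂(rectMeasure a b)
      = ∫ t in a..b, ∫ x in (0)..1, bulkDensity K t x (u t x) (g t x) := by
    rw [integral_prod _ (hp.integrable_bulkDensity K), iint_of_le hab]; simp only [iint01]
  rw [e, ← iint_of_le hab, ← iint_sub
    (intervalIntegrable_integral_of_rect hab (F := fun t x => bulkDensity K t x (u t x) (g t x))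
    (hp.integrable_bulkDensity K)) (hp.intervalIntegrable_bdryDensity hab α β A B K)]
  rfl

theorem bdryDensity_convexComb (K : SpaceTimeTest T) (t θ u₀ u₁ v₀ v₁ : ℝ) :
    bdryDensity α β A B K t (θ * u₀ + (1 - θ) * v₀) (θ * u₁ + (1 - θ) * v₁)
      = θ * bdryDensity α β A B K t u₀ u₁ + (1 - θ) * bdryDensity α β A B K t v₀ v₁ := by
  simp only [bdryDensity, bdryB]; ring

theorem bulkDensity_convexComb_le (K : SpaceTimeTest T) {u g v k : ℝ} (hθ : θ ∈ 𝕁) :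
    bulkDensity K t x (θ * u + (1 - θ) * v) (θ * g + (1 - θ) * k)
      ≤ θ * bulkDensity K t x u g + (1 - θ) * bulkDensity K t x v k := by
  have : 0 ≤ θ * (1 - θ) * ((u - v) ^ 2 * K.hx t x ^ 2) :=
    mul_nonneg (mul_nonneg hθ.1 (sub_nonneg.2 hθ.2)) (by positivity)
  simp only [bulkDensity]; linarith

theorem IsPath.convexComb (hu : IsPath a b u g) (hv : IsPath a b v k) (hθ : θ ∈ 𝕁) :
    IsPath a b (fun t x => θ * u t x + (1 - θ) * v t x) (fun t x => θ * g t x + (1 - θ) * k t x) where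
  meas := (hu.meas.const_mul θ).add (hv.meas.const_mul (1 - θ))
  meas_x := (hu.meas_x.const_mul θ).add (hv.meas_x.const_mul (1 - θ))
  mem t ht x hx := (convex_Icc (0 : ℝ) 1) (hu.mem t ht x hx) (hv.mem t ht x hx) hθ.1
    (sub_nonneg.2 hθ.2) (by ring)
  memLp := (hu.memLp.const_mul θ).add (hv.memLp.const_mul (1 - θ))

theorem integrable_mul_slice {u : ℝ → ℝ} (K : ℝ → ℝ) (hK : Continuous K) (hu : Measurable u)
    (h : ∀ x ∈ 𝕁, u x ∈ 𝕁) : IvlInt (fun x => u x * K x) 0 1 := by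
  refine (intervalIntegrable_of_measurable_of_bound (C := 1) zero_le_one hu fun x hx => ?_
    ).mul_continuousOn hK.continuousOn
  have := h x (Ioc_subset_Icc_self hx)
  rw [abs_of_nonneg this.1]; exact this.2

theorem SpaceTimeTest.cont_left (K : SpaceTimeTest T) (t : ℝ) : Continuous (K.h t) := K.cont.along t

theorem action_convexComb_le (hu : IsPath a b u g)
    (hv : IsPath a b v k) (hab : a ≤ b) (hθ : θ ∈ 𝕁) (K : SpaceTimeTest T)
    (hua : ∀ x ∈ 𝕁, u a x ∈ 𝕁) (hva : ∀ x ∈ 𝕁, v a x ∈ 𝕁) (hub : ∀ x ∈ 𝕁, u b x ∈ 𝕁)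
    (hvb : ∀ x ∈ 𝕁, v b x ∈ 𝕁) : action α β A B K a b (fun t x => θ * u t x + (1 - θ) * v t x)
      (fun t x => θ * g t x + (1 - θ) * k t x)
      ≤ θ * action α β A B K a b u g + (1 - θ) * action α β A B K a b v k := by
  have ends : ∀ t, (∀ x ∈ 𝕁, u t x ∈ 𝕁) → (∀ x ∈ 𝕁, v t x ∈ 𝕁) →
      ∫ x in (0)..1, (θ * u t x + (1 - θ) * v t x) * K.h t x
        = θ * (∫ x in (0)..1, u t x * K.h t x) + (1 - θ) * ∫ x in (0)..1, v t x * K.h t x := by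
    intro t h1 h2
    rw [← iint_const_mul, ← iint_const_mul, ← iint_add
        ((integrable_mul_slice _ (K.cont_left t) (measurable_slice hu.meas t) h1).const_mul _)
        ((integrable_mul_slice _ (K.cont_left t) (measurable_slice hv.meas t) h2).const_mul _)]
    exact iint_congr fun x _ => by ring
  have i1 := hu.integrable_bulkDensity K
  have i2 := hv.integrable_bulkDensity K
  have j1 := (hu.intervalIntegrable_bdryDensity hab α β A B K)
  have j2 := (hv.intervalIntegrable_bdryDensity hab α β A B K)
  rw [intervalIntegrable_iff_integrableOn_Ioc_of_le hab] at j1 j2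
  rw [(hu.convexComb hv hθ).action_eq hab K, hu.action_eq hab K, hv.action_eq hab K,
    ends a hua hva, ends b hub hvb]
  have e1 : ∫ t in Ioc a b, bdryDensity α β A B K t (θ * u t 0 + (1 - θ) * v t 0)
      (θ * u t 1 + (1 - θ) * v t 1) = θ * (∫ t in Ioc a b, bdryDensity α β A B K t (u t 0) (u t 1))
        + (1 - θ) * ∫ t in Ioc a b, bdryDensity α β A B K t (v t 0) (v t 1) := by
    rw [← integral_const_mul, ← integral_const_mul, ← integral_add (j1.const_mul _)
      (j2.const_mul _)]
    simp only [bdryDensity_convexComb]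
  have e2 : ∫ p, bulkDensity K p.1 p.2 (θ * u p.1 p.2 + (1 - θ) * v p.1 p.2)
      (θ * g p.1 p.2 + (1 - θ) * k p.1 p.2) ∂(rectMeasure a b)
      ≤ θ * (∫ p, bulkDensity K p.1 p.2 (u p.1 p.2) (g p.1 p.2) ∂(rectMeasure a b))
        + (1 - θ) * ∫ p, bulkDensity K p.1 p.2 (v p.1 p.2) (k p.1 p.2) ∂(rectMeasure a b) := by
    rw [← integral_const_mul, ← integral_const_mul, ← integral_add (i1.const_mul _)
      (i2.const_mul _)]
    exact integral_mono ((hu.convexComb hv hθ).integrable_bulkDensity K)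
      ((i1.const_mul _).add (i2.const_mul _)) fun p => bulkDensity_convexComb_le K hθ
  linarith

/-! ### Averages of paths -/

section Average

variable {ν : Measure ℝ} {U G : ℝ → ℝ → ℝ → ℝ}

/-- A measurable family of paths, square integrable with respect to the parameter measure `ν`. -/
structure IsPathFamily (ν : Measure ℝ) (a b : ℝ) (U G : ℝ → ℝ → ℝ → ℝ) : Prop where
  meas : Measurable fun p : ℝ × ℝ² => U p.1 p.2.1 p.2.2
  meas_x : Measurable fun p : ℝ × ℝ² => G p.1 p.2.1 p.2.2
  mem : ∀ r t, ∀ x ∈ 𝕁, U r t x ∈ 𝕁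
  memLp : MemLp (fun p : ℝ × ℝ² => G p.1 p.2.1 p.2.2) 2 (ν.prod (rectMeasure a b))
  memLp_slice : ∀ r, MemLp (fun p : ℝ² => G r p.1 p.2) 2 (rectMeasure a b)

theorem IsPathFamily.measurable_param (h : IsPathFamily ν a b U G) (t x : ℝ) : Measurable fun r => U r t x :=
  h.meas.comp (by fun_prop : Measurable fun r : ℝ => (r, t, x))

theorem IsPathFamily.isPath_slice (h : IsPathFamily ν a b U G) (r : ℝ) : IsPath a b (U r) (G r) where
  meas := h.meas.comp (by fun_prop : Measurable fun p : ℝ² => (r, p.1, p.2))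
  meas_x := h.meas_x.comp (by fun_prop : Measurable fun p : ℝ² => (r, p.1, p.2))
  mem t _ x hx := h.mem r t x hx
  memLp := h.memLp_slice r

variable [IsProbabilityMeasure ν]

theorem sq_integral_le_integral_sq (h1 : Integrable f ν)
    (h2 : Integrable (fun r => f r ^ 2) ν) : (∫ r, f r ∂ν) ^ 2 ≤ ∫ r, f r ^ 2 ∂ν := by
  have : 0 ≤ ∫ r, (f r - ∫ s, f s ∂ν) ^ 2 ∂ν := integral_nonneg fun r => sq_nonneg _
  set m := ∫ s, f s ∂ν with hm
  have e : ∫ r, (f r - m) ^ 2 ∂ν = (∫ r, f r ^ 2 ∂ν) - 2 * m * m + m ^ 2 := by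
    have : ∀ r, (f r - m) ^ 2 = f r ^ 2 - 2 * m * f r + m ^ 2 := fun r => by ring
    simp only [this]
    rw [integral_add (h2.sub_fun (h1.const_mul _)) (integrable_const _),
      integral_sub h2 (h1.const_mul _), integral_const_mul, ← hm]
    simp
  nlinarith

namespace IsPathFamily

theorem integrable_param (h : IsPathFamily ν a b U G) (t : ℝ) (hx : x ∈ 𝕁) :
    Integrable (fun r => U r t x) ν := by
  refine Integrable.of_bound (h.measurable_param t x).aestronglyMeasurable 1
    (.of_forall fun r => ?_)
  rw [norm_eq_abs, abs_of_nonneg (h.mem r t x hx).1]; exact (h.mem r t x hx).2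

theorem integrable_param_sq (h : IsPathFamily ν a b U G) (t : ℝ)
    (hx : x ∈ 𝕁) : Integrable (fun r => U r t x ^ 2) ν := by
  refine Integrable.of_bound ((h.measurable_param t x).pow_const 2).aestronglyMeasurable 1
    (.of_forall fun r => ?_)
  rw [norm_eq_abs, abs_of_nonneg (sq_nonneg _)]
  exact pow_le_one₀ (h.mem r t x hx).1 (h.mem r t x hx).2

theorem average_mem (h : IsPathFamily ν a b U G) (t : ℝ) (hx : x ∈ 𝕁) : ∫ r, U r t x ∂ν ∈ 𝕁 := by
  constructor
  · exact integral_nonneg fun r => (h.mem r t x hx).1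
  · refine (integral_mono (h.integrable_param t hx) (integrable_const (1 : ℝ))
      fun r => (h.mem r t x hx).2).trans ?_
    simp

theorem ae_prod_mem (ν : Measure ℝ) [IsProbabilityMeasure ν] (a b : ℝ) :
    ∀ᵐ p ∂(ν.prod (rectMeasure a b)), p.2 ∈ Ioc a b ×ˢ Ioc (0 : ℝ) 1 :=
  Measure.quasiMeasurePreserving_snd.ae (ae_rectMeasure_mem a b)

theorem ae_integrable_G (h : IsPathFamily ν a b U G) :
    ∀ᵐ p ∂(rectMeasure a b), Integrable (fun r => G r p.1 p.2) ν ∧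
      Integrable (fun r => G r p.1 p.2 ^ 2) ν := by
  have h1 := (h.memLp.integrable (by norm_num)).prod_left_ae
  have h2 := h.memLp.integrable_sq.prod_left_ae
  filter_upwards [h1, h2] with p hp1 hp2
  exact ⟨hp1, hp2⟩

theorem isPath_average (h : IsPathFamily ν a b U G) :
    IsPath a b (fun t x => ∫ r, U r t x ∂ν) (fun t x => ∫ r, G r t x ∂ν) where
  meas := (StronglyMeasurable.integral_prod_left' (μ := ν)
    (f := fun p : ℝ × ℝ² => U p.1 p.2.1 p.2.2) h.meas.stronglyMeasurable).measurable
  meas_x := (StronglyMeasurable.integral_prod_left' (μ := ν)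
    (f := fun p : ℝ × ℝ² => G p.1 p.2.1 p.2.2) h.meas_x.stronglyMeasurable).measurable
  mem t _ x hx := h.average_mem t hx
  memLp := by
    have hm : StronglyMeasurable fun p : ℝ² => ∫ r, G r p.1 p.2 ∂ν :=
      StronglyMeasurable.integral_prod_left' (μ := ν)
        (f := fun p : ℝ × ℝ² => G p.1 p.2.1 p.2.2) h.meas_x.stronglyMeasurable
    refine (memLp_two_iff_integrable_sq hm.aestronglyMeasurable).2 ?_
    refine h.memLp.integrable_sq.integral_prod_right.mono' (hm.pow 2).aestronglyMeasurable ?_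
    filter_upwards [h.ae_integrable_G] with p hp
    rw [norm_eq_abs, abs_of_nonneg (sq_nonneg _)]; exact sq_integral_le_integral_sq hp.1 hp.2

theorem integrable_mul_continuous {f : ℝ × ℝ² → ℝ} (hf : Integrable f (ν.prod (rectMeasure a b)))
    {F : ℝ² → ℝ} (hF : Continuous F) :
    Integrable (fun p => F p.2 * f p) (ν.prod (rectMeasure a b)) := by
  obtain ⟨C, hC⟩ := (isCompact_Icc.prod isCompact_Icc :
    IsCompact (Icc a b ×ˢ 𝕁)).exists_bound_of_continuousOn hF.continuousOn
  refine hf.bdd_mul (c := C) (hF.comp continuous_snd).aestronglyMeasurable ?_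
  filter_upwards [ae_prod_mem ν a b] with p hp
  exact hC p.2 ⟨Ioc_subset_Icc_self hp.1, Ioc_subset_Icc_self hp.2⟩

theorem integrable_bulk (h : IsPathFamily ν a b U G) (K : SpaceTimeTest T) :
    Integrable (fun p : ℝ × ℝ² => bulkDensity K p.2.1 p.2.2 (U p.1 p.2.1 p.2.2)
      (G p.1 p.2.1 p.2.2)) (ν.prod (rectMeasure a b)) := by
  have iu : Integrable (fun p : ℝ × ℝ² => U p.1 p.2.1 p.2.2) (ν.prod (rectMeasure a b)) := by
    refine Integrable.of_bound h.meas.aestronglyMeasurable 1 ?_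
    filter_upwards [ae_prod_mem ν a b] with p hp
    have := h.mem p.1 p.2.1 p.2.2 (Ioc_subset_Icc_self hp.2)
    rw [norm_eq_abs, abs_of_nonneg this.1]; exact this.2
  have im : Integrable (fun p : ℝ × ℝ² => U p.1 p.2.1 p.2.2 * (1 - U p.1 p.2.1 p.2.2))
      (ν.prod (rectMeasure a b)) := by
    refine Integrable.of_bound (h.meas.mul (measurable_const.sub h.meas)).aestronglyMeasurable 1 ?_
    filter_upwards [ae_prod_mem ν a b] with p hp
    have := h.mem p.1 p.2.1 p.2.2 (Ioc_subset_Icc_self hp.2)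
    rw [norm_eq_abs, abs_le]
    constructor <;> nlinarith [this.1, this.2]
  have h1 := integrable_mul_continuous iu K.cont_t
  have h2 := integrable_mul_continuous (h.memLp.integrable (by norm_num)) K.cont_x
  have h3 := integrable_mul_continuous im (F := fun p => K.hx p.1 p.2 ^ 2) (K.cont_x.pow 2)
  refine ((h1.neg.add h2).sub h3).congr (.of_forall fun p => ?_)
  simp only [bulkDensity, Pi.add_apply, Pi.sub_apply, Pi.neg_apply]; ring

theorem bulk_average_le (h : IsPathFamily ν a b U G) (K : SpaceTimeTest T) :
    ∫ p, bulkDensity K p.1 p.2 (∫ r, U r p.1 p.2 ∂ν) (∫ r, G r p.1 p.2 ∂ν) ∂(rectMeasure a b)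
      ≤ ∫ r, ∫ p, bulkDensity K p.1 p.2 (U r p.1 p.2) (G r p.1 p.2) ∂(rectMeasure a b) ∂ν := by
  have hi := h.integrable_bulk K
  rw [integral_integral_swap hi]
  refine integral_mono_ae (h.isPath_average.integrable_bulkDensity K) hi.integral_prod_right ?_
  filter_upwards [h.ae_integrable_G, ae_rectMeasure_mem a b] with p hp hpm
  have hx := Ioc_subset_Icc_self hpm.2
  have i1 := h.integrable_param p.1 hx
  have i2 := h.integrable_param_sq p.1 hx
  have hsq := sq_integral_le_integral_sq i1 i2
  have e : ∫ r, bulkDensity K p.1 p.2 (U r p.1 p.2) (G r p.1 p.2) ∂ν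
      = -(∫ r, U r p.1 p.2 ∂ν) * K.ht p.1 p.2 + (∫ r, G r p.1 p.2 ∂ν) * K.hx p.1 p.2
        - ((∫ r, U r p.1 p.2 ∂ν) - ∫ r, U r p.1 p.2 ^ 2 ∂ν) * K.hx p.1 p.2 ^ 2 := by
    have : ∀ r, bulkDensity K p.1 p.2 (U r p.1 p.2) (G r p.1 p.2)
        = (-K.ht p.1 p.2) * U r p.1 p.2 + K.hx p.1 p.2 * G r p.1 p.2
          - K.hx p.1 p.2 ^ 2 * (U r p.1 p.2 - U r p.1 p.2 ^ 2) := fun r => by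
      simp only [bulkDensity]; ring
    simp only [this]
    rw [integral_sub ((i1.const_mul _).fun_add (hp.1.const_mul _)) ((i1.sub_fun i2).const_mul _),
      integral_add (i1.const_mul _) (hp.1.const_mul _), integral_const_mul, integral_const_mul,
      integral_const_mul, integral_sub i1 i2]
    ring
  rw [e]; simp only [bulkDensity]
  nlinarith [mul_le_mul_of_nonneg_right hsq (sq_nonneg (K.hx p.1 p.2))]

theorem bdryDensity_average (h : IsPathFamily ν a b U G) (K : SpaceTimeTest T) (t : ℝ) :
    bdryDensity α β A B K t (∫ r, U r t 0 ∂ν) (∫ r, U r t 1 ∂ν)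
      = ∫ r, bdryDensity α β A B K t (U r t 0) (U r t 1) ∂ν := by
  have i0 := h.integrable_param t (x := 0) (by simp)
  have i1 := h.integrable_param t (x := 1) (by simp)
  have key : ∀ (ϱ D M : ℝ) {f : ℝ → ℝ}, Integrable f ν → Integrable (fun r => bdryB ϱ D (f r) M) ν ∧
        ∫ r, bdryB ϱ D (f r) M ∂ν = bdryB ϱ D (∫ r, f r ∂ν) M := by
    intro ϱ D M f hf
    have : ∀ c, bdryB ϱ D c M = 1 / D * (ϱ * (exp M - 1))
        + (1 / D * ((1 - ϱ) * (exp (-M) - 1) - ϱ * (exp M - 1))) * c := fun c => by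
      simp only [bdryB]; ring
    simp only [this]
    refine ⟨(integrable_const _).add (hf.const_mul _), ?_⟩
    rw [integral_add (integrable_const _) (hf.const_mul _), integral_const, integral_const_mul]
    simp
  simp only [bdryDensity]
  rw [integral_add (key _ _ _ i0).1 (key _ _ _ i1).1, (key _ _ _ i0).2, (key _ _ _ i1).2]

theorem integrable_bdryDensity (h : IsPathFamily ν a b U G) (K : SpaceTimeTest T) :
    Integrable (fun p : ℝ² => bdryDensity α β A B K p.2 (U p.1 p.2 0) (U p.1 p.2 1))
      (ν.prod (volume.restrict (Ioc a b))) := by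
  have hm : ∀ x : ℝ, Measurable fun p : ℝ² => U p.1 p.2 x := fun x =>
    h.meas.comp (by fun_prop : Measurable fun p : ℝ² => (p.1, p.2, x))
  have iu : ∀ x ∈ 𝕁, Integrable (fun p : ℝ² => U p.1 p.2 x)
      (ν.prod (volume.restrict (Ioc a b))) := fun x hx =>
    Integrable.of_bound (hm x).aestronglyMeasurable 1 (.of_forall fun p => by
      rw [norm_eq_abs, abs_of_nonneg (h.mem p.1 p.2 x hx).1]
      exact (h.mem p.1 p.2 x hx).2)
  have key : ∀ (ϱ D : ℝ), ∀ x ∈ 𝕁, Integrable (fun p : ℝ² =>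
      bdryB ϱ D (U p.1 p.2 x) (K.h p.2 x)) (ν.prod (volume.restrict (Ioc a b))) := by
    intro ϱ D x hx
    set F : ℝ → ℝ := fun t => 1 / D * (ϱ * (exp (K.h t x) - 1))
    set F' : ℝ → ℝ := fun t => 1 / D * ((1 - ϱ) * (exp (-K.h t x) - 1) - ϱ * (exp (K.h t x) - 1))
    have ck := K.cont_right x
    have cF : Continuous F := by simp only [F]; fun_prop
    have cF' : Continuous F' := by simp only [F']; fun_prop
    obtain ⟨C, hC⟩ := (isCompact_Icc (a := a) (b := b)).exists_bound_of_continuousOn cF.continuousOn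
    obtain ⟨C', hC'⟩ := (isCompact_Icc (a := a) (b := b)).exists_bound_of_continuousOn
      cF'.continuousOn
    have hae : ∀ᵐ p ∂(ν.prod (volume.restrict (Ioc a b))), p.2 ∈ Ioc a b :=
      Measure.quasiMeasurePreserving_snd.ae (ae_restrict_mem measurableSet_Ioc)
    have q1 : Integrable (fun p : ℝ² => F p.2) (ν.prod (volume.restrict (Ioc a b))) := by
      refine Integrable.of_bound (cF.comp continuous_snd).aestronglyMeasurable C ?_
      filter_upwards [hae] with p hp using hC p.2 (Ioc_subset_Icc_self hp)
    have q2 : Integrable (fun p : ℝ² => F' p.2 * U p.1 p.2 x)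
        (ν.prod (volume.restrict (Ioc a b))) := by
      refine (iu x hx).bdd_mul (c := C') (cF'.comp continuous_snd).aestronglyMeasurable ?_
      filter_upwards [hae] with p hp using hC' p.2 (Ioc_subset_Icc_self hp)
    refine (q1.add q2).congr (.of_forall fun p => ?_)
    simp only [F, F', bdryB, Pi.add_apply]; ring
  exact (key α A 0 (by simp)).add (key β B 1 (by simp))

theorem integral_average_mul (h : IsPathFamily ν a b U G) (K : SpaceTimeTest T) (t : ℝ) :
    Integrable (fun r => ∫ x in (0)..1, U r t x * K.h t x) ν ∧
      ∫ x in (0)..1, (∫ r, U r t x ∂ν) * K.h t x = ∫ r, (∫ x in (0)..1, U r t x * K.h t x) ∂ν := by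
  have hm : Measurable fun p : ℝ² => U p.1 t p.2 :=
    h.meas.comp (by fun_prop : Measurable fun p : ℝ² => (p.1, t, p.2))
  have hae : ∀ᵐ p ∂(ν.prod (volume.restrict (Ioc (0 : ℝ) 1))), p.2 ∈ Ioc (0 : ℝ) 1 :=
    Measure.quasiMeasurePreserving_snd.ae (ae_restrict_mem measurableSet_Ioc)
  obtain ⟨C, hC⟩ := (isCompact_Icc (a := (0 : ℝ)) (b := 1)).exists_bound_of_continuousOn
    (K.cont_left t).continuousOn
  have hi : Integrable (fun p : ℝ² => U p.1 t p.2 * K.h t p.2)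
      (ν.prod (volume.restrict (Ioc (0 : ℝ) 1))) := by
    refine Integrable.of_bound (hm.mul ((K.cont_left t).comp
      continuous_snd).measurable).aestronglyMeasurable (1 * C) ?_
    filter_upwards [hae] with p hp
    have := h.mem p.1 t p.2 (Ioc_subset_Icc_self hp)
    rw [norm_mul]
    refine mul_le_mul ?_ (hC p.2 (Ioc_subset_Icc_self hp)) (norm_nonneg _) zero_le_one
    rw [norm_eq_abs, abs_of_nonneg this.1]; exact this.2
  simp only [iint01]
  refine ⟨hi.integral_prod_left, ?_⟩
  rw [integral_integral_swap hi]; simp only [integral_mul_const]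

theorem action_average_le (h : IsPathFamily ν a b U G) (hab : a ≤ b) (K : SpaceTimeTest T)
    (hC : ∀ᵐ r ∂ν, action α β A B K a b (U r) (G r) ≤ C) :
    action α β A B K a b (fun t x => ∫ r, U r t x ∂ν) (fun t x => ∫ r, G r t x ∂ν) ≤ C := by
  rw [h.isPath_average.action_eq hab K, (h.integral_average_mul K a).2,
    (h.integral_average_mul K b).2]
  have hbd := h.integrable_bdryDensity (α := α) (β := β) (A := A) (B := B) K
  have e : ∫ t in Ioc a b, bdryDensity α β A B K t (∫ r, U r t 0 ∂ν) (∫ r, U r t 1 ∂ν)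
      = ∫ r, (∫ t in Ioc a b, bdryDensity α β A B K t (U r t 0) (U r t 1)) ∂ν := by
    rw [integral_integral_swap hbd]; simp only [h.bdryDensity_average K]
  rw [e]
  have i1 := (h.integral_average_mul K b).1
  have i2 := (h.integral_average_mul K a).1
  have i3 := (h.integrable_bulk K).integral_prod_left
  have i4 := hbd.integral_prod_left
  calc _ ≤ (∫ r, (∫ x in (0)..1, U r b x * K.h b x) ∂ν)
        - (∫ r, (∫ x in (0)..1, U r a x * K.h a x) ∂ν)
        + ((∫ r, ∫ p, bulkDensity K p.1 p.2 (U r p.1 p.2) (G r p.1 p.2) ∂(rectMeasure a b) ∂ν)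
          - ∫ r, (∫ t in Ioc a b, bdryDensity α β A B K t (U r t 0) (U r t 1)) ∂ν) := by
        gcongr; exact h.bulk_average_le K
    _ = ∫ r, action α β A B K a b (U r) (G r) ∂ν := by
        rw [← integral_sub i1 i2, ← integral_sub i3 i4, ← integral_add (i1.sub_fun i2) (i3.sub_fun i4)]
        exact integral_congr_ae (.of_forall fun r => ((h.isPath_slice r).action_eq hab K).symm)
    _ ≤ ∫ _, C ∂ν := by
        refine integral_mono_ae (((i1.sub i2).add (i3.sub i4)).congr
          (.of_forall fun r => ((h.isPath_slice r).action_eq hab K).symm))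
          (integrable_const _) hC
    _ = C := by simp

end IsPathFamily

end Average

/-! ### Smooth bumps and steps -/

/-- A smooth probability density supported in `[s,s+e]` (for `e > 0`). -/
def timeBump (s e : ℝ) : ℝ → ℝ := if h : 0 < e then
    (⟨e / 4, e / 2, by positivity, by linarith⟩ : ContDiffBump (s + e / 2)).normed volume
  else 0

section TimeBump

variable {s e : ℝ}

theorem contDiff_timeBump (s e : ℝ) : ContDiff ℝ ∞ (timeBump s e) := by
  unfold timeBump
  split_ifs with h
  · exact ContDiffBump.contDiff_normed _ (n := ⊤)
  · exact contDiff_const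

theorem continuous_timeBump (s e : ℝ) : Continuous (timeBump s e) := (contDiff_timeBump s e).continuous

theorem timeBump_nonneg (s e τ : ℝ) : 0 ≤ timeBump s e τ := by
  unfold timeBump
  split_ifs with h
  · exact ContDiffBump.nonneg_normed _ _
  · exact le_rfl

theorem support_timeBump (s e : ℝ) : Function.support (timeBump s e) ⊆ Ioo s (s + e) := by
  unfold timeBump
  split_ifs with h
  · rw [ContDiffBump.support_normed_eq, Real.ball_eq_Ioo]
    intro x hx
    constructor <;> linarith [hx.1, hx.2]
  · simp

theorem timeBump_eq_zero {τ : ℝ} (h : τ ∉ Ioo s (s + e)) : timeBump s e τ = 0 := by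
  by_contra h'
  exact h (support_timeBump s e h')

theorem integral_timeBump_eq_one (he : 0 < e) : ∫ τ, timeBump s e τ = 1 := by
  unfold timeBump
  rw [dif_pos he]; exact ContDiffBump.integral_normed _

theorem integral_timeBump (he : 0 < e) (ha : a ≤ s) (hb : s + e ≤ b) :
    ∫ τ in a..b, timeBump s e τ = 1 := by
  rw [intervalIntegral.integral_eq_integral_of_support_subset
    ((support_timeBump s e).trans ((Ioo_subset_Ioo ha hb).trans Ioo_subset_Ioc_self)),
    integral_timeBump_eq_one he]

/-- Averaging against a bump. -/
theorem abs_integral_timeBump_mul_sub_le (he : 0 < e) (ha : a ≤ s)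
    (hb : s + e ≤ b) (hf : IvlInt f a b) (h : ∀ τ ∈ Ioo s (s + e), |f τ - c| ≤ ε) :
    |(∫ τ in a..b, timeBump s e τ * f τ) - c| ≤ ε := by
  have hab : a ≤ b := by linarith
  have i0 : IvlInt (timeBump s e) a b := (continuous_timeBump s e).intervalIntegrable _ _
  have i1 : IvlInt (fun τ => timeBump s e τ * f τ) a b :=
    hf.continuousOn_mul (continuous_timeBump s e).continuousOn
  have e1 : (∫ τ in a..b, timeBump s e τ * f τ) - c = ∫ τ in a..b, timeBump s e τ * (f τ - c) := by
    have : c = ∫ τ in a..b, timeBump s e τ * c := by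
      rw [iint_mul_const, integral_timeBump he ha hb, one_mul]
    conv_lhs => rw [this]
    rw [← iint_sub i1 (i0.mul_const c)]; exact iint_congr fun τ _ => by ring
  have e2 : ε = ∫ τ in a..b, timeBump s e τ * ε := by
    rw [iint_mul_const, integral_timeBump he ha hb, one_mul]
  rw [e1, e2, ← norm_eq_abs]
  refine intervalIntegral.norm_integral_le_of_norm_le hab (.of_forall fun τ _ => ?_)
    (i0.mul_const ε)
  rw [norm_mul, Real.norm_of_nonneg (timeBump_nonneg s e τ)]
  by_cases hτ : τ ∈ Ioo s (s + e)
  · exact mul_le_mul_of_nonneg_left (h τ hτ) (timeBump_nonneg s e τ)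
  · simp [timeBump_eq_zero hτ]

/-- A smooth step, rising from `0` to `1` on `[s,s+e]`. -/
def timeStep (s e τ : ℝ) : ℝ := ∫ r in s..τ, timeBump s e r

theorem hasDerivAt_timeStep (s e τ : ℝ) : HasDerivAt (timeStep s e) (timeBump s e τ) τ :=
  iint_hasDerivAt_right ((continuous_timeBump s e).intervalIntegrable _ _)
    (continuous_timeBump s e).aestronglyMeasurable.stronglyMeasurableAtFilter
    (continuous_timeBump s e).continuousAt

theorem contDiff_timeStep (s e : ℝ) : ContDiff ℝ ∞ (timeStep s e) := by
  refine contDiff_infty_iff_deriv.2 ⟨fun τ => (hasDerivAt_timeStep s e τ).differentiableAt, ?_⟩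
  rw [funext fun τ => (hasDerivAt_timeStep s e τ).deriv]
  exact contDiff_timeBump s e

theorem continuous_timeStep (s e : ℝ) : Continuous (timeStep s e) := (contDiff_timeStep s e).continuous

theorem timeStep_mono (s e : ℝ) : Monotone (timeStep s e) :=
  monotone_of_deriv_nonneg (fun τ => (hasDerivAt_timeStep s e τ).differentiableAt) fun τ => by
    rw [(hasDerivAt_timeStep s e τ).deriv]; exact timeBump_nonneg s e τ

theorem timeStep_eq_zero {τ : ℝ} (h : τ ≤ s) : timeStep s e τ = 0 := by
  rw [timeStep, intervalIntegral.integral_symm, iint_of_le h,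
    setIntegral_congr_fun (g := fun _ => (0 : ℝ)) measurableSet_Ioc fun r hr =>
      timeBump_eq_zero fun hr' => absurd hr'.1 (not_lt.2 hr.2)]
  simp

theorem timeStep_eq_one {τ : ℝ} (he : 0 < e) (h : s + e ≤ τ) : timeStep s e τ = 1 :=
  integral_timeBump he le_rfl h

theorem timeStep_mem (he : 0 < e) (τ : ℝ) : timeStep s e τ ∈ 𝕁 := by
  constructor
  · rw [← timeStep_eq_zero (s := s) (e := e) (min_le_left s τ)]
    exact timeStep_mono s e (min_le_right _ _)
  · rw [← timeStep_eq_one (s := s) he (le_max_left (s + e) τ)]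
    exact timeStep_mono s e (le_max_right _ _)

end TimeBump

/-! ### Densities -/

namespace SubProb

theorem HasDensity.dens_ae {μ : SubProb} {f : I → ℝ} (h : μ.HasDensity f) (h0 : ∀ x, 0 ≤ f x) :
    μ.dens =ᵐ[volume] f := by
  have h1 := Measure.rnDeriv_withDensity₀ (volume : Measure I) h.1.ennreal_ofReal
  rw [← h.2] at h1
  filter_upwards [h1] with x hx
  rw [dens, hx, ENNReal.toReal_ofReal (h0 x)]

theorem HasDensity.integral_eq {μ : SubProb} {f : I → ℝ} (h : μ.HasDensity f) (h0 : ∀ x, 0 ≤ f x)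
    (F : I → ℝ) : ∫ x, F x ∂μ.meas = ∫ x, f x * F x := by
  rw [h.2, integral_withDensity_eq_integral_toReal_smul₀ h.1.ennreal_ofReal
    (.of_forall fun x => ENNReal.ofReal_lt_top)]
  exact integral_congr_ae (.of_forall fun x => by
    simp only [ENNReal.toReal_ofReal (h0 x), smul_eq_mul])

theorem HasDensity.congr {μ : SubProb} {f g : I → ℝ} (h : μ.HasDensity f) (hfg : f =ᵐ[volume] g) :
    μ.HasDensity g := ⟨h.1.congr hfg, by
    rw [h.2]
    exact withDensity_congr_ae (hfg.mono fun x hx => by simp only [hx])⟩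

instance (μ : SubProb) : IsFiniteMeasure μ.meas := by
  unfold meas
  infer_instance

theorem measure_univ_le (μ : SubProb) : μ.meas.real univ ≤ 1 := by
  change ((μ.1 : Measure I) univ).toReal ≤ 1; rw [← FiniteMeasure.ennreal_mass, ENNReal.coe_toReal]
  exact_mod_cast μ.2

theorem abs_integral_le (μ : SubProb) {F : I → ℝ} (hC : ∀ x, |F x| ≤ C) :
    |∫ x, F x ∂μ.meas| ≤ C := by
  have h := norm_integral_le_of_norm_le_const (μ := μ.meas) (f := F) (C := C)
    (.of_forall hC)
  have hC0 : 0 ≤ C := (abs_nonneg _).trans (hC 0)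
  calc |∫ x, F x ∂μ.meas| ≤ C * μ.meas.real univ := h
    _ ≤ C * 1 := by gcongr; exact μ.measure_univ_le
    _ = C := mul_one C

theorem continuous_integral (F : C(I, ℝ)) : Continuous fun μ : SubProb => ∫ x, F x ∂μ.meas :=
  (continuous_apply F).comp
    (⟨rfl⟩ : IsInducing (fun (μ : SubProb) (F : C(I, ℝ)) => ∫ x, F x ∂μ.meas)).continuous

theorem IsAC.dens_mem {μ : SubProb} (h : μ.IsAC) : ∀ᵐ x : I, μ.dens x ∈ 𝕁 := by
  obtain ⟨f, hf, hd⟩ := h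
  filter_upwards [hd.dens_ae fun x => (hf x).1] with x hx
  rw [hx]; exact hf x

theorem IsAC.contVal_mem {μ : SubProb} (h : μ.IsAC) (x₀ : I) : contVal μ.dens x₀ ∈ 𝕁 := by
  by_cases hex : ∃ g : C(I, ℝ), g =ᵐ[volume] μ.dens
  · obtain ⟨g, hg⟩ := hex
    let g' : C(I, ℝ) := ⟨fun x => max 0 (min 1 (g x)), by fun_prop⟩
    have hg' : g' =ᵐ[volume] μ.dens := by
      filter_upwards [hg, h.dens_mem] with x hx hx'
      change max 0 (min 1 (g x)) = _; rw [hx, min_eq_right hx'.2, max_eq_right hx'.1]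
    rw [contVal_eq g' hg']; exact ⟨le_max_left _ _, max_le zero_le_one (min_le_left _ _)⟩
  · rw [contVal, dif_neg hex]; simp

end SubProb

/-! ### Right continuity -/

theorem measurable_of_rightContinuous (h : ∀ t, ContinuousWithinAt f (Ici t) t) : Measurable f := by
  have hlim : ∀ t : ℝ, Tendsto (fun n : ℕ => ((⌊((n : ℝ) + 1) * t⌋ : ℝ) + 1) / ((n : ℝ) + 1)) atTop
      (𝓝[≥] t) := by
    intro t
    refine tendsto_nhdsWithin_iff.2 ⟨?_, .of_forall fun n => ?_⟩
    · have h1 : Tendsto (fun n : ℕ => t + 1 / ((n : ℝ) + 1)) atTop (𝓝 (t + 0)) :=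
        tendsto_const_nhds.add tendsto_one_div_add_atTop_nhds_zero_nat
      rw [add_zero] at h1
      refine tendsto_of_tendsto_of_tendsto_of_le_of_le tendsto_const_nhds h1 (fun n => ?_) fun n => ?_
      · have hn : (0 : ℝ) < (n : ℝ) + 1 := by positivity
        rw [le_div_iff₀ hn]; linarith [(Int.lt_floor_add_one (((n : ℝ) + 1) * t)).le]
      · have hn : (0 : ℝ) < (n : ℝ) + 1 := by positivity
        rw [div_le_iff₀ hn]
        have := Int.floor_le (((n : ℝ) + 1) * t)
        have e : (t + 1 / ((n : ℝ) + 1)) * ((n : ℝ) + 1) = ((n : ℝ) + 1) * t + 1 := by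
          field_simp
        rw [e]; linarith
    · have hn : (0 : ℝ) < (n : ℝ) + 1 := by positivity
      rw [mem_Ici, le_div_iff₀ hn]; linarith [(Int.lt_floor_add_one (((n : ℝ) + 1) * t)).le]
  refine measurable_of_tendsto_metrizable
    (f := fun (n : ℕ) t => f (((⌊((n : ℝ) + 1) * t⌋ : ℝ) + 1) / ((n : ℝ) + 1))) (fun n => ?_)
    (tendsto_pi_nhds.2 fun t => (h t).tendsto.comp (hlim t))
  exact (measurable_from_top (f := fun k : ℤ => f (((k : ℝ) + 1) / ((n : ℝ) + 1)))).comp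
    (Int.measurable_floor.comp (measurable_id.const_mul _))

namespace SkorohodPath

theorem ev_rightContinuous {X : Type*} [TopologicalSpace X] (w : SkorohodPath T X) (t : ℝ) :
    ContinuousWithinAt (w.ev hT) (Ici t) t := by
  have h1 := w.right_cont (projIcc 0 T hT.le t)
  exact h1.comp (t := Ici (projIcc 0 T hT.le t)) (f := projIcc 0 T hT.le)
    continuous_projIcc.continuousWithinAt fun s hs => monotone_projIcc hT.le hs

theorem integral_rightContinuous (w : SkorohodPath T SubProb) (F : C(I, ℝ)) (t : ℝ) :
    ContinuousWithinAt (fun t => ∫ x, F x ∂(w.ev hT t).meas) (Ici t) t :=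
  (SubProb.continuous_integral F).continuousAt.comp_continuousWithinAt (w.ev_rightContinuous t)

theorem measurable_integral (w : SkorohodPath T SubProb) (F : C(I, ℝ)) :
    Measurable fun t => ∫ x, F x ∂(w.ev hT t).meas :=
  measurable_of_rightContinuous (w.integral_rightContinuous F)

theorem isAC_ev (h : FiniteEnergyAC hT w) (t : ℝ) : (w.ev hT t).IsAC := h.1 _

theorem bdryVal_mem (h : FiniteEnergyAC hT w) (x₀ : I) (t : ℝ) :
    bdryVal hT w x₀ t ∈ 𝕁 := (isAC_ev h t).contVal_mem x₀

end SkorohodPath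

/-- The test function `ξ(t) p(x)`. -/
def C12.ofProd (T : ℝ) (ξ ξ' : ℝ → ℝ) (p : Polynomial ℝ) (hξ : ∀ t, HasDerivAt ξ (ξ' t) t)
    (hξ' : Continuous ξ') : C12 T where
  toFun t x := ξ t * p.eval x
  dt t x := ξ' t * p.eval x
  dx t x := ξ t * p.derivative.eval x
  dxx t x := ξ t * p.derivative.derivative.eval x
  cont := by
    have : Continuous ξ := continuous_iff_continuousAt.2 fun t => (hξ t).continuousAt
    fun_prop
  cont_dt := by fun_prop
  cont_dx := by
    have : Continuous ξ := continuous_iff_continuousAt.2 fun t => (hξ t).continuousAt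
    fun_prop
  cont_dxx := by
    have : Continuous ξ := continuous_iff_continuousAt.2 fun t => (hξ t).continuousAt
    fun_prop
  has_dt t _ x _ := ((hξ t).mul_const _).hasDerivWithinAt
  has_dx t _ x _ := ((p.hasDerivAt x).const_mul _).hasDerivWithinAt
  has_dxx t _ x _ := ((p.derivative.hasDerivAt x).const_mul _).hasDerivWithinAt

theorem abs_bdryB_le {M L : ℝ} (hD : 0 < D) (hϱ : ϱ ∈ 𝕁) (ha : a ∈ 𝕁)
    (hM : |M| ≤ L) : |bdryB ϱ D a M| ≤ 1 / D * (2 * exp L) := by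
  have h1 : exp M ≤ exp L := Real.exp_le_exp.2 ((le_abs_self M).trans hM)
  have h2 : exp (-M) ≤ exp L := Real.exp_le_exp.2 ((neg_le_abs M).trans hM)
  have h3 := Real.exp_pos M
  have h4 := Real.exp_pos (-M)
  have h5 : 1 ≤ exp L := Real.one_le_exp ((abs_nonneg M).trans hM)
  have key : ∀ {p E : ℝ}, 0 ≤ p → p ≤ 1 → 0 < E → E ≤ exp L → |p * (E - 1)| ≤ exp L := by
    intro p E h0 h1 h2 h3; rw [abs_mul, abs_of_nonneg h0]
    refine (mul_le_of_le_one_left (abs_nonneg _) h1).trans ?_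
    rw [abs_le]
    constructor <;> linarith
  rw [bdryB, abs_mul, abs_of_pos (by positivity : 0 < 1 / D)]; gcongr
  refine (abs_add_le _ _).trans ?_
  have k1 := key (p := (1 - a) * ϱ) (mul_nonneg (by linarith [ha.2]) hϱ.1)
    (by nlinarith [ha.1, ha.2, hϱ.1, hϱ.2]) h3 h1
  have k2 := key (p := a * (1 - ϱ)) (mul_nonneg ha.1 (by linarith [hϱ.2]))
    (by nlinarith [ha.1, ha.2, hϱ.1, hϱ.2]) h4 h2
  linarith

namespace SkorohodPath

theorem integral_polynomial_sub_le {I₀ M : ℝ} (hA : 0 < A) (hB : 0 < B) (hα : α ∈ 𝕁) (hβ : β ∈ 𝕁)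
    (hw : FiniteEnergyAC hT w) (hI : ∀ H, functionalJ α β A B hT H w ≤ I₀) (q : Polynomial ℝ)
    (hq : ∀ x : I, |q.eval (x : ℝ)| ≤ M) (hq' : ∀ x : I, |q.derivative.eval (x : ℝ)| ≤ M)
    (hq'' : ∀ x : I, |q.derivative.derivative.eval (x : ℝ)| ≤ M) {s : ℝ} (hs : 0 ≤ s)
    (hst : s ≤ t) (htT : t ≤ T) :
    (∫ x : I, q.eval (x : ℝ) ∂(w.ev hT t).meas) - (∫ x : I, q.eval (x : ℝ) ∂(w.ev hT s).meas)
      ≤ I₀ + (3 * M + M ^ 2 + (1 / A + 1 / B) * (2 * exp M)) * (t - s) := by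
  have hM : 0 ≤ M := (abs_nonneg _).trans (hq 0)
  set C := 3 * M + M ^ 2 + (1 / A + 1 / B) * (2 * exp M) with hC
  have hC0 : 0 ≤ C := by positivity
  let Q : C(I, ℝ) := ⟨fun x => q.eval (x : ℝ), by fun_prop⟩
  set m : ℝ → ℝ := fun τ => ∫ x : I, q.eval (x : ℝ) ∂(w.ev hT τ).meas with hm
  have mmeas : Measurable m := w.measurable_integral Q
  have mb : ∀ τ, |m τ| ≤ M := fun τ => (w.ev hT τ).abs_integral_le hq
  have mi : ∀ a b, a ≤ b → IvlInt m a b := fun a b hab =>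
    intervalIntegrable_of_measurable_of_bound hab mmeas fun τ _ => mb τ
  have mrc : ∀ τ, ContinuousWithinAt m (Ici τ) τ := w.integral_rightContinuous Q
  change m t - m s ≤ I₀ + C * (t - s)
  refine le_of_forall_pos_le_add fun ε hε => ?_
  set ε' := ε / (C + 2) with hε'
  have hε'0 : 0 < ε' := by positivity
  have near : ∀ τ, ∀ᶠ e in 𝓝[>] (0 : ℝ), ∀ r ∈ Ioo τ (τ + e), |m r - m τ| ≤ ε' := by
    intro τ
    have h1 : ∀ᶠ r in 𝓝[≥] τ, |m r - m τ| < ε' := by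
      have := (Metric.tendsto_nhds.1 (mrc τ).tendsto) ε' hε'0
      simpa [Real.dist_eq] using this
    obtain ⟨b, hb, hb'⟩ := (mem_nhdsGE_iff_exists_Ico_subset).1 h1
    filter_upwards [Ioo_mem_nhdsGT (sub_pos.2 hb)] with e he r hr
    exact (hb' ⟨hr.1.le, by linarith [hr.2, he.2]⟩ : |m r - m τ| < ε').le
  obtain ⟨e, ⟨⟨he1, he2⟩, he0⟩⟩ := ((near s).and (near t)).and
    (Ioo_mem_nhdsGT (lt_min hε'0 one_pos)) |>.exists
  have he : 0 < e := he0.1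
  have heε : e ≤ ε' := (he0.2.trans_le (min_le_left _ _)).le
  have he1' : e ≤ 1 := (he0.2.trans_le (min_le_right _ _)).le
  set ξ : ℝ → ℝ := fun τ => timeStep s e τ - timeStep t e τ with hξ
  set ξ' : ℝ → ℝ := fun τ => timeBump s e τ - timeBump t e τ with hξ'
  have hder : ∀ τ, HasDerivAt ξ (ξ' τ) τ := fun τ =>
    (hasDerivAt_timeStep s e τ).fun_sub (hasDerivAt_timeStep t e τ)
  have cξ' : Continuous ξ' := (continuous_timeBump s e).sub (continuous_timeBump t e)
  have ξ1 : ∀ τ, |ξ τ| ≤ 1 := fun τ => by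
    have h1 := timeStep_mem (s := s) he τ
    have h2 := timeStep_mem (s := t) he τ
    rw [abs_le]
    constructor <;> simp only [hξ] <;> linarith [h1.1, h1.2, h2.1, h2.2]
  have ξ0 : ∀ τ, τ ∉ Icc s (t + e) → ξ τ = 0 := by
    intro τ hτ; rw [mem_Icc, not_and_or, not_le, not_le] at hτ
    rcases hτ with h | h
    · simp only [hξ]; rw [timeStep_eq_zero h.le, timeStep_eq_zero (h.le.trans hst), sub_zero]
    · simp only [hξ]; rw [timeStep_eq_one he (by linarith), timeStep_eq_one he h.le, sub_self]
  have rest : ∀ (f : ℝ → ℝ) (c : ℝ), (∀ τ, |f τ| ≤ c) → (∀ τ, τ ∉ Icc s (t + e) → f τ = 0) →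
      |∫ τ in (0)..T, f τ| ≤ c * (t - s + e) := by
    intro f c hf hf0
    have hc : 0 ≤ c := (abs_nonneg _).trans (hf 0)
    have hind : IvlInt (indicator (Icc s (t + e)) fun _ => c) 0 T := by
      rw [intervalIntegrable_iff_integrableOn_Ioc_of_le hT.le]
      exact (integrable_const c).indicator measurableSet_Icc
    have h1 := intervalIntegral.norm_integral_le_of_norm_le (f := f) (μ := volume) hT.le
      (.of_forall fun τ _ => show ‖f τ‖ ≤ indicator (Icc s (t + e)) (fun _ => c) τ by
        by_cases hτ : τ ∈ Icc s (t + e)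
        · rw [indicator_of_mem hτ]; exact hf τ
        · rw [indicator_of_notMem hτ, hf0 τ hτ, norm_zero]) hind
    refine h1.trans ?_
    rw [iint_of_le hT.le, setIntegral_indicator measurableSet_Icc,
      setIntegral_const, smul_eq_mul, mul_comm]
    gcongr
    calc volume.real (Ioc 0 T ∩ Icc s (t + e)) ≤ volume.real (Icc s (t + e)) :=
          measureReal_mono inter_subset_right (by simp)
      _ = t - s + e := by rw [Real.volume_real_Icc_of_le (by linarith)]; ring
  have key := hI (C12.ofProd T ξ ξ' q hder cξ')
  simp only [functionalJ, C12.ofProd, integral_const_mul] at key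
  have hT1 : ξ (T + 1) = 0 := by
    simp only [hξ]
    rw [timeStep_eq_one he (by linarith), timeStep_eq_one he (by linarith), sub_self]
  have hξ00 : ξ 0 = 0 := by
    simp only [hξ]; rw [timeStep_eq_zero hs, timeStep_eq_zero (hs.trans hst), sub_self]
  have tail : ∫ τ in T..(T + 1), ξ' τ * m τ = -(ξ T * m T) := by
    have h1 : ∫ τ in T..(T + 1), ξ' τ * m τ = ∫ τ in T..(T + 1), ξ' τ * m T := by
      refine iint_congr fun τ hτ => ?_
      rw [uIcc_of_le (by linarith)] at hτ
      have : w.ev hT τ = w.ev hT T := by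
        simp only [ev, IccExtend, Function.comp]; rw [projIcc_of_right_le hT.le hτ.1, projIcc_right]
      simp only [hm, this]
    rw [h1, iint_mul_const, integral_deriv_Icc (by linarith) (fun τ _ => (hder τ).hasDerivWithinAt)
        (cξ'.intervalIntegrable _ _), hT1]
    ring
  have all : ∫ τ in (0)..(T + 1), ξ' τ * m τ = (∫ τ in (0)..T, ξ' τ * m τ) - ξ T * m T := by
    rw [← iint_add_adjacent (b := T) ((mi _ _ hT.le).continuousOn_mul cξ'.continuousOn)
      ((mi _ _ (by linarith)).continuousOn_mul cξ'.continuousOn), tail]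
    ring
  have mi' := mi 0 (T + 1) (by linarith)
  have all' : ∫ τ in (0)..(T + 1), ξ' τ * m τ = (∫ τ in (0)..(T + 1), timeBump s e τ * m τ)
        - ∫ τ in (0)..(T + 1), timeBump t e τ * m τ := by
    rw [← iint_sub (mi'.continuousOn_mul (continuous_timeBump s e).continuousOn)
      (mi'.continuousOn_mul (continuous_timeBump t e).continuousOn)]
    exact iint_congr fun τ _ => by simp only [hξ']; ring
  have a1 := abs_le.1 (abs_integral_timeBump_mul_sub_le he hs (by linarith) mi' he1)
  have a2 := abs_le.1 (abs_integral_timeBump_mul_sub_le he (hs.trans hst) (by linarith) mi' he2)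
  have hmul : ∀ (τ : ℝ) {c d : ℝ}, |c| ≤ d → |ξ τ * c| ≤ d := fun τ c d h => by
    rw [abs_mul]; exact (mul_le_of_le_one_left (abs_nonneg _) (ξ1 τ)).trans h
  have hbv : ∀ (x₀ : I) (τ : ℝ), |bdryVal hT w x₀ τ| ≤ 1 := fun x₀ τ => by
    rw [abs_of_nonneg (bdryVal_mem hw x₀ τ).1]; exact (bdryVal_mem hw x₀ τ).2
  have r1 := abs_le.1 (rest (fun τ => ξ τ * ∫ x : I, q.derivative.derivative.eval (x : ℝ)
    ∂(w.ev hT τ).meas) M (fun τ => hmul τ ((w.ev hT τ).abs_integral_le hq''))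
    fun τ hτ => by rw [ξ0 τ hτ, zero_mul])
  have r2 : ∀ x₀ : I, |∫ τ in (0)..T, bdryVal hT w x₀ τ * (ξ τ * q.derivative.eval (x₀ : ℝ))|
      ≤ M * (t - s + e) := fun x₀ => rest _ M (fun τ => by
        rw [abs_mul]
        exact (mul_le_of_le_one_left (abs_nonneg _) (hbv x₀ τ)).trans (hmul τ (hq' x₀)))
      fun τ hτ => by rw [ξ0 τ hτ]; ring
  have r21 := abs_le.1 (r2 1)
  have r20 := abs_le.1 (r2 0)
  have r3 := abs_le.1 (rest (fun τ => ∫ x : I, mobility ((w.ev hT τ).dens x)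
      * (ξ τ * q.derivative.eval (x : ℝ)) ^ 2) (M ^ 2) (fun τ => by
        have h1 : ∀ᵐ x : I, ‖mobility ((w.ev hT τ).dens x)
            * (ξ τ * q.derivative.eval (x : ℝ)) ^ 2‖ ≤ M ^ 2 := by
          filter_upwards [(isAC_ev hw τ).dens_mem] with x hx
          have h2 : |mobility ((w.ev hT τ).dens x)| ≤ 1 := by
            rw [mobility, abs_le]
            constructor <;> nlinarith [hx.1, hx.2]
          rw [norm_mul, norm_eq_abs, norm_eq_abs, abs_pow]
          refine (mul_le_of_le_one_left (by positivity) h2).trans ?_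
          exact pow_le_pow_left₀ (abs_nonneg _) (hmul τ (hq' x)) 2
        have h3 := norm_integral_le_of_norm_le_const h1
        simpa using h3)
      fun τ hτ => by simp [ξ0 τ hτ])
  have r4 := abs_le.1 (rest (fun τ => bdryB α A (bdryVal hT w 0 τ) (ξ τ * q.eval ((0 : I) : ℝ))
      + bdryB β B (bdryVal hT w 1 τ) (ξ τ * q.eval ((1 : I) : ℝ)))
      ((1 / A + 1 / B) * (2 * exp M)) (fun τ => by
        have b0 := abs_bdryB_le hA hα (bdryVal_mem hw 0 τ) (hmul τ (hq 0))
        have b1 := abs_bdryB_le hB hβ (bdryVal_mem hw 1 τ) (hmul τ (hq 1))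
        refine (abs_add_le _ _).trans ?_
        linarith)
      fun τ hτ => by simp [ξ0 τ hτ, bdryB])
  simp only [Icc.coe_zero, Icc.coe_one] at r20 r21 r4; rw [hξ00] at key
  have e3 : C * (t - s + e) = 3 * (M * (t - s + e)) + M ^ 2 * (t - s + e)
      + (1 / A + 1 / B) * (2 * exp M) * (t - s + e) := by rw [hC]; ring
  have e4 : C * (t - s + e) ≤ C * (t - s) + C * ε' := by
    rw [← mul_add]; gcongr
  have e5 : C * ε' + 2 * ε' = ε := by rw [hε']; field_simp
  simp only [zero_mul, sub_zero] at key
  change ξ T * m T - (∫ τ in (0)..T, ξ' τ * m τ) - _ + _ - _ - _ - _ ≤ I₀ at key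
  linarith [a1.1, a1.2, a2.1, a2.2, r1.1, r1.2, r21.1, r21.2, r20.1, r20.2, r3.1, r3.2, r4.1, r4.2]

theorem ev_projIcc (w : SkorohodPath T SubProb) (t : ℝ) :
    w.ev hT (projIcc 0 T hT.le t) = w.ev hT t := by
  simp only [ev, IccExtend, Function.comp, projIcc_val]

theorem exists_bound_polynomial (p : Polynomial ℝ) : ∃ M, ∀ x : I, |p.eval (x : ℝ)| ≤ M := by
  obtain ⟨M, hM⟩ := (isCompact_univ (X := I)).exists_bound_of_continuousOn
    (f := fun x : I => p.eval (x : ℝ)) (by fun_prop)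
  exact ⟨M, fun x => hM x (mem_univ x)⟩

/-- A path of finite rate is weakly continuous. -/
theorem continuous_integral_ev {I₀ : ℝ} (hA : 0 < A) (hB : 0 < B) (hα : α ∈ 𝕁) (hβ : β ∈ 𝕁)
    (hw : FiniteEnergyAC hT w) (hI : ∀ H, functionalJ α β A B hT H w ≤ I₀) (F : C(I, ℝ)) :
    Continuous fun t => ∫ x, F x ∂(w.ev hT t).meas := by
  have poly : ∀ p : Polynomial ℝ, Continuous fun t => ∫ x : I, p.eval (x : ℝ) ∂(w.ev hT t).meas := by
    intro p
    set m : ℝ → ℝ := fun t => ∫ x : I, p.eval (x : ℝ) ∂(w.ev hT t).meas with hm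
    obtain ⟨M0, h0⟩ := exists_bound_polynomial p
    obtain ⟨M1, h1⟩ := exists_bound_polynomial p.derivative
    obtain ⟨M2, h2⟩ := exists_bound_polynomial p.derivative.derivative
    set M := max M0 (max M1 M2)
    have hM : 0 ≤ M := (abs_nonneg _).trans ((h0 0).trans (le_max_left _ _))
    have main : ∀ c : ℝ, ∀ s t, 0 ≤ s → s ≤ t → t ≤ T → c * (m t - m s) ≤ I₀ +
        (3 * (|c| * M) + (|c| * M) ^ 2 + (1 / A + 1 / B) * (2 * exp (|c| * M))) * (t - s) := by
      intro c s t hs hst htT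
      have hc : ∀ {y N : ℝ}, |y| ≤ N → N ≤ M → |c * y| ≤ |c| * M := fun h h' => by
        rw [abs_mul]; exact mul_le_mul_of_nonneg_left (h.trans h') (abs_nonneg c)
      have := integral_polynomial_sub_le (M := |c| * M) hA hB hα hβ hw hI (Polynomial.C c * p)
        (fun x => by simpa using hc (h0 x) (le_max_left _ _))
        (fun x => by
          simpa using hc (h1 x) ((le_max_left _ _).trans (le_max_right _ _)))
        (fun x => by
          simpa using hc (h2 x) ((le_max_right _ _).trans (le_max_right _ _))) hs hst htT
      simp only [Polynomial.eval_mul, Polynomial.eval_C, integral_const_mul] at this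
      rw [← mul_sub] at this; exact this
    have hproj : ∀ t, m (projIcc 0 T hT.le t) = m t := fun t => by
      simp only [hm, ev_projIcc]
    have main' : ∀ c > 0, ∃ D, 0 ≤ D ∧ ∀ s t, c * |m t - m s| ≤ I₀ + D * |t - s| := by
      intro c hc
      set D := 3 * (c * M) + (c * M) ^ 2 + (1 / A + 1 / B) * (2 * exp (c * M))
      have hD : 0 ≤ D := by positivity
      have hle : ∀ s t, 0 ≤ s → s ≤ t → t ≤ T → c * |m t - m s| ≤ I₀ + D * (t - s) := by
        intro s t hs hst ht
        have k1 := main c s t hs hst ht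
        have k2 := main (-c) s t hs hst ht
        rw [abs_neg, abs_of_pos hc] at k2; rw [abs_of_pos hc] at k1
        rcases le_total 0 (m t - m s) with h | h
        · rw [abs_of_nonneg h]; exact k1
        · rw [abs_of_nonpos h]; linarith
      refine ⟨D, hD, fun s t => ?_⟩
      rw [← hproj s, ← hproj t]
      set s' := projIcc 0 T hT.le s
      set t' := projIcc 0 T hT.le t
      have hd : |(t' : ℝ) - s'| ≤ |t - s| := by
        have := (LipschitzWith.projIcc hT.le).dist_le_mul t s
        simpa [Subtype.dist_eq, Real.dist_eq] using this
      have hmul : D * |(t' : ℝ) - s'| ≤ D * |t - s| := by gcongr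
      rcases le_total (s' : ℝ) t' with h | h
      · have := hle s' t' s'.2.1 h t'.2.2
        rw [abs_of_nonneg (sub_nonneg.2 h)] at hmul; linarith
      · have := hle t' s' t'.2.1 h s'.2.2
        rw [abs_sub_comm (t' : ℝ), abs_of_nonneg (sub_nonneg.2 h)] at hmul; rw [abs_sub_comm (m t')]
        linarith
    rw [Metric.continuous_iff]
    intro s ε hε
    set c := 2 * (|I₀| + 1) / ε with hc
    have hc0 : 0 < c := by positivity
    obtain ⟨D, hD, h⟩ := main' c hc0
    refine ⟨1 / (D + 1), by positivity, fun t ht => ?_⟩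
    rw [Real.dist_eq] at ht ⊢
    have h3 : D * |t - s| ≤ 1 := by
      calc D * |t - s| ≤ D * (1 / (D + 1)) := by gcongr
        _ = D / (D + 1) := by ring
        _ ≤ 1 := by rw [div_le_one (by positivity)]; linarith
    have h4 := h s t
    have h5 : c * ε = 2 * (|I₀| + 1) := by rw [hc]; field_simp
    by_contra! hcon
    have h6 : c * ε ≤ c * |m t - m s| := by gcongr
    linarith [le_abs_self I₀, abs_nonneg I₀]
  refine continuous_of_uniform_approx_of_continuous fun u hu => ?_
  obtain ⟨ε, hε, hu'⟩ := Metric.mem_uniformity_dist.1 hu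
  obtain ⟨p, hp⟩ := exists_polynomial_near_continuousMap 0 1 F (ε / 2) (by positivity)
  refine ⟨_, poly p, fun t => hu' ?_⟩
  have i1 : Integrable (fun x => F x) (w.ev hT t).meas :=
    Integrable.of_bound F.continuous.aestronglyMeasurable ‖F‖
      (.of_forall fun x => F.norm_coe_le_norm x)
  have i2 : Integrable (fun x : I => p.eval (x : ℝ)) (w.ev hT t).meas := by
    obtain ⟨M, hM⟩ := exists_bound_polynomial p
    exact Integrable.of_bound (Continuous.aestronglyMeasurable (by fun_prop)) M
      (.of_forall hM)
  rw [Real.dist_eq, ← integral_sub i1 i2]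
  refine lt_of_le_of_lt ((w.ev hT t).abs_integral_le (C := ε / 2) fun x => ?_) (by linarith)
  have := (ContinuousMap.norm_lt_iff _ (by positivity)).1 hp x
  rw [abs_sub_comm]; exact this.le

end SkorohodPath

/-! ### The gradient of a path of finite energy -/

/-- Integration by parts for the primitive of an integrable function. -/
theorem integral_primitive_mul_deriv {g ψ ψ' : ℝ → ℝ} (hg : IvlInt g 0 1)
    (hψ : ∀ x ∈ 𝕁, HasDerivWithinAt ψ (ψ' x) 𝕁 x) (hψ' : IvlInt ψ' 0 1) :
    ∫ x in (0)..1, (∫ y in (0)..x, g y) * ψ' x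
      = (∫ y in (0)..1, g y) * ψ 1 - ∫ y in (0)..1, g y * ψ y := by
  set μ : Measure ℝ := volume.restrict (Ioc (0 : ℝ) 1)
  have cψ : ContinuousOn ψ 𝕁 := fun x hx => (hψ x hx).continuousWithinAt
  have ig : Integrable g μ := (intervalIntegrable_iff_integrableOn_Ioc_of_le zero_le_one).1 hg
  have iψ : Integrable ψ' μ := (intervalIntegrable_iff_integrableOn_Ioc_of_le zero_le_one).1 hψ'
  have iF : Integrable (indicator {p : ℝ² | p.2 ≤ p.1} fun p => ψ' p.1 * g p.2) (μ.prod μ) :=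
    (iψ.mul_prod ig).indicator (measurableSet_le measurable_snd measurable_fst)
  have hsw := integral_integral_swap (f := fun x y =>
    indicator {p : ℝ² | p.2 ≤ p.1} (fun p => ψ' p.1 * g p.2) (x, y)) iF
  have e1 : ∀ x ∈ Ioc (0 : ℝ) 1, ∫ y, indicator {p : ℝ² | p.2 ≤ p.1}
      (fun p => ψ' p.1 * g p.2) (x, y) ∂μ = (∫ y in (0)..x, g y) * ψ' x := by
    intro x hx
    have : (fun y => indicator {p : ℝ² | p.2 ≤ p.1} (fun p => ψ' p.1 * g p.2) (x, y))
        = indicator (Iic x) fun y => ψ' x * g y := by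
      ext y; simp only [indicator, mem_ofPred_eq, mem_Iic]
    rw [this, integral_indicator measurableSet_Iic, Measure.restrict_restrict measurableSet_Iic,
      integral_const_mul, iint_of_le hx.1.le, mul_comm]
    congr 2; rw [inter_comm, Ioc_inter_Iic, min_eq_right hx.2]
  have e2 : ∀ y ∈ Ioc (0 : ℝ) 1, ∫ x, indicator {p : ℝ² | p.2 ≤ p.1}
      (fun p => ψ' p.1 * g p.2) (x, y) ∂μ = (ψ 1 - ψ y) * g y := by
    intro y hy
    have : (fun x => indicator {p : ℝ² | p.2 ≤ p.1} (fun p => ψ' p.1 * g p.2) (x, y))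
        = indicator (Ici y) fun x => ψ' x * g y := by
      ext x; simp only [indicator, mem_ofPred_eq, mem_Ici]
    have hs : Ici y ∩ Ioc (0 : ℝ) 1 = Icc y 1 := by
      ext x; simp only [mem_inter_iff, mem_Ici, mem_Ioc, mem_Icc]
      exact ⟨fun h => ⟨h.1, h.2.2⟩, fun h => ⟨h.1, hy.1.trans_le h.1, h.2⟩⟩
    rw [this, integral_indicator measurableSet_Ici, Measure.restrict_restrict measurableSet_Ici,
      integral_mul_const, hs, integral_Icc_eq_integral_Ioc, ← iint_of_le hy.2,
      integral_deriv_Icc hy.2 (fun x hx => (hψ x ⟨hy.1.le.trans hx.1, hx.2⟩).mono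
        (Icc_subset_Icc hy.1.le le_rfl)) (hψ'.mono_set (by
          rw [uIcc_of_le hy.2, uIcc01]; exact Icc_subset_Icc hy.1.le le_rfl))]
  rw [iint01, ← setIntegral_congr_fun measurableSet_Ioc e1,
    hsw, setIntegral_congr_fun measurableSet_Ioc e2, ← iint01,
    ← iint_mul_const, ← iint_sub (hg.mul_const _) (hg.mul_continuousOn (by rwa [uIcc01]))]
  exact iint_congr fun y _ => by ring

/-- The Riesz representation of a functional dominated by a Hilbert space seminorm. -/
theorem exists_inner_eq_of_bound {V H : Type*} [AddCommGroup V] [Module ℝ V] [NormedAddCommGroup H]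
    [InnerProductSpace ℝ H] [CompleteSpace H] (Φ : V →ₗ[ℝ] H) (l : V →ₗ[ℝ] ℝ)
    (h : ∀ v, |l v| ≤ C * ‖Φ v‖) : ∃ g : H, ∀ v, l v = inner ℝ g (Φ v) := by
  obtain ⟨s, hs⟩ := LinearMap.exists_rightInverse_of_surjective Φ.rangeRestrict
    (LinearMap.range_rangeRestrict Φ)
  have hs' : ∀ y : LinearMap.range Φ, Φ (s y) = y := fun y => by
    have := congrArg Subtype.val (LinearMap.congr_fun hs y)
    simpa using this
  let f : LinearMap.range Φ →L[ℝ] ℝ := (l.comp s).mkContinuous C fun y => by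
    have := h (s y)
    rw [hs'] at this; exact this
  obtain ⟨F, hF, -⟩ := exists_extension_norm_eq (LinearMap.range Φ) f
  refine ⟨(InnerProductSpace.toDual ℝ H).symm F, fun v => ?_⟩
  rw [InnerProductSpace.toDual_symm_apply]
  have h1 : F (Φ v) = l (s ⟨Φ v, LinearMap.mem_range_self Φ v⟩) :=
    hF ⟨Φ v, LinearMap.mem_range_self Φ v⟩
  have h2 : l (v - s ⟨Φ v, LinearMap.mem_range_self Φ v⟩) = 0 := by
    have := h (v - s ⟨Φ v, LinearMap.mem_range_self Φ v⟩)
    rw [map_sub Φ, hs', sub_self, norm_zero, mul_zero] at this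
    exact abs_eq_zero.1 (le_antisymm this (abs_nonneg _))
  rw [map_sub, sub_eq_zero] at h2; rw [h1, h2]

theorem memLp_rect_of_continuous {F : ℝ² → ℝ} (hF : Continuous F) (a b : ℝ) :
    MemLp F 2 (rectMeasure a b) := by
  obtain ⟨C, hC⟩ := (isCompact_Icc.prod isCompact_Icc :
    IsCompact (Icc a b ×ˢ 𝕁)).exists_bound_of_continuousOn hF.continuousOn
  refine MemLp.of_bound hF.aestronglyMeasurable C ?_
  filter_upwards [ae_rectMeasure_mem a b] with p hp
  exact hC p ⟨Ioc_subset_Icc_self hp.1, Ioc_subset_Icc_self hp.2⟩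

section Energy

variable (hT : 0 < T) (w : SkorohodPath T SubProb)

theorem IsEnergyTest.add {G G' : ℝ → ℝ → ℝ} (h : IsEnergyTest T G) (h' : IsEnergyTest T G') :
    IsEnergyTest T (G + G') := by
  obtain ⟨h1, K, hK, hKs, h0⟩ := h
  obtain ⟨h1', K', hK', hKs', h0'⟩ := h'
  refine ⟨h1.add h1', K ∪ K', hK.union hK', union_subset hKs hKs', fun p hp hpK => ?_⟩
  rw [mem_union, not_or] at hpK; simp [h0 p hp hpK.1, h0' p hp hpK.2]

theorem IsEnergyTest.smul {G : ℝ → ℝ → ℝ} (h : IsEnergyTest T G) (c : ℝ) :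
    IsEnergyTest T (c • G) := by
  obtain ⟨h1, K, hK, hKs, h0⟩ := h
  refine ⟨contDiffOn_const.mul h1 (f := fun _ => c), K, hK, hKs, fun p hp hpK => ?_⟩
  simp [h0 p hp hpK]

theorem IsEnergyTest.zero : IsEnergyTest T 0 :=
  ⟨contDiffOn_const, ∅, isCompact_empty, empty_subset _, fun _ _ _ => rfl⟩

theorem integrable_deriv_of_contDiff (μ : SubProb) (hf : ContDiff ℝ 1 f) :
    Integrable (fun x : I => deriv f x) μ.meas := by
  have hc : Continuous fun x : I => deriv f x :=
    (hf.continuous_deriv le_rfl).comp continuous_subtype_val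
  obtain ⟨M, hM⟩ := (isCompact_univ (X := I)).exists_bound_of_continuousOn hc.continuousOn
  exact Integrable.of_bound hc.aestronglyMeasurable M
    (.of_forall fun x => hM x (mem_univ x))

/-- The test functions on which the energy functional is represented by the gradient. -/
def energySpace : Submodule ℝ (ℝ → ℝ → ℝ) where
  carrier := {G | IsEnergyTest T G ∧ (Continuous ⇈G) ∧
    (∀ t, ContDiff ℝ 1 (G t)) ∧
    IvlInt (fun t => ∫ x : I, deriv (G t) x ∂(w.ev hT t).meas) 0 T}
  add_mem' := by
    rintro G G' ⟨h1, h2, h3, h4⟩ ⟨h1', h2', h3', h4'⟩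
    refine ⟨h1.add h1', h2.add h2', fun t => (h3 t).add (h3' t), (h4.add h4').congr fun t _ => ?_⟩
    simp only [Pi.add_apply]
    rw [← integral_add (integrable_deriv_of_contDiff _ (h3 t))
      (integrable_deriv_of_contDiff _ (h3' t))]
    refine integral_congr_ae (.of_forall fun x => ?_)
    exact (deriv_add ((h3 t).differentiable one_ne_zero x)
      ((h3' t).differentiable one_ne_zero x)).symm
  zero_mem' := by
    refine ⟨IsEnergyTest.zero, continuous_const, fun t => contDiff_const, ?_⟩
    simp
  smul_mem' := by
    rintro c G ⟨h1, h2, h3, h4⟩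
    refine ⟨h1.smul c, continuous_const.mul h2, fun t => contDiff_const.mul (h3 t) (f := fun _ => c),
      (h4.const_mul c).congr fun t _ => ?_⟩
    rw [← integral_const_mul]
    refine integral_congr_ae (.of_forall fun x => ?_)
    exact (deriv_const_smul c ((h3 t).differentiable one_ne_zero x)).symm

/-- The linear part of the energy functional. -/
def energyLin : energySpace hT w →ₗ[ℝ] ℝ where
  toFun G := ∫ t in (0)..T, ∫ x : I, deriv (G.1 t) x ∂(w.ev hT t).meas
  map_add' := by
    rintro ⟨G, h1, h2, h3, h4⟩ ⟨G', h1', h2', h3', h4'⟩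
    rw [← iint_add h4 h4']
    refine iint_congr fun t _ => ?_
    rw [← integral_add (integrable_deriv_of_contDiff _ (h3 t))
      (integrable_deriv_of_contDiff _ (h3' t))]
    refine integral_congr_ae (.of_forall fun x => ?_)
    exact deriv_add ((h3 t).differentiable one_ne_zero x) ((h3' t).differentiable one_ne_zero x)
  map_smul' := by
    rintro c ⟨G, h1, h2, h3, h4⟩
    rw [RingHom.id_apply, smul_eq_mul, ← iint_const_mul]
    refine iint_congr fun t _ => ?_
    rw [← integral_const_mul]
    refine integral_congr_ae (.of_forall fun x => ?_)
    exact deriv_const_smul c ((h3 t).differentiable one_ne_zero x)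

/-- The embedding of the test functions into `L²`. -/
def energyEmb : energySpace hT w →ₗ[ℝ] Lp ℝ 2 (rectMeasure 0 T) where
  toFun G := (memLp_rect_of_continuous G.2.2.1 0 T).toLp _
  map_add' G G' := MemLp.toLp_add (memLp_rect_of_continuous G.2.2.1 0 T)
    (memLp_rect_of_continuous G'.2.2.1 0 T)
  map_smul' c G := MemLp.toLp_const_smul c (memLp_rect_of_continuous G.2.2.1 0 T)

theorem norm_sq_energyEmb (G : energySpace hT w) :
    ‖energyEmb hT w G‖ ^ 2 = ∫ t in (0)..T, ∫ x : I, G.1 t x ^ 2 := by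
  have hG := memLp_rect_of_continuous G.2.2.1 0 T
  rw [← real_inner_self_eq_norm_sq, L2.inner_def]
  have h1 : ∫ p, inner ℝ (energyEmb hT w G p) (energyEmb hT w G p) ∂(rectMeasure 0 T)
      = ∫ p, G.1 p.1 p.2 ^ 2 ∂(rectMeasure 0 T) := by
    refine integral_congr_ae ?_
    filter_upwards [hG.coeFn_toLp] with p hp
    change inner ℝ (hG.toLp _ p) (hG.toLp _ p) = _; rw [hp]; simp [sq]
  rw [h1, integral_prod _ hG.integrable_sq, iint_of_le hT.le]
  refine setIntegral_congr_fun measurableSet_Ioc fun t _ => ?_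
  rw [integral_unitInterval (fun x => G.1 t x ^ 2), iint01]

variable {hT w}

theorem exists_energy_repr (hw : energy hT w < ⊤) : ∃ g : Lp ℝ 2 (rectMeasure 0 T),
    ∀ G : energySpace hT w, (∫ t in (0)..T, ∫ x : I, deriv (G.1 t) x ∂(w.ev hT t).meas)
      = ∫ p, g p * G.1 p.1 p.2 ∂(rectMeasure 0 T) := by
  set E := (energy hT w).toReal
  have hE : ∀ G : energySpace hT w, energyLin hT w G - 1 / 2 * ‖energyEmb hT w G‖ ^ 2 ≤ E := by
    intro G; rw [norm_sq_energyEmb]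
    have h1 : ((energyLin hT w G - 1 / 2 * ∫ t in (0)..T, ∫ x : I, G.1 t x ^ 2 : ℝ) : EReal)
        ≤ energy hT w := le_iSup₂_of_le G.1 G.2.1 le_rfl
    exact_mod_cast h1.trans (EReal.le_coe_toReal hw.ne)
  have hE0 : 0 ≤ E := by simpa using hE 0
  have key : ∀ G : energySpace hT w, energyLin hT w G ≤ (E + 1) * ‖energyEmb hT w G‖ := by
    intro G
    set N := ‖energyEmb hT w G‖
    have scale : ∀ c : ℝ, c * energyLin hT w G - 1 / 2 * (c ^ 2 * N ^ 2) ≤ E := by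
      intro c
      have := hE (c • G)
      rw [map_smul, map_smul, norm_smul, mul_pow, norm_eq_abs, sq_abs, smul_eq_mul] at this
      exact this
    rcases (norm_nonneg (energyEmb hT w G)).eq_or_lt with h0 | h0
    · have hN : N = 0 := h0.symm
      rw [hN, mul_zero]
      by_contra! hpos
      have := scale ((E + 1) / energyLin hT w G)
      rw [hN, div_mul_cancel₀ _ hpos.ne'] at this; linarith
    · have := scale (1 / N)
      have hN : 0 < N := h0
      have e : 1 / N * energyLin hT w G - 1 / 2 * ((1 / N) ^ 2 * N ^ 2)
          = energyLin hT w G / N - 1 / 2 := by field_simp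
      rw [e] at this
      have h3 : energyLin hT w G / N ≤ E + 1 := by linarith
      rwa [div_le_iff₀ hN] at h3
  obtain ⟨g, hg⟩ := exists_inner_eq_of_bound (energyEmb hT w) (energyLin hT w) (C := E + 1)
    fun G => by
      rw [abs_le]
      refine ⟨?_, key G⟩
      have := key (-G)
      rw [map_neg, map_neg, norm_neg] at this; linarith
  refine ⟨g, fun G => (hg G).trans ?_⟩
  rw [L2.inner_def]
  refine integral_congr_ae ?_
  filter_upwards [(memLp_rect_of_continuous G.2.2.1 0 T).coeFn_toLp] with p hp
  change inner ℝ (g p) ((memLp_rect_of_continuous G.2.2.1 0 T).toLp _ p) = _; rw [hp]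
  simp [mul_comm]

theorem mul_mem_energySpace {a ψ : ℝ → ℝ} (ha : ContDiff ℝ ∞ a) (hψ : ContDiff ℝ ∞ ψ)
    (hc : HasCompactSupport ψ) (hs : tsupport ψ ⊆ Ioo 0 1) :
    (fun t x => a t * ψ x) ∈ energySpace hT w := by
  have hder : ∀ t x, deriv (fun x => a t * ψ x) x = a t * deriv ψ x := fun t x =>
    deriv_const_mul_field (a t)
  refine ⟨⟨?_, Icc 0 T ×ˢ tsupport ψ, isCompact_Icc.prod hc.isCompact,
    prod_mono le_rfl hs, fun p hp hpK => ?_⟩, ?_, fun t => ?_, ?_⟩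
  · exact ((ha.comp contDiff_fst).mul (hψ.comp contDiff_snd)).contDiffOn
  · have : ψ p.2 = 0 := image_eq_zero_of_notMem_tsupport fun h => hpK ⟨hp.1, h⟩
    simp [this]
  · exact (ha.continuous.comp continuous_fst).mul (hψ.continuous.comp continuous_snd)
  · exact contDiff_const.mul (hψ.of_le (by simp))
  · simp only [hder, integral_const_mul]
    have hd : Continuous (deriv ψ) := hψ.continuous_deriv (by simp)
    obtain ⟨M, hM⟩ := (isCompact_univ (X := I)).exists_bound_of_continuousOn
      (f := fun x : I => deriv ψ x) (hd.comp continuous_subtype_val).continuousOn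
    refine IntervalIntegrable.continuousOn_mul ?_ ha.continuous.continuousOn
    exact intervalIntegrable_of_measurable_of_bound (C := M) hT.le
      (w.measurable_integral ⟨fun x : I => deriv ψ x, hd.comp continuous_subtype_val⟩)
      fun t _ => (w.ev hT t).abs_integral_le fun x => hM x (mem_univ x)

/-- A path of finite energy has a weak gradient in `L²`. -/
theorem exists_weak_gradient (hw : energy hT w < ⊤) : ∃ g : ℝ → ℝ → ℝ, (Measurable ⇈g) ∧
    MemLp ⇈g 2 (rectMeasure 0 T) ∧
    ∀ ψ : ℝ → ℝ, ContDiff ℝ ∞ ψ → HasCompactSupport ψ → tsupport ψ ⊆ Ioo 0 1 →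
      ∀ᵐ t ∂(volume.restrict (Ioc 0 T)), ∫ x : I, deriv ψ x ∂(w.ev hT t).meas
        = -∫ x in (0)..1, g t x * ψ x := by
  obtain ⟨g₀, hg₀⟩ := exists_energy_repr hw
  have hm := (Lp.memLp g₀).1
  set g : ℝ² → ℝ := fun p => -(hm.mk g₀ p) with hg
  have hgm : Measurable g := hm.stronglyMeasurable_mk.measurable.neg
  have hge : g =ᵐ[rectMeasure 0 T] fun p => -g₀ p := hm.ae_eq_mk.symm.mono fun p hp => by
    simp only [hg, hp]
  have hgL : MemLp g 2 (rectMeasure 0 T) := (Lp.memLp g₀).neg.ae_eq hge.symm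
  refine ⟨fun t x => g (t, x), hgm, hgL, fun ψ hψ hc hs => ?_⟩
  have hgψ : Integrable (fun p : ℝ² => ψ p.2 * g p) (rectMeasure 0 T) :=
    Integrable.continuous_mul_rect (F := fun p => ψ p.2) (hψ.continuous.comp continuous_snd)
      (hgL.integrable (by norm_num))
  set d : ℝ → ℝ := fun t => (∫ x : I, deriv ψ x ∂(w.ev hT t).meas)
    + ∫ x in (0)..1, g (t, x) * ψ x with hd
  have i1 : IvlInt (fun t => ∫ x : I, deriv ψ x ∂(w.ev hT t).meas) 0 T := by
    have := (mul_mem_energySpace (hT := hT) (w := w) (contDiff_const (c := (1 : ℝ))) hψ hc hs).2.2.2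
    simpa using this
  have i2 : IvlInt (fun t => ∫ x in (0)..1, g (t, x) * ψ x) 0 T :=
    intervalIntegrable_integral_of_rect hT.le (F := fun t x => g (t, x) * ψ x)
      (hgψ.congr (.of_forall fun p => mul_comm _ _))
  have id : IvlInt d 0 T := i1.add i2
  have hz : ∀ᵐ t, t ∈ Ioo 0 T → d t = 0 := by
    refine isOpen_Ioo.ae_eq_zero_of_integral_contDiff_smul_eq_zero ?_ fun a ha hac has => ?_
    · rw [intervalIntegrable_iff_integrableOn_Ioc_of_le hT.le] at id
      exact (id.mono_set Ioo_subset_Ioc_self).locallyIntegrableOn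
    · have h1 := hg₀ ⟨_, mul_mem_energySpace ha hψ hc hs⟩
      have hder : ∀ t x, deriv (fun x => a t * ψ x) x = a t * deriv ψ x := fun t x =>
        deriv_const_mul_field (a t)
      simp only [hder, integral_const_mul] at h1
      have h2 : ∫ p, g₀ p * (a p.1 * ψ p.2) ∂(rectMeasure 0 T)
          = -∫ t in (0)..T, a t * ∫ x in (0)..1, g (t, x) * ψ x := by
        have : ∫ p, g₀ p * (a p.1 * ψ p.2) ∂(rectMeasure 0 T)
            = -∫ p, a p.1 * (ψ p.2 * g p) ∂(rectMeasure 0 T) := by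
          rw [← integral_neg]
          refine integral_congr_ae ?_
          filter_upwards [hge] with p hp
          rw [hp]; ring
        rw [this, integral_prod _ (Integrable.continuous_mul_rect (F := fun p => a p.1)
          (ha.continuous.comp continuous_fst) hgψ), iint_of_le hT.le]
        congr 1
        refine setIntegral_congr_fun measurableSet_Ioc fun t _ => ?_
        simp only
        rw [integral_const_mul, iint01]; simp only [mul_comm]
      rw [h2] at h1
      have hsupp : Function.support (fun t => a t • d t) ⊆ Ioc 0 T := fun t ht => by
        refine Ioo_subset_Ioc_self (has (subset_tsupport a ?_))
        intro h0
        apply ht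
        simp [h0]
      rw [← intervalIntegral.integral_eq_integral_of_support_subset hsupp]
      simp only [smul_eq_mul, hd, mul_add]
      rw [iint_add (i1.continuousOn_mul ha.continuous.continuousOn)
        (i2.continuousOn_mul ha.continuous.continuousOn), h1]
      ring
  rw [← restrict_Ioo_eq_restrict_Ioc, ae_restrict_iff' measurableSet_Ioo]
  filter_upwards [hz] with t ht htm
  have := ht htm
  simp only [hd] at this; linarith

end Energy

/-! ### A regular version of the density -/

/-- The restrictions to `[0,1]` of the smooth functions with compact support in `(0,1)`. -/
def interiorTests : Set C(I, ℝ) :=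
  {F | ∃ θ : ℝ → ℝ, ContDiff ℝ ∞ θ ∧ HasCompactSupport θ ∧ tsupport θ ⊆ Ioo 0 1 ∧
    ∀ x : I, F x = θ x}

/-- The primitive of `θ - (∫ θ) ω`, where `ω` is a fixed bump. -/
def balancedPrimitive (θ : ℝ → ℝ) (x : ℝ) : ℝ :=
  ∫ y in (0)..x, (θ y - (∫ z in (0)..1, θ z) * timeBump (1 / 4) (1 / 2) y)

theorem hasDerivAt_balancedPrimitive {θ : ℝ → ℝ} (hθ : Continuous θ) (x : ℝ) :
    HasDerivAt (balancedPrimitive θ)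
      (θ x - (∫ z in (0)..1, θ z) * timeBump (1 / 4) (1 / 2) x) x := by
  have hc : Continuous fun y => θ y - (∫ z in (0)..1, θ z) * timeBump (1 / 4) (1 / 2) y :=
    hθ.sub (continuous_const.mul (continuous_timeBump _ _))
  exact iint_hasDerivAt_right (hc.intervalIntegrable _ _)
    hc.aestronglyMeasurable.stronglyMeasurableAtFilter hc.continuousAt

theorem balancedPrimitive_zero (θ : ℝ → ℝ) : balancedPrimitive θ 0 = 0 := by
  simp [balancedPrimitive]

theorem balancedPrimitive_one {θ : ℝ → ℝ} (hθ : Continuous θ) : balancedPrimitive θ 1 = 0 := by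
  rw [balancedPrimitive, iint_sub (hθ.intervalIntegrable _ _)
    (((continuous_timeBump _ _).intervalIntegrable _ _).const_mul _),
    iint_const_mul, integral_timeBump (by norm_num) (by norm_num)
    (by norm_num)]
  ring

theorem contDiff_balancedPrimitive {θ : ℝ → ℝ} (hθ : ContDiff ℝ ∞ θ) :
    ContDiff ℝ ∞ (balancedPrimitive θ) := by
  refine contDiff_infty_iff_deriv.2
    ⟨fun x => (hasDerivAt_balancedPrimitive hθ.continuous x).differentiableAt, ?_⟩
  rw [funext fun x => (hasDerivAt_balancedPrimitive hθ.continuous x).deriv]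
  exact hθ.sub (contDiff_const.mul (contDiff_timeBump _ _))

theorem tsupport_balancedPrimitive {θ : ℝ → ℝ} (hθ : ContDiff ℝ ∞ θ) (hc : HasCompactSupport θ)
    (hs : tsupport θ ⊆ Ioo 0 1) :
    HasCompactSupport (balancedPrimitive θ) ∧ tsupport (balancedPrimitive θ) ⊆ Ioo 0 1 := by
  obtain ⟨a, b, ha, hb, hab⟩ : ∃ a b : ℝ, 0 < a ∧ b < 1 ∧
      ∀ x, x ∉ Icc a b → θ x - (∫ z in (0)..1, θ z) * timeBump (1 / 4) (1 / 2) x = 0 := by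
    have hK : IsCompact (tsupport θ ∪ Icc (1 / 4 : ℝ) (3 / 4)) := hc.isCompact.union isCompact_Icc
    have hne : (tsupport θ ∪ Icc (1 / 4 : ℝ) (3 / 4)).Nonempty :=
      ⟨1 / 2, Or.inr ⟨by norm_num, by norm_num⟩⟩
    have hsub : tsupport θ ∪ Icc (1 / 4 : ℝ) (3 / 4) ⊆ Ioo 0 1 :=
      union_subset hs fun x hx => ⟨by linarith [hx.1], by linarith [hx.2]⟩
    refine ⟨sInf (tsupport θ ∪ Icc (1 / 4 : ℝ) (3 / 4)), sSup (tsupport θ ∪ Icc (1 / 4 : ℝ) (3 / 4)),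
      (hsub (hK.sInf_mem hne)).1, (hsub (hK.sSup_mem hne)).2, fun x hx => ?_⟩
    have hx' : x ∉ tsupport θ ∪ Icc (1 / 4 : ℝ) (3 / 4) := fun h =>
      hx ⟨csInf_le hK.bddBelow h, le_csSup hK.bddAbove h⟩
    rw [mem_union, not_or] at hx'
    rw [image_eq_zero_of_notMem_tsupport hx'.1, timeBump_eq_zero fun h => hx'.2
      ⟨h.1.le, by linarith [h.2]⟩]
    ring
  have hcont := hθ.continuous
  have hi : ∀ c d, IvlInt (fun y => θ y - (∫ z in (0)..1, θ z)
      * timeBump (1 / 4) (1 / 2) y) c d := fun c d => Continuous.intervalIntegrable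
    (hcont.sub (continuous_const.mul (continuous_timeBump _ _))) _ _
  have hzero : ∀ x, x ∉ Icc a b → balancedPrimitive θ x = 0 := by
    intro x hx; rw [mem_Icc, not_and_or, not_le, not_le] at hx
    rcases hx with h | h
    · rw [balancedPrimitive, iint_congr (g := fun _ => (0 : ℝ))]
      · simp
      · intro y hy
        refine hab y fun h' => ?_
        have := hy.2
        rcases le_total 0 x with h0 | h0
        · rw [max_eq_right h0] at this; linarith [h'.1]
        · rw [max_eq_left h0] at this; linarith [h'.1]
    · have h1 := balancedPrimitive_one hcont
      rw [balancedPrimitive, ← iint_add_adjacent (hi 0 x) (hi x 1)]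
        at h1
      have h2 : ∫ y in x..1, (θ y - (∫ z in (0)..1, θ z) * timeBump (1 / 4) (1 / 2) y) = 0 := by
        rw [iint_congr (g := fun _ => (0 : ℝ))]
        · simp
        · intro y hy
          refine hab y fun h' => ?_
          have := hy.1
          rcases le_total x 1 with h0 | h0
          · rw [min_eq_left h0] at this; linarith [h'.2]
          · rw [min_eq_right h0] at this; linarith [h'.2]
      rw [h2, add_zero] at h1; exact h1
  have hsupp : tsupport (balancedPrimitive θ) ⊆ Icc a b := closure_minimal (fun x hx => by
      by_contra h
      exact hx (hzero x h)) isClosed_Icc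
  exact ⟨HasCompactSupport.of_support_subset_isCompact isCompact_Icc
    ((subset_tsupport _).trans hsupp), hsupp.trans (Icc_subset_Ioo ha hb)⟩

/-- A bounded density whose weak gradient is `g` coincides with the primitive of `g`. -/
theorem ae_eq_of_weak_gradient {f : I → ℝ} (hfm : AEMeasurable f) (hf : ∀ x, f x ∈ 𝕁)
    {g : ℝ → ℝ} (hg : IvlInt g 0 1) {D : Set interiorTests} (hD : Dense D)
    (h : ∀ F ∈ D, ∃ θ : ℝ → ℝ, Continuous θ ∧ (∀ x : I, F.1 x = θ x) ∧
      ∫ x : I, f x * deriv (balancedPrimitive θ) x = -∫ x in (0)..1, g x * balancedPrimitive θ x)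
    (hc : c = (∫ x : I, f x * timeBump (1 / 4) (1 / 2) x)
      - ∫ x in (0)..1, (∫ y in (0)..x, g y) * timeBump (1 / 4) (1 / 2) x) :
    f =ᵐ[volume] fun x : I => c + ∫ y in (0)..x, g y := by
  set om : ℝ → ℝ := timeBump (1 / 4) (1 / 2) with hom
  have com : Continuous om := continuous_timeBump _ _
  have cprim : ContinuousOn (fun x => ∫ y in (0)..x, g y) 𝕁 := by
    have := intervalIntegral.continuousOn_primitive_interval
      ((intervalIntegrable_iff' (by simp)).1 hg)
    rwa [uIcc01] at this
  set ū : I → ℝ := fun x => c + ∫ y in (0)..x, g y with hū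
  have cū : Continuous ū := by
    refine continuous_const.add ?_
    exact continuousOn_iff_continuous_domRestrict.1 cprim
  have iū : Integrable ū := by
    obtain ⟨M, hM⟩ := (isCompact_univ (X := I)).exists_bound_of_continuousOn cū.continuousOn
    exact Integrable.of_bound cū.aestronglyMeasurable M
      (.of_forall fun x => hM x (mem_univ x))
  have if' : Integrable f := Integrable.of_bound hfm.aestronglyMeasurable 1
    (.of_forall fun x => by
      rw [norm_eq_abs, abs_of_nonneg (hf x).1]; exact (hf x).2)
  have imul : ∀ {k : I → ℝ}, Integrable k → ∀ {F : I → ℝ}, Continuous F →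
      Integrable (fun x => k x * F x) := by
    intro k hk F hF
    obtain ⟨M, hM⟩ := (isCompact_univ (X := I)).exists_bound_of_continuousOn hF.continuousOn
    exact hk.mul_bdd (c := M) hF.aestronglyMeasurable (.of_forall fun x => hM x (mem_univ x))
  have ibpū : ∀ {ψ ψ' : ℝ → ℝ}, (∀ x, HasDerivAt ψ (ψ' x) x) → Continuous ψ' → ψ 0 = 0 →
      ψ 1 = 0 → ∫ x : I, ū x * ψ' x = -∫ x in (0)..1, g x * ψ x := by
    intro ψ ψ' hψ hψ' h0 h1
    have e1 := integral_primitive_mul_deriv hg (fun x _ => (hψ x).hasDerivWithinAt)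
      (hψ'.intervalIntegrable 0 1)
    rw [integral_unitInterval (fun x => (c + ∫ y in (0)..x, g y) * ψ' x)]
    have e2 : ∫ x in (0)..1, (c + ∫ y in (0)..x, g y) * ψ' x
        = c * (∫ x in (0)..1, ψ' x) + ∫ x in (0)..1, (∫ y in (0)..x, g y) * ψ' x := by
      rw [← iint_const_mul, ← iint_add ((hψ'.intervalIntegrable 0 1).const_mul c)
        (intble01 (cprim.fun_mul hψ'.continuousOn))]
      exact iint_congr fun x _ => by ring
    rw [e2, e1, integral_deriv_Icc zero_le_one (fun x _ => (hψ x).hasDerivWithinAt)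
      (hψ'.intervalIntegrable 0 1), h0, h1]
    ring
  have hom0 : ∫ x : I, (f x - ū x) * om x = 0 := by
    have e1 : ∫ x : I, ū x * om x = c + ∫ x in (0)..1, (∫ y in (0)..x, g y) * om x := by
      rw [integral_unitInterval (fun x => (c + ∫ y in (0)..x, g y) * om x)]
      have : ∀ x, (c + ∫ y in (0)..x, g y) * om x
          = c * om x + (∫ y in (0)..x, g y) * om x := fun x => by ring
      simp only [this]
      rw [iint_add ((com.intervalIntegrable 0 1).const_mul c)
        (intble01 (cprim.fun_mul com.continuousOn)),
        iint_const_mul, integral_timeBump (by norm_num) (by norm_num)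
        (by norm_num), mul_one]
    have com' : Continuous fun x : I => om x := com.comp continuous_subtype_val
    simp only [sub_mul]; rw [integral_sub (imul if' com') (imul iū com'), e1, hc]; ring
  have hD0 : ∀ F ∈ D, ∫ x : I, (f x - ū x) * F.1 x = 0 := by
    intro F hF
    obtain ⟨θ, hθ, hFθ, hrel⟩ := h F hF
    set ψ' : ℝ → ℝ := fun x => θ x - (∫ z in (0)..1, θ z) * om x
    have cψ' : Continuous ψ' := hθ.sub (continuous_const.mul com)
    have hder := fun x => hasDerivAt_balancedPrimitive hθ x
    have e1 := ibpū hder cψ' (balancedPrimitive_zero θ) (balancedPrimitive_one hθ)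
    simp only [fun x => (hder x).deriv] at hrel
    have cψI : Continuous fun x : I => ψ' x := cψ'.comp continuous_subtype_val
    have comI : Continuous fun x : I => om x := com.comp continuous_subtype_val
    have e2 : ∫ x : I, (f x - ū x) * ψ' x = 0 := by
      simp only [sub_mul]; rw [integral_sub (imul if' cψI) (imul iū cψI), e1]
      change (∫ x : I, f x * ψ' x) - _ = 0; rw [hrel]; ring
    have e3 : ∀ x : I, (f x - ū x) * F.1 x
        = (f x - ū x) * ψ' x + (∫ z in (0)..1, θ z) * ((f x - ū x) * om x) := fun x => by
      rw [hFθ x]; simp only [ψ']; ring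
    simp only [e3]
    rw [integral_add (imul (if'.sub_fun iū) cψI) ((imul (if'.sub_fun iū) comI).const_mul _), e2,
      integral_const_mul, hom0]
    ring
  have hcont : Continuous fun F : C(I, ℝ) => ∫ x : I, (f x - ū x) * F x := by
    have hk := if'.sub_fun iū
    refine (LipschitzWith.of_dist_le' (K := ∫ x, |f x - ū x|) fun F F' => ?_).continuous
    rw [Real.dist_eq, ← integral_sub (imul hk F.continuous) (imul hk F'.continuous),
      ← integral_mul_const, ← norm_eq_abs]
    refine norm_integral_le_of_norm_le (hk.abs.mul_const _) (.of_forall fun x => ?_)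
    rw [← mul_sub, norm_mul, norm_eq_abs]
    exact mul_le_mul_of_nonneg_left
      (by rw [← dist_eq_norm]; exact ContinuousMap.dist_apply_le_dist x) (abs_nonneg _)
  have hS : ∀ F : interiorTests, ∫ x : I, (f x - ū x) * F.1 x = 0 := by
    intro F
    have hcl : IsClosed {F : interiorTests | ∫ x : I, (f x - ū x) * F.1 x = 0} :=
      isClosed_eq (hcont.comp continuous_subtype_val) continuous_const
    exact hcl.closure_subset_iff.2 hD0 (hD F)
  set k : ℝ → ℝ := fun x => f (𝕡 x) - ū (𝕡 x) with hk
  have ik : IntegrableOn k 𝕁 := by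
    refine integrableOn_unitInterval_iff.2 ?_
    simpa [hk] using if'.sub_fun iū
  have hz : ∀ᵐ x : ℝ, x ∈ 𝕁ᵒ → k x = 0 := by
    refine isOpen_Ioo.ae_eq_zero_of_integral_contDiff_smul_eq_zero
      (ik.mono_set Ioo_subset_Icc_self).locallyIntegrableOn fun θ hθ hθc hθs => ?_
    have h1 := hS ⟨⟨fun x => θ x, hθ.continuous.comp continuous_subtype_val⟩,
      θ, hθ, hθc, hθs, fun x => rfl⟩
    rw [integral_unitInterval'] at h1
    have hsupp : Function.support (fun x => θ x • k x) ⊆ Ioc 0 1 := fun x hx => by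
      refine Ioo_subset_Ioc_self (hθs (subset_tsupport θ ?_))
      intro h0
      apply hx
      simp [h0]
    rw [← intervalIntegral.integral_eq_integral_of_support_subset hsupp]
    refine Eq.trans ?_ h1
    refine iint_congr fun x hx => ?_
    rw [uIcc01] at hx
    simp only [hk, smul_eq_mul, ContinuousMap.coe_mk, projIcc_of_mem zero_le_one hx]; ring
  have hz' : ∀ᵐ x ∂(volume.restrict 𝕁), k x = 0 := by
    rw [← Measure.restrict_congr_set Ioo_ae_eq_Icc]; exact (ae_restrict_iff' measurableSet_Ioo).2 hz
  filter_upwards [ae_unitInterval_iff.2 hz'] with x hx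
  simp only [hk, projIcc_val] at hx; linarith

/-- `u` is a regular version, with gradient `g`, of the density of the path `w`. -/
structure IsVersion {T : ℝ} (hT : 0 < T) (w : SkorohodPath T SubProb) (u g : ℝ → ℝ → ℝ) : Prop where
  meas : Measurable ⇈u
  meas_x : Measurable ⇈g
  mem : ∀ t x, u t x ∈ 𝕁
  memLp : MemLp ⇈g 2 (rectMeasure 0 T)
  ae : ∀ᵐ t ∂(volume.restrict (Ioc 0 T)), (w.ev hT t).HasDensity (fun x : I => u t x) ∧
    IvlInt (g t) 0 1 ∧ ∀ x ∈ 𝕁, u t x = u t 0 + ∫ y in (0)..x, g t y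

theorem measurable_primitive (hg : Measurable ⇈g) :
    Measurable fun p : ℝ² => ∫ y in Ioc (0 : ℝ) p.2, g p.1 y := by
  have h1 : Measurable fun q : (ℝ²) × ℝ =>
      indicator {q : (ℝ²) × ℝ | q.2 ∈ Ioc 0 q.1.2} (fun q => g q.1.1 q.2) q := by
    refine Measurable.indicator ?_ ?_
    · exact hg.comp (by fun_prop : Measurable fun q : (ℝ²) × ℝ => (q.1.1, q.2))
    · exact (measurableSet_lt measurable_const measurable_snd).inter
        (measurableSet_le measurable_snd (measurable_snd.comp measurable_fst))
  have h2 := (StronglyMeasurable.integral_prod_right' (ν := (volume : Measure ℝ))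
    h1.stronglyMeasurable).measurable
  convert h2 using 2 with p
  rw [← integral_indicator measurableSet_Ioc]; rfl

/-- A path of finite energy has a regular version. -/
theorem exists_isVersion (hw : FiniteEnergyAC hT w) : ∃ u g, IsVersion hT w u g := by
  obtain ⟨g, hgm, hgL, hgψ⟩ := exists_weak_gradient hw.2
  set om : ℝ → ℝ := timeBump (1 / 4) (1 / 2) with hom
  have com : Continuous om := continuous_timeBump _ _
  set c : ℝ → ℝ := fun t => (∫ x : I, om x ∂(w.ev hT t).meas)
    - ∫ x in (0)..1, (∫ y in Ioc (0 : ℝ) x, g t y) * om x with hc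
  have hcm : Measurable c := by
    refine (w.measurable_integral ⟨fun x : I => om x, com.comp continuous_subtype_val⟩).sub ?_
    simp only [iint01]
    exact (StronglyMeasurable.integral_prod_right' (ν := volume.restrict (Ioc (0 : ℝ) 1))
      (f := fun p : ℝ² => (∫ y in Ioc (0 : ℝ) p.2, g p.1 y) * om p.2)
      ((measurable_primitive hgm).mul (com.measurable.comp measurable_snd)).stronglyMeasurable
      ).measurable
  set ū : ℝ → ℝ → ℝ := fun t x => c t + ∫ y in Ioc (0 : ℝ) x, g t y with hū
  have hūm : Measurable ⇈ū := (hcm.comp measurable_fst).add (measurable_primitive hgm)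
  refine ⟨fun t x => max 0 (min 1 (ū t x)), g, ⟨measurable_const.max (measurable_const.min hūm),
    hgm, fun t x => ⟨le_max_left _ _, max_le zero_le_one (min_le_left _ _)⟩, hgL, ?_⟩⟩
  obtain ⟨D, hDc, hD⟩ := TopologicalSpace.exists_countable_dense interiorTests
  have hrel : ∀ᵐ t ∂(volume.restrict (Ioc 0 T)), ∀ F ∈ D, ∃ θ : ℝ → ℝ, Continuous θ ∧
      (∀ x : I, F.1 x = θ x) ∧ ∫ x : I, deriv (balancedPrimitive θ) x ∂(w.ev hT t).meas
        = -∫ x in (0)..1, g t x * balancedPrimitive θ x := by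
    rw [ae_ball_iff hDc]
    intro F _
    obtain ⟨θ, hθ, hθc, hθs, hFθ⟩ := F.2
    have hsupp := tsupport_balancedPrimitive hθ hθc hθs
    filter_upwards [hgψ _ (contDiff_balancedPrimitive hθ) hsupp.1 hsupp.2] with t ht
    exact ⟨θ, hθ.continuous, hFθ, ht⟩
  filter_upwards [hrel, ae_intervalIntegrable_of_rect (hgL.integrable (by norm_num))] with t h1 h2
  obtain ⟨f, hf, hd⟩ := SkorohodPath.isAC_ev hw t
  have hf0 := fun x => (hf x).1
  have hprim : ∀ x : ℝ, 0 ≤ x → ∫ y in (0)..x, g t y = ∫ y in Ioc (0 : ℝ) x, g t y := fun x hx =>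
    iint_of_le hx
  have hfu : f =ᵐ[volume] fun x : I => c t + ∫ y in (0)..x, g t y := by
    refine ae_eq_of_weak_gradient hd.1 hf h2 hD (fun F hF => ?_) ?_
    · obtain ⟨θ, hθ, hFθ, hr⟩ := h1 F hF
      refine ⟨θ, hθ, hFθ, ?_⟩
      rw [← hr, hd.integral_eq hf0]
    · simp only [hc]; rw [hd.integral_eq hf0]
      congr 1
      refine iint_congr fun x hx => ?_
      rw [uIcc01] at hx; rw [hprim x hx.1]
  have cū : ContinuousOn (ū t) 𝕁 := by
    have := intervalIntegral.continuousOn_primitive_interval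
      ((intervalIntegrable_iff' (by simp)).1 h2)
    rw [uIcc01] at this
    refine continuousOn_const.add (this.congr fun x hx => (hprim x hx.1).symm)
  have hfu' : f =ᵐ[volume] fun x : I => ū t x := by
    filter_upwards [hfu] with x hx
    rw [hx, hprim x x.2.1]
  have heq : EqOn (fun x => max 0 (min 1 (ū t x))) (ū t) 𝕁 := by
    refine Measure.eqOn_Icc_of_ae_eq volume zero_ne_one ?_
      (continuousOn_const.sup (continuousOn_const.inf cū)) cū
    refine (ae_restrict_iff_subtype measurableSet_Icc).2 ?_
    filter_upwards [hfu'] with x hx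
    rw [← hx, min_eq_right (hf x).2, max_eq_right (hf x).1]
  refine ⟨hd.congr (hfu'.trans (.of_forall fun x => (heq x.2).symm)), h2, fun x hx => ?_⟩
  have e1 := heq hx
  have e0 := heq (left_mem_Icc.2 (zero_le_one' ℝ))
  beta_reduce at e1 e0
  rw [e1, e0, hprim x hx.1]; simp [hū]

/-! ### The rate functional in terms of the action -/

theorem ContinuousOn.clamp (hT : 0 ≤ T) (hF : ContinuousOn ⇈F (Icc 0 T ×ˢ 𝕁)) :
    Continuous fun p : ℝ² => F (projIcc 0 T hT p.1) (𝕡 p.2) := by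
  have h1 : Continuous fun p : ℝ² => ((projIcc 0 T hT p.1 : ℝ), (𝕡 p.2 : ℝ)) :=
    (continuous_subtype_val.comp (continuous_projIcc.comp continuous_fst)).prodMk
      (continuous_subtype_val.comp (continuous_projIcc.comp continuous_snd))
  exact hF.comp_continuous h1 fun p => ⟨(projIcc 0 T hT p.1).2, (𝕡 p.2).2⟩

namespace C12

/-- A `C^{1,2}` function, extended continuously to the plane. -/
def toTest (hT : 0 ≤ T) (H : C12 T) : SpaceTimeTest T where
  h t x := H.toFun (projIcc 0 T hT t) (𝕡 x)
  ht t x := H.dt (projIcc 0 T hT t) (𝕡 x)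
  hx t x := H.dx (projIcc 0 T hT t) (𝕡 x)
  cont := H.cont.clamp hT
  cont_t := H.cont_dt.clamp hT
  cont_x := H.cont_dx.clamp hT
  has_t t ht x hx := by
    rw [projIcc_of_mem hT ht, projIcc_of_mem zero_le_one hx]
    exact (H.has_dt t ht x hx).congr_of_mem (fun s hs => by rw [projIcc_of_mem hT hs]) ht
  has_x t ht x hx := by
    rw [projIcc_of_mem hT ht, projIcc_of_mem zero_le_one hx]
    exact (H.has_dx t ht x hx).congr_of_mem (fun y hy => by rw [projIcc_of_mem zero_le_one hy]) hx

theorem toTest_h (hT : 0 ≤ T) (H : C12 T) (ht : t ∈ Icc 0 T) (hx : x ∈ 𝕁) :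
    (H.toTest hT).h t x = H.toFun t x := by
  simp only [toTest, projIcc_of_mem hT ht, projIcc_of_mem zero_le_one hx]

theorem toTest_ht (hT : 0 ≤ T) (H : C12 T) (ht : t ∈ Icc 0 T) (hx : x ∈ 𝕁) :
    (H.toTest hT).ht t x = H.dt t x := by
  simp only [toTest, projIcc_of_mem hT ht, projIcc_of_mem zero_le_one hx]

theorem toTest_hx (hT : 0 ≤ T) (H : C12 T) (ht : t ∈ Icc 0 T) (hx : x ∈ 𝕁) :
    (H.toTest hT).hx t x = H.dx t x := by
  simp only [toTest, projIcc_of_mem hT ht, projIcc_of_mem zero_le_one hx]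

end C12

theorem IsPath.mobility_rect (hp : IsPath a b u g) (K : SpaceTimeTest T) :
    Integrable (fun p : ℝ² => u p.1 p.2 * (1 - u p.1 p.2) * K.hx p.1 p.2 ^ 2) (rectMeasure a b) :=
  (Integrable.continuous_mul_rect (F := fun p => K.hx p.1 p.2 ^ 2) (K.cont_x.pow 2)
    hp.integrable_mobility).congr (.of_forall fun _ => mul_comm _ _)

theorem bdryVal_eq {u : ℝ → ℝ} (hu : ContinuousOn u 𝕁) (h0 : ∀ x ∈ 𝕁, 0 ≤ u x)
    (h : (w.ev hT t).HasDensity fun x : I => u x) (x₀ : I) : bdryVal hT w x₀ t = u x₀ :=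
  contVal_eq ⟨fun x : I => u x, continuousOn_iff_continuous_domRestrict.1 hu⟩
    (h.dens_ae fun x => h0 x x.2).symm x₀

/-- The functional `J_{T,H}` as an action. -/
theorem functionalJ_eq (α β A B : ℝ) (hp : IsPath 0 T u g)
    (hae : ∀ᵐ t ∂(volume.restrict (Ioc 0 T)), (w.ev hT t).HasDensity (fun x : I => u t x) ∧
      IvlInt (g t) 0 1 ∧ ∀ x ∈ 𝕁, u t x = u t 0 + ∫ y in (0)..x, g t y) (H : C12 T) :
    functionalJ α β A B hT H w
      = (∫ x : I, H.toFun T x ∂(w.ev hT T).meas) - (∫ x : I, H.toFun 0 x ∂(w.ev hT 0).meas)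
        + ∫ t in (0)..T, rateDensity α β A B (H.toTest hT.le) t (u t) (g t) := by
  set K := H.toTest hT.le with hK
  have int_u : ∀ {F : ℝ → ℝ → ℝ}, (Continuous ⇈F) →
      Integrable (fun p : ℝ² => u p.1 p.2 * F p.1 p.2) (rectMeasure 0 T) := fun hF =>
    (Integrable.continuous_mul_rect hF hp.integrable_u).congr
      (.of_forall fun p => mul_comm _ _)
  have int_g : Integrable (fun p : ℝ² => g p.1 p.2 * K.hx p.1 p.2) (rectMeasure 0 T) :=
    (Integrable.continuous_mul_rect K.cont_x hp.integrable_g).congr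
      (.of_forall fun p => mul_comm _ _)
  have iu : ∀ x ∈ 𝕁, IvlInt (fun t => u t x * K.hx t x) 0 T := by
    intro x hx
    refine (intervalIntegrable_of_measurable_of_bound (C := 1) hT.le
      (measurable_slice_left hp.meas x) fun t ht => ?_).mul_continuousOn
      (K.cont_x.comp (by fun_prop : Continuous fun t : ℝ => (t, x))).continuousOn
    have := hp.mem t ht x hx
    rw [abs_of_nonneg this.1]; exact this.2
  have i1 := intervalIntegrable_integral_of_rect hT.le (F := fun t x => u t x * K.ht t x)
    (int_u K.cont_t)
  have i3 := iu 1 (by simp)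
  have i4 := iu 0 (by simp)
  have ig := intervalIntegrable_integral_of_rect hT.le (F := fun t x => g t x * K.hx t x) int_g
  have i5 := intervalIntegrable_integral_of_rect hT.le
    (F := fun t x => u t x * (1 - u t x) * K.hx t x ^ 2) (hp.mobility_rect K)
  have i6 := hp.intervalIntegrable_bdryDensity hT.le α β A B K
  have congr : ∀ {f f' : ℝ → ℝ}, (∀ᵐ t ∂(volume.restrict (Ioc 0 T)), f t = f' t) →
      ∫ t in (0)..T, f t = ∫ t in (0)..T, f' t := fun h => by
    rw [iint_of_le hT.le, iint_of_le hT.le]; exact integral_congr_ae h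
  have hmem := ae_restrict_mem (μ := volume) (measurableSet_Ioc (a := (0 : ℝ)) (b := T))
  have hcu : ∀ {t : ℝ}, IvlInt (g t) 0 1 → (∀ x ∈ 𝕁, u t x = u t 0 + ∫ y in (0)..x, g t y) →
      ContinuousOn (u t) 𝕁 := by
    intro t h1 h2
    have := intervalIntegral.continuousOn_primitive_interval
      ((intervalIntegrable_iff' (by simp)).1 h1)
    rw [uIcc01] at this; exact (continuousOn_const.add this).congr h2
  have hpair : ∀ {t : ℝ}, t ∈ Ioc 0 T → (w.ev hT t).HasDensity (fun x : I => u t x) →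
      ∀ F : ℝ → ℝ, ∫ x : I, F x ∂(w.ev hT t).meas = ∫ x in (0)..1, u t x * F x := by
    intro t ht hd F
    rw [hd.integral_eq (fun x => (hp.mem t ht x x.2).1) (fun x : I => F x),
      integral_unitInterval (fun x => u t x * F x)]
  have e1 : ∫ t in (0)..T, ∫ x : I, H.dt t x ∂(w.ev hT t).meas
      = ∫ t in (0)..T, ∫ x in (0)..1, u t x * K.ht t x := by
    refine congr ?_
    filter_upwards [hae, hmem] with t ht htm
    rw [hpair htm ht.1]
    refine iint_congr fun x hx => ?_
    rw [uIcc01] at hx; rw [hK, H.toTest_ht hT.le (Ioc_subset_Icc_self htm) hx]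
  have e2 : ∫ t in (0)..T, ∫ x : I, H.dxx t x ∂(w.ev hT t).meas
      = ∫ t in (0)..T, (u t 1 * K.hx t 1 - u t 0 * K.hx t 0 - ∫ x in (0)..1, g t x * K.hx t x) := by
    refine congr ?_
    filter_upwards [hae, hmem] with t ht htm
    have htI := Ioc_subset_Icc_self htm
    have cxx : ContinuousOn (H.dxx t) 𝕁 := H.cont_dxx.slice htI
    have ibp := integral_primitive_mul_deriv ht.2.1 (H.has_dxx t htI)
      (intble01 cxx)
    rw [hpair htm ht.1]
    have s1 : ∫ x in (0)..1, u t x * H.dxx t x = u t 0 * (∫ x in (0)..1, H.dxx t x)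
        + ∫ x in (0)..1, (∫ y in (0)..x, g t y) * H.dxx t x := by
      have cprim := intervalIntegral.continuousOn_primitive_interval
        ((intervalIntegrable_iff' (by simp)).1 ht.2.1)
      rw [uIcc01] at cprim
      rw [← iint_const_mul, ← iint_add ((intble01 cxx).const_mul _) (intble01 (cprim.fun_mul cxx))]
      refine iint_congr fun x hx => ?_
      rw [uIcc01] at hx; rw [ht.2.2 x hx]; ring
    have s2 : ∫ x in (0)..1, g t x * H.dx t x = ∫ x in (0)..1, g t x * K.hx t x := by
      refine iint_congr fun x hx => ?_
      rw [uIcc01] at hx; rw [hK, H.toTest_hx hT.le htI hx]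
    rw [s1, ibp, s2, integral_deriv_Icc zero_le_one (H.has_dxx t htI)
      (intble01 cxx), ht.2.2 1 (by simp),
      hK, H.toTest_hx hT.le htI (by simp), H.toTest_hx hT.le htI (by simp)]
    ring
  have ebv : ∀ x₀ : I, ∀ᵐ t ∂(volume.restrict (Ioc 0 T)), bdryVal hT w x₀ t = u t x₀ := by
    intro x₀
    filter_upwards [hae, hmem] with t ht htm
    exact bdryVal_eq (hcu ht.2.1 ht.2.2) (fun x hx => (hp.mem t htm x hx).1) ht.1 x₀
  have e3 : ∀ x₀ : I, ∫ t in (0)..T, bdryVal hT w x₀ t * H.dx t x₀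
      = ∫ t in (0)..T, u t x₀ * K.hx t x₀ := by
    intro x₀
    refine congr ?_
    filter_upwards [ebv x₀, hmem] with t ht htm
    rw [ht, hK, H.toTest_hx hT.le (Ioc_subset_Icc_self htm) x₀.2]
  have e5 : ∫ t in (0)..T, ∫ x : I, mobility ((w.ev hT t).dens x) * H.dx t x ^ 2
      = ∫ t in (0)..T, ∫ x in (0)..1, u t x * (1 - u t x) * K.hx t x ^ 2 := by
    refine congr ?_
    filter_upwards [hae, hmem] with t ht htm
    rw [← integral_unitInterval (fun x => u t x * (1 - u t x) * K.hx t x ^ 2)]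
    refine integral_congr_ae ?_
    filter_upwards [ht.1.dens_ae fun x => (hp.mem t htm x x.2).1] with x hx
    rw [hx, mobility, hK, H.toTest_hx hT.le (Ioc_subset_Icc_self htm) x.2]
  have e6 : ∫ t in (0)..T, (bdryB α A (bdryVal hT w 0 t) (H.toFun t 0)
      + bdryB β B (bdryVal hT w 1 t) (H.toFun t 1))
      = ∫ t in (0)..T, bdryDensity α β A B K t (u t 0) (u t 1) := by
    refine congr ?_
    filter_upwards [ebv 0, ebv 1, hmem] with t h0 h1 htm
    rw [h0, h1, bdryDensity, hK, H.toTest_h hT.le (Ioc_subset_Icc_self htm) (by simp),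
      H.toTest_h hT.le (Ioc_subset_Icc_self htm) (by simp), Icc.coe_zero, Icc.coe_one]
  have e30 := e3 0
  have e31 := e3 1
  rw [Icc.coe_zero] at e30; rw [Icc.coe_one] at e31
  have er : ∫ t in (0)..T, rateDensity α β A B K t (u t) (g t)
      = ∫ t in (0)..T, ((∫ x in (0)..1, g t x * K.hx t x) - (∫ x in (0)..1, u t x * K.ht t x)
        - (∫ x in (0)..1, u t x * (1 - u t x) * K.hx t x ^ 2)
        - bdryDensity α β A B K t (u t 0) (u t 1)) := by
    refine congr ?_
    filter_upwards [ae_intervalIntegrable_of_rect (F := fun t x => u t x * K.ht t x)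
      (int_u K.cont_t), ae_intervalIntegrable_of_rect (F := fun t x => g t x * K.hx t x) int_g,
      ae_intervalIntegrable_of_rect (F := fun t x => u t x * (1 - u t x) * K.hx t x ^ 2)
        (hp.mobility_rect K)] with t h1 h2 h3
    rw [rateDensity, ← iint_sub h2 h1, ← iint_sub (h2.sub_fun h1) h3]
    congr 1
    refine iint_congr fun x _ => ?_
    simp only [bulkDensity]; ring
  rw [er, functionalJ, e1, e2, e30, e31, e5, e6, iint_sub (i3.sub_fun i4) ig, iint_sub i3 i4,
    iint_sub ((ig.sub_fun i1).sub_fun i5) i6, iint_sub (ig.sub_fun i1) i5, iint_sub ig i1]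
  ring

/-! ### Restriction and time shift of paths of finite rate -/

namespace C12

/-- The time shift of a test function. -/
def shift {d : ℝ} (hd : 0 ≤ d) (H : C12 T) : C12 (T - d) :=
  have hm : MapsTo (fun p : ℝ² => (p.1 + d, p.2)) (Icc 0 (T - d) ×ˢ 𝕁)
      (Icc 0 T ×ˢ 𝕁) := fun p hp =>
    ⟨⟨by linarith [hp.1.1], by linarith [hp.1.2]⟩, hp.2⟩
  have hc : ContinuousOn (fun p : ℝ² => (p.1 + d, p.2)) (Icc 0 (T - d) ×ˢ 𝕁) := by
    fun_prop
  have ht : ∀ {t : ℝ}, t ∈ Icc 0 (T - d) → t + d ∈ Icc 0 T := fun ht =>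
    ⟨by linarith [ht.1], by linarith [ht.2]⟩
  { toFun := fun s x => H.toFun (s + d) x
    dt := fun s x => H.dt (s + d) x
    dx := fun s x => H.dx (s + d) x
    dxx := fun s x => H.dxx (s + d) x
    cont := H.cont.comp hc hm
    cont_dt := H.cont_dt.comp hc hm
    cont_dx := H.cont_dx.comp hc hm
    cont_dxx := H.cont_dxx.comp hc hm
    has_dt := fun t h x hx => by
      have h1 := (H.has_dt (t + d) (ht h) x hx).comp t
        ((hasDerivWithinAt_id t (Icc 0 (T - d))).add_const d) fun s hs => ht hs
      simpa [Function.comp_def] using h1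
    has_dx := fun t h x hx => H.has_dx _ (ht h) x hx
    has_dxx := fun t h x hx => H.has_dxx _ (ht h) x hx }

/-- A test function on `[0,S]×[0,1]` multiplied by a time cutoff which vanishes near `S`. -/
def cutoff {S c : ℝ} (hS : 0 ≤ S) (H : C12 S) (ζ ζ' : ℝ → ℝ) (hζ : ∀ t, HasDerivAt ζ (ζ' t) t)
    (hζ' : Continuous ζ') (hc : c < S) (hz : ∀ t, c ≤ t → ζ t = 0 ∧ ζ' t = 0) (T : ℝ) : C12 T :=
  have cζ : Continuous ζ := continuous_iff_continuousAt.2 fun t => (hζ t).continuousAt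
  have hm : ∀ {F : ℝ → ℝ → ℝ}, ContinuousOn ⇈F (Icc 0 S ×ˢ 𝕁) →
      ContinuousOn (fun p : ℝ² => F (projIcc 0 S hS p.1) p.2) (Icc 0 T ×ˢ 𝕁) := fun hF => by
    have h1 : Continuous fun p : ℝ² => ((projIcc 0 S hS p.1 : ℝ), p.2) :=
      (continuous_subtype_val.comp (continuous_projIcc.comp continuous_fst)).prodMk continuous_snd
    exact hF.comp h1.continuousOn fun p hp => ⟨(projIcc 0 S hS p.1).2, hp.2⟩
  { toFun := fun s x => ζ s * H.toFun (projIcc 0 S hS s) x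
    dt := fun s x => ζ' s * H.toFun (projIcc 0 S hS s) x + ζ s * H.dt (projIcc 0 S hS s) x
    dx := fun s x => ζ s * H.dx (projIcc 0 S hS s) x
    dxx := fun s x => ζ s * H.dxx (projIcc 0 S hS s) x
    cont := (cζ.comp continuous_fst).continuousOn.fun_mul (hm H.cont)
    cont_dt := ((hζ'.comp continuous_fst).continuousOn.fun_mul (hm H.cont)).fun_add
      ((cζ.comp continuous_fst).continuousOn.fun_mul (hm H.cont_dt))
    cont_dx := (cζ.comp continuous_fst).continuousOn.fun_mul (hm H.cont_dx)
    cont_dxx := (cζ.comp continuous_fst).continuousOn.fun_mul (hm H.cont_dxx)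
    has_dt := fun t ht x hx => by
      rcases lt_or_ge t S with h | h
      · have htS : t ∈ Icc 0 S := ⟨ht.1, h.le⟩
        have h1 : HasDerivWithinAt (fun s => H.toFun (projIcc 0 S hS s) x)
            (H.dt (projIcc 0 S hS t) x) (Icc 0 S) t := by
          rw [projIcc_of_mem hS htS]
          exact (H.has_dt t htS x hx).congr_of_mem (fun s hs => by rw [projIcc_of_mem hS hs]) htS
        have h2 : Icc 0 S ∈ 𝓝[Icc 0 T] t := by
          filter_upwards [self_mem_nhdsWithin, mem_nhdsWithin_of_mem_nhds (Iio_mem_nhds h)]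
            with s hs hs'
          exact ⟨hs.1, le_of_lt hs'⟩
        exact (hζ t).hasDerivWithinAt.fun_mul (h1.mono_of_mem_nhdsWithin h2)
      · rw [(hz t (hc.le.trans h)).1, (hz t (hc.le.trans h)).2, zero_mul, zero_mul, add_zero]
        refine ((hasDerivAt_const t (0 : ℝ)).congr_of_eventuallyEq ?_).hasDerivWithinAt
        filter_upwards [Ioi_mem_nhds (hc.trans_le h)] with s hs
        rw [(hz s (le_of_lt hs)).1, zero_mul]
    has_dx := fun t _ x hx => (H.has_dx _ (projIcc 0 S hS t).2 x hx).const_mul _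
    has_dxx := fun t _ x hx => (H.has_dxx _ (projIcc 0 S hS t).2 x hx).const_mul _ }

end C12

theorem bdryB_mul_le {M : ℝ} (hD : 0 < D) (hϱ : ϱ ∈ 𝕁) (ha : a ∈ 𝕁)
    (hθ : θ ∈ 𝕁) : bdryB ϱ D a (θ * M) ≤ θ * bdryB ϱ D a M := by
  have key : ∀ N : ℝ, exp (θ * N) - 1 ≤ θ * (exp N - 1) := fun N => by
    have := convexOn_exp.2 (mem_univ N) (mem_univ 0) hθ.1 (sub_nonneg.2 hθ.2) (by ring)
    simp only [smul_eq_mul, mul_zero, add_zero, Real.exp_zero, mul_one] at this; linarith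
  have h1 := mul_le_mul_of_nonneg_left (key M) (mul_nonneg (sub_nonneg.2 ha.2) hϱ.1)
  have h2 := mul_le_mul_of_nonneg_left (key (-M)) (mul_nonneg ha.1 (sub_nonneg.2 hϱ.2))
  rw [mul_neg] at h2; rw [bdryB, bdryB, mul_left_comm]
  refine mul_le_mul_of_nonneg_left ?_ (one_div_pos.2 hD).le
  linarith

namespace SkorohodPath

theorem continuous_integral_ev_param
    (hw : ∀ F : C(I, ℝ), Continuous fun t => ∫ x, F x ∂(w.ev hT t).meas) (hF : Continuous ⇈F) :
    Continuous fun t => ∫ x : I, F t x ∂(w.ev hT t).meas := by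
  set Φ : C(ℝ, C(I, ℝ)) := ContinuousMap.curry ⟨fun p : ℝ × I => F p.1 p.2,
    hF.comp (continuous_fst.prodMk (continuous_subtype_val.comp continuous_snd))⟩ with hΦ
  rw [Metric.continuous_iff']
  intro t ε hε
  have h1 : ∀ᶠ s in 𝓝 t, dist (Φ s) (Φ t) < ε / 2 :=
    Metric.continuous_iff'.1 Φ.continuous t _ (half_pos hε)
  have h2 : ∀ᶠ s in 𝓝 t, dist (∫ x, Φ t x ∂(w.ev hT s).meas) (∫ x, Φ t x ∂(w.ev hT t).meas)
      < ε / 2 := Metric.continuous_iff'.1 (hw (Φ t)) t _ (half_pos hε)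
  filter_upwards [h1, h2] with s hs1 hs2
  have h3 : dist (∫ x, Φ s x ∂(w.ev hT s).meas) (∫ x, Φ t x ∂(w.ev hT s).meas) ≤ dist (Φ s) (Φ t) := by
    rw [Real.dist_eq, ← integral_sub ((Φ s).continuous.integrable_of_hasCompactSupport
      (HasCompactSupport.of_compactSpace _)) ((Φ t).continuous.integrable_of_hasCompactSupport
      (HasCompactSupport.of_compactSpace _))]
    exact (w.ev hT s).abs_integral_le fun x => by
      rw [← Real.dist_eq]; exact ContinuousMap.dist_apply_le_dist x
  calc _ ≤ dist (∫ x, Φ s x ∂(w.ev hT s).meas) (∫ x, Φ t x ∂(w.ev hT s).meas)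
        + dist (∫ x, Φ t x ∂(w.ev hT s).meas) (∫ x, Φ t x ∂(w.ev hT t).meas) := dist_triangle _ _ _
    _ < ε := by linarith

end SkorohodPath

theorem IsVersion.isPath (h : IsVersion hT w u g) : IsPath 0 T u g :=
  ⟨h.meas, h.meas_x, fun t _ x _ => h.mem t x, h.memLp⟩

theorem integral_h_of_density {u : ℝ → ℝ} (h : (w.ev hT t).HasDensity fun x : I => u x) (h0 : ∀ x : I, 0 ≤ u x)
    (F : ℝ → ℝ) : ∫ x : I, F x ∂(w.ev hT t).meas = ∫ x in (0)..1, u x * F x := by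
  rw [h.integral_eq h0 (fun x : I => F x), integral_unitInterval (fun x => u x * F x)]

/-- The rate functional dominates the truncated action. -/
theorem IsVersion.truncated_le {I₀ : ℝ} (hA : 0 < A) (hB : 0 < B)
    (hα : α ∈ 𝕁) (hβ : β ∈ 𝕁) (hv : IsVersion hT w u g)
    (hw : ∀ F : C(I, ℝ), Continuous fun t => ∫ x, F x ∂(w.ev hT t).meas)
    (hI : ∀ H, functionalJ α β A B hT H w ≤ I₀) {S : ℝ} (hS : 0 < S) (hST : S ≤ T) (H : C12 S) :
    (∫ x : I, H.toFun S x ∂(w.ev hT S).meas) - (∫ x : I, H.toFun 0 x ∂(w.ev hT 0).meas)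
      + ∫ t in (0)..S, rateDensity α β A B (H.toTest hS.le) t (u t) (g t) ≤ I₀ := by
  set K := H.toTest hS.le with hK
  set m : ℝ → ℝ := fun t => ∫ x : I, K.h t x ∂(w.ev hT t).meas with hm
  set R : ℝ → ℝ := fun t => rateDensity α β A B K t (u t) (g t) with hR
  have hp := hv.isPath
  have hpS := hp.mono le_rfl hST
  have cm : Continuous m := SkorohodPath.continuous_integral_ev_param hw K.cont
  have iR : IvlInt R 0 S := hpS.intervalIntegrable_rateDensity hS.le α β A B K
  have hm0 : m 0 = ∫ x : I, H.toFun 0 x ∂(w.ev hT 0).meas :=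
    integral_congr_ae (.of_forall fun x => H.toTest_h hS.le ⟨le_rfl, hS.le⟩ x.2)
  have hmS : m S = ∫ x : I, H.toFun S x ∂(w.ev hT S).meas :=
    integral_congr_ae (.of_forall fun x => H.toTest_h hS.le ⟨hS.le, le_rfl⟩ x.2)
  rw [← hm0, ← hmS]
  have main : ∀ e, 0 < e → 2 * e < S → (∫ t in (0)..S, timeBump (S - 2 * e) e t * m t) - m 0
      + ∫ t in (0)..S, (1 - timeStep (S - 2 * e) e t) * R t ≤ I₀ := by
    intro e he heS
    set ζ : ℝ → ℝ := fun t => 1 - timeStep (S - 2 * e) e t with hζ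
    set ζ' : ℝ → ℝ := fun t => -timeBump (S - 2 * e) e t with hζ'
    have hζm : ∀ t, ζ t ∈ 𝕁 := fun t => by
      have := timeStep_mem (s := S - 2 * e) he t
      exact ⟨sub_nonneg.2 this.2, sub_le_self _ this.1⟩
    have hz : ∀ t, S - e ≤ t → ζ t = 0 ∧ ζ' t = 0 := fun t ht => by
      refine ⟨?_, ?_⟩
      · simp only [hζ]; rw [timeStep_eq_one he (by linarith), sub_self]
      · simp only [hζ']; rw [timeBump_eq_zero (fun h => by linarith [h.2]), neg_zero]
    set H' := H.cutoff hS.le ζ ζ' (fun t => (hasDerivAt_timeStep _ _ t).const_sub 1)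
      (continuous_timeBump _ _).neg (by linarith : S - e < S) hz T with hH'
    set K' := H'.toTest hT.le with hK'
    have hJ := hI H'
    rw [functionalJ_eq α β A B hp hv.ae H'] at hJ
    have iR' := hp.intervalIntegrable_rateDensity hT.le α β A B K'
    have z1 : ∫ x : I, H'.toFun T x ∂(w.ev hT T).meas = 0 := by
      simp only [hH', C12.cutoff, (hz T (by linarith)).1, zero_mul, integral_zero]
    have z2 : ∫ x : I, H'.toFun 0 x ∂(w.ev hT 0).meas = m 0 := by
      refine integral_congr_ae (.of_forall fun x => ?_)
      simp only [hH', C12.cutoff, hζ, hK, C12.toTest, projIcc_val]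
      rw [timeStep_eq_zero (by linarith)]; ring
    have z3 : ∫ t in S..T, rateDensity α β A B K' t (u t) (g t) = 0 := by
      rw [iint_of_le hST]
      refine setIntegral_eq_zero_of_forall_eq_zero fun t ht => ?_
      have htT : t ∈ Icc 0 T := ⟨hS.le.trans ht.1.le, ht.2⟩
      have e1 : ∀ x ∈ 𝕁, K'.h t x = 0 ∧ K'.ht t x = 0 ∧ K'.hx t x = 0 := fun x hx => by
        rw [hK', H'.toTest_h hT.le htT hx, H'.toTest_ht hT.le htT hx, H'.toTest_hx hT.le htT hx]
        simp [hH', C12.cutoff, (hz t (by linarith [ht.1])).1, (hz t (by linarith [ht.1])).2]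
      rw [rateDensity, bdryDensity, (e1 0 (by simp)).1, (e1 1 (by simp)).1]
      have e2 : ∫ x in (0)..1, bulkDensity K' t x (u t x) (g t x) = 0 := by
        refine (iint_congr fun x hx => ?_).trans
          intervalIntegral.integral_zero
        rw [uIcc01] at hx; simp [bulkDensity, (e1 x hx).2.1, (e1 x hx).2.2]
      rw [e2]; simp [bdryB]
    have i1 : IvlInt (fun t => timeBump (S - 2 * e) e t * m t) 0 S :=
      ((continuous_timeBump _ _).mul cm).intervalIntegrable _ _
    have i2 : IvlInt (fun t => ζ t * R t) 0 S :=
      iR.continuousOn_mul (continuous_const.sub (continuous_timeStep _ _)).continuousOn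
    have low : ∫ t in (0)..S, (timeBump (S - 2 * e) e t * m t + ζ t * R t)
        ≤ ∫ t in (0)..S, rateDensity α β A B K' t (u t) (g t) := by
      refine iint_mono_ae hS.le
        (i1.add_fun i2) ((hp.mono le_rfl hST).intervalIntegrable_rateDensity hS.le α β A B K') ?_
      rw [← Measure.restrict_congr_set Ioc_ae_eq_Icc]
      have hmem := ae_restrict_mem (μ := volume) (measurableSet_Ioc (a := (0 : ℝ)) (b := S))
      filter_upwards [hmem, ae_mono (Measure.restrict_mono (Ioc_subset_Ioc_right hST) le_rfl) hv.ae,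
        ae_intervalIntegrable_of_rect (F := fun t x => bulkDensity K' t x (u t x) (g t x))
          (hpS.integrable_bulkDensity K'),
        ae_intervalIntegrable_of_rect (F := fun t x => bulkDensity K t x (u t x) (g t x))
          (hpS.integrable_bulkDensity K)] with t ht hd hi' hi
      have htS : t ∈ Icc 0 S := Ioc_subset_Icc_self ht
      have htT : t ∈ Icc 0 T := ⟨htS.1, htS.2.trans hST⟩
      have e1 : ∀ x ∈ 𝕁, K'.h t x = ζ t * K.h t x ∧
          K'.ht t x = ζ' t * K.h t x + ζ t * K.ht t x ∧ K'.hx t x = ζ t * K.hx t x := fun x hx => by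
        rw [hK', H'.toTest_h hT.le htT hx, H'.toTest_ht hT.le htT hx, H'.toTest_hx hT.le htT hx,
          hK, H.toTest_h hS.le htS hx, H.toTest_ht hS.le htS hx, H.toTest_hx hS.le htS hx]
        simp [hH', C12.cutoff, projIcc_of_mem hS.le htS]
      have em : m t = ∫ x in (0)..1, u t x * K.h t x :=
        integral_h_of_density hd.1 (fun x => (hv.mem t x).1) (K.h t)
      have iu : IvlInt (fun x => u t x * K.h t x) 0 1 :=
        integrable_mul_slice _ (K.cont_left t) (measurable_slice hv.meas t) fun x _ => hv.mem t x
      have b0 := bdryB_mul_le (M := K.h t 0) hA hα (hv.mem t 0) (hζm t)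
      have b1 := bdryB_mul_le (M := K.h t 1) hB hβ (hv.mem t 1) (hζm t)
      have bulk : -ζ' t * (∫ x in (0)..1, u t x * K.h t x)
          + ζ t * (∫ x in (0)..1, bulkDensity K t x (u t x) (g t x))
          ≤ ∫ x in (0)..1, bulkDensity K' t x (u t x) (g t x) := by
        rw [← iint_const_mul, ← iint_const_mul, ← iint_add (iu.const_mul _) (hi.const_mul _)]
        refine iint_mono_on zero_le_one
          ((iu.const_mul _).add_fun (hi.const_mul _)) hi' fun x hx => ?_
        rw [bulkDensity, bulkDensity, (e1 x hx).2.1, (e1 x hx).2.2]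
        have h1 := hv.mem t x
        have h2 : 0 ≤ u t x * (1 - u t x) * K.hx t x ^ 2 * (ζ t * (1 - ζ t)) :=
          mul_nonneg (mul_nonneg (mul_nonneg h1.1 (sub_nonneg.2 h1.2)) (sq_nonneg _))
            (mul_nonneg (hζm t).1 (sub_nonneg.2 (hζm t).2))
        linarith
      have hζ't : -ζ' t = timeBump (S - 2 * e) e t := by simp only [hζ', neg_neg]
      rw [hζ't] at bulk
      simp only [hR, rateDensity, bdryDensity, (e1 0 (by simp)).1, (e1 1 (by simp)).1, em]; linarith
    rw [iint_add i1 i2] at low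
    rw [z1, z2, ← iint_add_adjacent
      ((hp.mono le_rfl hST).intervalIntegrable_rateDensity hS.le α β A B K')
      ((hp.mono hS.le le_rfl).intervalIntegrable_rateDensity hST α β A B K'), z3] at hJ
    linarith
  have lim1 : Tendsto (fun e => ∫ t in (0)..S, timeBump (S - 2 * e) e t * m t) (𝓝[>] 0)
      (𝓝 (m S)) := by
    rw [Metric.tendsto_nhds]
    intro ε hε
    obtain ⟨δ, hδ, h⟩ := Metric.continuous_iff.1 cm S (ε / 2) (half_pos hε)
    filter_upwards [Ioo_mem_nhdsGT (lt_min (half_pos hδ) (half_pos hS))] with e he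
    have he1 : 2 * e < δ := by linarith [he.2.trans_le (min_le_left _ _)]
    have he2 : 2 * e < S := by linarith [he.2.trans_le (min_le_right _ _)]
    refine (abs_integral_timeBump_mul_sub_le he.1 (by linarith) (by linarith [he.1])
      (cm.intervalIntegrable _ _) (ε := ε / 2) fun τ hτ => ?_).trans_lt (half_lt_self hε)
    refine (h τ ?_).le
    rw [Real.dist_eq, abs_lt]
    constructor <;> linarith [hτ.1, hτ.2, he.1]
  have lim2 : Tendsto (fun e => ∫ t in (0)..S, (1 - timeStep (S - 2 * e) e t) * R t) (𝓝[>] 0)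
      (𝓝 (∫ t in (0)..S, R t)) := by
    refine intervalIntegral.tendsto_integral_filter_of_dominated_convergence (fun t => |R t|) ?_ ?_
      iR.abs ?_
    · refine .of_forall fun e => ?_
      exact (continuous_const.sub (continuous_timeStep _ _)).aestronglyMeasurable.mul
        (by rw [uIoc_of_le hS.le]; exact iR.1.aestronglyMeasurable)
    · filter_upwards [self_mem_nhdsWithin] with e he
      refine .of_forall fun t _ => ?_
      have := timeStep_mem (s := S - 2 * e) he t
      rw [norm_mul, norm_eq_abs, norm_eq_abs, abs_of_nonneg (sub_nonneg.2 this.2)]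
      exact mul_le_of_le_one_left (abs_nonneg _) (sub_le_self _ this.1)
    · have hne : ∀ᵐ t : ℝ, t ≠ S := by simp [ae_iff, measure_singleton]
      filter_upwards [hne] with t hne ht
      rw [uIoc_of_le hS.le] at ht
      have hlt : t < S := lt_of_le_of_ne ht.2 hne
      refine tendsto_const_nhds.congr' ?_
      filter_upwards [Ioo_mem_nhdsGT (half_pos (sub_pos.2 hlt))] with e he
      rw [timeStep_eq_zero (by linarith [he.2]), sub_zero, one_mul]
  refine le_of_tendsto ((lim1.sub_const (m 0)).add lim2) ?_
  filter_upwards [Ioo_mem_nhdsGT (half_pos hS)] with e he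
  exact main e he.1 (by linarith [he.2])

/-- The action of a time-shifted path is at most its rate. -/
theorem IsVersion.action_shift_le {I₀ : ℝ} (hA : 0 < A) (hB : 0 < B)
    (hα : α ∈ 𝕁) (hβ : β ∈ 𝕁) (hv : IsVersion hT w u g)
    (hw : ∀ F : C(I, ℝ), Continuous fun t => ∫ x, F x ∂(w.ev hT t).meas)
    (hI : ∀ H, functionalJ α β A B hT H w ≤ I₀) {d : ℝ} (hd : 0 ≤ d) (hdT : d < T) (H : C12 T) (hv0 : ∀ x : I, 0 ≤ v d x)
    (h0 : (w.ev hT 0).HasDensity fun x : I => v d x)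
    (h1 : (w.ev hT (T - d)).HasDensity fun x : I => u (T - d) x)
    (hvu : ∀ t ∈ Ioc d T, v t = u (t - d) ∧ k t = g (t - d)) :
    action α β A B (H.toTest hT.le) d T v k ≤ I₀ := by
  have hS : 0 < T - d := sub_pos.2 hdT
  have key := hv.truncated_le hA hB hα hβ hw hI hS (by linarith) (H.shift hd)
  set K := H.toTest hT.le
  have e1 : ∫ x : I, (H.shift hd).toFun (T - d) x ∂(w.ev hT (T - d)).meas
      = ∫ x in (0)..1, v T x * K.h T x := by
    rw [integral_h_of_density h1 (fun x => (hv.mem _ x).1), (hvu T ⟨hdT, le_rfl⟩).1]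
    refine iint_congr fun x hx => ?_
    rw [uIcc01] at hx; simp only [K, H.toTest_h hT.le ⟨hT.le, le_rfl⟩ hx, C12.shift, sub_add_cancel]
  have e0 : ∫ x : I, (H.shift hd).toFun 0 x ∂(w.ev hT 0).meas = ∫ x in (0)..1, v d x * K.h d x := by
    rw [integral_h_of_density h0 hv0]
    refine iint_congr fun x hx => ?_
    rw [uIcc01] at hx; simp only [K, H.toTest_h hT.le ⟨hd, hdT.le⟩ hx, C12.shift, zero_add]
  have e2 : ∫ t in d..T, rateDensity α β A B K t (v t) (k t)
      = ∫ t in (0)..(T - d), rateDensity α β A B ((H.shift hd).toTest hS.le) t (u t) (g t) := by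
    have := intervalIntegral.integral_comp_sub_right
      (fun t => rateDensity α β A B ((H.shift hd).toTest hS.le) t (u t) (g t)) d (a := d) (b := T)
    rw [sub_self] at this; rw [← this, iint_of_le hdT.le, iint_of_le hdT.le]
    refine setIntegral_congr_fun measurableSet_Ioc fun t ht => ?_
    have htT : t ∈ Icc 0 T := ⟨hd.trans ht.1.le, ht.2⟩
    have htS : t - d ∈ Icc 0 (T - d) := ⟨by linarith [ht.1], by linarith [ht.2]⟩
    have ee : ∀ x ∈ 𝕁, ((H.shift hd).toTest hS.le).h (t - d) x = K.h t x ∧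
        ((H.shift hd).toTest hS.le).ht (t - d) x = K.ht t x ∧
        ((H.shift hd).toTest hS.le).hx (t - d) x = K.hx t x := fun x hx => by
      simp only [K, H.toTest_h hT.le htT hx, H.toTest_ht hT.le htT hx, H.toTest_hx hT.le htT hx,
        C12.toTest_h _ _ htS hx, C12.toTest_ht _ _ htS hx, C12.toTest_hx _ _ htS hx, C12.shift,
        sub_add_cancel, and_self]
    rw [(hvu t ht).1, (hvu t ht).2, rateDensity, rateDensity, bdryDensity, bdryDensity,
      (ee 0 (by simp)).1, (ee 1 (by simp)).1]
    congr 1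
    refine iint_congr fun x hx => ?_
    rw [uIcc01] at hx; simp only [bulkDensity, (ee x hx).2.1, (ee x hx).2.2]
  rw [action, e2, ← e1, ← e0]; exact key

/-! ### Averaging over small delays -/

theorem timeBump_le {s e : ℝ} (he : 0 < e) (τ : ℝ) : timeBump s e τ ≤ 2 / e := by
  rw [timeBump, dif_pos he]
  refine (ContDiffBump.normed_le_div_measure_closedBall_rIn _ _ _).trans (le_of_eq ?_)
  rw [Measure.real, Real.volume_closedBall, ENNReal.toReal_ofReal (by positivity)]; field_simp
  norm_num

/-- The probability measure with density `timeBump 0 e`. -/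
def bumpMeasure (e : ℝ) : Measure ℝ := volume.withDensity fun r => ENNReal.ofReal (timeBump 0 e r)

theorem measurable_ofReal_timeBump (e : ℝ) : Measurable fun r => ENNReal.ofReal (timeBump 0 e r) :=
  (continuous_timeBump 0 e).measurable.ennreal_ofReal

theorem isProbabilityMeasure_bumpMeasure {e : ℝ} (he : 0 < e) :
    IsProbabilityMeasure (bumpMeasure e) := by
  refine ⟨?_⟩
  rw [bumpMeasure, withDensity_apply _ MeasurableSet.univ, Measure.restrict_univ,
    ← ofReal_integral_eq_lintegral_ofReal _ (.of_forall fun r => timeBump_nonneg 0 e r),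
    integral_timeBump_eq_one he, ENNReal.ofReal_one]
  by_contra h
  have := integral_timeBump_eq_one (s := 0) he
  rw [integral_undef h] at this; exact zero_ne_one this

theorem integral_bumpMeasure (e : ℝ) (f : ℝ → ℝ) :
    ∫ r, f r ∂(bumpMeasure e) = ∫ r, timeBump 0 e r * f r := by
  rw [bumpMeasure, integral_withDensity_eq_integral_toReal_smul (measurable_ofReal_timeBump e)
    (.of_forall fun _ => ENNReal.ofReal_lt_top)]
  simp only [ENNReal.toReal_ofReal (timeBump_nonneg 0 e _), smul_eq_mul]

theorem ae_bumpMeasure {e : ℝ} {P : ℝ → Prop} (h : ∀ᵐ r, r ∈ Ioo 0 e → P r) :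
    ∀ᵐ r ∂(bumpMeasure e), P r := by
  rw [bumpMeasure, ae_withDensity_iff (measurable_ofReal_timeBump e)]
  filter_upwards [h] with r hr hne
  refine hr ?_
  by_contra hcon
  exact hne (by rw [timeBump_eq_zero (by simpa using hcon), ENNReal.ofReal_zero])

/-- Lebesgue measure on `ℝ × (0,1]`. -/
abbrev stripMeasure : Measure (ℝ²) := (volume : Measure ℝ).prod (volume.restrict (Ioc 0 1))

theorem rectMeasure_eq_restrict (a b : ℝ) :
    rectMeasure a b = stripMeasure.restrict (Ioc a b ×ˢ univ) :=
  Measure.restrict_prod_eq_prod_univ _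

theorem rectMeasure_le_stripMeasure (a b : ℝ) : rectMeasure a b ≤ stripMeasure := by
  rw [rectMeasure_eq_restrict]; exact Measure.restrict_le_self

theorem measurePreserving_strip_sub (a : ℝ) :
    MeasurePreserving (fun p : ℝ² => (p.1 - a, p.2)) stripMeasure stripMeasure :=
  (measurePreserving_sub_right volume a).prod (MeasurePreserving.id _)

/-- `v` on the negative half line, read backwards, followed by `u`. -/
def gluePath (v u : ℝ → ℝ → ℝ) (s x : ℝ) : ℝ := if s ≤ 0 then v (-s) x else u s x

/-- The gradient of a glued path, cut off outside `(-T,T]`. -/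
def glueGrad (T : ℝ) (v u : ℝ → ℝ → ℝ) (s x : ℝ) : ℝ :=
  if s ∈ Ioc (-T) T then gluePath v u s x else 0

/-- The path which crosses over, at time `δ`, from `v` to `u` delayed by `2δ + r`. -/
def crossPath (δ μ : ℝ) (v u : ℝ → ℝ → ℝ) (r t x : ℝ) : ℝ :=
  (1 - timeStep δ μ t) * v t x + timeStep δ μ t * u (t - 2 * δ - r) x

theorem measurable_gluePath (hv : Measurable ⇈v) (hu : Measurable ⇈u) :
    Measurable fun p : ℝ² => gluePath v u p.1 p.2 :=
  Measurable.ite (measurableSet_le measurable_fst measurable_const)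
    (hv.comp (by fun_prop : Measurable fun p : ℝ² => (-p.1, p.2))) hu

theorem measurable_glueGrad (T : ℝ) (hv : Measurable ⇈v) (hu : Measurable ⇈u) :
    Measurable fun p : ℝ² => glueGrad T v u p.1 p.2 :=
  Measurable.ite (measurable_fst measurableSet_Ioc) (measurable_gluePath hv hu) measurable_const

theorem measurable_crossPath (δ μ : ℝ) (hv : Measurable ⇈v) (hu : Measurable ⇈u) :
    Measurable fun p : ℝ × ℝ² => crossPath δ μ v u p.1 p.2.1 p.2.2 := by
  have hc : Measurable fun p : ℝ × ℝ² => timeStep δ μ p.2.1 :=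
    (continuous_timeStep δ μ).measurable.comp (by fun_prop)
  have h1 : Measurable fun p : ℝ × ℝ² => v p.2.1 p.2.2 :=
    hv.comp (by fun_prop : Measurable fun p : ℝ × ℝ² => (p.2.1, p.2.2))
  have h2 : Measurable fun p : ℝ × ℝ² => u (p.2.1 - 2 * δ - p.1) p.2.2 :=
    hu.comp (by fun_prop : Measurable fun p : ℝ × ℝ² => (p.2.1 - 2 * δ - p.1, p.2.2))
  exact ((measurable_const.sub hc).mul h1).add (hc.mul h2)

theorem memLp_glueGrad (hT : 0 < T) (hv : MemLp (fun p : ℝ² => v (-p.1) p.2) 2 (rectMeasure (-T) 0))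
    (hu : MemLp ⇈u 2 (rectMeasure 0 T)) :
    MemLp (fun p : ℝ² => glueGrad T v u p.1 p.2) 2 stripMeasure := by
  rw [rectMeasure_eq_restrict] at hv hu
  have hm : ∀ a b : ℝ, MeasurableSet (Ioc a b ×ˢ (univ : Set ℝ)) := fun a b =>
    measurableSet_Ioc.prod MeasurableSet.univ
  refine (((memLp_indicator_iff_restrict (hm _ _)).2 hv).add
    ((memLp_indicator_iff_restrict (hm _ _)).2 hu)).ae_eq (.of_forall fun p => ?_)
  simp only [Pi.add_apply, indicator, mem_prod, mem_univ, and_true, glueGrad, gluePath, mem_Ioc]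
  by_cases h1 : p.1 ≤ 0
  · by_cases h2 : -T < p.1
    · simp [h1, h2, not_lt.2 h1, h1.trans hT.le]
    · simp [h2, not_lt.2 h1]
  · have h1' := not_le.1 h1
    by_cases h2 : p.1 ≤ T
    · simp [h1, h2, h1', (neg_lt_zero.2 hT).trans h1']
    · simp [h1, h2]

theorem MeasureTheory.MemLp.step_mul {X : Type*} [MeasurableSpace X] {ν : Measure X} {f c : X → ℝ}
    (hf : MemLp f 2 ν) (hc : Measurable c) (h : ∀ x, c x ∈ 𝕁) : MemLp (fun x => c x * f x) 2 ν := by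
  refine hf.of_le (hc.aestronglyMeasurable.mul hf.1) (.of_forall fun x => ?_)
  rw [norm_mul, norm_eq_abs, abs_of_nonneg (h x).1]
  exact mul_le_of_le_one_left (norm_nonneg _) (h x).2

theorem memLp_delay {e : ℝ} (he : 0 < e) (hk : MemLp ⇈k 2 stripMeasure) :
    MemLp (fun p : ℝ × ℝ² => k (p.2.1 - 2 * δ - p.1) p.2.2) 2
      ((bumpMeasure e).prod stripMeasure) := by
  have := isProbabilityMeasure_bumpMeasure he
  have hmp : MeasurePreserving (fun p : ℝ × ℝ² => (p.1, (p.2.1 - (2 * δ + p.1), p.2.2)))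
      ((bumpMeasure e).prod stripMeasure) ((bumpMeasure e).prod stripMeasure) :=
    MeasurePreserving.skew_product (g := fun r (q : ℝ²) => (q.1 - (2 * δ + r), q.2))
      (MeasurePreserving.id _) (by unfold Function.uncurry; fun_prop)
      (.of_forall fun r => (measurePreserving_strip_sub (2 * δ + r)).map_eq)
  have h := (hk.comp_snd (bumpMeasure e)).comp_measurePreserving hmp
  refine h.ae_eq (.of_forall fun p => ?_)
  simp only [Function.comp, sub_sub]

theorem isPathFamily_crossPath (hμ : 0 < μ) {vx : ℝ → ℝ → ℝ}
    (hv : Measurable ⇈v) (hvx : Measurable ⇈vx) (hv1 : ∀ t, ∀ x ∈ 𝕁, v t x ∈ 𝕁)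
    (hvL : MemLp ⇈vx 2 (rectMeasure 0 T)) (hu : Measurable ⇈u) (hk : Measurable ⇈k)
    (hu1 : ∀ t, ∀ x ∈ 𝕁, u t x ∈ 𝕁) (hkL : MemLp ⇈k 2 stripMeasure) :
    IsPathFamily (bumpMeasure μ) 0 T (crossPath δ μ v u) (crossPath δ μ vx k) where
  meas := measurable_crossPath δ μ hv hu
  meas_x := measurable_crossPath δ μ hvx hk
  mem r t x hx := by
    have h := timeStep_mem (s := δ) hμ t
    exact (convex_Icc (0 : ℝ) 1) (hv1 t x hx) (hu1 _ x hx) (sub_nonneg.2 h.2) h.1 (by ring)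
  memLp := by
    have := isProbabilityMeasure_bumpMeasure hμ
    have hc : Measurable fun p : ℝ × ℝ² => timeStep δ μ p.2.1 :=
      (continuous_timeStep δ μ).measurable.comp (by fun_prop)
    refine ((hvL.comp_snd (bumpMeasure μ)).step_mul (measurable_const.sub hc) fun p => ?_).add
      (((memLp_delay (δ := δ) hμ hkL).mono_measure
        (Measure.prod_mono le_rfl (rectMeasure_le_stripMeasure 0 T))).step_mul hc
        fun p => timeStep_mem hμ _)
    have := timeStep_mem (s := δ) hμ p.2.1
    exact ⟨sub_nonneg.2 this.2, sub_le_self _ this.1⟩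
  memLp_slice r := by
    have hc : Measurable fun p : ℝ² => timeStep δ μ p.1 :=
      (continuous_timeStep δ μ).measurable.comp (by fun_prop)
    have h2 : MemLp (fun p : ℝ² => k (p.1 - 2 * δ - r) p.2) 2 stripMeasure := by
      refine (hkL.comp_measurePreserving (measurePreserving_strip_sub (2 * δ + r))).ae_eq
        (.of_forall fun p => ?_)
      simp only [Function.comp, sub_sub]
    refine (hvL.step_mul (measurable_const.sub hc) fun p => ?_).add
      ((h2.mono_measure (rectMeasure_le_stripMeasure 0 T)).step_mul hc fun p => timeStep_mem hμ _)
    have := timeStep_mem (s := δ) hμ p.1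
    exact ⟨sub_nonneg.2 this.2, sub_le_self _ this.1⟩

/-! ### The action of the crossover path -/

theorem ContinuousOn.measurable_indicator {F : ℝ² → ℝ} {s : Set (ℝ²)} (hF : ContinuousOn F s)
    (hs : MeasurableSet s) : Measurable (s.indicator F) := by
  classical
  rw [← piecewise_eq_indicator]; exact hF.measurable_piecewise continuousOn_const hs

namespace HydroFlow

theorem exists_deriv_bound (h : HydroFlow α β A B ρ ρx ρt) (ha : 0 < a) :
    ∃ M, 0 ≤ M ∧ ∀ t ∈ Icc a b, ∀ x ∈ 𝕁, |ρt t x| ≤ M ∧ |ρx t x| ≤ M := by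
  have hs : Icc a b ×ˢ 𝕁 ⊆ Ioi 0 ×ˢ 𝕁 := prod_mono (fun t ht => ha.trans_le ht.1) le_rfl
  have hcpt : IsCompact (Icc a b ×ˢ 𝕁) := isCompact_Icc.prod isCompact_Icc
  obtain ⟨M₁, h₁⟩ := hcpt.exists_bound_of_continuousOn (h.cont_t.mono hs)
  obtain ⟨M₂, h₂⟩ := hcpt.exists_bound_of_continuousOn (h.cont_x.mono hs)
  exact ⟨max 0 (max M₁ M₂), le_max_left _ _, fun t ht x hx =>
    ⟨(h₁ (t, x) ⟨ht, hx⟩).trans ((le_max_left _ _).trans (le_max_right _ _)),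
      (h₂ (t, x) ⟨ht, hx⟩).trans ((le_max_right _ _).trans (le_max_right _ _))⟩⟩

theorem exists_action_crossover_le (h : HydroFlow α β A B ρ ρx ρt) (hA : 0 < A) (hB : 0 < B)
    (hα : α ∈ 𝕁ᵒ) (hβ : β ∈ 𝕁ᵒ) (hδ : 0 < δ) :
    ∃ C, ∀ (T : ℝ) (K : SpaceTimeTest T), 2 * δ ≤ T → ∀ μ ∈ Ioc 0 (δ / 2), ∀ r ∈ Ioo 0 μ,
      action α β A B K δ (δ + μ)
        (fun t x => (1 - timeStep δ μ t) * ρ t x + timeStep δ μ t * ρ (2 * δ + r - t) x)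
        (fun t x => (1 - timeStep δ μ t) * ρx t x + timeStep δ μ t * ρx (2 * δ + r - t) x)
        ≤ C * μ := by
  obtain ⟨M, hM0, hM⟩ := h.exists_deriv_bound (b := 2 * δ) (half_pos hδ)
  obtain ⟨ε, hε, hbd⟩ := h.bound (δ / 2) (half_pos hδ) (2 * δ)
  obtain ⟨C, hC, hact⟩ := exists_action_le hA hB hα hβ hε
  refine ⟨C * (1 + (6 * M) ^ 2 + M ^ 2), fun T K hT μ hμ r hr => ?_⟩
  set χ := timeStep δ μ with hχ
  set S : Set (ℝ²) := Icc (δ / 2) (2 * δ) ×ˢ 𝕁 with hS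
  have hSm : MeasurableSet S := measurableSet_Icc.prod measurableSet_Icc
  have hSs : S ⊆ Ioi 0 ×ˢ 𝕁 := prod_mono (fun t ht => (half_pos hδ).trans_le ht.1) le_rfl
  set τ : ℝ² → ℝ := S.indicator fun p => ρt p.1 p.2 with hτ
  have τm : Measurable τ := (h.cont_t.mono hSs).measurable_indicator hSm
  have τe : ∀ t ∈ Icc (δ / 2) (2 * δ), ∀ x ∈ 𝕁, τ (t, x) = ρt t x := fun t ht x hx =>
    indicator_of_mem (show (t, x) ∈ S from ⟨ht, hx⟩) _
  have hχm : ∀ t, χ t ∈ 𝕁 := fun t => timeStep_mem hμ.1 t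
  have hχc : Measurable fun p : ℝ² => χ p.1 := (continuous_timeStep δ μ).measurable.comp measurable_fst
  have t1 : ∀ t ∈ Icc δ (δ + μ), t ∈ Icc (δ / 2) (2 * δ) := fun t ht =>
    ⟨by linarith [ht.1], by linarith [ht.2, hμ.2]⟩
  have t2 : ∀ t ∈ Icc δ (δ + μ), 2 * δ + r - t ∈ Icc (δ / 2) (2 * δ) := fun t ht =>
    ⟨by linarith [ht.2, hμ.2, hr.1], by linarith [ht.1, hr.2, hμ.2]⟩
  have hrev : Measurable fun p : ℝ² => (2 * δ + r - p.1, p.2) := by fun_prop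
  have hρm := h.meas
  have hgb : ∀ t ∈ Icc δ (δ + μ), ∀ x ∈ 𝕁,
      |(1 - χ t) * ρx t x + χ t * ρx (2 * δ + r - t) x| ≤ M := by
    intro t ht x hx
    have b1 := abs_le.1 (hM t (t1 t ht) x hx).2
    have b2 := abs_le.1 (hM _ (t2 t ht) x hx).2
    exact abs_le.2 ((convex_Icc (-M) M) b1 b2 (sub_nonneg.2 (hχm t).2) (hχm t).1 (by ring))
  have gm : Measurable fun p : ℝ² => (1 - χ p.1) * ρx p.1 p.2 + χ p.1 * ρx (2 * δ + r - p.1) p.2 :=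
    ((measurable_const.sub hχc).mul h.meas_x).add (hχc.mul (h.meas_x.comp hrev))
  have hp : IsPath δ (δ + μ)
      (fun t x => (1 - χ t) * ρ t x + χ t * ρ (2 * δ + r - t) x)
      (fun t x => (1 - χ t) * ρx t x + χ t * ρx (2 * δ + r - t) x) := by
    refine ⟨((measurable_const.sub hχc).mul hρm).add (hχc.mul (hρm.comp hrev)), gm,
      fun t _ x hx => (convex_Icc (0 : ℝ) 1) (h.mem t x hx) (h.mem _ x hx)
        (sub_nonneg.2 (hχm t).2) (hχm t).1 (by ring), ?_⟩
    refine MemLp.of_bound gm.aestronglyMeasurable M ?_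
    filter_upwards [ae_rectMeasure_mem δ (δ + μ)] with p hp
    exact hgb p.1 (Ioc_subset_Icc_self hp.1) p.2 (Ioc_subset_Icc_self hp.2)
  have key := hact T K δ (δ + μ) (6 * M) _ _
    (fun t x => (1 - χ t) * τ (t, x) - χ t * τ (2 * δ + r - t, x)
      + timeBump δ μ t * (ρ (2 * δ + r - t) x - ρ t x)) hδ.le (by linarith [hμ.1])
    (by linarith [hμ.2]) hp ?_ ?_ ?_ ?_
  · refine key.trans ?_
    have hItg : ∫ t in δ..(δ + μ), ∫ x in (0)..1,
        ((1 - χ t) * ρx t x + χ t * ρx (2 * δ + r - t) x) ^ 2 ≤ ∫ t in δ..(δ + μ), M ^ 2 := by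
      have hδμ : δ ≤ δ + μ := by linarith [hμ.1]
      refine iint_mono_on hδμ (intervalIntegrable_integral_of_rect hδμ
        (F := fun t x => ((1 - χ t) * ρx t x + χ t * ρx (2 * δ + r - t) x) ^ 2)
        hp.memLp.integrable_sq) intervalIntegrable_const fun t ht => ?_
      have : ∫ x in (0)..1, ((1 - χ t) * ρx t x + χ t * ρx (2 * δ + r - t) x) ^ 2
          ≤ ∫ x in (0)..1, M ^ 2 := by
        refine intervalIntegral.integral_mono_on_of_le_Ioo zero_le_one ?_
          intervalIntegrable_const fun x hx => ?_
        · refine intervalIntegrable_of_measurable_of_bound zero_le_one (C := M ^ 2)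
            ((measurable_slice (u := fun t x => (1 - χ t) * ρx t x + χ t * ρx (2 * δ + r - t) x)
              gm t).pow_const 2) fun x hx => ?_
          rw [abs_of_nonneg (sq_nonneg _)]
          exact sq_le_sq' (abs_le.1 (hgb t ht x (Ioc_subset_Icc_self hx))).1
            (abs_le.1 (hgb t ht x (Ioc_subset_Icc_self hx))).2
        · exact sq_le_sq' (abs_le.1 (hgb t ht x (Ioo_subset_Icc_self hx))).1
            (abs_le.1 (hgb t ht x (Ioo_subset_Icc_self hx))).2
      simpa using this
    rw [iint_const, smul_eq_mul] at hItg; rw [mul_assoc]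
    refine mul_le_mul_of_nonneg_left ?_ hC
    linarith
  · intro t ht x hx
    have b1 := hbd t (t1 t ht) x hx
    have b2 := hbd _ (t2 t ht) x hx
    exact (convex_Icc ε (1 - ε)) b1 b2 (sub_nonneg.2 (hχm t).2) (hχm t).1 (by ring)
  · exact (((measurable_const.sub hχc).mul τm).sub (hχc.mul (τm.comp hrev))).add
      (((continuous_timeBump δ μ).measurable.comp measurable_fst).mul ((hρm.comp hrev).sub hρm))
  · intro t ht x hx; rw [τe t (t1 t ht) x hx, τe _ (t2 t ht) x hx]
    have b1 := abs_le.1 (hM t (t1 t ht) x hx).1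
    have b2 := abs_le.1 (hM _ (t2 t ht) x hx).1
    have b3 : |ρ (2 * δ + r - t) x - ρ t x| ≤ M * (2 * μ) := by
      have := Convex.norm_image_sub_le_of_norm_hasDerivWithin_le (f := fun s => ρ s x)
        (f' := fun s => ρt s x) (s := Icc (δ / 2) (2 * δ)) (C := M)
        (fun s hs => (h.has_t s ((half_pos hδ).trans_le hs.1) x hx).hasDerivWithinAt)
        (fun s hs => (hM s hs x hx).1) (convex_Icc _ _) (t1 t ht) (t2 t ht)
      refine this.trans (mul_le_mul_of_nonneg_left ?_ hM0)
      rw [norm_eq_abs, abs_le]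
      constructor <;> linarith [ht.1, ht.2, hr.1, hr.2]
    have b4 : |timeBump δ μ t * (ρ (2 * δ + r - t) x - ρ t x)| ≤ 4 * M := by
      rw [abs_mul, abs_of_nonneg (timeBump_nonneg _ _ _)]
      refine (mul_le_mul (timeBump_le hμ.1 t) b3 (abs_nonneg _) (by have := hμ.1; positivity)).trans
        (le_of_eq ?_)
      have := hμ.1.ne'
      field_simp; ring
    have b5 := abs_le.1 b4
    have c1 : |(1 - χ t) * ρt t x - χ t * ρt (2 * δ + r - t) x| ≤ M := by
      have b2' : -ρt (2 * δ + r - t) x ∈ Icc (-M) M := ⟨by linarith [b2.2], by linarith [b2.1]⟩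
      have := (convex_Icc (-M) M) b1 b2' (sub_nonneg.2 (hχm t).2) (hχm t).1 (by ring)
      simp only [smul_eq_mul, mul_neg, ← sub_eq_add_neg] at this; exact abs_le.2 this
    have c2 := abs_le.1 c1
    exact abs_le.2 ⟨by linarith [b5.1, c2.1], by linarith [b5.2, c2.2]⟩
  · intro x hx t ht; rw [τe t (t1 t ht) x hx, τe _ (t2 t ht) x hx]
    have p1 : 0 < t := (half_pos hδ).trans_le (t1 t ht).1
    have p2 : 0 < 2 * δ + r - t := (half_pos hδ).trans_le (t2 t ht).1
    have d0 := hasDerivAt_timeStep δ μ t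
    have d1 := h.has_t t p1 x hx
    have d2 := (h.has_t _ p2 x hx).comp t ((hasDerivAt_id t).const_sub (2 * δ + r))
    have := ((d0.const_sub 1).mul d1).add (d0.mul d2)
    refine HasDerivAt.hasDerivWithinAt (this.congr_deriv ?_)
    simp only [hχ, Function.comp]; ring

end HydroFlow

section Crossover

variable {I₀ : ℝ}

theorem gluePath_mem (h : HydroFlow α β A B ρ ρx ρt) (hv : IsVersion hT w u g) (s : ℝ)
    (hx : x ∈ 𝕁) : gluePath ρ u s x ∈ 𝕁 := by
  unfold gluePath
  split_ifs
  · exact h.mem _ x hx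
  · exact hv.mem s x

theorem memLp_glueGrad_of_version (h : HydroFlow α β A B ρ ρx ρt) (hv : IsVersion hT w u g) :
    MemLp (fun p : ℝ² => glueGrad T ρx g p.1 p.2) 2 stripMeasure := by
  refine memLp_glueGrad hT ?_ hv.memLp
  have := (h.isPath_reverse hT 0).memLp
  simpa only [zero_sub] using this

theorem isPathFamily_cross (h : HydroFlow α β A B ρ ρx ρt) (hv : IsVersion hT w u g) (δ : ℝ) (hμ : 0 < μ) : IsPathFamily (bumpMeasure μ) 0 T (crossPath δ μ ρ (gluePath ρ u))
      (crossPath δ μ ρx (glueGrad T ρx g)) :=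
  isPathFamily_crossPath hμ h.meas h.meas_x h.mem (h.memLp T hT) (measurable_gluePath h.meas hv.meas)
    (measurable_glueGrad T h.meas_x hv.meas_x) (fun s _ hx => gluePath_mem h hv s hx)
    (memLp_glueGrad_of_version h hv)

theorem ae_density_sub (hv : IsVersion hT w u g) (c : ℝ) : ∀ᵐ r : ℝ, c - r ∈ Ioc 0 T →
    (w.ev hT (c - r)).HasDensity (fun x : I => u (c - r) x) ∧ IvlInt (g (c - r)) 0 1 ∧
    ∀ x ∈ 𝕁, u (c - r) x = u (c - r) 0 + ∫ y in (0)..x, g (c - r) y :=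
  (Measure.measurePreserving_sub_left volume c).quasiMeasurePreserving.ae
    ((ae_restrict_iff' measurableSet_Ioc).1 hv.ae)

theorem action_crossPath_le (h : HydroFlow α β A B ρ ρx ρt) (hA : 0 < A) (hB : 0 < B)
    (hα : α ∈ 𝕁ᵒ) (hβ : β ∈ 𝕁ᵒ) (hv : IsVersion hT w u g)
    (hw : ∀ F : C(I, ℝ), Continuous fun t => ∫ x, F x ∂(w.ev hT t).meas)
    (hI : ∀ H, functionalJ α β A B hT H w ≤ I₀)
    (h0 : (w.ev hT 0).HasDensity fun x : I => ρ 0 x) (hδ : 0 < δ) (hδT : 4 * δ ≤ T)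
    (hμ : μ ∈ Ioc 0 (δ / 2)) (hr : r ∈ Ioo 0 μ)
    (hd : (w.ev hT (T - 2 * δ - r)).HasDensity fun x : I => u (T - 2 * δ - r) x)
    (hC : ∀ (T : ℝ) (K : SpaceTimeTest T), 2 * δ ≤ T → ∀ μ ∈ Ioc 0 (δ / 2), ∀ r ∈ Ioo 0 μ,
      action α β A B K δ (δ + μ)
        (fun t x => (1 - timeStep δ μ t) * ρ t x + timeStep δ μ t * ρ (2 * δ + r - t) x)
        (fun t x => (1 - timeStep δ μ t) * ρx t x + timeStep δ μ t * ρx (2 * δ + r - t) x)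
        ≤ C * μ) (H : C12 T) :
    action α β A B (H.toTest hT.le) 0 T (crossPath δ μ ρ (gluePath ρ u) r)
      (crossPath δ μ ρx (glueGrad T ρx g) r)
      ≤ I₀ + C * μ + (profileEntropy (ρ 0) - profileEntropy (ρ (δ + r - μ))
        + (δ + r - μ) * (|logit α| / A + |logit β| / B)) := by
  set K := H.toTest hT.le
  have hp := (isPathFamily_cross h hv δ hμ.1).isPath_slice r
  have hα' := Ioo_subset_Icc_self hα
  have hβ' := Ioo_subset_Icc_self hβ
  have l1 := hμ.1
  have l2 := hμ.2
  have l3 := hr.1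
  have l4 := hr.2
  have step0 : ∀ t, t ≤ δ → timeStep δ μ t = 0 := fun t ht => timeStep_eq_zero ht
  have step1 : ∀ t, δ + μ ≤ t → timeStep δ μ t = 1 := fun t ht => timeStep_eq_one l1 ht
  have glue : ∀ t, t ≤ 2 * δ + r → gluePath ρ u (t - 2 * δ - r) = ρ (2 * δ + r - t) := by
    intro t ht
    funext x
    rw [gluePath, if_pos (by linarith), show -(t - 2 * δ - r) = 2 * δ + r - t by ring]
  have glueG : ∀ t, 0 ≤ t → t ≤ 2 * δ + r →
      glueGrad T ρx g (t - 2 * δ - r) = ρx (2 * δ + r - t) := by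
    intro t ht0 ht
    funext x
    rw [glueGrad, if_pos ⟨by linarith, by linarith⟩, gluePath, if_pos (by linarith),
      show -(t - 2 * δ - r) = 2 * δ + r - t by ring]
  have a1 : action α β A B K 0 δ (crossPath δ μ ρ (gluePath ρ u) r)
      (crossPath δ μ ρx (glueGrad T ρx g) r) ≤ 0 := by
    have e : ∀ (v u : ℝ → ℝ → ℝ) (t : ℝ), t ≤ δ → crossPath δ μ v u r t = v t := by
      intro v u t ht
      funext x
      simp [crossPath, step0 t ht]
    rw [action_congr K hδ.le (u' := ρ) (g' := ρx) (by rw [e _ _ 0 hδ.le]) (by rw [e _ _ δ le_rfl])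
      fun t ht => ⟨e _ _ t ht.2.le, e _ _ t ht.2.le⟩]
    exact h.action_nonpos hA hB hα' hβ' K hδ (by linarith)
  have a2 : action α β A B K δ (δ + μ) (crossPath δ μ ρ (gluePath ρ u) r)
      (crossPath δ μ ρx (glueGrad T ρx g) r) ≤ C * μ := by
    have e : ∀ t ∈ Icc δ (δ + μ), crossPath δ μ ρ (gluePath ρ u) r t
        = fun x => (1 - timeStep δ μ t) * ρ t x + timeStep δ μ t * ρ (2 * δ + r - t) x := by
      intro t ht
      funext x
      rw [crossPath, glue t (by linarith [ht.2])]
    have e' : ∀ t ∈ Icc δ (δ + μ), crossPath δ μ ρx (glueGrad T ρx g) r t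
        = fun x => (1 - timeStep δ μ t) * ρx t x + timeStep δ μ t * ρx (2 * δ + r - t) x := by
      intro t ht
      funext x
      rw [crossPath, glueG t (by linarith [ht.1]) (by linarith [ht.2])]
    refine le_trans (le_of_eq ?_) (hC T K (by linarith) μ hμ r hr)
    exact action_congr K (by linarith) (by rw [e δ ⟨le_rfl, by linarith⟩])
      (by rw [e (δ + μ) ⟨by linarith, le_rfl⟩])
      fun t ht => ⟨e t (Ioo_subset_Icc_self ht), e' t (Ioo_subset_Icc_self ht)⟩
  have a3 : action α β A B K (δ + μ) (2 * δ + r) (crossPath δ μ ρ (gluePath ρ u) r)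
      (crossPath δ μ ρx (glueGrad T ρx g) r) ≤ profileEntropy (ρ 0) - profileEntropy (ρ (δ + r - μ))
        + (δ + r - μ) * (|logit α| / A + |logit β| / B) := by
    have e : ∀ t ∈ Icc (δ + μ) (2 * δ + r), crossPath δ μ ρ (gluePath ρ u) r t
        = ρ (2 * δ + r - t) := by
      intro t ht
      funext x
      rw [crossPath, glue t ht.2, step1 t ht.1]; ring
    have e' : ∀ t ∈ Icc (δ + μ) (2 * δ + r), crossPath δ μ ρx (glueGrad T ρx g) r t
        = ρx (2 * δ + r - t) := by
      intro t ht
      funext x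
      rw [crossPath, glueG t (by linarith [ht.1]) ht.2, step1 t ht.1]; ring
    have := h.action_reverse_le hA hB hα hβ K (b := δ + r - μ) (θ := 2 * δ + r) (by linarith)
      (by linarith) (by linarith)
    rw [show 2 * δ + r - (δ + r - μ) = δ + μ by ring] at this
    refine le_trans (le_of_eq ?_) this
    exact action_congr K (by linarith) (by rw [e (δ + μ) ⟨le_rfl, by linarith⟩])
      (by rw [e (2 * δ + r) ⟨by linarith, le_rfl⟩])
      fun t ht => ⟨e t (Ioo_subset_Icc_self ht), e' t (Ioo_subset_Icc_self ht)⟩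
  have e0 : crossPath δ μ ρ (gluePath ρ u) r (2 * δ + r) = ρ 0 := by
    funext x
    rw [crossPath, glue _ le_rfl, step1 _ (by linarith), sub_self, sub_self]; ring
  have a4 : action α β A B K (2 * δ + r) T (crossPath δ μ ρ (gluePath ρ u) r)
      (crossPath δ μ ρx (glueGrad T ρx g) r) ≤ I₀ := by
    refine hv.action_shift_le hA hB hα' hβ' hw hI (by linarith) (by linarith) H
      (fun x => ?_) ?_ ?_ fun t ht => ⟨?_, ?_⟩
    · rw [e0]; exact (h.mem 0 x x.2).1
    · rw [e0]; exact h0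
    · rw [show T - (2 * δ + r) = T - 2 * δ - r by ring]; exact hd
    · funext x
      rw [crossPath, gluePath, if_neg (by linarith [ht.1]), step1 _ (by linarith [ht.1]),
        show t - 2 * δ - r = t - (2 * δ + r) by ring]
      ring
    · funext x
      rw [crossPath, glueGrad, if_pos ⟨by linarith [ht.1], by linarith [ht.2]⟩, gluePath,
        if_neg (by linarith [ht.1]), step1 _ (by linarith [ht.1]),
        show t - 2 * δ - r = t - (2 * δ + r) by ring]
      ring
  rw [← action_add K (b := δ) hδ.le (by linarith) hp,
    ← action_add K (b := δ + μ) (by linarith) (by linarith) (hp.mono hδ.le le_rfl),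
    ← action_add K (b := 2 * δ + r) (by linarith) (by linarith)
      (hp.mono (by linarith : (0 : ℝ) ≤ δ + μ) le_rfl)]
  linarith

/-- The averaged crossover path has almost minimal action. -/
theorem exists_action_average_crossPath_le (h : HydroFlow α β A B ρ ρx ρt) (hA : 0 < A) (hB : 0 < B)
    (hα : α ∈ 𝕁ᵒ) (hβ : β ∈ 𝕁ᵒ) (hv : IsVersion hT w u g)
    (hw : ∀ F : C(I, ℝ), Continuous fun t => ∫ x, F x ∂(w.ev hT t).meas)
    (hI : ∀ H, functionalJ α β A B hT H w ≤ I₀)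
    (h0 : (w.ev hT 0).HasDensity fun x : I => ρ 0 x) (hε : 0 < ε) :
    ∃ δ, 0 < δ ∧ δ ≤ ε ∧ 4 * δ ≤ T ∧ ∃ μ, 0 < μ ∧ μ ≤ δ / 2 ∧ ∀ H : C12 T,
      action α β A B (H.toTest hT.le) 0 T
        (fun t x => ∫ r, crossPath δ μ ρ (gluePath ρ u) r t x ∂(bumpMeasure μ))
        (fun t x => ∫ r, crossPath δ μ ρx (glueGrad T ρx g) r t x ∂(bumpMeasure μ)) ≤ I₀ + ε := by
  set L := |logit α| / A + |logit β| / B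
  have lim : Tendsto (fun b => profileEntropy (ρ 0) - profileEntropy (ρ b) + b * L) (𝓝[>] 0)
      (𝓝 0) := by
    have := (h.tendsto_profileEntropy.const_sub (profileEntropy (ρ 0))).add
      (((continuous_id.mul_const L).tendsto (0 : ℝ)).mono_left
        (nhdsWithin_le_nhds (s := Ioi (0 : ℝ))))
    simpa using this
  obtain ⟨b₁, hb₁, hb⟩ := mem_nhdsGT_iff_exists_Ioo_subset.1
    (lim.eventually (Iic_mem_nhds (half_pos hε)))
  rw [mem_Ioi] at hb₁
  set δ := min (min ε (T / 4)) (b₁ / 2)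
  have hδ : 0 < δ := by positivity
  have d1 : δ ≤ ε := (min_le_left _ _).trans (min_le_left _ _)
  have d2 : δ ≤ T / 4 := (min_le_left _ _).trans (min_le_right _ _)
  have d3 : δ ≤ b₁ / 2 := min_le_right _ _
  obtain ⟨C, hC⟩ := h.exists_action_crossover_le hA hB hα hβ hδ
  set μ := min (δ / 2) (ε / (2 * (|C| + 1)))
  have hμ : 0 < μ := by positivity
  have m1 : μ ≤ δ / 2 := min_le_left _ _
  have m2 : C * μ ≤ ε / 2 := by
    have : μ ≤ ε / (2 * (|C| + 1)) := min_le_right _ _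
    rw [le_div_iff₀ (by positivity)] at this; nlinarith [le_abs_self C]
  refine ⟨δ, hδ, d1, by linarith, μ, hμ, m1, fun H => ?_⟩
  have := isProbabilityMeasure_bumpMeasure hμ
  refine (isPathFamily_cross h hv δ hμ).action_average_le hT.le (H.toTest hT.le) ?_
  refine ae_bumpMeasure ?_
  filter_upwards [ae_density_sub hv (T - 2 * δ)] with r hd hr
  refine (action_crossPath_le h hA hB hα hβ hv hw hI h0 hδ (by linarith) ⟨hμ, m1⟩ hr
    (hd ⟨by linarith [hr.2], by linarith [hr.1]⟩).1 hC H).trans ?_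
  have := hb (show δ + r - μ ∈ Ioo 0 b₁ from ⟨by linarith [hr.1], by linarith [hr.2]⟩)
  have h2 : profileEntropy (ρ 0) - profileEntropy (ρ (δ + r - μ)) + (δ + r - μ) * L ≤ ε / 2 := this
  linarith

end Crossover

/-! ### Approximation in space -/

/-- A square integrable function on the strip is approximated by finite sums of products of a
continuous function of time and a polynomial in space. -/
theorem exists_tensor_approx (hk : MemLp ⇈k 2 stripMeasure) {κ : ℝ} (hκ : 0 < κ) :
    ∃ (n : ℕ) (a : Fin n → ℝ → ℝ) (p : Fin n → Polynomial ℝ), (∀ i, Continuous (a i)) ∧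
      MemLp (fun z : ℝ² => ∑ i, a i z.1 * (p i).eval z.2) 2 stripMeasure ∧
      ∫ z : ℝ², ((∑ i, a i z.1 * (p i).eval z.2) - k z.1 z.2) ^ 2 ∂stripMeasure ≤ κ ^ 2 := by
  obtain ⟨f, hfs, hfi, hfc, hfL⟩ := MemLp.exists_hasCompactSupport_integral_rpow_sub_le
    (p := 2) two_pos (f := ⇈k) (by simpa using hk)
    (show 0 < κ ^ 2 / 4 by positivity)
  simp only [Real.rpow_two, norm_eq_abs, sq_abs] at hfi
  have hfL' : MemLp f 2 stripMeasure := by simpa using hfL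
  obtain ⟨R₀, hR₀⟩ := hfs.isCompact.isBounded.subset_closedBall 0
  set R := max R₀ 1
  have hR : 0 < R := lt_of_lt_of_le one_pos (le_max_right _ _)
  have hf0 : ∀ s y, s ∉ Icc (-R) R → f (s, y) = 0 := by
    intro s y hs
    by_contra hne
    have h1 := hR₀ (subset_tsupport _ (Function.mem_support.2 hne))
    rw [mem_closedBall_zero_iff] at h1
    have h2 : |s| ≤ R := (norm_fst_le (s, y)).trans (h1.trans (le_max_left _ _))
    exact hs (abs_le.1 h2)
  set κ' := κ / (4 * R)  with hκ'
  have hκ'0 : 0 < κ' := by positivity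
  set Φ : C(I, C(Icc (-R) R, ℝ)) := ContinuousMap.curry ⟨fun z : I × Icc (-R) R =>
    f (z.2, z.1), hfc.comp ((continuous_subtype_val.comp continuous_snd).prodMk
      (continuous_subtype_val.comp continuous_fst))⟩ with hΦ
  obtain ⟨n, hn⟩ := (Metric.tendstoUniformly_iff.1
    (ContinuousMap.tendsto_iff_tendstoUniformly.1 (bernsteinApproximation_uniform Φ)) κ' hκ'0).exists
  set a : Fin (n + 1) → ℝ → ℝ := fun i s => f (s, ((bernstein.z i : I) : ℝ)) with ha
  set p : Fin (n + 1) → Polynomial ℝ := fun i => bernsteinPolynomial ℝ n i with hp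
  set F : ℝ² → ℝ := fun z => ∑ i, a i z.1 * (p i).eval z.2 with hF
  have hac : ∀ i, Continuous (a i) := fun i => hfc.comp (by fun_prop)
  have hFc : Continuous F := by
    refine continuous_finsetSum _ fun i _ => ((hac i).comp continuous_fst).mul ?_
    exact (p i).continuous.comp continuous_snd
  have close : ∀ s ∈ Icc (-R) R, ∀ y ∈ 𝕁, |F (s, y) - f (s, y)| ≤ κ' := by
    intro s hs y hy
    have h1 : dist (bernsteinApproximation n Φ ⟨y, hy⟩ ⟨s, hs⟩) (Φ ⟨y, hy⟩ ⟨s, hs⟩) ≤ κ' :=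
      (ContinuousMap.dist_apply_le_dist (f := bernsteinApproximation n Φ ⟨y, hy⟩)
        (g := Φ ⟨y, hy⟩) ⟨s, hs⟩).trans
        (by rw [dist_comm]; exact (hn ⟨y, hy⟩).le)
    rw [Real.dist_eq] at h1
    convert h1 using 2
    rw [bernsteinApproximation.apply]
    simp only [hF, ha, hp, hΦ, ContinuousMap.coe_sum, Finset.sum_apply, ContinuousMap.coe_smul,
      Pi.smul_apply, smul_eq_mul, bernstein, Polynomial.toContinuousMapOn_apply,
      Polynomial.toContinuousMap_apply]
    congr 1
    refine Finset.sum_congr rfl fun i _ => ?_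
    rw [mul_comm]; rfl
  set S : Set (ℝ²) := Icc (-R) R ×ˢ univ with hS
  have hSm : MeasurableSet S := measurableSet_Icc.prod MeasurableSet.univ
  have hSv : stripMeasure S = ENNReal.ofReal (2 * R) := by
    rw [hS, Measure.prod_prod, Real.volume_Icc, Measure.restrict_apply_univ, Real.volume_Ioc]
    simp only [sub_zero, ENNReal.ofReal_one, mul_one]
    congr 1; ring
  have hmem : ∀ᵐ z ∂stripMeasure, z.2 ∈ Ioc (0 : ℝ) 1 :=
    Measure.quasiMeasurePreserving_snd.ae (ae_restrict_mem measurableSet_Ioc)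
  have hdiff : ∀ᵐ z ∂stripMeasure, |F z - f z| ≤ S.indicator (fun _ => κ') z := by
    filter_upwards [hmem] with z hz
    by_cases hzs : z.1 ∈ Icc (-R) R
    · rw [indicator_of_mem (show z ∈ S from ⟨hzs, trivial⟩)]
      exact close z.1 hzs z.2 (Ioc_subset_Icc_self hz)
    · rw [indicator_of_notMem (fun h => hzs h.1), hf0 z.1 z.2 hzs]
      simp [hF, ha, hf0 _ _ hzs]
  have hind : MemLp (S.indicator fun _ => κ') 2 stripMeasure :=
    memLp_indicator_const 2 hSm κ' (Or.inr (by rw [hSv]; exact ENNReal.ofReal_ne_top))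
  have hFf : MemLp (fun z => F z - f z) 2 stripMeasure := by
    refine hind.of_le (hFc.sub hfc).aestronglyMeasurable ?_
    filter_upwards [hdiff] with z hz
    exact hz.trans (le_abs_self _)
  have hFL : MemLp F 2 stripMeasure := (hFf.add hfL').ae_eq (.of_forall fun z => by simp)
  refine ⟨n + 1, a, p, hac, hFL, ?_⟩
  have i1 := hFf.integrable_sq
  have hkf : MemLp (fun z : ℝ² => k z.1 z.2 - f z) 2 stripMeasure := hk.sub hfL'
  have b1 : ∫ z, (F z - f z) ^ 2 ∂stripMeasure ≤ κ ^ 2 / 8 := by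
    have : ∫ z, (F z - f z) ^ 2 ∂stripMeasure ≤ ∫ z, S.indicator (fun _ => κ' ^ 2) z ∂stripMeasure := by
      refine integral_mono_ae i1 ((integrable_indicator_iff hSm).2
        (integrableOn_const (by rw [hSv]; exact ENNReal.ofReal_ne_top))) ?_
      filter_upwards [hdiff] with z hz
      by_cases hzs : z ∈ S
      · rw [indicator_of_mem hzs] at hz ⊢; rw [← sq_abs]; exact pow_le_pow_left₀ (abs_nonneg _) hz 2
      · rw [indicator_of_notMem hzs] at hz ⊢; rw [← sq_abs, le_antisymm hz (abs_nonneg _)]; norm_num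
    refine this.trans ?_
    rw [integral_indicator hSm, setIntegral_const, Measure.real, hSv,
      ENNReal.toReal_ofReal (by positivity), smul_eq_mul, hκ']
    have hR1 : 1 ≤ R := le_max_right _ _
    rw [div_pow, mul_div_assoc', div_le_div_iff₀ (by positivity) (by norm_num)]
    nlinarith [sq_nonneg κ, mul_nonneg (sq_nonneg κ) hR.le, mul_nonneg (mul_nonneg (sq_nonneg κ) hR.le) (sub_nonneg.2 hR1)]
  have i2 := hkf.integrable_sq
  calc ∫ z : ℝ², (F z - k z.1 z.2) ^ 2 ∂stripMeasure
      ≤ ∫ z : ℝ², (2 * (F z - f z) ^ 2 + 2 * (k z.1 z.2 - f z) ^ 2) ∂stripMeasure := by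
        refine integral_mono (hFL.sub hk).integrable_sq ((i1.const_mul 2).add (i2.const_mul 2))
          fun z => ?_
        beta_reduce
        nlinarith [sq_nonneg ((F z - f z) + (k z.1 z.2 - f z))]
    _ = 2 * (∫ z, (F z - f z) ^ 2 ∂stripMeasure)
        + 2 * ∫ z : ℝ², (k z.1 z.2 - f z) ^ 2 ∂stripMeasure := by
        rw [integral_add (i1.const_mul 2) (i2.const_mul 2), integral_const_mul, integral_const_mul]
    _ ≤ κ ^ 2 := by linarith [sq_nonneg κ]

/-! ### Time averages -/

section TimeAverage

theorem hasCompactSupport_timeBump (s e : ℝ) : HasCompactSupport (timeBump s e) :=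
  HasCompactSupport.of_support_subset_isCompact isCompact_Icc
    ((support_timeBump s e).trans Ioo_subset_Icc_self)

theorem integral_bump_eq_convolution (f : ℝ → ℝ) (c t : ℝ) : ∫ r, f (t - c - r) ∂(bumpMeasure μ)
      = convolution f (timeBump 0 μ) (ContinuousLinearMap.lsmul ℝ ℝ) volume (t - c) := by
  rw [integral_bumpMeasure, convolution_lsmul_swap]
  refine integral_congr_ae (.of_forall fun r => ?_)
  simp [mul_comm]

theorem contDiff_integral_bump (hf : LocallyIntegrable f volume) (c : ℝ) :
    ContDiff ℝ ∞ fun t => ∫ r, f (t - c - r) ∂(bumpMeasure μ) := by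
  simp only [integral_bump_eq_convolution]
  exact ((hasCompactSupport_timeBump 0 μ).contDiff_convolution_right
    (ContinuousLinearMap.lsmul ℝ ℝ) hf (contDiff_timeBump 0 μ)).comp
    (contDiff_id.sub contDiff_const)

theorem hasDerivAt_integral_bump (hf : LocallyIntegrable f volume) (c t : ℝ) :
    HasDerivAt (fun t => ∫ r, f (t - c - r) ∂(bumpMeasure μ))
      (∫ r, deriv (timeBump 0 μ) r * f (t - c - r)) t := by
  simp only [integral_bump_eq_convolution]
  have h := (hasCompactSupport_timeBump 0 μ).hasDerivAt_convolution_right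
    (ContinuousLinearMap.lsmul ℝ ℝ) hf ((contDiff_timeBump 0 μ).of_le (by simp)) (t - c)
  have h2 := h.comp t ((hasDerivAt_id t).sub_const c)
  rw [mul_one] at h2
  refine h2.congr_deriv ?_
  rw [convolution_lsmul_swap]
  refine integral_congr_ae (.of_forall fun r => ?_)
  simp [mul_comm]

end TimeAverage

/-! ### Error estimates for the space approximation -/

section Primitive

variable {q : ℝ → ℝ → ℝ} {κ : ℝ}

theorem ae_abs_primitive_le (hq : MemLp ⇈q 2 stripMeasure) (hκ : 0 < κ) :
    ∀ᵐ s : ℝ, ∀ x ∈ 𝕁, |∫ y in Ioc (0 : ℝ) x, q s y|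
      ≤ κ / 2 + (∫ y in Ioc (0 : ℝ) 1, q s y ^ 2) / (2 * κ) := by
  have h2 := hq.integrable_sq.prod_right_ae
  have hm := hq.1.prodMk_left
  filter_upwards [h2, hm] with s hs2 hsm x hx
  have hs1 : Integrable (q s) (volume.restrict (Ioc 0 1)) :=
    ((memLp_two_iff_integrable_sq hsm).2 hs2).integrable (by norm_num)
  have a1 : |∫ y in Ioc (0 : ℝ) x, q s y| ≤ ∫ y in Ioc (0 : ℝ) 1, |q s y| := by
    refine (abs_integral_le_integral_abs).trans ?_
    exact setIntegral_mono_set hs1.abs (.of_forall fun _ => abs_nonneg _)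
      (Ioc_subset_Ioc_right hx.2).eventuallyLE
  have a2 : ∫ y in Ioc (0 : ℝ) 1, |q s y| ≤ ∫ y in Ioc (0 : ℝ) 1, (κ / 2 + q s y ^ 2 / (2 * κ)) := by
    refine integral_mono hs1.abs ((integrable_const _).add (hs2.div_const _)) fun y => ?_
    beta_reduce
    have : 0 ≤ (|q s y| - κ) ^ 2 / (2 * κ) := by positivity
    have e : (|q s y| - κ) ^ 2 / (2 * κ) = κ / 2 + q s y ^ 2 / (2 * κ) - |q s y| := by
      rw [← sq_abs (q s y)]; field_simp; ring
    linarith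
  refine a1.trans (a2.trans (le_of_eq ?_))
  rw [integral_add (integrable_const _) (hs2.div_const _), integral_div (2 * κ)]; simp

theorem integrable_slice_sq (hq : MemLp ⇈q 2 stripMeasure) :
    Integrable fun s : ℝ => ∫ y in Ioc (0 : ℝ) 1, q s y ^ 2 := hq.integrable_sq.integral_prod_left

theorem locallyIntegrable_primitive (hqm : Measurable ⇈q)
    (hq : MemLp ⇈q 2 stripMeasure) (hx : x ∈ 𝕁) :
    LocallyIntegrable (fun s => ∫ y in Ioc (0 : ℝ) x, q s y) volume := by
  have h1 : LocallyIntegrable (fun s : ℝ => (1 : ℝ) / 2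
      + (∫ y in Ioc (0 : ℝ) 1, q s y ^ 2) / (2 * 1)) volume :=
    (locallyIntegrable_const _).add ((integrable_slice_sq hq).div_const _).locallyIntegrable
  refine h1.mono ((measurable_primitive hqm).comp
    (by fun_prop : Measurable fun s : ℝ => (s, x))).aestronglyMeasurable ?_
  filter_upwards [ae_abs_primitive_le hq one_pos] with s hs
  exact (hs x hx).trans (le_abs_self _)

theorem abs_integral_mul_primitive_le (hq : MemLp ⇈q 2 stripMeasure)
    (hκ : 0 < κ) (hqκ : ∫ p : ℝ², q p.1 p.2 ^ 2 ∂stripMeasure ≤ κ ^ 2) {ψ : ℝ → ℝ} {M : ℝ}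
    (hμ : 0 < μ) (hM : ∀ r, |ψ r| ≤ M) (hψ : ∀ r, r ∉ Ioc 0 μ → ψ r = 0) (c : ℝ) (hx : x ∈ 𝕁) :
    |∫ r, ψ r * ∫ y in Ioc (0 : ℝ) x, q (c - r) y| ≤ M * (κ * (μ + 1) / 2) := by
  have hM0 : 0 ≤ M := (abs_nonneg _).trans (hM 0)
  set S : ℝ → ℝ := fun s => ∫ y in Ioc (0 : ℝ) 1, q s y ^ 2 with hS
  have iS : Integrable S := integrable_slice_sq hq
  have hS0 : ∀ s, 0 ≤ S s := fun s => integral_nonneg fun y => sq_nonneg _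
  have iSc : Integrable fun r => S (c - r) := iS.comp_sub_left c
  have hSi : ∫ r, S (c - r) ≤ κ ^ 2 := by
    rw [integral_sub_left_eq_self S volume c]
    refine le_trans (le_of_eq ?_) hqκ
    rw [integral_prod _ hq.integrable_sq]
  have hae := (Measure.measurePreserving_sub_left volume c).quasiMeasurePreserving.ae
    (ae_abs_primitive_le hq hκ)
  have iI : Integrable ((Ioc 0 μ).indicator fun _ => κ / 2) :=
    (integrable_indicator_iff measurableSet_Ioc).2 (integrableOn_const (by simp))
  have hb : ∀ᵐ r : ℝ, ‖ψ r * ∫ y in Ioc (0 : ℝ) x, q (c - r) y‖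
      ≤ M * ((Ioc 0 μ).indicator (fun _ => κ / 2) r + S (c - r) / (2 * κ)) := by
    filter_upwards [hae] with r hr
    by_cases hrm : r ∈ Ioc 0 μ
    · rw [indicator_of_mem hrm, norm_mul]; exact mul_le_mul (hM r) (hr x hx) (norm_nonneg _) hM0
    · rw [hψ r hrm, zero_mul, norm_zero, indicator_of_notMem hrm]
      have := hS0 (c - r)
      positivity
  refine (norm_integral_le_of_norm_le ((iI.add (iSc.div_const _)).const_mul M) hb).trans ?_
  simp only [Pi.add_apply]
  rw [integral_const_mul, integral_add iI (iSc.div_const _), integral_indicator measurableSet_Ioc,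
    setIntegral_const, integral_div]
  refine mul_le_mul_of_nonneg_left ?_ hM0
  have h3 : (∫ r, S (c - r)) / (2 * κ) ≤ κ / 2 := by
    rw [div_le_div_iff₀ (by positivity) (by norm_num)]; nlinarith
  have h4 : volume.real (Ioc 0 μ) • (κ / 2) = μ * (κ / 2) := by
    rw [Real.volume_real_Ioc_of_le hμ.le, sub_zero, smul_eq_mul]
  rw [h4]; linarith

/-- Averaging over delays is a contraction of `L²`. -/
theorem memLp_average (hμ : 0 < μ) (δ : ℝ) (hqm : Measurable ⇈q)
    (hq : MemLp ⇈q 2 stripMeasure) (T : ℝ) :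
    (Measurable fun p : ℝ² => ∫ r, q (p.1 - 2 * δ - r) p.2 ∂(bumpMeasure μ)) ∧
    MemLp (fun p : ℝ² => ∫ r, q (p.1 - 2 * δ - r) p.2 ∂(bumpMeasure μ)) 2 (rectMeasure 0 T) ∧
    (∀ᵐ p ∂(rectMeasure 0 T), Integrable (fun r => q (p.1 - 2 * δ - r) p.2) (bumpMeasure μ)) ∧
    ∫ p : ℝ², (∫ r, q (p.1 - 2 * δ - r) p.2 ∂(bumpMeasure μ)) ^ 2 ∂(rectMeasure 0 T)
      ≤ ∫ p : ℝ², q p.1 p.2 ^ 2 ∂stripMeasure := by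
  have := isProbabilityMeasure_bumpMeasure hμ
  have h3 := memLp_delay (δ := δ) hμ hq
  have hmeas3 : Measurable fun p : ℝ × ℝ² => q (p.2.1 - 2 * δ - p.1) p.2.2 :=
    hqm.comp (by fun_prop : Measurable fun p : ℝ × ℝ² => (p.2.1 - 2 * δ - p.1, p.2.2))
  have hm : StronglyMeasurable fun p : ℝ² => ∫ r, q (p.1 - 2 * δ - r) p.2 ∂(bumpMeasure μ) :=
    StronglyMeasurable.integral_prod_left' (μ := bumpMeasure μ)
      (f := fun p : ℝ × ℝ² => q (p.2.1 - 2 * δ - p.1) p.2.2) hmeas3.stronglyMeasurable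
  have i2 := h3.integrable_sq
  have hmono : rectMeasure 0 T ≤ stripMeasure := rectMeasure_le_stripMeasure 0 T
  have hle : (bumpMeasure μ).prod (rectMeasure 0 T) ≤ (bumpMeasure μ).prod stripMeasure :=
    Measure.prod_mono le_rfl hmono
  have h3' := h3.mono_measure hle
  have i2' := h3'.integrable_sq
  have a2 := i2'.prod_left_ae
  have a1 := (h3'.integrable (by norm_num)).prod_left_ae
  have hb : ∀ᵐ p ∂(rectMeasure 0 T), (∫ r, q (p.1 - 2 * δ - r) p.2 ∂(bumpMeasure μ)) ^ 2
      ≤ ∫ r, q (p.1 - 2 * δ - r) p.2 ^ 2 ∂(bumpMeasure μ) := by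
    filter_upwards [a1, a2] with p h1 h2
    exact sq_integral_le_integral_sq h1 h2
  have hItg : Integrable (fun p : ℝ² => (∫ r, q (p.1 - 2 * δ - r) p.2 ∂(bumpMeasure μ)) ^ 2)
      (rectMeasure 0 T) := by
    refine i2'.integral_prod_right.mono' (hm.pow 2).aestronglyMeasurable ?_
    filter_upwards [hb] with p hp
    rw [norm_eq_abs, abs_of_nonneg (sq_nonneg _)]; exact hp
  refine ⟨hm.measurable, (memLp_two_iff_integrable_sq hm.aestronglyMeasurable).2 hItg, a1, ?_⟩
  have e : ∀ r : ℝ, ∫ p : ℝ², q (p.1 - 2 * δ - r) p.2 ^ 2 ∂stripMeasure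
      = ∫ p : ℝ², q p.1 p.2 ^ 2 ∂stripMeasure := by
    intro r
    have hmp := measurePreserving_strip_sub (2 * δ + r)
    have h := integral_map (μ := stripMeasure) hmp.measurable.aemeasurable
      (f := fun p : ℝ² => q p.1 p.2 ^ 2) (hqm.pow_const 2).aestronglyMeasurable
    rw [hmp.map_eq] at h; rw [h]; simp only [sub_sub]
  calc _ ≤ ∫ p : ℝ², (∫ r, q (p.1 - 2 * δ - r) p.2 ^ 2 ∂(bumpMeasure μ)) ∂(rectMeasure 0 T) :=
        integral_mono_ae hItg i2'.integral_prod_right hb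
    _ = ∫ r, (∫ p : ℝ², q (p.1 - 2 * δ - r) p.2 ^ 2 ∂(rectMeasure 0 T)) ∂(bumpMeasure μ) :=
        (integral_integral_swap i2').symm
    _ ≤ ∫ r, (∫ p : ℝ², q (p.1 - 2 * δ - r) p.2 ^ 2 ∂stripMeasure) ∂(bumpMeasure μ) := by
        refine integral_mono_ae i2'.integral_prod_left i2.integral_prod_left ?_
        filter_upwards [i2.prod_right_ae] with r hr
        exact integral_mono_measure hmono (.of_forall fun p => sq_nonneg _) hr
    _ = _ := by
        simp only [e]; simp

end Primitive

/-! ### Smooth approximations -/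

theorem integrable_bumpMeasure_of_continuous (hμ : 0 < μ) (hf : Continuous f) :
    Integrable f (bumpMeasure μ) := by
  have := isProbabilityMeasure_bumpMeasure hμ
  obtain ⟨C, hC⟩ := (isCompact_Icc (a := (0 : ℝ)) (b := μ)).exists_bound_of_continuousOn
    hf.continuousOn
  exact Integrable.of_bound hf.aestronglyMeasurable C
    (ae_bumpMeasure (.of_forall fun r hr => hC r (Ioo_subset_Icc_self hr)))

theorem deriv_timeBump_eq_zero (hr : r ∉ Ioo 0 μ) : deriv (timeBump 0 μ) r = 0 := by
  have h0 : timeBump 0 μ r = 0 := timeBump_eq_zero (by simpa using hr)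
  refine IsLocalMin.deriv_eq_zero (.of_forall fun s => ?_)
  rw [h0]; exact timeBump_nonneg _ _ _

theorem exists_deriv_timeBump_bound (μ : ℝ) : ∃ M, ∀ r, |deriv (timeBump 0 μ) r| ≤ M :=
  (hasCompactSupport_timeBump 0 μ).deriv.exists_bound_of_continuous
    ((contDiff_timeBump 0 μ).continuous_deriv (by simp))

theorem hasDerivAt_polynomial_primitive (p : Polynomial ℝ) (x : ℝ) :
    HasDerivAt (fun x => ∫ y in (0)..x, p.eval y) (p.eval x) x :=
  iint_hasDerivAt_right (p.continuous.intervalIntegrable _ _)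
    (p.continuous.stronglyMeasurableAtFilter _ _) p.continuous.continuousAt

theorem contDiff_polynomial_primitive (p : Polynomial ℝ) :
    ContDiff ℝ ∞ fun x => ∫ y in (0)..x, p.eval y := by
  rw [contDiff_infty_iff_deriv]
  refine ⟨fun x => (hasDerivAt_polynomial_primitive p x).differentiableAt, ?_⟩
  rw [funext fun x => (hasDerivAt_polynomial_primitive p x).deriv]
  exact p.contDiff_aeval _

section Construction

theorem gluePath_eq_primitive (h : HydroFlow α β A B ρ ρx ρt) (hv : IsVersion hT w u g) :
    ∀ᵐ s : ℝ, s ∈ Ioc (-T) T → IvlInt (glueGrad T ρx g s) 0 1 ∧ ∀ x ∈ 𝕁, gluePath ρ u s x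
        = gluePath ρ u s 0 + ∫ y in (0)..x, glueGrad T ρx g s y := by
  have hne : ∀ᵐ s : ℝ, s ≠ 0 := by simp [ae_iff, measure_singleton]
  filter_upwards [(ae_restrict_iff' measurableSet_Ioc).1 hv.ae, hne] with s hs hs0 hsT
  rcases lt_or_gt_of_ne hs0 with hneg | hpos
  · have e : glueGrad T ρx g s = ρx (-s) := by
      funext y
      rw [glueGrad, if_pos hsT, gluePath, if_pos hneg.le]
    have e' : ∀ x, gluePath ρ u s x = ρ (-s) x := fun x => by rw [gluePath, if_pos hneg.le]
    have hp : 0 < -s := neg_pos.2 hneg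
    have cx : ContinuousOn (ρx (-s)) 𝕁 := h.cont_x.slice hp
    rw [e]
    refine ⟨intble01 cx, fun x hx => ?_⟩
    rw [e', e', integral_deriv_Icc hx.1 (fun y hy => (h.has_x (-s) hp y ⟨hy.1, hy.2.trans hx.2⟩).mono
      (Icc_subset_Icc le_rfl hx.2)) (intble_Icc hx.1 (cx.mono (Icc_subset_Icc le_rfl hx.2)))]
    ring
  · have e : glueGrad T ρx g s = g s := by
      funext y
      rw [glueGrad, if_pos hsT, gluePath, if_neg (not_le.2 hpos)]
    have e' : ∀ x, gluePath ρ u s x = u s x := fun x => by rw [gluePath, if_neg (not_le.2 hpos)]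
    have := (hs ⟨hpos, hsT.2⟩).2
    rw [e]; exact ⟨this.1, fun x hx => by rw [e', e', this.2 x hx]⟩

/-- `V = (1-η) U + η Z`, where `V` is smooth for positive times and follows `ρ` up to time `δ`, and
`Z` is a perturbation of `ρ`, of size `κ`, after time `δ`. -/
structure IsSmoothing (T δ η κ : ℝ) (ρ ρx U Ux V Vx Z Zx R Rt q : ℝ → ℝ → ℝ) : Prop where
  smooth : ContDiffOn ℝ ∞ ⇈V (Ioi 0 ×ˢ 𝕁)
  has_x : ∀ t > 0, ∀ x ∈ 𝕁, HasDerivWithinAt (V t) (Vx t x) 𝕁 x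
  cont_x : ∀ t > 0, ContinuousOn (Vx t) 𝕁
  meas_Z : Measurable ⇈Z
  meas_Zx : Measurable ⇈Zx
  eq_init : ∀ t ≤ δ, V t = ρ t ∧ Vx t = ρx t ∧ Z t = ρ t ∧ Zx t = ρx t
  eq_V : V = fun t x => (1 - η) * U t x + (1 - (1 - η)) * Z t x
  eq_Vx : Vx = fun t x => (1 - η) * Ux t x + (1 - (1 - η)) * Zx t x
  eq_Z : ∀ t ∈ Icc δ T, ∀ x ∈ 𝕁, Z t x = ρ t x + R t x
  bound_R : ∀ t, ∀ x ∈ 𝕁, |R t x| ≤ κ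
  bound_Rt : ∀ t, ∀ x ∈ 𝕁, |Rt t x| ≤ κ
  has_Rt : ∀ t, ∀ x ∈ 𝕁, HasDerivAt (fun s => R s x) (Rt t x) t
  meas_Rt : Measurable ⇈Rt
  eq_Zx : ∀ᵐ p ∂(rectMeasure 0 T), Zx p.1 p.2 = ρx p.1 p.2 + q p.1 p.2
  memLp_q : MemLp ⇈q 2 (rectMeasure 0 T)
  sq_le : ∫ p : ℝ², q p.1 p.2 ^ 2 ∂(rectMeasure 0 T) ≤ κ ^ 2

theorem exists_isSmoothing (h : HydroFlow α β A B ρ ρx ρt) (hv : IsVersion hT w u g) {η κ₀ : ℝ}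
    (hδ : 0 < δ) (hδT : 4 * δ ≤ T) (hμ : μ ∈ Ioc 0 (δ / 2)) (hη : η ∈ 𝕁ᵒ)
    (hκ₀ : 0 < κ₀) : ∃ V Vx Z Zx R Rt q, IsSmoothing T δ η κ₀ ρ ρx
      (fun t x => ∫ r, crossPath δ μ ρ (gluePath ρ u) r t x ∂(bumpMeasure μ))
      (fun t x => ∫ r, crossPath δ μ ρx (glueGrad T ρx g) r t x ∂(bumpMeasure μ))
      V Vx Z Zx R Rt q := by
  have hμ0 := hμ.1
  have hprob := isProbabilityMeasure_bumpMeasure hμ0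
  obtain ⟨M, hM⟩ := exists_deriv_timeBump_bound μ
  have hM0 : 0 ≤ M := (abs_nonneg _).trans (hM 0)
  set d₁ := 2 / μ * ((μ + 1) / 2) with hd₁
  set d₂ := M * ((μ + 1) / 2) with hd₂
  have hd₁0 : 0 ≤ d₁ := by positivity
  have hd₂0 : 0 ≤ d₂ := by positivity
  set κ := κ₀ * η / (1 + d₁ + 2 / μ * d₁ + d₂) with hκdef
  have hη0 := hη.1
  have hκ : 0 < κ := by positivity
  have hκη : κ / η * (1 + d₁ + 2 / μ * d₁ + d₂) = κ₀ := by
    rw [hκdef]; field_simp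
  have hkL := memLp_glueGrad_of_version h hv
  have hkm := measurable_glueGrad T h.meas_x hv.meas_x
  have hum := measurable_gluePath h.meas hv.meas
  obtain ⟨n, a, p, hac, hFL, hFκ⟩ := exists_tensor_approx hkL hκ
  set ũ := gluePath ρ u with hũ
  set k := glueGrad T ρx g with hk
  set ν := bumpMeasure μ with hν
  set χ := timeStep δ μ with hχ
  have hχm : ∀ t, χ t ∈ 𝕁 := fun t => timeStep_mem hμ0 t
  have hχ0 : ∀ t ≤ δ, χ t = 0 := fun t ht => timeStep_eq_zero ht
  set F : ℝ → ℝ → ℝ := fun s y => ∑ i, a i s * (p i).eval y with hF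
  set q : ℝ → ℝ → ℝ := fun s y => F s y - k s y with hq
  have Fm : Measurable fun z : ℝ² => F z.1 z.2 :=
    Finset.measurable_sum _ fun i _ => ((hac i).measurable.comp measurable_fst).mul
      ((p i).continuous.measurable.comp measurable_snd)
  have qm : Measurable fun z : ℝ² => q z.1 z.2 := Fm.sub hkm
  have qL : MemLp (fun z : ℝ² => q z.1 z.2) 2 stripMeasure := hFL.sub hkL
  set Q : ℝ → ℝ → ℝ := fun s x => ∫ y in Ioc (0 : ℝ) x, q s y with hQ
  set D : ℝ → ℝ → ℝ := fun t x => ∫ r, Q (t - 2 * δ - r) x ∂ν with hD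
  set D' : ℝ → ℝ → ℝ := fun t x => ∫ r, deriv (timeBump 0 μ) r * Q (t - 2 * δ - r) x with hD'
  set P : Fin n → ℝ → ℝ := fun i x => ∫ y in (0)..x, (p i).eval y with hP
  set e₀ : ℝ → ℝ := fun t => ∫ r, ũ (t - 2 * δ - r) 0 ∂ν with he₀
  set b : Fin n → ℝ → ℝ := fun i t => ∫ r, a i (t - 2 * δ - r) ∂ν with hb
  set E : ℝ → ℝ → ℝ := fun t x => e₀ t + ∑ i, b i t * P i x with hE
  set Ex : ℝ → ℝ → ℝ := fun t x => ∑ i, b i t * (p i).eval x with hEx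
  set V : ℝ → ℝ → ℝ := fun t x => (1 - η) * ((1 - χ t) * ρ t x + χ t * E t x) + η * ρ t x with hV
  set Vx : ℝ → ℝ → ℝ := fun t x => (1 - η) * ((1 - χ t) * ρx t x + χ t * Ex t x) + η * ρx t x
    with hVx
  set U : ℝ → ℝ → ℝ := fun t x => ∫ r, crossPath δ μ ρ ũ r t x ∂ν with hU
  set Ux : ℝ → ℝ → ℝ := fun t x => ∫ r, crossPath δ μ ρx k r t x ∂ν with hUx
  have hfam := isPathFamily_cross h hv δ hμ0
  have hUp : IsPath 0 T U Ux := hfam.isPath_average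
  have u_int : ∀ t, ∀ x ∈ 𝕁, Integrable (fun r => ũ (t - 2 * δ - r) x) ν := by
    intro t x hx
    refine Integrable.of_bound (hum.comp
      (by fun_prop : Measurable fun r : ℝ => (t - 2 * δ - r, x))).aestronglyMeasurable 1
      (.of_forall fun r => ?_)
    have := gluePath_mem h hv (t - 2 * δ - r) hx
    rw [norm_eq_abs, abs_of_nonneg this.1]; exact this.2
  have a_int : ∀ i t, Integrable (fun r => a i (t - 2 * δ - r)) ν := fun i t =>
    integrable_bumpMeasure_of_continuous hμ0 ((hac i).comp (by fun_prop))
  have U_eq : ∀ t, ∀ x ∈ 𝕁, U t x = (1 - χ t) * ρ t x + χ t * ∫ r, ũ (t - 2 * δ - r) x ∂ν := by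
    intro t x hx; simp only [hU, crossPath]
    rw [integral_add (integrable_const _) ((u_int t x hx).const_mul _), integral_const_mul (timeStep δ μ t)]
    simp [hχ]
  have e₀s : ContDiff ℝ ∞ e₀ := by
    refine contDiff_integral_bump (f := fun s => ũ s 0) ?_ (2 * δ)
    refine (locallyIntegrable_const (1 : ℝ)).mono
      (hum.comp (by fun_prop : Measurable fun s : ℝ => (s, (0 : ℝ)))).aestronglyMeasurable
      (.of_forall fun s => ?_)
    have := gluePath_mem h hv s (x := 0) (by simp)
    rw [norm_eq_abs, norm_eq_abs, abs_of_nonneg this.1, abs_one]; exact this.2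
  have bs : ∀ i, ContDiff ℝ ∞ (b i) := fun i =>
    contDiff_integral_bump (hac i).locallyIntegrable (2 * δ)
  have Es : ContDiff ℝ ∞ fun z : ℝ² => E z.1 z.2 :=
    (e₀s.comp contDiff_fst).add (ContDiff.sum fun i _ => ((bs i).comp contDiff_fst).mul
      ((contDiff_polynomial_primitive (p i)).comp contDiff_snd))
  have E_has : ∀ t x, HasDerivAt (E t) (Ex t x) x := fun t x =>
    (HasDerivAt.fun_sum fun i _ => (hasDerivAt_polynomial_primitive (p i) x).const_mul (b i t)).const_add _
  have Ex_c : Continuous fun z : ℝ² => Ex z.1 z.2 :=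
    continuous_finsetSum _ fun i _ => ((bs i).continuous.comp continuous_fst).mul
      ((p i).continuous.comp continuous_snd)
  have χs : ContDiff ℝ ∞ fun z : ℝ² => χ z.1 := (contDiff_timeStep δ μ).comp contDiff_fst
  have χc : Measurable fun z : ℝ² => χ z.1 := χs.continuous.measurable
  have Vm : Measurable fun z : ℝ² => V z.1 z.2 :=
    ((((measurable_const.sub χc).mul h.meas).add (χc.mul Es.continuous.measurable)).const_mul _).add
      (h.meas.const_mul _)
  have Vxm : Measurable fun z : ℝ² => Vx z.1 z.2 :=
    ((((measurable_const.sub χc).mul h.meas_x).add (χc.mul Ex_c.measurable)).const_mul _).add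
      (h.meas_x.const_mul _)
  have D_eq : ∀ t ∈ Icc δ T, ∀ x ∈ 𝕁, D t x = E t x - ∫ r, ũ (t - 2 * δ - r) x ∂ν := by
    intro t ht x hx
    have hae : ∀ᵐ r ∂ν, Q (t - 2 * δ - r) x = (ũ (t - 2 * δ - r) 0
        + ∑ i, a i (t - 2 * δ - r) * P i x) - ũ (t - 2 * δ - r) x := by
      refine ae_bumpMeasure ?_
      filter_upwards [(Measure.measurePreserving_sub_left volume (t - 2 * δ)).quasiMeasurePreserving.ae
        (gluePath_eq_primitive h hv)] with r hr hrm
      obtain ⟨g1, g2⟩ := hr ⟨by linarith [ht.1, hrm.2, hμ.2], by linarith [ht.2, hrm.1]⟩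
      have g3 : ũ (t - 2 * δ - r) x
          = ũ (t - 2 * δ - r) 0 + ∫ y in (0)..x, k (t - 2 * δ - r) y := g2 x hx
      rw [g3]
      have i1 : IvlInt (k (t - 2 * δ - r)) 0 x :=
        g1.mono_set (by rw [uIcc_of_le hx.1, uIcc01]; exact Icc_subset_Icc le_rfl hx.2)
      have i2 : ∀ i, IvlInt (fun y => a i (t - 2 * δ - r) * (p i).eval y) 0 x :=
        fun i => ((p i).continuous.intervalIntegrable _ _).const_mul _
      have i3 : IvlInt (F (t - 2 * δ - r)) 0 x := (continuous_finsetSum _ fun i _ =>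
          continuous_const.mul (p i).continuous).intervalIntegrable _ _
      simp only [hQ, hq]; rw [← iint_of_le hx.1, iint_sub i3 i1]; simp only [hF]
      rw [intervalIntegral.integral_finsetSum fun i _ => i2 i]
      simp only [iint_const_mul, hP]; ring
    simp only [hD]
    rw [integral_congr_ae hae, integral_sub _ (u_int t x hx), integral_add
      (u_int t 0 (by simp)), integral_finsetSum _ fun i _ => (a_int i t).mul_const _]
    · simp only [integral_mul_const, hE, he₀, hb]
    · exact integrable_finsetSum _ fun i _ => (a_int i t).mul_const _
    · exact (u_int t 0 (by simp)).add (integrable_finsetSum _ fun i _ => (a_int i t).mul_const _)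
  have Ql : ∀ x ∈ 𝕁, LocallyIntegrable (fun s => Q s x) volume := fun x hx =>
    locallyIntegrable_primitive qm qL hx
  have D_bound : ∀ t, ∀ x ∈ 𝕁, |D t x| ≤ κ * d₁ := by
    intro t x hx; simp only [hD, hν]; rw [integral_bumpMeasure]
    refine (abs_integral_mul_primitive_le qL hκ hFκ hμ0 (M := 2 / μ) (fun r => ?_) (fun r hr => ?_)
      (t - 2 * δ) hx).trans (le_of_eq ?_)
    · rw [abs_of_nonneg (timeBump_nonneg _ _ _)]; exact timeBump_le hμ0 r
    · exact timeBump_eq_zero fun h' => hr (by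
        rw [zero_add] at h'
        exact Ioo_subset_Ioc_self h')
    · rw [hd₁]; ring
  have D'_bound : ∀ t, ∀ x ∈ 𝕁, |D' t x| ≤ κ * d₂ := by
    intro t x hx; simp only [hD']
    refine (abs_integral_mul_primitive_le qL hκ hFκ hμ0 hM (fun r hr => ?_)
      (t - 2 * δ) hx).trans (le_of_eq ?_)
    · exact deriv_timeBump_eq_zero fun h' => hr (Ioo_subset_Ioc_self h')
    · rw [hd₂]; ring
  have D_has : ∀ t, ∀ x ∈ 𝕁, HasDerivAt (fun s => D s x) (D' t x) t := fun t x hx =>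
    hasDerivAt_integral_bump (Ql x hx) (2 * δ) t
  have Qm : Measurable fun z : ℝ² => Q z.1 z.2 := measurable_primitive qm
  have Dm : Measurable fun z : ℝ² => D z.1 z.2 := (StronglyMeasurable.integral_prod_left' (μ := ν)
      (f := fun z : ℝ × ℝ² => Q (z.2.1 - 2 * δ - z.1) z.2.2)
      (Qm.comp (by fun_prop : Measurable fun z : ℝ × ℝ² =>
        (z.2.1 - 2 * δ - z.1, z.2.2))).stronglyMeasurable).measurable
  have D'm : Measurable fun z : ℝ² => D' z.1 z.2 := by
    refine (StronglyMeasurable.integral_prod_left' (μ := (volume : Measure ℝ))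
      (f := fun z : ℝ × ℝ² => deriv (timeBump 0 μ) z.1 * Q (z.2.1 - 2 * δ - z.1) z.2.2)
      (Measurable.stronglyMeasurable ?_)).measurable
    exact ((measurable_deriv _).comp measurable_fst).mul
      (Qm.comp (by fun_prop : Measurable fun z : ℝ × ℝ² => (z.2.1 - 2 * δ - z.1, z.2.2)))
  obtain ⟨-, aL, -, asq⟩ := memLp_average hμ0 δ qm qL T
  obtain ⟨-, -, ki, -⟩ := memLp_average hμ0 δ hkm hkL T
  set c := (1 - η) / η with hc
  have hc0 : 0 ≤ c := div_nonneg (sub_nonneg.2 hη.2.le) hη0.le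
  have hc1 : c ≤ 1 / η := div_le_div_of_nonneg_right (by linarith) hη0.le
  have hκc : c * κ ≤ κ / η := by
    rw [div_eq_mul_one_div, mul_comm]; exact mul_le_mul_of_nonneg_left hc1 hκ.le
  have hκη0 : 0 ≤ κ / η := by positivity
  have hκ1 : κ / η ≤ κ₀ := by
    rw [← hκη]; exact le_mul_of_one_le_right hκη0 (by linarith [show 0 ≤ 2 / μ * d₁ by positivity])
  refine ⟨V, Vx, fun t x => (V t x - (1 - η) * U t x) / η,
    fun t x => (Vx t x - (1 - η) * Ux t x) / η, fun t x => c * (χ t * D t x),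
    fun t x => c * (timeBump δ μ t * D t x + χ t * D' t x),
    fun t x => c * (χ t * ∫ r, q (t - 2 * δ - r) x ∂ν), ?_⟩
  have one_sub' : 1 - (1 - η) = η := by ring
  refine ⟨?_, ?_, ?_, ?_, ?_, ?_, ?_, ?_, ?_, ?_, ?_, ?_, ?_, ?_, ?_, ?_⟩
  · exact (contDiffOn_const.mul (((contDiff_const.sub χs).contDiffOn.mul h.smooth).add
      (χs.mul Es).contDiffOn)).add (contDiffOn_const.mul h.smooth)
  · intro t ht x hx
    have hr := h.has_x t ht x hx
    exact (((hr.const_mul (1 - χ t)).add ((E_has t x).hasDerivWithinAt.const_mul (χ t))).const_mul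
      (1 - η)).add (hr.const_mul η)
  · intro t ht
    have hr : ContinuousOn (ρx t) 𝕁 := h.cont_x.slice ht
    have hex : ContinuousOn (Ex t) 𝕁 := (Ex_c.along t).continuousOn
    exact (continuousOn_const.fun_mul ((continuousOn_const.fun_mul hr).fun_add
      (continuousOn_const.fun_mul hex))).fun_add (continuousOn_const.fun_mul hr)
  · exact (Vm.sub (hUp.meas.const_mul _)).div_const _
  · exact (Vxm.sub (hUp.meas_x.const_mul _)).div_const _
  · intro t ht
    have v1 : V t = ρ t := by funext x; simp only [hV, hχ0 t ht]; ring
    have v2 : Vx t = ρx t := by funext x; simp only [hVx, hχ0 t ht]; ring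
    have u1 : ∀ x, U t x = ρ t x := fun x => by
      simp only [hU, crossPath]; rw [timeStep_eq_zero ht]; simp
    have u2 : ∀ x, Ux t x = ρx t x := fun x => by
      simp only [hUx, crossPath]; rw [timeStep_eq_zero ht]; simp
    refine ⟨v1, v2, ?_, ?_⟩
    · funext x
      rw [v1, u1 x]; field_simp; ring
    · funext x
      rw [v2, u2 x]; field_simp; ring
  · funext t x
    rw [one_sub']; field_simp; ring
  · funext t x
    rw [one_sub']; field_simp; ring
  · intro t ht x hx; rw [U_eq t x hx, D_eq t ht x hx]; simp only [hV, hc]; field_simp; ring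
  · intro t x hx; rw [abs_mul, abs_mul, abs_of_nonneg hc0, abs_of_nonneg (hχm t).1]
    calc c * (χ t * |D t x|) ≤ c * (1 * (κ * d₁)) := by
          refine mul_le_mul_of_nonneg_left ?_ hc0
          exact mul_le_mul (hχm t).2 (D_bound t x hx) (abs_nonneg _) zero_le_one
      _ = (c * κ) * d₁ := by ring
      _ ≤ κ / η * d₁ := mul_le_mul_of_nonneg_right hκc hd₁0
      _ ≤ κ₀ := by
          rw [← hκη]
          refine mul_le_mul_of_nonneg_left ?_ hκη0
          linarith [show 0 ≤ 2 / μ * d₁ by positivity]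
  · intro t x hx; rw [abs_mul, abs_of_nonneg hc0]
    have b1 : |timeBump δ μ t * D t x| ≤ 2 / μ * (κ * d₁) := by
      rw [abs_mul, abs_of_nonneg (timeBump_nonneg _ _ _)]
      exact mul_le_mul (timeBump_le hμ0 t) (D_bound t x hx) (abs_nonneg _) (by positivity)
    have b2 : |χ t * D' t x| ≤ κ * d₂ := by
      rw [abs_mul, abs_of_nonneg (hχm t).1]
      exact (mul_le_of_le_one_left (abs_nonneg _) (hχm t).2).trans (D'_bound t x hx)
    calc c * |timeBump δ μ t * D t x + χ t * D' t x| ≤ c * (2 / μ * (κ * d₁) + κ * d₂) :=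
          mul_le_mul_of_nonneg_left ((abs_add_le _ _).trans (add_le_add b1 b2)) hc0
      _ = (c * κ) * (2 / μ * d₁ + d₂) := by ring
      _ ≤ κ / η * (2 / μ * d₁ + d₂) := mul_le_mul_of_nonneg_right hκc (by positivity)
      _ ≤ κ₀ := by
          rw [← hκη]
          refine mul_le_mul_of_nonneg_left ?_ hκη0
          linarith
  · intro t x hx; exact ((hasDerivAt_timeStep δ μ t).fun_mul (D_has t x hx)).const_mul c
  · exact ((((continuous_timeBump δ μ).measurable.comp measurable_fst).mul Dm).add
      (χc.mul D'm)).const_mul c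
  · filter_upwards [ki] with z hz
    have hz2 : Integrable (fun r => k (z.1 - 2 * δ - r) z.2) ν := hz
    have ux : Ux z.1 z.2 = (1 - χ z.1) * ρx z.1 z.2 + χ z.1 * ∫ r, k (z.1 - 2 * δ - r) z.2 ∂ν := by
      simp only [hUx, crossPath]
      rw [integral_add (integrable_const _) (hz2.const_mul _), integral_const_mul (timeStep δ μ z.1)]
      simp [hχ]
    have fx : ∫ r, q (z.1 - 2 * δ - r) z.2 ∂ν = Ex z.1 z.2 - ∫ r, k (z.1 - 2 * δ - r) z.2 ∂ν := by
      simp only [hq]; rw [integral_sub _ hz2]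
      · simp only [hF, hEx, hb]; rw [integral_finsetSum _ fun i _ => (a_int i z.1).mul_const _]
        simp only [integral_mul_const]
      · exact integrable_finsetSum _ fun i _ => (a_int i z.1).mul_const _
    rw [ux, fx]; simp only [hVx, hc]; field_simp; ring
  · exact (aL.step_mul χc fun z => hχm z.1).const_mul c
  · have hle : ∀ z : ℝ², (c * (χ z.1 * ∫ r, q (z.1 - 2 * δ - r) z.2 ∂ν)) ^ 2
        ≤ c ^ 2 * (∫ r, q (z.1 - 2 * δ - r) z.2 ∂ν) ^ 2 := by
      intro z; rw [mul_pow, mul_pow]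
      refine mul_le_mul_of_nonneg_left ?_ (sq_nonneg c)
      exact mul_le_of_le_one_left (sq_nonneg _) (pow_le_one₀ (hχm _).1 (hχm _).2)
    refine (integral_mono ((aL.step_mul χc fun z => hχm z.1).const_mul c).integrable_sq
      (aL.integrable_sq.const_mul (c ^ 2)) hle).trans ?_
    rw [integral_const_mul]
    calc _ ≤ c ^ 2 * κ ^ 2 := mul_le_mul_of_nonneg_left (asq.trans hFκ) (sq_nonneg c)
      _ = (c * κ) ^ 2 := by ring
      _ ≤ κ₀ ^ 2 := pow_le_pow_left₀ (by positivity) (hκc.trans hκ1) 2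

end Construction

theorem integral_integral_eq_rect (hab : a ≤ b) (h : Integrable ⇈F (rectMeasure a b)) :
    ∫ t in a..b, ∫ x in (0)..1, F t x = ∫ p : ℝ², F p.1 p.2 ∂(rectMeasure a b) := by
  rw [integral_prod _ h, iint_of_le hab]; simp only [iint01]

section Approximation

variable {I₀ : ℝ}

/-- The pairing of `F` with the path `w`, preceded by `ρ` read backwards. -/
def glueMoment (hT : 0 < T) (w : SkorohodPath T SubProb) (ρ : ℝ → ℝ → ℝ) (F : C(I, ℝ)) (s : ℝ) : ℝ :=
  if s ≤ 0 then ∫ x : I, ρ (-s) x * F x else ∫ x, F x ∂(w.ev hT s).meas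

/-- `V` is a smooth path which follows `ρ` for a short time, whose action exceeds `I₀` by at
most `ε`, and which is `ε`-close to `w`. -/
structure IsApprox (α β A B I₀ ε C : ℝ) (hT : 0 < T) (w : SkorohodPath T SubProb)
    (ρ ρx V Vx : ℝ → ℝ → ℝ) : Prop where
  smooth : ContDiffOn ℝ ∞ ⇈V (Ioi 0 ×ˢ 𝕁)
  has_x : ∀ t > 0, ∀ x ∈ 𝕁, HasDerivWithinAt (V t) (Vx t x) 𝕁 x
  cont_x : ∀ t > 0, ContinuousOn (Vx t) 𝕁
  isPath : IsPath 0 T V Vx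
  mem : ∀ t ∈ Icc 0 T, ∀ x ∈ 𝕁, V t x ∈ 𝕁
  init : ∃ δ ∈ Ioo 0 T, (∀ t ≤ δ, V t = ρ t ∧ Vx t = ρx t) ∧
    ∃ c > 0, ∀ t ∈ Icc δ T, ∀ x ∈ 𝕁, c ≤ V t x ∧ V t x ≤ 1 - c
  action_le : ∀ H : C12 T, action α β A B (H.toTest hT.le) 0 T V Vx ≤ I₀ + ε
  energy_le : ∫ p : ℝ², Vx p.1 p.2 ^ 2 ∂(rectMeasure 0 T) ≤ C
  close : ∀ (F : C(I, ℝ)) (κ : ℝ), (∀ s ∈ Icc (-T) T, ∀ s' ∈ Icc (-T) T, |s - s'| ≤ 3 * ε →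
    |glueMoment hT w ρ F s - glueMoment hT w ρ F s'| ≤ κ) → ∀ t ∈ Icc 0 T,
    |(∫ x : I, V t x * F x) - ∫ x, F x ∂(w.ev hT t).meas| ≤ κ + ε * ‖F‖

theorem sq_add_le_two_mul (a b : ℝ) : (a + b) ^ 2 ≤ 2 * a ^ 2 + 2 * b ^ 2 := by
  nlinarith [sq_nonneg (a - b)]

theorem integral_sq_le_of_ae_eq {X : Type*} [MeasurableSpace X] {ν : Measure X} {f f₁ f₂ : X → ℝ}
    (h₁ : MemLp f₁ 2 ν) (h₂ : MemLp f₂ 2 ν) (h : ∀ᵐ x ∂ν, f x ^ 2 ≤ 2 * f₁ x ^ 2 + 2 * f₂ x ^ 2) :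
    ∫ x, f x ^ 2 ∂ν ≤ 2 * (∫ x, f₁ x ^ 2 ∂ν) + 2 * ∫ x, f₂ x ^ 2 ∂ν := by
  rw [← integral_const_mul, ← integral_const_mul, ← integral_add (h₁.integrable_sq.const_mul 2)
    (h₂.integrable_sq.const_mul 2)]
  exact integral_mono_of_nonneg (.of_forall fun x => sq_nonneg _)
    ((h₁.integrable_sq.const_mul 2).add (h₂.integrable_sq.const_mul 2)) h

theorem abs_integral_crossPath_sub_le (h : HydroFlow α β A B ρ ρx ρt) (hv : IsVersion hT w u g)
    (h0 : (w.ev hT 0).HasDensity fun x : I => ρ 0 x) {κ : ℝ}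
    (hδ : 0 < δ) (hδT : 4 * δ ≤ T) (hδε : δ ≤ ε) (hμ : μ ∈ Ioc 0 (δ / 2)) (F : C(I, ℝ))
    (hF : ∀ s ∈ Icc (-T) T, ∀ s' ∈ Icc (-T) T, |s - s'| ≤ 3 * ε →
      |glueMoment hT w ρ F s - glueMoment hT w ρ F s'| ≤ κ) (ht : t ∈ Icc 0 T) :
    |(∫ x : I, (∫ r, crossPath δ μ ρ (gluePath ρ u) r t x ∂(bumpMeasure μ)) * F x)
      - ∫ x, F x ∂(w.ev hT t).meas| ≤ κ := by
  have hμ0 := hμ.1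
  have hprob := isProbabilityMeasure_bumpMeasure hμ0
  have hfam := isPathFamily_cross h hv δ hμ0
  set χ := timeStep δ μ t with hχ
  have hχm : χ ∈ 𝕁 := timeStep_mem hμ0 t
  set m := glueMoment hT w ρ F with hm
  have hm0 : ∀ s, 0 ≤ s → m s = ∫ x, F x ∂(w.ev hT s).meas := by
    intro s hs
    rcases hs.eq_or_lt with rfl | hs
    · rw [hm, glueMoment, if_pos le_rfl, h0.integral_eq (fun x => (h.mem 0 x x.2).1), neg_zero]
    · rw [hm, glueMoment, if_neg (not_le.2 hs)]
  have Fb : ∀ x, |F x| ≤ ‖F‖ := fun x => F.norm_coe_le_norm x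
  have slice_int : ∀ v : ℝ → ℝ, Measurable v → (∀ x ∈ 𝕁, v x ∈ 𝕁) →
      Integrable fun x : I => v x * F x := by
    intro v hvm hv1
    refine Integrable.of_bound ((hvm.comp measurable_subtype_coe).mul
      F.continuous.measurable).aestronglyMeasurable ‖F‖ (.of_forall fun x => ?_)
    rw [norm_mul, norm_eq_abs, abs_of_nonneg (hv1 x x.2).1]
    exact (mul_le_of_le_one_left (norm_nonneg _) (hv1 x x.2).2).trans (Fb x)
  have hi : Integrable (fun z : ℝ × I => crossPath δ μ ρ (gluePath ρ u) z.1 t z.2 * F z.2)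
      ((bumpMeasure μ).prod volume) := by
    refine Integrable.of_bound (Measurable.aestronglyMeasurable ?_) ‖F‖
      (.of_forall fun z => ?_)
    · exact (hfam.meas.comp (by fun_prop : Measurable fun z : ℝ × I => (z.1, t, (z.2 : ℝ)))).mul
        (F.continuous.measurable.comp measurable_snd)
    · have := hfam.mem z.1 t z.2 z.2.2
      rw [norm_mul, norm_eq_abs, abs_of_nonneg this.1]
      exact (mul_le_of_le_one_left (norm_nonneg _) this.2).trans (Fb z.2)
  have e1 : ∫ x : I, (∫ r, crossPath δ μ ρ (gluePath ρ u) r t x ∂(bumpMeasure μ)) * F x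
      = ∫ r, (∫ x : I, crossPath δ μ ρ (gluePath ρ u) r t x * F x) ∂(bumpMeasure μ) := by
    rw [integral_integral_swap hi]; simp only [integral_mul_const]
  have hbound : ∀ᵐ r ∂(bumpMeasure μ),
      ‖(∫ x : I, crossPath δ μ ρ (gluePath ρ u) r t x * F x) - m t‖ ≤ κ := by
    refine ae_bumpMeasure ?_
    filter_upwards [ae_density_sub hv (t - 2 * δ)] with r hd hr
    have hsT : t - 2 * δ - r ∈ Icc (-T) T :=
      ⟨by linarith [ht.1, hr.2, hμ.2], by linarith [ht.2, hr.1]⟩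
    have es : ∫ x : I, gluePath ρ u (t - 2 * δ - r) x * F x = m (t - 2 * δ - r) := by
      rw [hm, glueMoment]
      split_ifs with hs
      · simp only [gluePath, if_pos hs]
      · rw [(hd ⟨not_le.1 hs, hsT.2⟩).1.integral_eq (fun x => (hv.mem _ x).1)]
        simp only [gluePath, if_neg hs]
    have eρ : ∫ x : I, ρ t x * F x = m (-t) := by
      rw [hm, glueMoment, if_pos (by linarith [ht.1]), neg_neg]
    have ex : ∫ x : I, crossPath δ μ ρ (gluePath ρ u) r t x * F x
        = (1 - χ) * m (-t) + χ * m (t - 2 * δ - r) := by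
      rw [← es, ← eρ, ← integral_const_mul, ← integral_const_mul, ← integral_add
        ((slice_int (ρ t) (measurable_slice h.meas t) fun x hx => h.mem t x hx).const_mul _)
        ((slice_int _ (measurable_slice (measurable_gluePath h.meas hv.meas) _)
          fun x hx => gluePath_mem h hv _ hx).const_mul _)]
      refine integral_congr_ae (.of_forall fun x => ?_)
      simp only [crossPath]; ring
    have htT : t ∈ Icc (-T) T := ⟨by linarith [ht.1], ht.2⟩
    have b2 : |m (t - 2 * δ - r) - m t| ≤ κ := by
      refine hF _ hsT _ htT ?_
      rw [abs_le]
      constructor <;> linarith [hr.1, hr.2, hμ.2]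
    have b1 : (1 - χ) * |m (-t) - m t| ≤ (1 - χ) * κ := by
      rcases lt_or_ge t (δ + μ) with hlt | hge
      · refine mul_le_mul_of_nonneg_left (hF _ ⟨by linarith [ht.2], by linarith [ht.1]⟩ _ htT ?_)
          (sub_nonneg.2 hχm.2)
        rw [abs_le]
        constructor <;> linarith [ht.1, hμ.2]
      · rw [hχ, timeStep_eq_one hμ0 hge]; simp
    rw [ex, norm_eq_abs]
    calc |(1 - χ) * m (-t) + χ * m (t - 2 * δ - r) - m t|
        = |(1 - χ) * (m (-t) - m t) + χ * (m (t - 2 * δ - r) - m t)| := by congr 1; ring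
      _ ≤ |(1 - χ) * (m (-t) - m t)| + |χ * (m (t - 2 * δ - r) - m t)| := abs_add_le _ _
      _ ≤ (1 - χ) * κ + χ * κ := by
          rw [abs_mul, abs_mul, abs_of_nonneg (sub_nonneg.2 hχm.2), abs_of_nonneg hχm.1]
          exact add_le_add b1 (mul_le_mul_of_nonneg_left b2 hχm.1)
      _ = κ := by ring
  rw [e1, ← hm0 t ht.1]
  have e2 : (∫ r, (∫ x : I, crossPath δ μ ρ (gluePath ρ u) r t x * F x) ∂(bumpMeasure μ)) - m t
      = ∫ r, ((∫ x : I, crossPath δ μ ρ (gluePath ρ u) r t x * F x) - m t) ∂(bumpMeasure μ) := by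
    rw [integral_sub hi.integral_prod_left (integrable_const _)]; simp
  rw [e2, ← norm_eq_abs]
  refine (norm_integral_le_of_norm_le_const hbound).trans ?_
  simp

theorem exists_isApprox (h : HydroFlow α β A B ρ ρx ρt) (hA : 0 < A) (hB : 0 < B)
    (hα : α ∈ 𝕁ᵒ) (hβ : β ∈ 𝕁ᵒ) (hv : IsVersion hT w u g)
    (hw : ∀ F : C(I, ℝ), Continuous fun t => ∫ x, F x ∂(w.ev hT t).meas) (hI0 : 0 ≤ I₀)
    (hI : ∀ H, functionalJ α β A B hT H w ≤ I₀) (h0 : (w.ev hT 0).HasDensity fun x : I => ρ 0 x) :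
    ∃ C, ∀ ε > 0, ∃ V Vx, IsApprox α β A B I₀ ε C hT w ρ ρx V Vx := by
  have hα' := Ioo_subset_Icc_self hα
  have hβ' := Ioo_subset_Icc_self hβ
  set P := ∫ p : ℝ², ρx p.1 p.2 ^ 2 ∂(rectMeasure 0 T) with hP
  have hP0 : 0 ≤ P := integral_nonneg fun p => sq_nonneg _
  set Γ := ∫ p : ℝ², glueGrad T ρx g p.1 p.2 ^ 2 ∂stripMeasure with hΓ
  have hρL := h.memLp T hT
  refine ⟨2 * (2 * P + 2 * Γ) + 2 * (2 * P + 2 * 1), fun ε hε => ?_⟩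
  obtain ⟨δ, hδ, hδε, hδT, μ, hμ0, hμδ, hact⟩ :=
    exists_action_average_crossPath_le h hA hB hα hβ hv hw hI h0 (half_pos hε)
  have hμ : μ ∈ Ioc 0 (δ / 2) := ⟨hμ0, hμδ⟩
  have hprob := isProbabilityMeasure_bumpMeasure hμ0
  have hδT' : δ ≤ T := by linarith
  obtain ⟨ε₁, hε₁, hbd⟩ := h.bound δ hδ T
  obtain ⟨M, hM0, hM⟩ := h.exists_deriv_bound (b := T) hδ
  obtain ⟨C, hC, hCact⟩ := exists_action_le hA hB hα hβ (half_pos hε₁)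
  set CZ := C * (T * (1 + (M + 1) ^ 2) + (2 * P + 2 * 1)) with hCZ
  have hCZ0 : 0 ≤ CZ := by positivity
  set η := min (min ε (1 / 2)) (ε / (2 * (CZ + 1))) with hη
  have hη0 : 0 < η := by positivity
  have η1 : η ≤ ε := (min_le_left _ _).trans (min_le_left _ _)
  have η2 : η ≤ 1 / 2 := (min_le_left _ _).trans (min_le_right _ _)
  have η3 : η * CZ ≤ ε / 2 := by
    have : η ≤ ε / (2 * (CZ + 1)) := min_le_right _ _
    rw [le_div_iff₀ (by positivity)] at this; nlinarith
  set κ₀ := min (ε₁ / 2) 1 with hκ₀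
  have hκ₀0 : 0 < κ₀ := by positivity
  obtain ⟨V, Vx, Z, Zx, R, Rt, q, S⟩ := exists_isSmoothing h hv hδ hδT hμ
    ⟨hη0, by linarith⟩ hκ₀0
  set U : ℝ → ℝ → ℝ := fun t x => ∫ r, crossPath δ μ ρ (gluePath ρ u) r t x ∂(bumpMeasure μ) with hU
  set Ux : ℝ → ℝ → ℝ := fun t x => ∫ r, crossPath δ μ ρx (glueGrad T ρx g) r t x ∂(bumpMeasure μ)
    with hUx
  have hfam := isPathFamily_cross h hv δ hμ0
  have hUp : IsPath 0 T U Ux := hfam.isPath_average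
  have hUm : ∀ t, ∀ x ∈ 𝕁, U t x ∈ 𝕁 := fun t x hx => hfam.average_mem t hx
  have Zb : ∀ t ∈ Icc δ T, ∀ x ∈ 𝕁, ε₁ / 2 ≤ Z t x ∧ Z t x ≤ 1 - ε₁ / 2 := by
    intro t ht x hx
    have b1 := hbd t ht x hx
    have b2 := abs_le.1 ((S.bound_R t x hx).trans (min_le_left _ _))
    rw [S.eq_Z t ht x hx]; exact ⟨by linarith [b2.1], by linarith [b2.2]⟩
  have Zm : ∀ t ∈ Icc 0 T, ∀ x ∈ 𝕁, Z t x ∈ 𝕁 := by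
    intro t ht x hx
    rcases le_total t δ with h1 | h1
    · rw [(S.eq_init t h1).2.2.1]; exact h.mem t x hx
    · have := Zb t ⟨h1, ht.2⟩ x hx
      exact ⟨by linarith, by linarith⟩
  have ZxL : MemLp ⇈Zx 2 (rectMeasure 0 T) := (hρL.add S.memLp_q).ae_eq (by
      filter_upwards [S.eq_Zx] with p hp
      rw [hp, Pi.add_apply])
  have Zx2 : ∫ p : ℝ², Zx p.1 p.2 ^ 2 ∂(rectMeasure 0 T) ≤ 2 * P + 2 * 1 := by
    refine (integral_sq_le_of_ae_eq hρL S.memLp_q ?_).trans ?_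
    · filter_upwards [S.eq_Zx] with p hp
      rw [hp]; exact sq_add_le_two_mul _ _
    · have : κ₀ ^ 2 ≤ 1 := pow_le_one₀ hκ₀0.le (min_le_right _ _)
      linarith [S.sq_le]
  have hZp : IsPath 0 T Z Zx :=
    ⟨S.meas_Z, S.meas_Zx, fun t ht => Zm t (Ioc_subset_Icc_self ht), ZxL⟩
  have hη' : 1 - η ∈ 𝕁 := ⟨by linarith, by linarith⟩
  have Vm : ∀ t ∈ Icc 0 T, ∀ x ∈ 𝕁, V t x ∈ 𝕁 := by
    intro t ht x hx; rw [S.eq_V]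
    exact (convex_Icc (0 : ℝ) 1) (hUm t x hx) (Zm t ht x hx) hη'.1 (by linarith) (by ring)
  have Zact : ∀ K : SpaceTimeTest T, action α β A B K 0 T Z Zx ≤ CZ := by
    intro K; rw [← action_add K hδ.le hδT' hZp]
    have a1 : action α β A B K 0 δ Z Zx ≤ 0 := by
      rw [action_congr K hδ.le (u' := ρ) (g' := ρx) (by rw [(S.eq_init 0 hδ.le).2.2.1])
        (by rw [(S.eq_init δ le_rfl).2.2.1])
        fun t ht => ⟨(S.eq_init t ht.2.le).2.2.1, (S.eq_init t ht.2.le).2.2.2⟩]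
      exact h.action_nonpos hA hB hα' hβ' K hδ hδT'
    have a2 : action α β A B K δ T Z Zx ≤ CZ := by
      set Sδ : Set (ℝ²) := Icc δ T ×ˢ 𝕁
      set τ : ℝ² → ℝ := Sδ.indicator fun p => ρt p.1 p.2
      have τm : Measurable τ := (h.cont_t.mono (prod_mono (fun t ht => hδ.trans_le ht.1)
        le_rfl)).measurable_indicator (measurableSet_Icc.prod measurableSet_Icc)
      have τe : ∀ t ∈ Icc δ T, ∀ x ∈ 𝕁, τ (t, x) = ρt t x := fun t ht x hx =>
        indicator_of_mem (show (t, x) ∈ Sδ from ⟨ht, hx⟩) _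
      have hZδ := hZp.mono hδ.le le_rfl
      have key := hCact T K δ T (M + 1) Z Zx (fun t x => τ (t, x) + Rt t x) hδ.le hδT' le_rfl hZδ Zb
        (τm.add S.meas_Rt) (fun t ht x hx => ?_) (fun x hx t ht => ?_)
      · refine key.trans (mul_le_mul_of_nonneg_left (add_le_add ?_ ?_) hC)
        · exact mul_le_mul_of_nonneg_right (by linarith) (by positivity)
        · rw [integral_integral_eq_rect hδT' (F := fun t x => Zx t x ^ 2) hZδ.memLp.integrable_sq]
          refine le_trans ?_ Zx2
          exact integral_mono_measure (IsPath.rectMeasure_mono hδ.le le_rfl)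
            (.of_forall fun p => sq_nonneg _) ZxL.integrable_sq
      · rw [τe t ht x hx]
        refine (abs_add_le _ _).trans (add_le_add (hM t ht x hx).1 ?_)
        exact (S.bound_Rt t x hx).trans (min_le_right _ _)
      · rw [τe t ht x hx]
        refine ((h.has_t t (hδ.trans_le ht.1) x hx).add (S.has_Rt t x hx)).hasDerivWithinAt.congr_of_mem
          (fun s hs => ?_) ht
        rw [S.eq_Z s hs x hx]; rfl
    linarith
  have hVp : IsPath 0 T V Vx := by
    rw [S.eq_V, S.eq_Vx]; exact hUp.convexComb hZp hη'
  refine ⟨V, Vx, S.smooth, S.has_x, S.cont_x, hVp, Vm,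
    ⟨δ, ⟨hδ, by linarith⟩, fun t ht => ⟨(S.eq_init t ht).1, (S.eq_init t ht).2.1⟩,
      η * (ε₁ / 2), by positivity, fun t ht x hx => ?_⟩, fun H => ?_, ?_, fun F κ hF t ht => ?_⟩
  · have b1 := hUm t x hx
    have b2 := Zb t ht x hx
    rw [S.eq_V]
    beta_reduce
    have c1 : 0 ≤ (1 - η) * U t x := mul_nonneg hη'.1 b1.1
    have c2 : (1 - η) * U t x ≤ (1 - η) := mul_le_of_le_one_right hη'.1 b1.2
    have c3 : η * (ε₁ / 2) ≤ η * Z t x := mul_le_mul_of_nonneg_left b2.1 hη0.le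
    have c4 : η * Z t x ≤ η * (1 - ε₁ / 2) := mul_le_mul_of_nonneg_left b2.2 hη0.le
    constructor <;> linarith
  · have key := action_convexComb_le (α := α) (β := β) (A := A) (B := B) hUp hZp hT.le hη'
      (H.toTest hT.le) (hUm 0) (Zm 0 ⟨le_rfl, hT.le⟩) (hUm T) (Zm T ⟨hT.le, le_rfl⟩)
    rw [← S.eq_V, ← S.eq_Vx] at key
    have k1 := mul_le_mul_of_nonneg_left (hact H) hη'.1
    have k2 := mul_le_mul_of_nonneg_left (Zact (H.toTest hT.le)) hη0.le
    have k3 : (1 - η) * (I₀ + ε / 2) ≤ I₀ + ε / 2 := mul_le_of_le_one_left (by linarith) hη'.2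
    have e : (1 - (1 - η)) = η := by ring
    rw [e] at key; linarith
  · obtain ⟨-, kL, ki, ksq⟩ := memLp_average hμ0 δ (measurable_glueGrad T h.meas_x hv.meas_x)
      (memLp_glueGrad_of_version h hv) T
    have Ux2 : ∫ p : ℝ², Ux p.1 p.2 ^ 2 ∂(rectMeasure 0 T) ≤ 2 * P + 2 * Γ := by
      refine (integral_sq_le_of_ae_eq hρL kL ?_).trans (by linarith)
      filter_upwards [ki] with p hp
      have ux : Ux p.1 p.2 = (1 - timeStep δ μ p.1) * ρx p.1 p.2
          + timeStep δ μ p.1 * ∫ r, glueGrad T ρx g (p.1 - 2 * δ - r) p.2 ∂(bumpMeasure μ) := by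
        simp only [hUx, crossPath]
        rw [integral_add (integrable_const _) (hp.const_mul _),
          integral_const_mul (timeStep δ μ p.1)]
        simp
      have hχ := timeStep_mem (s := δ) hμ0 p.1
      rw [ux]
      refine (sq_add_le_two_mul _ _).trans (add_le_add ?_ ?_)
      · rw [mul_pow]
        refine mul_le_mul_of_nonneg_left (mul_le_of_le_one_left (sq_nonneg _) ?_) two_pos.le
        exact pow_le_one₀ (sub_nonneg.2 hχ.2) (sub_le_self _ hχ.1)
      · rw [mul_pow]
        exact mul_le_mul_of_nonneg_left (mul_le_of_le_one_left (sq_nonneg _)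
          (pow_le_one₀ hχ.1 hχ.2)) two_pos.le
    refine (integral_sq_le_of_ae_eq hUp.memLp ZxL (.of_forall fun p => ?_)).trans
      (by linarith)
    rw [S.eq_Vx]
    refine (sq_add_le_two_mul _ _).trans (add_le_add ?_ ?_)
    · rw [mul_pow]
      exact mul_le_mul_of_nonneg_left (mul_le_of_le_one_left (sq_nonneg _)
        (pow_le_one₀ hη'.1 hη'.2)) two_pos.le
    · rw [mul_pow]
      exact mul_le_mul_of_nonneg_left (mul_le_of_le_one_left (sq_nonneg _)
        (pow_le_one₀ (by linarith) (by linarith))) two_pos.le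
  · have b1 := abs_integral_crossPath_sub_le h hv h0 hδ hδT (hδε.trans (by linarith)) hμ F hF ht
    have int : ∀ v : ℝ → ℝ, Measurable v → (∀ x ∈ 𝕁, v x ∈ 𝕁) →
        Integrable fun x : I => v x * F x := by
      intro v hvm hv1
      refine Integrable.of_bound ((hvm.comp measurable_subtype_coe).mul
        F.continuous.measurable).aestronglyMeasurable ‖F‖ (.of_forall fun x => ?_)
      rw [norm_mul, norm_eq_abs, abs_of_nonneg (hv1 x x.2).1]
      exact (mul_le_of_le_one_left (norm_nonneg _) (hv1 x x.2).2).trans (F.norm_coe_le_norm x)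
    have b2 : |(∫ x : I, V t x * F x) - ∫ x : I, U t x * F x| ≤ ε * ‖F‖ := by
      rw [← integral_sub (int _ (measurable_slice hVp.meas t) (Vm t ht))
        (int _ (measurable_slice hUp.meas t) (hUm t)), ← norm_eq_abs]
      refine (norm_integral_le_of_norm_le_const (C := ε * ‖F‖)
        (.of_forall fun x => ?_)).trans (by simp)
      rw [← sub_mul, norm_mul]
      refine mul_le_mul ?_ (F.norm_coe_le_norm x) (norm_nonneg _) hε.le
      have z1 := Zm t ht x x.2
      have z2 := hUm t x x.2
      have e : V t x - U t x = η * (Z t x - U t x) := by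
        rw [S.eq_V]; ring
      rw [e, norm_mul, norm_eq_abs, abs_of_pos hη0, norm_eq_abs]
      refine (mul_le_of_le_one_right hη0.le ?_).trans η1
      rw [abs_le]
      constructor <;> linarith [z1.1, z1.2, z2.1, z2.2]
    calc |(∫ x : I, V t x * F x) - ∫ x, F x ∂(w.ev hT t).meas|
        ≤ |(∫ x : I, V t x * F x) - ∫ x : I, U t x * F x|
          + |(∫ x : I, U t x * F x) - ∫ x, F x ∂(w.ev hT t).meas| := abs_sub_le _ _ _
      _ ≤ κ + ε * ‖F‖ := by linarith

end Approximation

/-! ### Paths of densities -/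

section DensityPath

theorem SubProb.exists_hasDensity {f : I → ℝ} (hf : Measurable f) (h : ∀ x, f x ∈ 𝕁) :
    ∃ μ : SubProb, μ.HasDensity f := by
  have hm : (volume : Measure I).withDensity (fun x => ENNReal.ofReal (f x)) univ ≤ 1 := by
    rw [withDensity_apply _ MeasurableSet.univ, Measure.restrict_univ]
    calc _ ≤ ∫⁻ _ : I, 1 := lintegral_mono fun x => ENNReal.ofReal_le_one.2 (h x).2
      _ = 1 := by simp
  have hfin : IsFiniteMeasure ((volume : Measure I).withDensity fun x => ENNReal.ofReal (f x)) :=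
    ⟨hm.trans_lt ENNReal.one_lt_top⟩
  let μ : FiniteMeasure I := ⟨_, hfin⟩
  have : μ.mass ≤ 1 := by
    rw [← ENNReal.coe_le_coe, FiniteMeasure.ennreal_mass]; exact hm
  exact ⟨⟨μ, this⟩, hf.aemeasurable, rfl⟩

theorem exists_densityPath (hT : 0 < T) {V : ℝ → ℝ → ℝ} (hm : Measurable ⇈V)
    (h : ∀ t ∈ Icc 0 T, ∀ x ∈ 𝕁, V t x ∈ 𝕁)
    (hc : ∀ F : C(I, ℝ), ContinuousOn (fun t => ∫ x : I, V t x * F x) (Icc 0 T)) :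
    ∃ s : SkorohodPath T SubProb, ∀ t ∈ Icc 0 T, (s.ev hT t).HasDensity fun x : I => V t x := by
  choose μ hμ using fun t : Icc (0 : ℝ) T => SubProb.exists_hasDensity
    ((measurable_slice hm t).comp measurable_subtype_coe) fun x => h t t.2 x x.2
  have cont : Continuous μ := by
    refine (⟨rfl⟩ : IsInducing (fun (μ : SubProb) (F : C(I, ℝ)) => ∫ x, F x ∂μ.meas)).continuous_iff.2
      (continuous_pi fun F => ?_)
    refine (continuousOn_iff_continuous_domRestrict.1 (hc F)).congr fun t => ?_
    exact ((hμ t).integral_eq (fun x => (h t t.2 x x.2).1) F).symm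
  refine ⟨⟨μ, fun t => cont.continuousWithinAt, fun t => ⟨μ t, cont.continuousAt.mono_left
    nhdsWithin_le_nhds⟩⟩, fun t ht => ?_⟩
  rw [SkorohodPath.ev, IccExtend_of_mem _ _ ht]; exact hμ ⟨t, ht⟩

/-- Uniform convergence in time of the pairings implies convergence in the Skorohod topology. -/
theorem SkorohodPath.tendsto_of_integral {s : ℕ → SkorohodPath T SubProb} (h : ∀ (F : C(I, ℝ)), ∀ κ > 0, ∀ᶠ n in atTop, ∀ t ∈ Icc 0 T,
      |(∫ x, F x ∂((s n).ev hT t).meas) - ∫ x, F x ∂(w.ev hT t).meas| ≤ κ) :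
    Tendsto s atTop (𝓝 w) := by
  have key : TendstoUniformly (fun n => (s n).toFun) w.toFun atTop := by
    rw [tendstoUniformly_iff_tendsto]
    change Tendsto _ _ (comap _ (𝓤 (C(I, ℝ) → ℝ)))
    rw [tendsto_comap_iff, Pi.uniformity, tendsto_iInf]
    intro F; rw [tendsto_comap_iff]
    have : TendstoUniformly (fun n t => ∫ x, F x ∂((s n).toFun t).meas)
        (fun t => ∫ x, F x ∂(w.toFun t).meas) atTop := by
      refine Metric.tendstoUniformly_iff.2 fun κ hκ => ?_
      filter_upwards [h F _ (half_pos hκ)] with n hn t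
      have := hn t t.2
      rw [SkorohodPath.ev, SkorohodPath.ev, IccExtend_val, IccExtend_val] at this
      rw [dist_comm, Real.dist_eq]; linarith
    exact tendstoUniformly_iff_tendsto.1 this
  refine Uniform.tendsto_nhds_right.2 fun S hS => mem_map.2 ?_
  obtain ⟨V, hV, ε, hε, hVS⟩ := SkorohodPath.mem_uniformity_iff.1 hS
  filter_upwards [key V hV] with n hn
  exact hVS ⟨OrderIso.refl _, fun t => by simpa using hε, hn⟩

theorem HydroFlow.continuousOn_integral {V : ℝ → ℝ → ℝ} (h : HydroFlow α β A B ρ ρx ρt)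
    (hV : ContinuousOn ⇈V (Ioi 0 ×ˢ 𝕁)) (hδ : 0 < δ) (hρ : ∀ t ≤ δ, V t = ρ t) (F : C(I, ℝ)) :
    ContinuousOn (fun t => ∫ x : I, V t x * F x) (Ici 0) := by
  have pos : ContinuousOn (fun t => ∫ x : I, V t x * F x) (Ioi 0) := by
    have : LocallyCompactSpace (Ioi (0 : ℝ)) := isOpen_Ioi.isLocallyClosed.locallyCompactSpace
    refine continuousOn_iff_continuous_domRestrict.2 ?_
    have := continuous_parametric_integral_of_continuous (μ := (volume : Measure I))
      (f := fun (t : Ioi (0 : ℝ)) (x : I) => V t x * F x) (s := univ)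
      ((hV.comp_continuous (f := fun q : Ioi (0 : ℝ) × I => ((q.1 : ℝ), (q.2 : ℝ))) (by fun_prop)
        fun q => ⟨q.1.2, q.2.2⟩).mul (by fun_prop)) isCompact_univ
    simp only [Measure.restrict_univ] at this; exact this
  intro t ht
  rcases (mem_Ici.1 ht).eq_or_lt with rfl | ht
  · rw [← Ioi_union_left, continuousWithinAt_union]
    refine ⟨?_, continuousWithinAt_singleton⟩
    have := h.tendsto_integral_comp (Φ := fun _ x r => r * IccExtend zero_le_one F x)
      (continuous_snd.snd.mul (F.continuous.Icc_extend'.comp continuous_snd.fst))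
    simp only [← integral_unitInterval, IccExtend_val] at this; rw [ContinuousWithinAt, hρ 0 hδ.le]
    refine this.congr' ?_
    filter_upwards [nhdsWithin_le_nhds (Iio_mem_nhds hδ)] with t ht
    rw [hρ t (le_of_lt ht)]
  · exact (pos.continuousAt (Ioi_mem_nhds ht)).continuousWithinAt

theorem HydroFlow.continuous_glueMoment (h : HydroFlow α β A B ρ ρx ρt)
    (hw : ∀ F : C(I, ℝ), Continuous fun t => ∫ x, F x ∂(w.ev hT t).meas)
    (h0 : (w.ev hT 0).HasDensity fun x : I => ρ 0 x) (F : C(I, ℝ)) :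
    Continuous (glueMoment hT w ρ F) := by
  have h1 := (h.continuousOn_integral h.smooth.continuousOn one_pos (fun _ _ => rfl) F).comp_continuous
    (f := fun s : ℝ => max (-s) 0) (by fun_prop) fun s => mem_Ici.2 (le_max_right _ _)
  refine (Continuous.if_le h1 (hw F) continuous_id (continuous_const (y := 0)) fun s hs => ?_).congr
    fun s => ?_
  · rw [id] at hs; rw [hs, h0.integral_eq fun x => (h.mem 0 x x.2).1]
    simp
  · simp only [glueMoment, id]
    split_ifs with hs
    · simp only [Function.comp_apply, max_eq_left (neg_nonneg.2 hs)]
    · rfl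

/-! ### Finite energy -/

theorem integral_mul_deriv_of_boundary {f' φ : ℝ → ℝ}
    (hf : ∀ x ∈ 𝕁, HasDerivWithinAt f (f' x) 𝕁 x)
    (hf' : ContinuousOn f' 𝕁) (hφ : ContDiff ℝ ∞ φ) (h0 : φ 0 = 0) (h1 : φ 1 = 0) :
    ∫ x : I, f x * deriv φ x = -∫ x : I, f' x * φ x := by
  rw [integral_unitInterval fun x => f x * deriv φ x, integral_unitInterval fun x => f' x * φ x,
    integral_mul_deriv_Icc zero_le_one hf (fun x _ =>
      (hφ.differentiable (by simp) x).hasDerivAt.hasDerivWithinAt)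
      (intble01 hf')
      ((hφ.continuous_deriv (by simp)).intervalIntegrable _ _), h0, h1]
  ring

theorem IsEnergyTest.exists_slice {G : ℝ → ℝ → ℝ} (hG : IsEnergyTest T G)
    (ht : t ∈ Icc 0 T) : ∃ φ : ℝ → ℝ, ContDiff ℝ ∞ φ ∧ φ 0 = 0 ∧ φ 1 = 0 ∧
      ∀ x ∈ 𝕁ᵒ, φ x = G t x ∧ deriv φ x = deriv (G t) x := by
  obtain ⟨hs, K, hK, hKs, hK0⟩ := hG
  have heq : ∀ x ∈ 𝕁ᵒ, 𝕁ᵒ.indicator (G t) =ᶠ[𝓝 x] G t := fun x hx => by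
    filter_upwards [Ioo_mem_nhds hx.1 hx.2] with y hy using indicator_of_mem hy _
  refine ⟨𝕁ᵒ.indicator (G t), contDiff_iff_contDiffAt.2 fun x => ?_, by simp, by simp,
    fun x hx => ⟨indicator_of_mem hx _, (heq x hx).deriv_eq⟩⟩
  by_cases hx : (t, x) ∈ K
  · have hx' := (hKs hx).2
    have := hs.comp (f := fun y : ℝ => (t, y)) (s := Ioo 0 1) (by fun_prop) fun y hy => ⟨ht, hy⟩
    exact (this.contDiffAt (Ioo_mem_nhds hx'.1 hx'.2)).congr_of_eventuallyEq (heq x hx')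
  · have : 𝕁ᵒ.indicator (G t) =ᶠ[𝓝 x] fun _ => 0 := by
      filter_upwards [(hK.isClosed.isOpen_compl.preimage
        (by fun_prop : Continuous fun y : ℝ => (t, y))).mem_nhds hx] with y hy
      exact indicator_apply_eq_zero.2 fun hy' => hK0 (t, y) ⟨ht, hy'⟩ hy
    exact contDiffAt_const.congr_of_eventuallyEq this

theorem IsEnergyTest.integrable_sq {G : ℝ → ℝ → ℝ} (hG : IsEnergyTest T G) :
    Integrable (fun p : ℝ² => G p.1 p.2 ^ 2) (rectMeasure 0 T) := by
  obtain ⟨hs, K, hK, hKs, hK0⟩ := hG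
  obtain ⟨C, hC⟩ := hK.exists_bound_of_continuousOn (hs.continuousOn.mono hKs)
  have hC0 : ∀ p ∈ Icc 0 T ×ˢ 𝕁ᵒ, ‖G p.1 p.2 ^ 2‖ ≤ C ^ 2 := by
    intro p hp
    by_cases h : p ∈ K
    · rw [norm_pow]; exact pow_le_pow_left₀ (norm_nonneg _) (hC p h) 2
    · rw [hK0 p hp h]; simpa using sq_nonneg C
  have hms : MeasurableSet (Icc 0 T ×ˢ 𝕁ᵒ) := measurableSet_Icc.prod measurableSet_Ioo
  have e : rectMeasure 0 T = volume.restrict (Icc 0 T ×ˢ 𝕁ᵒ) := by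
    rw [rectMeasure, Measure.restrict_congr_set Ioc_ae_eq_Icc, restrict_Ioo_eq_restrict_Ioc.symm,
      Measure.prod_restrict]
    rfl
  have : IsFiniteMeasure (volume.restrict (Icc 0 T ×ˢ 𝕁ᵒ)) := e ▸ inferInstance
  rw [e]
  exact Integrable.of_bound ((hs.continuousOn.pow 2).aestronglyMeasurable hms) (C ^ 2)
    ((ae_restrict_iff' hms).2 (.of_forall hC0))

theorem finiteEnergyAC_of_density {s : SkorohodPath T SubProb} {V Vx : ℝ → ℝ → ℝ}
    (hd : ∀ t ∈ Icc 0 T, (s.ev hT t).HasDensity fun x : I => V t x)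
    (hm : ∀ t ∈ Icc 0 T, ∀ x ∈ 𝕁, V t x ∈ 𝕁)
    (hx : ∀ t > 0, ∀ x ∈ 𝕁, HasDerivWithinAt (V t) (Vx t x) 𝕁 x)
    (hc : ∀ t > 0, ContinuousOn (Vx t) 𝕁)
    (hL : MemLp ⇈Vx 2 (rectMeasure 0 T)) : FiniteEnergyAC hT s := by
  refine ⟨fun t => ⟨fun x => V t x, fun x => hm t t.2 x x.2, ?_⟩, lt_of_le_of_lt ?_
    (EReal.coe_lt_top (1 / 2 * ∫ t in (0)..T, ∫ x in (0)..1, Vx t x ^ 2))⟩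
  · have := hd t t.2
    rwa [SkorohodPath.ev, IccExtend_val] at this
  refine iSup₂_le fun G hG => EReal.coe_le_coe_iff.2 ?_
  have i1 := intervalIntegrable_integral_of_rect hT.le (F := fun t x => Vx t x ^ 2) hL.integrable_sq
  have i2 := intervalIntegrable_integral_of_rect hT.le (F := fun t x => G t x ^ 2) hG.integrable_sq
  have eG : ∀ t, ∫ x : I, G t x ^ 2 = _ := fun t => integral_unitInterval fun x => G t x ^ 2
  simp only [eG]; rw [sub_le_iff_le_add, ← mul_add, ← iint_add i1 i2, ← iint_const_mul]
  have pt : ∀ t ∈ Ioc 0 T, ∫ x : I, deriv (G t) x ∂(s.ev hT t).meas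
      ≤ 1 / 2 * ((∫ x in (0)..1, Vx t x ^ 2) + ∫ x in (0)..1, G t x ^ 2) := by
    intro t ht
    have htI := Ioc_subset_Icc_self ht
    obtain ⟨φ, hφ, h0, h1, he⟩ := hG.exists_slice htI
    have ae : ∀ᵐ x : I, (x : ℝ) ∈ 𝕁ᵒ := ae_unitInterval_iff.2 (by
      rw [← Measure.restrict_congr_set Ioo_ae_eq_Icc]
      exact ae_restrict_mem measurableSet_Ioo)
    have e1 : ∫ x : I, V t x * deriv (G t) x = ∫ x : I, V t x * deriv φ x :=
      integral_congr_ae (ae.mono fun x hx => by simp only [(he x hx).2])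
    have e2 : ∫ x : I, G t x ^ 2 = ∫ x : I, φ x ^ 2 :=
      integral_congr_ae (ae.mono fun x hx => by simp only [(he x hx).1])
    rw [(hd t htI).integral_eq (fun x => (hm t htI x x.2).1) fun x : I => deriv (G t) x, e1,
      integral_mul_deriv_of_boundary (hx t ht.1) (hc t ht.1) hφ h0 h1,
      ← integral_unitInterval fun x => G t x ^ 2, e2, integral_unitInterval fun x => φ x ^ 2,
      integral_unitInterval fun x => Vx t x * φ x, ← iint_neg]
    have c1 := hc t ht.1
    have c2 := hφ.continuous.continuousOn (s := 𝕁)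
    rw [← iint_add (intble01 (c1.fun_pow 2)) (intble01 (c2.fun_pow 2)), ← iint_const_mul]
    refine iint_mono_on zero_le_one
      (intble01 (c1.fun_mul c2).fun_neg)
      ((intble01 ((c1.fun_pow 2).fun_add (c2.fun_pow 2))).const_mul _)
      fun x _ => ?_
    nlinarith [sq_nonneg (Vx t x + φ x)]
  by_cases hi : IvlInt (fun t => ∫ x : I, deriv (G t) x ∂(s.ev hT t).meas) 0 T
  · rw [iint_of_le hT.le, iint_of_le hT.le]
    exact setIntegral_mono_on hi.1 ((i1.add_fun i2).const_mul _).1 measurableSet_Ioc pt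
  · rw [intervalIntegral.integral_undef hi]
    refine iint_nonneg hT.le fun t _ => ?_
    have : ∀ f : ℝ → ℝ, 0 ≤ ∫ x in (0)..1, f x ^ 2 := fun f =>
      iint_nonneg zero_le_one fun x _ => sq_nonneg _
    linarith [this (Vx t), this (G t)]

end DensityPath

/-! ### Lower semicontinuity -/

/-- `f` is a profile in `H¹` with derivative `g`. -/
structure IsProfile (f g : ℝ → ℝ) : Prop where
  int : IvlInt g 0 1
  sq : IvlInt (fun x => g x ^ 2) 0 1
  eq : ∀ x ∈ 𝕁, f x = f 0 + ∫ y in (0)..x, g y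

namespace IsProfile

variable {g u k : ℝ → ℝ}

theorem cont (h : IsProfile f g) : ContinuousOn f 𝕁 := by
  have := intervalIntegral.continuousOn_primitive_interval
    ((intervalIntegrable_iff' (by simp)).1 h.int)
  rw [uIcc01] at this; exact (continuousOn_const.add this).congr h.eq

theorem abs_sub_le (h : IsProfile f g) {y η : ℝ} (hη : 0 < η) (hx : x ∈ 𝕁) (hy : y ∈ 𝕁) :
    |f x - f y| ≤ η * (∫ z in (0)..1, g z ^ 2) + |x - y| / (4 * η) := by
  wlog hxy : y ≤ x generalizing x y
  · rw [abs_sub_comm, abs_sub_comm x]; exact this hy hx (not_le.1 hxy).le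
  have sub : ∀ {k : ℝ → ℝ}, IvlInt k 0 1 → IvlInt k y x := fun hk => hk.mono_set (by
      rw [uIcc_of_le hxy, uIcc01]
      exact Icc_subset_Icc hy.1 hx.2)
  have e : f x - f y = ∫ z in y..x, g z := by
    have i : ∀ z ∈ 𝕁, IvlInt g 0 z := fun z hz => h.int.mono_set (by
      rw [uIcc_of_le hz.1, uIcc01]
      exact Icc_subset_Icc_right hz.2)
    rw [h.eq x hx, h.eq y hy, ← intervalIntegral.integral_interval_sub_left (i x hx) (i y hy)]; ring
  rw [e, abs_of_nonneg (sub_nonneg.2 hxy)]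
  calc |∫ z in y..x, g z| ≤ ∫ z in y..x, |g z| := intervalIntegral.abs_integral_le_integral_abs hxy
    _ ≤ ∫ z in y..x, (η * g z ^ 2 + 1 / (4 * η)) := by
      refine iint_mono_on hxy (sub h.int).abs
        (((sub h.sq).const_mul η).add_fun intervalIntegrable_const) fun z _ => ?_
      have e : η * g z ^ 2 + 1 / (4 * η) - |g z| = η * (|g z| - 1 / (2 * η)) ^ 2 := by
        rw [← sq_abs (g z)]; field_simp; ring
      nlinarith [mul_nonneg hη.le (sq_nonneg (|g z| - 1 / (2 * η)))]
    _ ≤ _ := by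
      rw [iint_add ((sub h.sq).const_mul η) intervalIntegrable_const,
        iint_const_mul, iint_const, smul_eq_mul]
      have := intervalIntegral.integral_mono_interval hy.1 hxy hx.2
        (.of_forall fun z => sq_nonneg (g z)) h.sq
      have e : (x - y) * (1 / (4 * η)) = (x - y) / (4 * η) := by ring
      nlinarith

/-- Approximation of the point value `f x₀` by an average, uniformly on bounded sets of `H¹`. -/
theorem exists_kernel {x₀ η : ℝ} (hx₀ : x₀ ∈ 𝕁) (hη : 0 < η) :
    ∃ p : ℝ → ℝ, Continuous p ∧ ∀ f g : ℝ → ℝ, IsProfile f g →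
      |(∫ x in (0)..1, p x * f x) - f x₀| ≤ η * ((∫ x in (0)..1, g x ^ 2) + 1) := by
  set e := min 1 (4 * η ^ 2) with he
  have he0 : 0 < e := by positivity
  have he1 : e ≤ 1 := min_le_left _ _
  have hs : 0 ≤ x₀ * (1 - e) := mul_nonneg hx₀.1 (by linarith)
  refine ⟨timeBump (x₀ * (1 - e)) e, continuous_timeBump _ _, fun f g h => ?_⟩
  refine abs_integral_timeBump_mul_sub_le he0 hs (by nlinarith [hx₀.2])
    (intble01 h.cont) fun y hy => ?_
  have hyI : y ∈ 𝕁 := ⟨by linarith [hy.1], by nlinarith [hy.2, hx₀.2]⟩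
  have h1 : |y - x₀| ≤ e := abs_le.2 ⟨by nlinarith [hy.1, hx₀.2], by nlinarith [hy.2, hx₀.1]⟩
  have h2 : |y - x₀| / (4 * η) ≤ η := by
    rw [div_le_iff₀ (by positivity)]; linarith [min_le_right 1 (4 * η ^ 2)]
  linarith [h.abs_sub_le hη hyI hx₀]

theorem sub (h : IsProfile f g) (h' : IsProfile u k) :
    IsProfile (fun x => f x - u x) fun x => g x - k x := by
  refine ⟨h.int.sub_fun h'.int, ?_, fun x hx => ?_⟩
  · rw [intervalIntegrable_iff_integrableOn_Ioc_of_le zero_le_one]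
    have m : ∀ {k : ℝ → ℝ}, IvlInt k 0 1 → IvlInt (fun x => k x ^ 2) 0 1 →
        MemLp k 2 (volume.restrict (Ioc (0 : ℝ) 1)) := fun i1 i2 =>
      (memLp_two_iff_integrable_sq i1.1.aestronglyMeasurable).2 i2.1
    exact ((m h.int h.sq).sub (m h'.int h'.sq)).integrable_sq
  · have s : ∀ {k : ℝ → ℝ}, IvlInt k 0 1 → IvlInt k 0 x := fun hk => hk.mono_set (by
        rw [uIcc_of_le hx.1, uIcc01]
        exact Icc_subset_Icc_right hx.2)
    rw [h.eq x hx, h'.eq x hx, iint_sub (s h.int) (s h'.int)]; ring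

end IsProfile

/-- The derivative of `bdryB ϱ D a M` in `a`. -/
def bdrySlope (ϱ D M : ℝ) : ℝ := 1 / D * ((1 - ϱ) * (exp (-M) - 1) - ϱ * (exp M - 1))

/-- The rate density is bounded below by its linearization. -/
theorem rateDensity_ge (K : SpaceTimeTest T) {f' u g q : ℝ → ℝ}
    (hf : IsProfile f f') (hu : IsProfile u g)
    (hq : ∀ x ∈ 𝕁, HasDerivWithinAt (K.hx t) (q x) 𝕁 x)
    (cq : Continuous q) : rateDensity α β A B K t u g
      + ((∫ x in (0)..1, (f x - u x) * (-K.ht t x - q x - K.hx t x ^ 2 + u x * (2 * K.hx t x ^ 2)))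
      + (f 1 - u 1) * (K.hx t 1 - bdrySlope β B (K.h t 1))
      + (f 0 - u 0) * (-K.hx t 0 - bdrySlope α A (K.h t 0))) ≤ rateDensity α β A B K t f f' := by
  have ct : Continuous (K.ht t) := K.cont_t.along t
  have cx : Continuous (K.hx t) := K.cont_x.along t
  have hD := hf.sub hu
  have int := fun {k : ℝ → ℝ} (hk : ContinuousOn k 𝕁) =>
    intble01 hk
  have cu := hu.cont
  have cD := hD.cont
  have ibp : ∫ x in (0)..1, (f' x - g x) * K.hx t x = (f 1 - u 1) * K.hx t 1
      - (f 0 - u 0) * K.hx t 0 - ∫ x in (0)..1, (f x - u x) * q x := by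
    have h1 := integral_primitive_mul_deriv hD.int hq (cq.intervalIntegrable 0 1)
    have h2 := integral_deriv_Icc zero_le_one hq (cq.intervalIntegrable 0 1)
    have h3 : ∫ x in (0)..1, (∫ y in (0)..x, (f' y - g y)) * q x
        = ∫ x in (0)..1, ((f x - u x) * q x - (f 0 - u 0) * q x) := iint_congr fun x hx => by
        rw [uIcc01] at hx
        have := hD.eq x hx
        rw [this]; ring
    rw [iint_sub (int (cD.fun_mul cq.continuousOn))
      ((cq.intervalIntegrable 0 1).const_mul _), iint_const_mul, h2] at h3
    have h4 := hD.eq 1 (by simp)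
    rw [h3] at h1; rw [h4]
    linear_combination h1
  have ib : ∀ {k k' : ℝ → ℝ}, IsProfile k k' →
      IvlInt (fun x => bulkDensity K t x (k x) (k' x)) 0 1 := by
    intro k k' hk
    have c := hk.cont
    have h1 := (hk.int.mul_continuousOn cx.continuousOn).add_fun
      (int (k := fun x => -k x * K.ht t x - k x * (1 - k x) * K.hx t x ^ 2) (by fun_prop))
    refine h1.congr fun x _ => ?_
    simp only [bulkDensity]; ring
  have i1 : IvlInt (fun x => (f x - u x) * (-K.ht t x - q x - K.hx t x ^ 2
      + u x * (2 * K.hx t x ^ 2))) 0 1 := int (by fun_prop)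
  have i2 : IvlInt (fun x => (f x - u x) * q x) 0 1 := int (by fun_prop)
  have i3 := hD.int.mul_continuousOn cx.continuousOn
  have main : (∫ x in (0)..1, bulkDensity K t x (u x) (g x))
      + (∫ x in (0)..1, (f x - u x) * (-K.ht t x - q x - K.hx t x ^ 2
        + u x * (2 * K.hx t x ^ 2))) + (∫ x in (0)..1, (f x - u x) * q x)
      + (∫ x in (0)..1, (f' x - g x) * K.hx t x)
      ≤ ∫ x in (0)..1, bulkDensity K t x (f x) (f' x) := by
    rw [← iint_add (ib hu) i1, ← iint_add ((ib hu).add_fun i1) i2,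
      ← iint_add (((ib hu).add_fun i1).add_fun i2) i3]
    refine iint_mono_on zero_le_one
      ((((ib hu).add_fun i1).add_fun i2).add_fun i3) (ib hf) fun x _ => ?_
    simp only [bulkDensity]; nlinarith [mul_nonneg (sq_nonneg (f x - u x)) (sq_nonneg (K.hx t x))]
  have eb : ∀ ϱ D a b M : ℝ, bdryB ϱ D a M = bdryB ϱ D b M + (a - b) * bdrySlope ϱ D M := by
    intro ϱ D a b M; simp only [bdryB, bdrySlope]; ring
  rw [rateDensity, rateDensity, bdryDensity, bdryDensity, eb α A (f 0) (u 0), eb β B (f 1) (u 1)]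
  linarith

theorem IsVersion.eventually_functionalJ_ge (hv : IsVersion hT w u g) {s : ℕ → SkorohodPath T SubProb}
    {V Vx : ℕ → ℝ → ℝ → ℝ} {κ : ℝ} (hp : ∀ n, IsPath 0 T (V n) (Vx n))
    (hd : ∀ n, ∀ t ∈ Ioc 0 T, ((s n).ev hT t).HasDensity fun x : I => V n t x)
    (hP : ∀ n, ∀ t ∈ Ioc 0 T, IsProfile (V n t) (Vx n t))
    (hC : ∀ n, ∫ p : ℝ², Vx n p.1 p.2 ^ 2 ∂(rectMeasure 0 T) ≤ C)
    (hlim : ∀ (F : C(I, ℝ)), ∀ t ∈ Icc 0 T, Tendsto (fun n => ∫ x, F x ∂((s n).ev hT t).meas) atTop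
      (𝓝 (∫ x, F x ∂(w.ev hT t).meas))) (H : C12 T) (hκ : 0 < κ) :
    ∀ᶠ n in atTop, functionalJ α β A B hT H w - κ < functionalJ α β A B hT H (s n) := by
  set K := H.toTest hT.le with hK
  set q : ℝ → ℝ → ℝ := fun t x => H.dxx (projIcc 0 T hT.le t) (𝕡 x) with hq
  have cq : Continuous ⇈q := H.cont_dxx.clamp hT.le
  have hhq : ∀ t ∈ Icc 0 T, ∀ x ∈ 𝕁, HasDerivWithinAt (K.hx t) (q t x) 𝕁 x := by
    intro t ht x hx
    simp only [hq, hK, C12.toTest, projIcc_of_mem hT.le ht, projIcc_of_mem zero_le_one hx]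
    exact (H.has_dxx t ht x hx).congr_of_mem (fun y hy => by rw [projIcc_of_mem zero_le_one hy]) hx
  set ξ₁ : ℝ → ℝ := fun t => K.hx t 1 - bdrySlope β B (K.h t 1) with hξ₁
  set ξ₀ : ℝ → ℝ := fun t => -K.hx t 0 - bdrySlope α A (K.h t 0) with hξ₀
  have ch := K.cont_right
  have chx : ∀ x, Continuous fun t => K.hx t x := fun x =>
    K.cont_x.comp (by fun_prop : Continuous fun t : ℝ => (t, x))
  have cξ₁ : Continuous ξ₁ := by
    have := ch 1; have := chx 1
    simp only [hξ₁, bdrySlope]; fun_prop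
  have cξ₀ : Continuous ξ₀ := by
    have := ch 0; have := chx 0
    simp only [hξ₀, bdrySlope]; fun_prop
  obtain ⟨M₁, hM₁⟩ := (isCompact_Icc (a := 0) (b := T)).exists_bound_of_continuousOn
    (cξ₁.prodMk cξ₀).continuousOn
  have hM0 : 0 ≤ M₁ := (norm_nonneg _).trans (hM₁ 0 ⟨le_rfl, hT.le⟩)
  set Q := ∫ p : ℝ², g p.1 p.2 ^ 2 ∂(rectMeasure 0 T) with hQ
  have hQ0 : 0 ≤ Q := integral_nonneg fun p => sq_nonneg _
  have hC0 : 0 ≤ C := (integral_nonneg fun p => sq_nonneg _).trans (hC 0)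
  set η := κ / (4 * (2 * M₁ * (2 * C + 2 * Q + T) + 1)) with hη
  have hη0 : 0 < η := by positivity
  obtain ⟨p₁, cp₁, hp₁⟩ := IsProfile.exists_kernel (x₀ := 1) (by simp) hη0
  obtain ⟨p₀, cp₀, hp₀⟩ := IsProfile.exists_kernel (x₀ := 0) (by simp) hη0
  set a : ℝ² → ℝ := fun p => -K.ht p.1 p.2 - q p.1 p.2 - K.hx p.1 p.2 ^ 2
    + ξ₁ p.1 * p₁ p.2 + ξ₀ p.1 * p₀ p.2 with ha
  set b : ℝ² → ℝ := fun p => 2 * K.hx p.1 p.2 ^ 2 with hb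
  have ca : Continuous a := by
    have := K.cont_t; have := K.cont_x
    fun_prop
  have cb : Continuous b := (K.cont_x.pow 2).const_mul 2
  set Θ : ℝ → ℝ → ℝ := fun t x => a (t, x) + u t x * b (t, x) with hΘ
  have hvp : ∀ᵐ t ∂(volume.restrict (Ioc 0 T)), IsProfile (u t) (g t) := by
    filter_upwards [hv.ae, ae_intervalIntegrable_of_rect (F := fun t x => g t x ^ 2)
      hv.memLp.integrable_sq] with t ht h2
    exact ⟨ht.2.1, h2, ht.2.2⟩
  have hmem := ae_restrict_mem (μ := volume) (measurableSet_Ioc (a := (0 : ℝ)) (b := T))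
  have ctΘ : ∀ {t : ℝ}, IsProfile (u t) (g t) → ContinuousOn (Θ t) 𝕁 := fun h =>
    (ca.comp (by fun_prop)).continuousOn.add (h.cont.mul (cb.comp (by fun_prop)).continuousOn)
  set L : ℕ → ℝ → ℝ := fun n t => ∫ x in (0)..1, (V n t x - u t x) * Θ t x with hL
  -- pointwise lower bound
  have low : ∀ n, ∀ᵐ t ∂(volume.restrict (Ioc 0 T)), rateDensity α β A B K t (u t) (g t) + L n t
      ≤ rateDensity α β A B K t (V n t) (Vx n t) + 2 * M₁ * η * (2 * (∫ x in (0)..1, Vx n t x ^ 2)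
        + 2 * (∫ x in (0)..1, g t x ^ 2) + 1) := by
    intro n
    filter_upwards [hvp, hmem] with t hu ht
    have htI := Ioc_subset_Icc_self ht
    have hf := hP n t ht
    have hD := hf.sub hu
    have cD := hD.cont
    have int := fun {k : ℝ → ℝ} (hk : ContinuousOn k 𝕁) =>
      intble01 hk
    have cqt : Continuous (q t) := cq.along t
    have key := rateDensity_ge (α := α) (β := β) (A := A) (B := B) K hf hu (hhq t htI) cqt
    have ct : Continuous (K.ht t) := K.cont_t.along t
    have cx : Continuous (K.hx t) := K.cont_x.along t
    have cu := hu.cont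
    have eL : L n t = (∫ x in (0)..1, (V n t x - u t x) * (-K.ht t x - q t x - K.hx t x ^ 2
        + u t x * (2 * K.hx t x ^ 2))) + ξ₁ t * (∫ x in (0)..1, p₁ x * (V n t x - u t x))
        + ξ₀ t * ∫ x in (0)..1, p₀ x * (V n t x - u t x) := by
      have j1 := int (cp₁.continuousOn.fun_mul cD)
      have j0 := int (cp₀.continuousOn.fun_mul cD)
      have j : IvlInt (fun x => (V n t x - u t x) * (-K.ht t x - q t x - K.hx t x ^ 2
        + u t x * (2 * K.hx t x ^ 2))) 0 1 := int (by fun_prop)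
      rw [← iint_const_mul, ← iint_const_mul, ← iint_add j (j1.const_mul _),
        ← iint_add (j.add_fun (j1.const_mul _)) (j0.const_mul _)]
      refine iint_congr fun x _ => ?_
      simp only [hΘ, ha, hb]; ring
    have sq : ∫ x in (0)..1, (Vx n t x - g t x) ^ 2
        ≤ 2 * (∫ x in (0)..1, Vx n t x ^ 2) + 2 * ∫ x in (0)..1, g t x ^ 2 := by
      rw [← iint_const_mul, ← iint_const_mul, ← iint_add (hf.sq.const_mul 2) (hu.sq.const_mul 2)]
      refine iint_mono_on zero_le_one hD.sq
        ((hf.sq.const_mul 2).add_fun (hu.sq.const_mul 2)) fun x _ => ?_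
      nlinarith [sq_nonneg (Vx n t x + g t x)]
    have err : ∀ {ξ y z : ℝ}, |ξ| ≤ M₁ → |y - z| ≤ η * ((∫ x in (0)..1, (Vx n t x - g t x) ^ 2) + 1) →
        ξ * y ≤ z * ξ + M₁ * η * (2 * (∫ x in (0)..1, Vx n t x ^ 2)
          + 2 * (∫ x in (0)..1, g t x ^ 2) + 1) := by
      intro ξ y z h1 h2
      have h3 : |y - z| ≤ η * (2 * (∫ x in (0)..1, Vx n t x ^ 2)
          + 2 * (∫ x in (0)..1, g t x ^ 2) + 1) :=
        h2.trans (mul_le_mul_of_nonneg_left (by linarith) hη0.le)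
      have h4 := mul_le_mul h1 h3 (abs_nonneg _) hM0
      rw [← abs_mul] at h4; linarith [le_abs_self (ξ * (y - z))]
    have hm := hM₁ t htI
    have e1 := err ((le_max_left |ξ₁ t| |ξ₀ t|).trans hm) (hp₁ _ _ hD)
    have e0 := err ((le_max_right |ξ₁ t| |ξ₀ t|).trans hm) (hp₀ _ _ hD)
    rw [eL]; linarith
  -- the linear term vanishes in the limit
  obtain ⟨N, hN⟩ := (isCompact_Icc.prod isCompact_Icc : IsCompact (Icc 0 T ×ˢ 𝕁)
    ).exists_bound_of_continuousOn (ca.prodMk cb).continuousOn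
  have bd : ∀ n, ∀ t ∈ Ioc 0 T, ∀ x ∈ 𝕁, ‖(V n t x - u t x) * Θ t x‖ ≤ 2 * N := by
    intro n t ht x hx
    have hm := hN (t, x) ⟨Ioc_subset_Icc_self ht, hx⟩
    have m1 : |a (t, x)| ≤ N := (le_max_left |a (t, x)| |b (t, x)|).trans hm
    have m2 : |b (t, x)| ≤ N := (le_max_right |a (t, x)| |b (t, x)|).trans hm
    have v1 := (hp n).mem t ht x hx
    have v2 := hv.mem t x
    rw [norm_mul, norm_eq_abs, norm_eq_abs]
    have d1 : |V n t x - u t x| ≤ 1 := abs_le.2 ⟨by linarith [v1.1, v2.2], by linarith [v1.2, v2.1]⟩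
    have d2 : |Θ t x| ≤ 2 * N := by
      refine (abs_add_le _ _).trans ?_
      rw [abs_mul, abs_of_nonneg v2.1]
      linarith [mul_le_of_le_one_left (abs_nonneg (b (t, x))) v2.2]
    exact (mul_le_of_le_one_left (abs_nonneg _) d1).trans d2
  have mL : ∀ n, Measurable fun p : ℝ² => (V n p.1 p.2 - u p.1 p.2) * Θ p.1 p.2 := fun n =>
    ((hp n).meas.sub hv.meas).mul (ca.measurable.add (hv.meas.mul cb.measurable))
  have iL : ∀ n, Integrable (fun p : ℝ² => (V n p.1 p.2 - u p.1 p.2) * Θ p.1 p.2)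
      (rectMeasure 0 T) := fun n => by
    refine Integrable.of_bound (mL n).aestronglyMeasurable (2 * N) ?_
    filter_upwards [ae_rectMeasure_mem 0 T] with p hp
    exact bd n p.1 hp.1 p.2 (Ioc_subset_Icc_self hp.2)
  have jL := fun n => intervalIntegrable_integral_of_rect hT.le
    (F := fun t x => (V n t x - u t x) * Θ t x) (iL n)
  have lim : Tendsto (fun n => ∫ t in (0)..T, L n t) atTop (𝓝 0) := by
    simp only [iint_of_le hT.le]
    have := tendsto_integral_of_dominated_convergence (μ := volume.restrict (Ioc 0 T)) (F := L)
      (f := fun _ => 0) (fun _ => 2 * N) (fun n => (jL n).1.aestronglyMeasurable)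
      (integrable_const _) (fun n => ?_) ?_
    · simpa using this
    · filter_upwards [hmem] with t ht
      refine (intervalIntegral.norm_integral_le_of_norm_le_const fun x hx => ?_).trans_eq
        (by rw [sub_zero, abs_one, mul_one])
      rw [uIoc_of_le zero_le_one] at hx; exact bd n t ht x (Ioc_subset_Icc_self hx)
    · filter_upwards [hv.ae, hvp, hmem] with t h1 h2 ht
      let F : C(I, ℝ) := ⟨fun x => Θ t x, continuousOn_iff_continuous_domRestrict.1 (ctΘ h2)⟩
      have := (hlim F t (Ioc_subset_Icc_self ht)).sub_const (∫ x, F x ∂(w.ev hT t).meas)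
      rw [sub_self] at this
      refine this.congr fun n => ?_
      have int := fun {k : ℝ → ℝ} (hk : ContinuousOn k 𝕁) =>
        intble01 hk
      change (∫ x : I, Θ t x ∂_) - (∫ x : I, Θ t x ∂_) = _
      rw [integral_h_of_density (hd n t ht) (fun x => ((hp n).mem t ht x x.2).1),
        integral_h_of_density h1.1 (fun x => (hv.mem t x).1),
        ← iint_sub (int ((hP n t ht).cont.fun_mul (ctΘ h2))) (int (h2.cont.fun_mul (ctΘ h2)))]
      exact iint_congr fun x _ => (sub_mul _ _ _).symm
  have hFH : ∀ t ∈ Icc 0 T, Tendsto (fun n => ∫ x : I, H.toFun t x ∂((s n).ev hT t).meas) atTop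
      (𝓝 (∫ x : I, H.toFun t x ∂(w.ev hT t).meas)) := fun t ht =>
    hlim ⟨fun x => H.toFun t x, continuousOn_iff_continuous_domRestrict.1 (H.cont.slice ht)⟩ t ht
  have tot := ((hFH T ⟨hT.le, le_rfl⟩).sub (hFH 0 ⟨le_rfl, hT.le⟩)).add lim
  filter_upwards [tot.eventually_const_lt (sub_lt_self _ (half_pos hκ))] with n hn
  have iV := intervalIntegrable_integral_of_rect hT.le (F := fun t x => Vx n t x ^ 2)
    (hp n).memLp.integrable_sq
  have ig := intervalIntegrable_integral_of_rect hT.le (F := fun t x => g t x ^ 2)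
    hv.memLp.integrable_sq
  have rV := (hp n).intervalIntegrable_rateDensity hT.le α β A B K
  have ru := hv.isPath.intervalIntegrable_rateDensity hT.le α β A B K
  have iE := ((((iV.const_mul 2).add_fun (ig.const_mul 2)).add_fun
    (intervalIntegrable_const (c := (1 : ℝ)))).const_mul (2 * M₁ * η))
  have mono := iint_mono_ae hT.le (ru.add_fun (jL n)) (rV.add_fun iE)
    (by rw [Measure.restrict_congr_set Ioc_ae_eq_Icc.symm]; exact low n)
  rw [iint_add ru (jL n), iint_add rV iE, iint_const_mul, iint_add
      ((iV.const_mul 2).add_fun (ig.const_mul 2)) intervalIntegrable_const,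
    iint_add (iV.const_mul 2) (ig.const_mul 2), iint_const_mul, iint_const_mul,
    integral_integral_eq_rect hT.le (F := fun t x => Vx n t x ^ 2) (hp n).memLp.integrable_sq,
    integral_integral_eq_rect hT.le (F := fun t x => g t x ^ 2) hv.memLp.integrable_sq,
    iint_const, smul_eq_mul, mul_one, sub_zero] at mono
  have e1 : 2 * M₁ * η * (2 * (∫ p : ℝ², Vx n p.1 p.2 ^ 2 ∂(rectMeasure 0 T)) + 2 * Q + T) ≤ κ / 4 := by
    have : 2 * M₁ * η * (2 * (∫ p : ℝ², Vx n p.1 p.2 ^ 2 ∂(rectMeasure 0 T)) + 2 * Q + T)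
        ≤ 2 * M₁ * η * (2 * C + 2 * Q + T) :=
      mul_le_mul_of_nonneg_left (by linarith [hC n]) (by positivity)
    have e : 4 * η * (2 * M₁ * (2 * C + 2 * Q + T) + 1) = κ := by
      rw [hη]; field_simp
    nlinarith
  have hae : ∀ᵐ t ∂(volume.restrict (Ioc 0 T)), ((s n).ev hT t).HasDensity (fun x : I => V n t x) ∧
      IvlInt (Vx n t) 0 1 ∧ ∀ x ∈ 𝕁, V n t x = V n t 0 + ∫ y in (0)..x, Vx n t y :=
    hmem.mono fun t ht => ⟨hd n t ht, (hP n t ht).int, (hP n t ht).eq⟩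
  rw [functionalJ_eq α β A B hv.isPath hv.ae, functionalJ_eq α β A B (hp n) hae]
  linarith

/-! ### The density theorem -/

section Density

variable {I₀ : ℝ} {V Vx : ℝ → ℝ → ℝ}

theorem HydroFlow.isHydroSolution (h : HydroFlow α β A B ρ ρx ρt) (hδ : 0 < δ)
    (hm : Measurable ⇈V) (hV : ∀ t ≤ δ, V t = ρ t) {γ : I → ℝ}
    (h0 : (fun x : I => V 0 x) =ᵐ[volume] γ) : IsHydroSolution α β A B δ γ fun t x => V t x := by
  have hmem := ae_restrict_mem (μ := volume) (measurableSet_Ioc (a := (0 : ℝ)) (b := δ))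
  have hres : volume.restrict (Icc 0 δ) = volume.restrict (Ioc 0 δ) :=
    Measure.restrict_congr_set Ioc_ae_eq_Icc.symm
  have cρ : ∀ {t : ℝ}, 0 < t → ContinuousOn (ρ t) 𝕁 := fun ht =>
    h.smooth.continuousOn.slice ht
  have cρx : ∀ {t : ℝ}, 0 < t → ContinuousOn (ρx t) 𝕁 := fun ht => h.cont_x.slice ht
  refine ⟨fun t x => ρx t x, ?_, ?_, ?_, fun t ht H => ?_⟩
  · refine MemLp.of_bound (hm.comp (measurable_fst.prodMk
      (measurable_subtype_coe.comp measurable_snd))).aestronglyMeasurable 1 ?_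
    have : ∀ᵐ p ∂((volume.restrict (Icc 0 δ)).prod (volume : Measure I)), p.1 ∈ Icc 0 δ :=
      Measure.quasiMeasurePreserving_fst.ae (ae_restrict_mem measurableSet_Icc)
    filter_upwards [this] with p hp
    have := h.mem p.1 p.2 p.2.2
    rw [hV p.1 hp.2, norm_eq_abs, abs_of_nonneg this.1]; exact this.2
  · have mp : MeasurePreserving (Prod.map id ((↑) : I → ℝ))
        ((volume.restrict (Icc 0 δ)).prod volume) (rectMeasure 0 δ) := by
      rw [rectMeasure, ← hres, Measure.restrict_congr_set (Ioc_ae_eq_Icc (a := (0 : ℝ)) (b := 1))]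
      exact (MeasurePreserving.id _).prod measurePreserving_coe_unitInterval
    exact (h.memLp δ hδ).comp_measurePreserving mp
  · rw [hres]
    filter_upwards [hmem] with t ht φ hφ hc hs
    have z : ∀ x ∉ 𝕁ᵒ, φ x = 0 := fun x hx =>
      image_eq_zero_of_notMem_tsupport fun hx' => hx (hs hx')
    rw [hV t ht.2]
    exact integral_mul_deriv_of_boundary (h.has_x t ht.1) (cρx ht.1) hφ (z 0 (by simp)) (z 1 (by simp))
  · set K := H.toTest hδ.le with hK
    have htI := Ioc_subset_Icc_self ht
    have hp := (h.isPath hδ).mono le_rfl ht.2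
    have key := h.lin_identity K ht.1 ht.2
    have cv : ∀ {f k k' : ℝ → ℝ}, (∀ x ∈ 𝕁, k' x = k x) →
        ∫ x : I, f x * k x = ∫ x in (0)..1, f x * k' x := fun {f k k'} e => by
      rw [← integral_unitInterval fun x => f x * k' x]
      exact integral_congr_ae (.of_forall fun x => by simp only [e x x.2])
    have e0 : ∫ x : I, γ x * H.toFun 0 x = ∫ x in (0)..1, ρ 0 x * K.h 0 x := by
      rw [← cv fun x hx => H.toTest_h hδ.le ⟨le_rfl, hδ.le⟩ hx, ← hV 0 hδ.le]
      exact integral_congr_ae (h0.symm.mono fun x hx => by simp only [hx])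
    have e1 : ∀ s ∈ uIcc 0 t, ∫ x : I, V s x * H.dt s x = ∫ x in (0)..1, ρ s x * K.ht s x := by
      intro s hs; rw [uIcc_of_le ht.1.le] at hs; rw [hV s (hs.2.trans ht.2)]
      exact cv fun x hx => H.toTest_ht hδ.le ⟨hs.1, hs.2.trans ht.2⟩ hx
    have e2 : ∀ s ∈ uIcc 0 t, ∫ x : I, ρx s x * H.dx s x = ∫ x in (0)..1, ρx s x * K.hx s x := by
      intro s hs; rw [uIcc_of_le ht.1.le] at hs
      exact cv fun x hx => H.toTest_hx hδ.le ⟨hs.1, hs.2.trans ht.2⟩ hx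
    have iP := intervalIntegrable_integral_of_rect ht.1.le (F := fun t x => ρ t x * K.ht t x)
      ((Integrable.continuous_mul_rect K.cont_t hp.integrable_u).congr
        (.of_forall fun _ => mul_comm _ _))
    have iR := intervalIntegrable_integral_of_rect ht.1.le (F := fun t x => ρx t x * K.hx t x)
      ((Integrable.continuous_mul_rect K.cont_x hp.integrable_g).congr
        (.of_forall fun _ => mul_comm _ _))
    have iL := hp.intervalIntegrable_linDensity ht.1.le α β A B K
    have e3 : ∫ s in (0)..t, (1 / B * (contVal (fun x : I => V s x) 1 - β) * H.toFun s 1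
          + 1 / A * (contVal (fun x : I => V s x) 0 - α) * H.toFun s 0)
        = ∫ s in (0)..t, (linDensity α β A B K s (ρ s) (ρx s)
          + (∫ x in (0)..1, ρ s x * K.ht s x) - ∫ x in (0)..1, ρx s x * K.hx s x) := by
      rw [iint_of_le ht.1.le, iint_of_le ht.1.le]
      refine setIntegral_congr_fun measurableSet_Ioc fun s hs => ?_
      have hsδ := hs.2.trans ht.2
      have hsI : s ∈ Icc 0 δ := ⟨hs.1.le, hsδ⟩
      have c : ∀ x₀ : I, contVal (fun x : I => V s x) x₀ = ρ s x₀ := fun x₀ =>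
        contVal_eq ⟨fun x : I => ρ s x, continuousOn_iff_continuous_domRestrict.1 (cρ hs.1)⟩
          (by rw [hV s hsδ]; rfl) x₀
      have ct : Continuous (K.ht s) := K.cont_t.along s
      have cx : Continuous (K.hx s) := K.cont_x.along s
      have i1 := intble01 ((cρ hs.1).fun_mul ct.continuousOn)
      have i2 := intble01 ((cρx hs.1).fun_mul cx.continuousOn)
      simp only [linDensity, neg_mul, neg_add_eq_sub]
      rw [iint_sub i2 i1, c, c, hK,
        H.toTest_h hδ.le hsI (by simp), H.toTest_h hδ.le hsI (by simp), Icc.coe_zero, Icc.coe_one]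
      ring
    rw [iint_congr e1, iint_congr e2, e3, e0]
    beta_reduce
    rw [hV t ht.2, cv fun x hx => H.toTest_h hδ.le htI hx, iint_sub (iL.add_fun iP) iR,
      iint_add iL iP]
    linarith

theorem IsApprox.isProfile (a : IsApprox α β A B I₀ ε C hT w ρ ρx V Vx)
    (ht : 0 < t) : IsProfile (V t) (Vx t) := by
  have c := a.cont_x t ht
  refine ⟨intble01 c, intble01 (c.fun_pow 2), fun x hx => ?_⟩
  have hs : Icc 0 x ⊆ 𝕁 := Icc_subset_Icc_right hx.2
  rw [integral_deriv_Icc hx.1 (fun y hy => (a.has_x t ht y (hs hy)).mono hs)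
    (intble_Icc hx.1 (c.mono hs))]
  ring

theorem IsApprox.exists_path (a : IsApprox α β A B I₀ ε C hT w ρ ρx V Vx)
    (h : HydroFlow α β A B ρ ρx ρt) : ∃ s : SkorohodPath T SubProb,
      (∀ t ∈ Icc 0 T, (s.ev hT t).HasDensity fun x : I => V t x) ∧ FiniteEnergyAC hT s ∧
      ∀ H, functionalJ α β A B hT H s ≤ I₀ + ε := by
  obtain ⟨δ, hδ, hV, -⟩ := a.init
  obtain ⟨s, hs⟩ := exists_densityPath hT a.isPath.meas a.mem fun F =>
    (h.continuousOn_integral a.smooth.continuousOn hδ.1 (fun t ht => (hV t ht).1) F).mono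
      Icc_subset_Ici_self
  refine ⟨s, hs, finiteEnergyAC_of_density hs a.mem a.has_x a.cont_x a.isPath.memLp, fun H => ?_⟩
  have e : ∀ t ∈ Icc 0 T, ∫ x : I, H.toFun t x ∂(s.ev hT t).meas
      = ∫ x in (0)..1, V t x * (H.toTest hT.le).h t x := fun t ht => by
    rw [← integral_h_of_density (hs t ht) fun x => (a.mem t ht x x.2).1]
    simp only [H.toTest_h hT.le ht (Subtype.prop _)]
  rw [functionalJ_eq α β A B a.isPath ((ae_restrict_mem measurableSet_Ioc).mono fun t ht =>
    ⟨hs t (Ioc_subset_Icc_self ht), (a.isProfile ht.1).int, (a.isProfile ht.1).eq⟩),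
    e T ⟨hT.le, le_rfl⟩, e 0 ⟨le_rfl, hT.le⟩]
  exact a.action_le H

theorem isRateDense_of_hydroFlow (hT : 0 < T) (h : HydroFlow α β A B ρ ρx ρt) (hA : 0 < A)
    (hB : 0 < B) (hα : α ∈ 𝕁ᵒ) (hβ : β ∈ 𝕁ᵒ) {γ : I → ℝ}
    (h0 : (fun x : I => ρ 0 x) =ᵐ[volume] γ) {bound : (ℝ → ℝ → ℝ) → Prop}
    (hb : ∀ V : ℝ → ℝ → ℝ, (∃ δ ∈ Ioo 0 T, (∀ t ≤ δ, V t = ρ t) ∧ ∃ c > 0, ∀ t ∈ Icc δ T,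
      ∀ x ∈ 𝕁, c ≤ V t x ∧ V t x ≤ 1 - c) → bound V) :
    IsRateDense (rateFrom α β A B hT γ) (smoothPaths α β A B hT γ bound) := by
  intro w hw
  have hd : (w.ev hT 0).HasDensity γ := by
    by_contra hn
    simp [rateFrom, hn] at hw
  let H₀ : C12 T := ⟨0, 0, 0, 0, continuousOn_const, continuousOn_const, continuousOn_const,
    continuousOn_const, fun _ _ _ _ => hasDerivWithinAt_const _ _ _,
    fun _ _ _ _ => hasDerivWithinAt_const _ _ _, fun _ _ _ _ => hasDerivWithinAt_const _ _ _⟩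
  have : Nonempty (C12 T) := ⟨H₀⟩
  rw [rateFrom, if_pos hd] at hw ⊢
  have hE : FiniteEnergyAC hT w := by
    by_contra hn
    simp [rate, hn] at hw
  have rate_eq : ∀ {s : SkorohodPath T SubProb}, FiniteEnergyAC hT s →
      rate α β A B hT s = ⨆ H, (functionalJ α β A B hT H s : EReal) := fun hs => by
    simp only [rate, if_pos hs]
  have le_rate := fun H => (le_iSup (fun H => (functionalJ α β A B hT H w : EReal)) H).trans_eq
    (rate_eq hE).symm
  have hJ0 : functionalJ α β A B hT H₀ w = 0 := by simp [functionalJ, bdryB, H₀]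
  have hr0 : 0 ≤ rate α β A B hT w := by simpa [hJ0] using le_rate H₀
  obtain ⟨I₀, hI₀⟩ : ∃ I₀ : ℝ, rate α β A B hT w = I₀ :=
    ⟨_, (EReal.coe_toReal hw.ne (EReal.bot_lt_zero.trans_le hr0).ne').symm⟩
  have hI0 : 0 ≤ I₀ := by rwa [hI₀, EReal.coe_nonneg] at hr0
  have hI : ∀ H, functionalJ α β A B hT H w ≤ I₀ := fun H => by
    simpa [hI₀] using le_rate H
  have hwc := w.continuous_integral_ev hA hB (Ioo_subset_Icc_self hα) (Ioo_subset_Icc_self hβ) hE hI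
  obtain ⟨u, g, hv⟩ := exists_isVersion hE
  have hd0 : (w.ev hT 0).HasDensity fun x : I => ρ 0 x := hd.congr h0.symm
  obtain ⟨C, hC⟩ := exists_isApprox h hA hB hα hβ hv hwc hI0 hI hd0
  choose V Vx a using fun n : ℕ => hC (1 / ((n : ℝ) + 1)) (by positivity)
  choose s hs hsE hsJ using fun n => (a n).exists_path h
  have lim0 : Tendsto (fun n : ℕ => 1 / ((n : ℝ) + 1)) atTop (𝓝 0) :=
    tendsto_one_div_add_atTop_nhds_zero_nat
  have conv : ∀ (F : C(I, ℝ)), ∀ κ > 0, ∀ᶠ n in atTop, ∀ t ∈ Icc 0 T,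
      |(∫ x, F x ∂((s n).ev hT t).meas) - ∫ x, F x ∂(w.ev hT t).meas| ≤ κ := by
    intro F κ hκ
    have uc := (isCompact_Icc (a := -T) (b := T)).uniformContinuousOn_of_continuous
      (h.continuous_glueMoment hwc hd0 F).continuousOn
    obtain ⟨r, hr, hrκ⟩ := Metric.uniformContinuousOn_iff.1 uc (κ / 2) (half_pos hκ)
    have l1 : Tendsto (fun n : ℕ => 3 * (1 / ((n : ℝ) + 1))) atTop (𝓝 (3 * 0)) := lim0.const_mul 3
    have l2 : Tendsto (fun n : ℕ => 1 / ((n : ℝ) + 1) * ‖F‖) atTop (𝓝 (0 * ‖F‖)) := lim0.mul_const _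
    rw [mul_zero] at l1; rw [zero_mul] at l2
    filter_upwards [l1.eventually_lt_const hr, l2.eventually_lt_const (half_pos hκ)] with n n1 n2 t ht
    rw [(hs n t ht).integral_eq fun x => ((a n).mem t ht x x.2).1]
    have := (a n).close F (κ / 2) (fun x hx y hy hxy => (hrκ x hx y hy (hxy.trans_lt n1)).le) t ht
    linarith
  have hlim : ∀ (F : C(I, ℝ)), ∀ t ∈ Icc 0 T, Tendsto (fun n => ∫ x, F x ∂((s n).ev hT t).meas) atTop
      (𝓝 (∫ x, F x ∂(w.ev hT t).meas)) := fun F t ht => Metric.tendsto_nhds.2 fun κ hκ => by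
    filter_upwards [conv F _ (half_pos hκ)] with n hn
    rw [Real.dist_eq]; linarith [hn t ht]
  have hs0 : ∀ n, (fun x : I => V n 0 x) =ᵐ[volume] γ := fun n => by
    obtain ⟨δ, hδ, hV, -⟩ := (a n).init
    rwa [(hV 0 hδ.1.le).1]
  refine ⟨s, fun n => ?_, SkorohodPath.tendsto_of_integral conv, ?_⟩
  · obtain ⟨δ, hδ, hV, hc⟩ := (a n).init
    exact ⟨V n, fun t ht => ⟨(a n).mem t ht, hs n t ht⟩, ⟨δ, ⟨hδ.1, hδ.2.le⟩,
      h.isHydroSolution hδ.1 (a n).isPath.meas (fun t ht => (hV t ht).1) (hs0 n)⟩, hs0 n,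
      hb _ ⟨δ, hδ, fun t ht => (hV t ht).1, hc⟩,
      (a n).smooth.mono (prod_mono (fun t ht => ht.1) le_rfl)⟩
  · have e : ∀ n, rateFrom α β A B hT γ (s n) = rate α β A B hT (s n) := fun n => by
      rw [rateFrom, if_pos ((hs n 0 ⟨le_rfl, hT.le⟩).congr (hs0 n))]
    simp only [e, rate_eq (hsE _), rate_eq hE] at hI₀ ⊢
    refine tendsto_order.2 ⟨fun r hr => ?_, fun r hr => ?_⟩
    · obtain ⟨H, hH⟩ := lt_iSup_iff.1 hr
      obtain ⟨y, hy1, hy2⟩ := EReal.lt_iff_exists_real_btwn.1 hH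
      filter_upwards [hv.eventually_functionalJ_ge (α := α) (β := β) (A := A) (B := B)
        (fun n => (a n).isPath) (fun n t ht => hs n t (Ioc_subset_Icc_self ht))
        (fun n t ht => (a n).isProfile ht.1) (fun n => (a n).energy_le) hlim H
        (sub_pos.2 (EReal.coe_lt_coe_iff.1 hy2))] with n hn
      refine hy1.trans (lt_of_lt_of_le (EReal.coe_lt_coe_iff.2 ?_)
        (le_iSup (fun H => (functionalJ α β A B hT H (s n) : EReal)) H))
      linarith
    · rw [hI₀] at hr
      obtain ⟨y, hy1, hy2⟩ := EReal.lt_iff_exists_real_btwn.1 hr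
      filter_upwards [lim0.eventually_lt_const (sub_pos.2 (EReal.coe_lt_coe_iff.1 hy1))] with n hn
      refine lt_of_le_of_lt (iSup_le fun H => EReal.coe_le_coe_iff.2 ?_) hy2
      linarith [hsJ n H]

end Density

end

theorem theorem5p2 (α β A B T : ℝ) (hα : 0 < α) (hαβ : α ≤ β) (hβ : β < 1) (hA : 0 < A)
    (hB : 0 < B) (hT : 0 < T) (γ : unitInterval → ℝ) (hγ : Measurable γ)
    (hγ01 : ∀ x, γ x ∈ Set.Icc (0 : ℝ) 1) :
    IsRateDense (rateFrom α β A B hT γ) (piGamma α β A B hT γ) ∧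
    ((∃ ε₀ > 0, ∀ᵐ x, ε₀ ≤ γ x ∧ γ x ≤ 1 - ε₀) →
      IsRateDense (rateFrom α β A B hT γ) (piGammaUniform α β A B hT γ)) := by
  have hα' : α ∈ Set.Ioo (0 : ℝ) 1 := ⟨hα, hαβ.trans_lt hβ⟩
  have hβ' : β ∈ Set.Ioo (0 : ℝ) 1 := ⟨hα.trans_le hαβ, hβ⟩
  constructor
  · obtain ⟨ρ, ρx, ρt, h, h0, -⟩ := exists_hydroFlow hA hB hα' hβ' hγ hγ01
    refine isRateDense_of_hydroFlow hT h hA hB hα' hβ'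
      (Filter.Eventually.of_forall fun x => by simp [h0]) fun V ⟨δ, hδ, hV, c, hc, hcV⟩ δ' hδ' => ?_
    obtain ⟨e, he, hbd⟩ := h.bound δ' hδ'.1 T
    refine ⟨min c e, lt_min hc he, fun t ht x hx => ?_⟩
    rcases le_total t δ with h1 | h1
    · rw [hV t h1]
      have := hbd t ht x hx
      exact ⟨(min_le_right _ _).trans this.1, by linarith [min_le_right c e]⟩
    · have := hcV t ⟨h1, ht.2⟩ x hx
      exact ⟨(min_le_left _ _).trans this.1, by linarith [min_le_left c e]⟩
  · rintro ⟨ε₀, hε₀, hγε⟩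
    set c := min ε₀ (min α (1 - β)) with hc
    have c1 : c ≤ ε₀ := min_le_left _ _
    have c2 : c ≤ α := (min_le_right _ _).trans (min_le_left _ _)
    have c3 : c ≤ 1 - β := (min_le_right _ _).trans (min_le_right _ _)
    have hc0 : 0 < c := lt_min hε₀ (lt_min hα (by linarith))
    have hcl : ∀ x, c ≤ max c (min (1 - c) (γ x)) ∧ max c (min (1 - c) (γ x)) ≤ 1 - c := fun x =>
      ⟨le_max_left _ _, max_le (by linarith) (min_le_left _ _)⟩
    obtain ⟨ρ, ρx, ρt, h, h0, hbd⟩ := exists_hydroFlow hA hB hα' hβ'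
      (γ := fun x => max c (min (1 - c) (γ x))) (by fun_prop)
      fun x => ⟨hc0.le.trans (hcl x).1, (hcl x).2.trans (by linarith)⟩
    refine isRateDense_of_hydroFlow hT h hA hB hα' hβ' ?_ fun V ⟨δ, hδ, hV, c', hc', hcV⟩ => ?_
    · filter_upwards [hγε] with x hx
      rw [h0, Set.projIcc_val, min_eq_right (by linarith), max_eq_right (by linarith)]
    · refine ⟨min c c', lt_min hc0 hc', fun t ht x hx => ?_⟩
      rcases le_total t δ with h1 | h1
      · rw [hV t h1]
        have := hbd c c2 (c2.trans hαβ) (by linarith) (by linarith) hcl t ht.1 x hx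
        exact ⟨(min_le_left _ _).trans this.1, by linarith [min_le_left c c']⟩
      · have := hcV t ⟨h1, ht.2⟩ x hx
        exact ⟨(min_le_right _ _).trans this.1, by linarith [min_le_right c c']⟩
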